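/- Let $N\ge 2$ and $1<p<\infty$. There exist constants $c>0$ and $C>0$, depending only on $p$ and $N$, such that the following holds. Let $T>0$ and let $(\rho_1,u_1,\nabla\Pi_1)$ and $(\rho_2,u_2,\nabla\Pi_2)$ be two solutions on $[0,T]\times\mathbb{R}^N$, with body forces $f_1$ and $f_2$ respectively, of the density-dependent incompressible Euler equations $$ \partial_t\rho+u\cdot\nabla\rho=0,\qquad \rho(\partial_tu+u\cdot\nabla u)+\nabla\Pi=\rho f,\qquad \operatorname{div}u=0 . $$ (Here $\rho$, $\rho u$, $u$, $\partial_tu$, $\nabla u$, $\Pi$, $\nabla\Pi$ are locally integrable on $(0,T)\times\mathbb{R}^N$, derivatives are weak derivatives, the first equation holds in the sense of distributions with $u\cdot\nabla\rho=\operatorname{div}(\rho u)$, and the other two hold almost everywhere.) Put $a_i:=1/\rho_i$, $\delta a:=a_2-a_1$, $\delta u:=u_2-u_1$, $\nabla\delta\Pi:=\nabla\Pi_2-\nabla\Pi_1$, $\delta f:=f_2-f_1$, and assume that * $\delta a$ and $\delta u$ are in $\mathcal C([0,T];L^p(\mathbb{R}^N))$, * $\nabla\delta\Pi$ is in $L^1([0,T];L^p(\mathbb{R}^N))$,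 * $a_1$ has a locally integrable weak gradient $\nabla a_1$ in the space variable, * for some real numbers $0<a_*\le a^*$ we have $a_*\le a_1,a_2\le a^*$ almost everywhere, and $a^*-a_*\le c\,a_*$, * for all $t\in[0,T]$, $$V(t):=\int_0^t\bigl(\|\nabla u_1\|_{L^\infty}+\|\nabla u_2\|_{L^\infty}+\|\nabla a_1\|_{L^\infty}+\|\nabla\Pi_1\|_{L^\infty}\bigr)\,d\tau<\infty .$$ Then for all $t\in[0,T]$, $$ \|(\delta a,\delta u)(t)\|_{L^p}\le e^{CV(t)}\Bigl(\|(\delta a,\delta u)(0)\|_{L^p}+C\int_0^te^{-CV(\tau)}\|\delta f(\tau)\|_{L^p}\,d\tau\Bigr), $$ where $\|(b,w)\|_{L^p}:=\|b\|_{L^p}+\|w\|_{L^p}$ and the right-hand side is allowed to be $+\infty$. -/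

import Mathlib

open MeasureTheory Set Filter Topology
open scoped ENNReal ContDiff

noncomputable section

namespace DensityEuler

/-- The space variable ranges over `ℝ^N` with its Euclidean norm. -/
abbrev Space (N : ℕ) : Type := EuclideanSpace ℝ (Fin N)

/-- The open space-time slab `(0,T) × ℝ^N`. -/
def slab (N : ℕ) (T : ℝ) : Set (ℝ × Space N) := Ioo 0 T ×ˢ univ

/-- Smooth test functions with compact support contained in the slab `(0,T) × ℝ^N`. -/
def IsTestFunction {N : ℕ} (T : ℝ) (φ : ℝ × Space N → ℝ) : Prop :=
  ContDiff ℝ ∞ φ ∧ HasCompactSupport φ ∧ tsupport φ ⊆ slab N T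

/-- `h` is the weak (distributional) derivative of `g` on the slab `(0,T) × ℝ^N` in the space-time
direction `e`; both functions are locally integrable there. -/
def HasWeakDirDeriv {N : ℕ} {F : Type*} [NormedAddCommGroup F] [NormedSpace ℝ F]
    (T : ℝ) (e : ℝ × Space N) (g h : ℝ → Space N → F) : Prop :=
  LocallyIntegrableOn (Function.uncurry g) (slab N T) ∧
  LocallyIntegrableOn (Function.uncurry h) (slab N T) ∧
  ∀ φ : ℝ × Space N → ℝ, IsTestFunction T φ →
    ∫ z : ℝ × Space N, (fderiv ℝ φ z e) • g z.1 z.2 = - ∫ z : ℝ × Space N, φ z • h z.1 z.2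

/-- `∂ₜ g = h` weakly on `(0,T) × ℝ^N`. -/
def HasWeakTimeDeriv {N : ℕ} {F : Type*} [NormedAddCommGroup F] [NormedSpace ℝ F]
    (T : ℝ) (g h : ℝ → Space N → F) : Prop :=
  HasWeakDirDeriv T ((1 : ℝ), (0 : Space N)) g h

/-- `G` is the weak derivative of `g` in the space variable on `(0,T) × ℝ^N`, a locally integrable
function with values in the linear maps: `∂_v g = G v` for each vector `v` of `ℝ^N`. -/
def HasWeakSpaceDeriv {N : ℕ} {F : Type*} [NormedAddCommGroup F] [NormedSpace ℝ F]
    (T : ℝ) (g : ℝ → Space N → F) (G : ℝ → Space N → Space N →L[ℝ] F) : Prop :=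
  LocallyIntegrableOn (Function.uncurry G) (slab N T) ∧
  ∀ v : Space N, HasWeakDirDeriv T ((0 : ℝ), v) g (fun t x => G t x v)

/-- The vector field `G` is the weak gradient `∇g`, in the space variable, of the scalar function
`g` on `(0,T) × ℝ^N`. -/
def HasWeakGradient {N : ℕ} (T : ℝ) (g : ℝ → Space N → ℝ) (G : ℝ → Space N → Space N) : Prop :=
  HasWeakSpaceDeriv T g (fun t x => innerSL ℝ (G t x))

/-- The triple `(ρ, u, ∇Π)`, with `∇Π` written `P` and the Jacobian `∇u` written `Du`, solves the
density-dependent incompressible Euler equations on `[0,T] × ℝ^N` with body force `f`.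

The transport equation for the density is read in the sense of distributions; as `div u = 0`, the
product `u · ∇ρ` is the distribution `div (ρ u)`, so no derivative of `ρ` needs to be a function.
In the momentum equation `∂ₜ u` is the weak derivative of `u`. -/
structure IsEulerSolution {N : ℕ} (T : ℝ) (ρ : ℝ → Space N → ℝ) (u P f : ℝ → Space N → Space N)
    (Du : ℝ → Space N → Space N →L[ℝ] Space N) : Prop where
  /-- `ρ` is locally integrable -/
  density : LocallyIntegrableOn (Function.uncurry ρ) (slab N T)
  /-- `ρ u` is locally integrable -/
  flux : LocallyIntegrableOn (fun z : ℝ × Space N => ρ z.1 z.2 • u z.1 z.2) (slab N T)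
  /-- `∂ₜ ρ + u · ∇ρ = 0`; note that `fderiv ℝ φ z (1, u) = ∂ₜ φ + u · ∇φ` -/
  mass : ∀ φ : ℝ × Space N → ℝ, IsTestFunction T φ →
    ∫ z : ℝ × Space N, ρ z.1 z.2 * fderiv ℝ φ z ((1 : ℝ), u z.1 z.2) = 0
  /-- `Du` is the Jacobian `∇u` -/
  jacobian : HasWeakSpaceDeriv T u Du
  /-- `ρ (∂ₜ u + u · ∇u) + ∇Π = ρ f` -/
  momentum : ∃ ut : ℝ → Space N → Space N, HasWeakTimeDeriv T u ut ∧
    ∀ᵐ z : ℝ × Space N ∂(volume.restrict (slab N T)),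
      ρ z.1 z.2 • (ut z.1 z.2 + Du z.1 z.2 (u z.1 z.2)) + P z.1 z.2 = ρ z.1 z.2 • f z.1 z.2
  /-- `div u = 0` -/
  incompressible : ∀ᵐ z : ℝ × Space N ∂(volume.restrict (slab N T)),
    ∑ i : Fin N, Du z.1 z.2 (EuclideanSpace.single i (1 : ℝ)) i = 0
  /-- `P` is the gradient of some pressure `Π` -/
  pressure : ∃ Pr : ℝ → Space N → ℝ, HasWeakGradient T Pr P

/-- `g ∈ C([0,T]; L^p(ℝ^N))`. -/
def ContinuousInLp {N : ℕ} {F : Type*} [NormedAddCommGroup F]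
    (T : ℝ) (p : ℝ≥0∞) (g : ℝ → Space N → F) : Prop :=
  (∀ t ∈ Icc 0 T, MemLp (g t) p volume) ∧
  ∀ t ∈ Icc 0 T, Tendsto (fun s => eLpNorm (g s - g t) p volume) (𝓝[Icc 0 T] t) (𝓝 0)

/-- `V(t) = ∫₀ᵗ (‖∇u₁‖_∞ + ‖∇u₂‖_∞ + ‖∇a₁‖_∞ + ‖∇Π₁‖_∞) dτ`, with values in `[0,∞]`. -/
def V {N : ℕ} (Du₁ Du₂ : ℝ → Space N → Space N →L[ℝ] Space N) (Da₁ P₁ : ℝ → Space N → Space N)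
    (t : ℝ) : ℝ≥0∞ :=
  ∫⁻ τ in Ioo 0 t, (eLpNorm (Du₁ τ) ∞ volume + eLpNorm (Du₂ τ) ∞ volume +
    eLpNorm (Da₁ τ) ∞ volume + eLpNorm (P₁ τ) ∞ volume)

/-- The norm `‖(b, w)‖_{L^p} = ‖b‖_{L^p} + ‖w‖_{L^p}` of a pair made of a function and a vector
field. -/
def pairNorm {N : ℕ} (p : ℝ≥0∞) (b : Space N → ℝ) (w : Space N → Space N) : ℝ≥0∞ :=
  eLpNorm b p volume + eLpNorm w p volume

end DensityEuler

end

/-! Both differences are carried by the same divergence-free field `u₂`: ∂ₜδa + u₂·∇δa = −δu·∇a₁ and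
∂ₜδu + u₂·∇δu = δf − δu·∇u₁ − δa ∇Π₁ − a₂ ∇δΠ. Transport by such a field preserves L^p norms, so the
norms of δa and δu grow at most at the rate of the norms of the right-hand sides. All terms but the
last are bounded by ‖δf‖ plus the integrand of V times ‖(δa,δu)‖. Once a₂∇δΠ has a bound of the same
kind, Grönwall's inequality (`gronwall_integral`) concludes.

The pressure. The divergence kills ∂ₜδu, and div(u₂·∇δu) = div(δu·∇u₂) because both fields are
divergence free. Hence div(a_*∇δΠ) = div F with F = δf − δu·∇u₁ − δu·∇u₂ − δa ∇Π₁ − (a₂ − a_*)∇δΠ.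
The elliptic estimate `exists_lpNorm_gradient_le` bounds a gradient by K‖F‖ with K depending on p
and N only. The last term of F costs K(a^* − a_*)‖∇δΠ‖, which is at most half of the left side if c
= 1/(2K); this is where the small oscillation of the inverse densities enters
(`exists_momentumSource_le`). What is controlled is a_*∇δΠ, hence a₂∇δΠ, so the constants do not
depend on a_* or a^*.

The elliptic estimate is the L^p boundedness of the second order Riesz transforms. It is obtained
here from the heat flow and a Bellman function instead of singular integrals. For p ≥ 2 and the
conjugate q, the function B(u,v) = A|v|^q + u²(|u|^p + |v|^q)^(1−2/p) has size at most |u|^p +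
(A+1)|v|^q, and its Hessian dominates 2|xy| (`bell_hessian_ge`). Along the heat flow ∫B(e^{tΔ}f,
e^{tΔ}g) decreases at the rate of this Hessian applied to the gradients, so the space-time integral
of |∂ᵢe^{tΔ}f · ∂ⱼe^{tΔ}g| is at most C‖f‖_p‖g‖_q (`exists_integral_abs_heat_mul_heat_le`).
Splitting e^{tΔ} into two halves turns this into an L^q bound for ∫₀^τ e^{tΔ}∂ᵢ∂ⱼh dt, uniform in τ
(`exists_lpNorm_heatInt_le`). These operators approximate ∂ᵢ∂ⱼ(−Δ)⁻¹, and duality with a gradient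
field gives the estimate.

The transport estimate `exists_lpNorm_transport_le` has to be proved for weak solutions. Mollifying
in space leaves a commutator, which is bounded in L^p by a multiple of ‖∇u₂‖_∞‖b‖_p, uniformly in
the mollification. Since ‖∇u₂‖_∞ belongs to V, this bound suffices and the commutator need not tend
to zero there. It does have to tend to zero for the renormalisation `TransportEq.comp_of_bounded`,
which shows that 1/ρ solves the same equation as ρ; this holds at Lebesgue points.

The equations are given in space-time while the estimates are made at a fixed time. The bridge is
`ae_forall_bump_integral_eq_zero`: a countable family of test functions, dense together with its
first derivatives, yields one null set of times that serves all test functions. The pieces are put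
together in `exists_norm_sub_le_add_integral`. -/

noncomputable section
namespace DensityEuler

/-! ### A Bellman function -/

section Bellman

/-- The smooth regularisation `(u² + ε)^{r/2}` of `|u|^r`. -/
def regPow (ε r u : ℝ) : ℝ := (u ^ 2 + ε) ^ (r / 2)

/-- The derivative of `regPow`. -/
def regPow₁ (ε r u : ℝ) : ℝ := r * u * (u ^ 2 + ε) ^ (r / 2 - 1)

/-- The second derivative of `regPow`. -/
def regPow₂ (ε r u : ℝ) : ℝ :=
  r * (u ^ 2 + ε) ^ (r / 2 - 1) + r * (r - 2) * u ^ 2 * (u ^ 2 + ε) ^ (r / 2 - 2)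

variable {ε r : ℝ}

lemma sq_add_pos (hε : 0 < ε) (u : ℝ) : 0 < u ^ 2 + ε := by positivity

lemma regPow_pos (hε : 0 < ε) (r u : ℝ) : 0 < regPow ε r u :=
  Real.rpow_pos_of_pos (sq_add_pos hε u) _

lemma regPow_zero_le (hε : 0 < ε) (hr : 0 ≤ r) (u : ℝ) : regPow ε r 0 ≤ regPow ε r u := by
  unfold regPow
  apply Real.rpow_le_rpow (by positivity) (by nlinarith [sq_nonneg u]) (by positivity)

lemma hasDerivAt_regPow (hε : 0 < ε) (r : ℝ) {u : ℝ → ℝ} {u' s : ℝ} (hu : HasDerivAt u u' s) :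
    HasDerivAt (fun s => regPow ε r (u s)) (regPow₁ ε r (u s) * u') s := by
  have h := ((hu.pow 2).add_const ε).rpow_const (p := r / 2) (Or.inl (sq_add_pos hε (u s)).ne')
  refine h.congr_deriv ?_
  simp [regPow₁]
  ring

lemma hasDerivAt_regPow₁ (hε : 0 < ε) (r : ℝ) {u : ℝ → ℝ} {u' s : ℝ} (hu : HasDerivAt u u' s) :
    HasDerivAt (fun s => regPow₁ ε r (u s)) (regPow₂ ε r (u s) * u') s := by
  have h := ((hu.pow 2).add_const ε).rpow_const (p := r / 2 - 1)
    (Or.inl (sq_add_pos hε (u s)).ne')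
  refine ((hu.const_mul r).mul h).congr_deriv ?_
  simp only [regPow₂, Pi.pow_apply]
  rw [show r / 2 - 1 - 1 = r / 2 - 2 by ring]
  push_cast
  ring

lemma continuous_regPow (hε : 0 < ε) (r : ℝ) : Continuous (regPow ε r) :=
  (by fun_prop : Continuous fun u : ℝ => u ^ 2 + ε).rpow_const
    fun u => Or.inl (sq_add_pos hε u).ne'

lemma continuous_regPow₁ (hε : 0 < ε) (r : ℝ) : Continuous (regPow₁ ε r) :=
  (by fun_prop : Continuous fun u : ℝ => r * u).mul <|
    (by fun_prop : Continuous fun u : ℝ => u ^ 2 + ε).rpow_const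
    fun u => Or.inl (sq_add_pos hε u).ne'

lemma continuous_regPow₂ (hε : 0 < ε) (r : ℝ) : Continuous (regPow₂ ε r) := by
  have h (s : ℝ) : Continuous fun u : ℝ => (u ^ 2 + ε) ^ s :=
    (by fun_prop : Continuous fun u : ℝ => u ^ 2 + ε).rpow_const
    fun u => Or.inl (sq_add_pos hε u).ne'
  unfold regPow₂
  have h1 := h (r / 2 - 1)
  have h2 := h (r / 2 - 2)
  fun_prop

lemma rpow_half_sub_two (hε : 0 < ε) (u : ℝ) (s : ℝ) :
    (u ^ 2 + ε) ^ (s - 1) * (u ^ 2 + ε) = (u ^ 2 + ε) ^ s := by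
  rw [Real.rpow_sub_one (sq_add_pos hε u).ne', div_mul_cancel₀ _ (sq_add_pos hε u).ne']

lemma mul_regPow₁_le (hε : 0 < ε) (hr : 0 ≤ r) (u : ℝ) :
    u * regPow₁ ε r u ≤ r * regPow ε r u := by
  have h0 := sq_add_pos hε u
  have h := rpow_half_sub_two hε u (r / 2)
  have h1 : 0 < (u ^ 2 + ε) ^ (r / 2 - 1) := Real.rpow_pos_of_pos h0 _
  unfold regPow₁ regPow
  rw [← h]
  have : r * (u ^ 2 + ε) ^ (r / 2 - 1) * u ^ 2 ≤ r * (u ^ 2 + ε) ^ (r / 2 - 1) * (u ^ 2 + ε) := by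
    gcongr; linarith
  nlinarith

lemma mul_regPow₁_nonneg (hε : 0 < ε) (hr : 0 ≤ r) (u : ℝ) : 0 ≤ u * regPow₁ ε r u := by
  have h1 : 0 < (u ^ 2 + ε) ^ (r / 2 - 1) := Real.rpow_pos_of_pos (sq_add_pos hε u) _
  unfold regPow₁
  have : u * (r * u * (u ^ 2 + ε) ^ (r / 2 - 1)) = r * u ^ 2 * (u ^ 2 + ε) ^ (r / 2 - 1) := by ring
  rw [this]; positivity

lemma regPow₂_nonneg (hε : 0 < ε) (hr : 2 ≤ r) (u : ℝ) : 0 ≤ regPow₂ ε r u := by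
  have h1 : 0 < (u ^ 2 + ε) ^ (r / 2 - 1) := Real.rpow_pos_of_pos (sq_add_pos hε u) _
  have h2 : 0 < (u ^ 2 + ε) ^ (r / 2 - 2) := Real.rpow_pos_of_pos (sq_add_pos hε u) _
  unfold regPow₂
  have : 0 ≤ r - 2 := by linarith
  positivity

lemma regPow₂_ge (hε : 0 < ε) (hr0 : 0 ≤ r) (hr : r ≤ 2) (u : ℝ) :
    r * (r - 1) * (u ^ 2 + ε) ^ (r / 2 - 1) ≤ regPow₂ ε r u := by
  have h := rpow_half_sub_two hε u (r / 2 - 1)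
  have h2 : 0 < (u ^ 2 + ε) ^ (r / 2 - 2) := Real.rpow_pos_of_pos (sq_add_pos hε u) _
  rw [show r / 2 - 1 - 1 = r / 2 - 2 by ring] at h
  unfold regPow₂
  rw [← h]
  -- This is exactly the difference of the two sides: u² falls short of u² + ε by ε.
  have h3 : 0 ≤ r * (2 - r) * (u ^ 2 + ε) ^ (r / 2 - 2) * ε := by
    have : 0 ≤ 2 - r := by linarith
    positivity
  nlinarith

lemma abs_regPow₁_le (hε : 0 < ε) (hr : 0 ≤ r) (u : ℝ) :
    |regPow₁ ε r u| ≤ r * (u ^ 2 + ε) ^ ((r - 1) / 2) := by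
  have h0 := sq_add_pos hε u
  have h1 : 0 < (u ^ 2 + ε) ^ (r / 2 - 1) := Real.rpow_pos_of_pos h0 _
  have hu : |u| ≤ (u ^ 2 + ε) ^ (1 / 2 : ℝ) := by
    rw [← Real.sqrt_eq_rpow]; exact Real.abs_le_sqrt (by linarith)
  unfold regPow₁
  rw [abs_mul, abs_mul, abs_of_nonneg hr, abs_of_pos h1,
    show (r - 1) / 2 = 1 / 2 + (r / 2 - 1) by ring, Real.rpow_add h0, mul_assoc]
  gcongr

/-- The regularised Bellman function. -/
def bell (ε A p q u v : ℝ) : ℝ :=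
  A * regPow ε q v + u ^ 2 * (regPow ε p u + regPow ε q v) ^ (1 - 2 / p)

/-- `∂_u` of the Bellman function. -/
def bellU (ε p q u v : ℝ) : ℝ :=
  2 * u * (regPow ε p u + regPow ε q v) ^ (1 - 2 / p) +
    (1 - 2 / p) * u ^ 2 * (regPow ε p u + regPow ε q v) ^ (1 - 2 / p - 1) * regPow₁ ε p u

/-- `∂_v` of the Bellman function. -/
def bellV (ε A p q u v : ℝ) : ℝ :=
  A * regPow₁ ε q v +
    (1 - 2 / p) * u ^ 2 * (regPow ε p u + regPow ε q v) ^ (1 - 2 / p - 1) * regPow₁ ε q v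

/-- `∂_u∂_u` of the Bellman function. -/
def bellUU (ε p q u v : ℝ) : ℝ :=
  2 * (regPow ε p u + regPow ε q v) ^ (1 - 2 / p) +
    4 * (1 - 2 / p) * u * (regPow ε p u + regPow ε q v) ^ (1 - 2 / p - 1) * regPow₁ ε p u +
    (1 - 2 / p) * u ^ 2 *
      ((1 - 2 / p - 1) * (regPow ε p u + regPow ε q v) ^ (1 - 2 / p - 1 - 1) * regPow₁ ε p u ^ 2 +
        (regPow ε p u + regPow ε q v) ^ (1 - 2 / p - 1) * regPow₂ ε p u)

/-- `∂_u∂_v` of the Bellman function. -/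
def bellUV (ε p q u v : ℝ) : ℝ :=
  2 * (1 - 2 / p) * u * (regPow ε p u + regPow ε q v) ^ (1 - 2 / p - 1) * regPow₁ ε q v +
    (1 - 2 / p) * (1 - 2 / p - 1) * u ^ 2 * (regPow ε p u + regPow ε q v) ^ (1 - 2 / p - 1 - 1) *
      regPow₁ ε p u * regPow₁ ε q v

/-- `∂_v∂_v` of the Bellman function. -/
def bellVV (ε A p q u v : ℝ) : ℝ :=
  A * regPow₂ ε q v +
    (1 - 2 / p) * u ^ 2 *
      ((1 - 2 / p - 1) * (regPow ε p u + regPow ε q v) ^ (1 - 2 / p - 1 - 1) * regPow₁ ε q v ^ 2 +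
        (regPow ε p u + regPow ε q v) ^ (1 - 2 / p - 1) * regPow₂ ε q v)

variable {A p q : ℝ}

lemma hasDerivAt_weight (hε : 0 < ε) (p q s : ℝ) {u v : ℝ → ℝ} {u' v' t : ℝ}
    (hu : HasDerivAt u u' t) (hv : HasDerivAt v v' t) :
    HasDerivAt (fun t => (regPow ε p (u t) + regPow ε q (v t)) ^ s)
      (s * (regPow ε p (u t) + regPow ε q (v t)) ^ (s - 1) *
        (regPow₁ ε p (u t) * u' + regPow₁ ε q (v t) * v')) t := by
  have h := ((hasDerivAt_regPow hε p hu).add (hasDerivAt_regPow hε q hv)).rpow_const (p := s)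
    (Or.inl (add_pos (regPow_pos hε p (u t)) (regPow_pos hε q (v t))).ne')
  refine h.congr_deriv ?_
  simp only [Pi.add_apply]
  ring

lemma hasDerivAt_bell (hε : 0 < ε) (A p q : ℝ) {u v : ℝ → ℝ} {u' v' t : ℝ}
    (hu : HasDerivAt u u' t) (hv : HasDerivAt v v' t) :
    HasDerivAt (fun t => bell ε A p q (u t) (v t))
      (bellU ε p q (u t) (v t) * u' + bellV ε A p q (u t) (v t) * v') t := by
  refine (((hasDerivAt_regPow hε q hv).const_mul A).add
    ((hu.pow 2).mul (hasDerivAt_weight hε p q (1 - 2 / p) hu hv))).congr_deriv ?_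
  simp only [bellU, bellV, Pi.pow_apply]
  push_cast
  ring

lemma hasDerivAt_bellU (hε : 0 < ε) (p q : ℝ) {u v : ℝ → ℝ} {u' v' t : ℝ}
    (hu : HasDerivAt u u' t) (hv : HasDerivAt v v' t) :
    HasDerivAt (fun t => bellU ε p q (u t) (v t))
      (bellUU ε p q (u t) (v t) * u' + bellUV ε p q (u t) (v t) * v') t := by
  refine (((hu.const_mul 2).mul (hasDerivAt_weight hε p q (1 - 2 / p) hu hv)).add
    ((((hu.pow 2).const_mul (1 - 2 / p)).mul
      (hasDerivAt_weight hε p q (1 - 2 / p - 1) hu hv)).mul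
        (hasDerivAt_regPow₁ hε p hu))).congr_deriv ?_
  simp only [bellUU, bellUV, Pi.pow_apply, Pi.mul_apply]
  push_cast
  ring

lemma hasDerivAt_bellV (hε : 0 < ε) (A p q : ℝ) {u v : ℝ → ℝ} {u' v' t : ℝ}
    (hu : HasDerivAt u u' t) (hv : HasDerivAt v v' t) :
    HasDerivAt (fun t => bellV ε A p q (u t) (v t))
      (bellUV ε p q (u t) (v t) * u' + bellVV ε A p q (u t) (v t) * v') t := by
  refine (((hasDerivAt_regPow₁ hε q hv).const_mul A).add
    ((((hu.pow 2).const_mul (1 - 2 / p)).mul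
      (hasDerivAt_weight hε p q (1 - 2 / p - 1) hu hv)).mul
        (hasDerivAt_regPow₁ hε q hv))).congr_deriv ?_
  simp only [bellVV, bellUV, Pi.pow_apply, Pi.mul_apply]
  push_cast
  ring

lemma continuous_weight (hε : 0 < ε) (p q s : ℝ) :
    Continuous fun z : ℝ × ℝ => (regPow ε p z.1 + regPow ε q z.2) ^ s := by
  refine Continuous.rpow_const ?_ fun z =>
    Or.inl (add_pos (regPow_pos hε p z.1) (regPow_pos hε q z.2)).ne'
  exact ((continuous_regPow hε p).comp continuous_fst).add
    ((continuous_regPow hε q).comp continuous_snd)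

lemma continuous_bells (hε : 0 < ε) (A p q : ℝ) :
    Continuous (fun z : ℝ × ℝ => bell ε A p q z.1 z.2) ∧
    Continuous (fun z : ℝ × ℝ => bellU ε p q z.1 z.2) ∧
    Continuous (fun z : ℝ × ℝ => bellV ε A p q z.1 z.2) ∧
    Continuous (fun z : ℝ × ℝ => bellUU ε p q z.1 z.2) ∧
    Continuous (fun z : ℝ × ℝ => bellUV ε p q z.1 z.2) ∧
    Continuous (fun z : ℝ × ℝ => bellVV ε A p q z.1 z.2) := by
  have w0 := continuous_weight hε p q (1 - 2 / p)
  have w1 := continuous_weight hε p q (1 - 2 / p - 1)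
  have w2 := continuous_weight hε p q (1 - 2 / p - 1 - 1)
  have a1 : Continuous fun z : ℝ × ℝ => regPow₁ ε p z.1 :=
    (continuous_regPow₁ hε p).comp continuous_fst
  have a2 : Continuous fun z : ℝ × ℝ => regPow₂ ε p z.1 :=
    (continuous_regPow₂ hε p).comp continuous_fst
  have b0 : Continuous fun z : ℝ × ℝ => regPow ε q z.2 :=
    (continuous_regPow hε q).comp continuous_snd
  have b1 : Continuous fun z : ℝ × ℝ => regPow₁ ε q z.2 :=
    (continuous_regPow₁ hε q).comp continuous_snd
  have b2 : Continuous fun z : ℝ × ℝ => regPow₂ ε q z.2 :=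
    (continuous_regPow₂ hε q).comp continuous_snd
  unfold bell bellU bellV bellUU bellUV bellVV
  refine ⟨?_, ?_, ?_, ?_, ?_, ?_⟩ <;> fun_prop

/-- By `q * (1 - 2 / p) = 2 - q` the weight dominates (v² + ε)^(1 − q/2), the inverse of the factor
that governs the second derivative in v. This balance of the two diagonal entries of the Hessian is
what makes the exponent 1 − 2/p the right one. -/
lemma conj_identities (hpq : p.HolderConjugate q) (hp : 2 ≤ p) :
    q ≤ 2 ∧ 1 < q ∧ q * (1 - 2 / p) = 2 - q ∧ 0 ≤ 1 - 2 / p := by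
  have h := hpq.inv_add_inv_eq_one
  have hp0 := hpq.pos
  have hq0 := hpq.symm.pos
  have hmul : q + p = p * q := by field_simp at h; linarith
  have e : q / p = q - 1 := by rw [div_eq_iff hp0.ne']; linarith
  refine ⟨by nlinarith, hpq.symm.lt, ?_, ?_⟩
  · have : q * (1 - 2 / p) = q - 2 * (q / p) := by ring
    rw [this, e]; ring
  · rw [sub_nonneg, div_le_one hp0]; exact hp

/-- As u² is at most the power 2/p of the weight base, the product u²·w^(1−2/p) is at most w. -/
lemma bell_le (hε : 0 < ε) (hp : 2 ≤ p) (u v : ℝ) :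
    bell ε A p q u v ≤ regPow ε p u + (A + 1) * regPow ε q v := by
  have hw := add_pos (regPow_pos hε p u) (regPow_pos hε q v)
  have hu : u ^ 2 ≤ (regPow ε p u + regPow ε q v) ^ (2 / p) := by
    calc u ^ 2 ≤ u ^ 2 + ε := by linarith
      _ = (regPow ε p u) ^ (2 / p) := by
        rw [regPow, ← Real.rpow_mul (sq_add_pos hε u).le,
          show p / 2 * (2 / p) = 1 by field_simp, Real.rpow_one]
      _ ≤ _ := Real.rpow_le_rpow (regPow_pos hε p u).le
        (by linarith [regPow_pos hε q v]) (by positivity)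
  have : u ^ 2 * (regPow ε p u + regPow ε q v) ^ (1 - 2 / p) ≤ regPow ε p u + regPow ε q v := by
    calc _ ≤ (regPow ε p u + regPow ε q v) ^ (2 / p) * (regPow ε p u + regPow ε q v) ^ (1 - 2 / p) := by
          gcongr
      _ = _ := by rw [← Real.rpow_add hw]; simp
  unfold bell
  linarith

/-- The value at the origin is positive because of ε, so only the excess over it can be integrated
over the whole space; this excess is nonnegative. -/
lemma bell_zero_le (hε : 0 < ε) (hA : 0 ≤ A) (hq : 0 ≤ q) (u v : ℝ) :
    bell ε A p q 0 0 ≤ bell ε A p q u v := by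
  have hw := add_pos (regPow_pos hε p u) (regPow_pos hε q v)
  have h1 := regPow_zero_le hε hq v
  have h2 : 0 ≤ u ^ 2 * (regPow ε p u + regPow ε q v) ^ (1 - 2 / p) := by positivity
  have h3 := mul_le_mul_of_nonneg_left h1 hA
  simp only [bell]
  linarith

set_option maxHeartbeats 800000 in
/-- The quadratic form of the Hessian of the Bellman function dominates `2|xy|`. -/
lemma bell_hessian_ge (hε : 0 < ε) (hpq : p.HolderConjugate q) (hp : 2 ≤ p)
    (hA : 45 ≤ A * (q * (q - 1))) (u v x y : ℝ) :
    2 * |x * y| ≤ bellUU ε p q u v * x ^ 2 + 2 * bellUV ε p q u v * (x * y) +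
      bellVV ε A p q u v * y ^ 2 := by
  obtain ⟨hq2, hq1, hκq, hκ0⟩ := conj_identities hpq hp
  have hp0 : 0 < p := by linarith
  have hA0 : 0 ≤ A := by
    have : 0 < q * (q - 1) := by nlinarith
    by_contra h; push Not at h; nlinarith
  set κ := 1 - 2 / p with hκ
  have hκ1 : κ ≤ 1 := by have : 0 ≤ 2 / p := by positivity
                         linarith
  have hpκ : p * (1 - κ) = 2 := by rw [hκ]; field_simp; ring
  set a := regPow ε p u with ha
  set b := regPow ε q v with hb
  have ha0 : 0 < a := regPow_pos hε p u
  have hb0 : 0 < b := regPow_pos hε q v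
  set w := a + b with hw
  have hw0 : 0 < w := by positivity
  set W := w ^ κ with hW
  set W1 := w ^ (κ - 1) with hW1
  set W2 := w ^ (κ - 1 - 1) with hW2
  have hWpos : 0 < W := Real.rpow_pos_of_pos hw0 _
  have hW1pos : 0 < W1 := Real.rpow_pos_of_pos hw0 _
  have hW2pos : 0 < W2 := Real.rpow_pos_of_pos hw0 _
  have e1 : W2 * w = W1 := by rw [hW1, hW2, Real.rpow_sub_one hw0.ne' (κ - 1)]; field_simp
  set a1 := regPow₁ ε p u with ha1
  set a2 := regPow₂ ε p u with ha2
  set b1 := regPow₁ ε q v with hb1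
  set b2 := regPow₂ ε q v with hb2
  set s := v ^ 2 + ε with hs
  have hs0 : 0 < s := sq_add_pos hε v
  -- The diagonal entries will be at least 2θ and 41θ⁻¹ and the mixed entry at most 8 in absolute
  -- value. The factors θ and θ⁻¹ cancel in the geometric mean, so the form is nondegenerate
  -- uniformly in u, v and ε.
  set θ := s ^ (1 - q / 2) with hθ
  set θ' := s ^ (q / 2 - 1) with hθ'
  have hθ0 : 0 < θ := Real.rpow_pos_of_pos hs0 _
  have hθ'0 : 0 < θ' := Real.rpow_pos_of_pos hs0 _
  have hθθ : θ * θ' = 1 := by rw [hθ, hθ', ← Real.rpow_add hs0]; simp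
  -- the three elementary size bounds
  have hup : |u| ≤ w ^ (1 / p) := by
    calc |u| ≤ (u ^ 2 + ε) ^ (1 / 2 : ℝ) := by
          rw [← Real.sqrt_eq_rpow]; exact Real.abs_le_sqrt (by linarith)
      _ = a ^ (1 / p) := by
        rw [ha, regPow, ← Real.rpow_mul (sq_add_pos hε u).le]
        congr 1; field_simp
      _ ≤ _ := Real.rpow_le_rpow ha0.le (by linarith) (by positivity)
  have hqp : (q - 1) / q = 1 / p := by
    have h := hpq.inv_add_inv_eq_one
    have : (q - 1) / q = 1 - q⁻¹ := by field_simp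
    rw [this, one_div]; linarith
  have hb1p : |b1| ≤ q * w ^ (1 / p) := by
    calc |b1| ≤ q * s ^ ((q - 1) / 2) := abs_regPow₁_le hε (by linarith) v
      _ = q * b ^ (1 / p) := by
        rw [hb, regPow, ← Real.rpow_mul hs0.le, ← hqp]
        congr 2; field_simp
      _ ≤ _ := by
        gcongr
        linarith
  have hwp : w ^ (1 / p) * w ^ (1 / p) * W1 = 1 := by
    rw [hW1, ← Real.rpow_add hw0, ← Real.rpow_add hw0, hκ,
      show 1 / p + 1 / p + (1 - 2 / p - 1) = 0 by ring, Real.rpow_zero]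
  have hwp0 : 0 < w ^ (1 / p) := Real.rpow_pos_of_pos hw0 _
  have hu2 : u ^ 2 * W1 ≤ 1 := by
    rw [← hwp, ← sq_abs]
    gcongr
    nlinarith [abs_nonneg u]
  have hub : |u| * |b1| * W1 ≤ q := by
    calc |u| * |b1| * W1 ≤ w ^ (1 / p) * (q * w ^ (1 / p)) * W1 := by gcongr
      _ = q * (w ^ (1 / p) * w ^ (1 / p) * W1) := by ring
      _ = q := by rw [hwp, mul_one]
  have hua : u * a1 ≤ p * w := (mul_regPow₁_le hε hp0.le u).trans (by gcongr; linarith)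
  have hua0 : 0 ≤ u * a1 := mul_regPow₁_nonneg hε hp0.le u
  have hθW : θ ≤ W := by
    calc θ = b ^ κ := by
          rw [hb, regPow, ← Real.rpow_mul hs0.le, hθ]; congr 1; linarith
      _ ≤ W := Real.rpow_le_rpow hb0.le (by linarith) hκ0
  -- the second derivatives
  have hUU : 2 * θ ≤ bellUU ε p q u v := by
    have ha2 : 0 ≤ a2 := regPow₂_nonneg hε hp u
    -- The negative contribution of the concave power is absorbed by half of the first order term
    -- 4κu·W1·a1, since u·a1 ≤ p·w and p(1 − κ) = 2.
    have h1 : (1 - κ) * u ^ 2 * W2 * a1 ^ 2 ≤ 2 * (u * a1) * W1 := by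
      calc (1 - κ) * u ^ 2 * W2 * a1 ^ 2 = (1 - κ) * (u * a1) * W2 * (u * a1) := by ring
        _ ≤ (1 - κ) * (u * a1) * W2 * (p * w) := by
          have : 0 ≤ 1 - κ := by linarith
          gcongr
        _ = (p * (1 - κ)) * (u * a1) * (W2 * w) := by ring
        _ = _ := by rw [hpκ, e1]
    have h2 : 0 ≤ κ * u ^ 2 * (W1 * a2) := by positivity
    have h3 : 0 ≤ κ * (2 * (u * a1) * W1) := by positivity
    have h4 := mul_le_mul_of_nonneg_left h1 hκ0
    have : bellUU ε p q u v = 2 * W + 4 * κ * u * W1 * a1 +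
      κ * u ^ 2 * ((κ - 1) * W2 * a1 ^ 2 + W1 * a2) := rfl
    have h5 : 2 * W + 4 * κ * u * W1 * a1 + κ * u ^ 2 * ((κ - 1) * W2 * a1 ^ 2 + W1 * a2) =
        2 * W + (κ * (2 * (u * a1) * W1) - κ * ((1 - κ) * u ^ 2 * W2 * a1 ^ 2)) +
          κ * (2 * (u * a1) * W1) + κ * u ^ 2 * (W1 * a2) := by ring
    rw [this, h5]
    linarith
  have hUV : |bellUV ε p q u v| ≤ 8 := by
    have : bellUV ε p q u v = 2 * κ * u * W1 * b1 + κ * (κ - 1) * u ^ 2 * W2 * a1 * b1 := rfl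
    rw [this]
    have h1 : |2 * κ * u * W1 * b1| = 2 * κ * (|u| * |b1| * W1) := by
      rw [abs_mul, abs_mul, abs_mul, abs_of_pos hW1pos, abs_of_nonneg (by positivity : 0 ≤ 2 * κ)]
      ring
    have h2 : |κ * (κ - 1) * u ^ 2 * W2 * a1 * b1| ≤ 2 * κ * (|u| * |b1| * W1) := by
      have : κ * (κ - 1) * u ^ 2 * W2 * a1 * b1 = - (κ * (1 - κ) * (u * a1) * W2 * (u * b1)) := by
        ring
      have hk : 0 ≤ κ * (1 - κ) * (u * a1) * W2 := by
        have : 0 ≤ 1 - κ := by linarith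
        positivity
      rw [this, abs_neg, abs_mul, abs_of_nonneg hk, abs_mul]
      calc _ ≤ κ * (1 - κ) * (p * w) * W2 * (|u| * |b1|) := by
            have : 0 ≤ 1 - κ := by linarith
            gcongr
        _ = κ * (p * (1 - κ)) * (W2 * w) * (|u| * |b1|) := by ring
        _ = _ := by rw [hpκ, e1]; ring
    calc _ ≤ 2 * κ * (|u| * |b1| * W1) + 2 * κ * (|u| * |b1| * W1) :=
          (abs_add_le _ _).trans (add_le_add h1.le h2)
      _ ≤ 2 * κ * q + 2 * κ * q := by gcongr
      _ ≤ 8 := by nlinarith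
  have hVV : 41 * θ' ≤ bellVV ε A p q u v := by
    have hb2' : q * (q - 1) * θ' ≤ b2 := regPow₂_ge hε (by linarith) hq2 v
    have hb20 : 0 ≤ b2 := le_trans (by have : 0 ≤ q - 1 := by linarith
                                       positivity) hb2'
    have : bellVV ε A p q u v = A * b2 + κ * u ^ 2 * ((κ - 1) * W2 * b1 ^ 2 + W1 * b2) := rfl
    rw [this]
    have h2 : 0 ≤ κ * u ^ 2 * (W1 * b2) := by positivity
    have hb1sq : b1 ^ 2 ≤ 4 * θ' * w := by
      have h := abs_regPow₁_le hε (by linarith : 0 ≤ q) v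
      calc b1 ^ 2 = |b1| ^ 2 := (sq_abs _).symm
        _ ≤ (q * s ^ ((q - 1) / 2)) ^ 2 := by gcongr
        _ = q ^ 2 * (s ^ (q / 2 - 1) * s ^ (q / 2)) := by
          rw [mul_pow, ← Real.rpow_natCast, ← Real.rpow_natCast, ← Real.rpow_mul hs0.le,
            ← Real.rpow_add hs0]
          congr 2; push_cast; ring
        _ = q ^ 2 * θ' * b := by rw [mul_assoc]; rfl
        _ ≤ 4 * θ' * w := by
          have : q ^ 2 ≤ 4 := by nlinarith
          gcongr
          linarith
    have h3 : κ * (1 - κ) * u ^ 2 * W2 * b1 ^ 2 ≤ 4 * θ' := by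
      have hk : κ * (1 - κ) ≤ 1 := by nlinarith
      have hk0 : 0 ≤ κ * (1 - κ) := mul_nonneg hκ0 (by linarith)
      calc κ * (1 - κ) * u ^ 2 * W2 * b1 ^ 2 ≤ 1 * u ^ 2 * W2 * (4 * θ' * w) := by gcongr
        _ = 4 * θ' * (u ^ 2 * (W2 * w)) := by ring
        _ ≤ 4 * θ' * 1 := by rw [e1]; gcongr
        _ = _ := by ring
    -- The power of v contributes 45; the concavity of the weight takes away at most 4.
    have h4 : 45 * θ' ≤ A * b2 := by
      calc 45 * θ' ≤ A * (q * (q - 1)) * θ' := by gcongr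
        _ = A * (q * (q - 1) * θ') := by ring
        _ ≤ _ := by gcongr
    have h5 : A * b2 + κ * u ^ 2 * ((κ - 1) * W2 * b1 ^ 2 + W1 * b2) =
        A * b2 - κ * (1 - κ) * u ^ 2 * W2 * b1 ^ 2 + κ * u ^ 2 * (W1 * b2) := by ring
    rw [h5]
    linarith
  -- conclusion
  have hxy : 18 * |x * y| ≤ 2 * θ * x ^ 2 + 41 * θ' * y ^ 2 := by
    rw [abs_mul]
    have hy : y ^ 2 = θ * θ' * y ^ 2 := by rw [hθθ, one_mul]
    -- The mixed entry costs 2·8, and 2 are to be kept, so 18 are needed. The square gives 2θx² +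
    -- 40.5θ⁻¹y² ≥ 18|xy|.
    have hsq : 0 ≤ θ' * (9 * |y| - 2 * (θ * |x|)) ^ 2 := by positivity
    have : θ' * (9 * |y| - 2 * (θ * |x|)) ^ 2 =
        81 * θ' * |y| ^ 2 - 36 * (θ * θ') * (|x| * |y|) + 4 * (θ * θ') * θ * |x| ^ 2 := by ring
    rw [this, hθθ, sq_abs, sq_abs] at hsq
    have := mul_nonneg hθ'0.le (sq_nonneg y)
    linarith
  have h1 : 2 * θ * x ^ 2 ≤ bellUU ε p q u v * x ^ 2 := by gcongr
  have h2 : 41 * θ' * y ^ 2 ≤ bellVV ε A p q u v * y ^ 2 := by gcongr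
  have h3 : -(8 * |x * y|) ≤ bellUV ε p q u v * (x * y) := by
    have : |bellUV ε p q u v * (x * y)| ≤ 8 * |x * y| := by
      rw [abs_mul]; gcongr
    exact (abs_le.1 this).1
  linarith

end Bellman

end DensityEuler
end

noncomputable section
namespace DensityEuler

/-! ### The heat semigroup on smooth compactly supported functions -/

variable {N : ℕ}

/-- Smooth compactly supported real functions on `ℝ^N`. -/
def IsBump (f : Space N → ℝ) : Prop := ContDiff ℝ ∞ f ∧ HasCompactSupport f

/-- The `i`-th standard basis vector. -/
def basisVec (i : Fin N) : Space N := EuclideanSpace.single i (1 : ℝ)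

/-- The `i`-th partial derivative. -/
def pd (i : Fin N) (f : Space N → ℝ) (x : Space N) : ℝ := fderiv ℝ f x (basisVec i)

/-- The Laplacian. -/
def lap (f : Space N → ℝ) (x : Space N) : ℝ := ∑ i, pd i (pd i f) x

lemma sum_smul_basisVec (v : Space N) : ∑ i, v i • basisVec i = v := by
  ext j
  simp [basisVec, Finset.sum_apply, Pi.single_apply]

lemma fderiv_apply_eq_sum (f : Space N → ℝ) (x v : Space N) :
    fderiv ℝ f x v = ∑ i, v i * pd i f x := by
  conv_lhs => rw [← sum_smul_basisVec v]
  simp [pd]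

namespace IsBump

variable {f g : Space N → ℝ}

lemma differentiable (hf : IsBump f) : Differentiable ℝ f := hf.1.differentiable (by simp)

lemma continuous (hf : IsBump f) : Continuous f := hf.1.continuous

lemma integrable (hf : IsBump f) : Integrable f := hf.continuous.integrable_of_hasCompactSupport hf.2

lemma memLp (hf : IsBump f) (p : ℝ≥0∞) : MemLp f p := hf.continuous.memLp_of_hasCompactSupport hf.2

lemma continuous_fderiv (hf : IsBump f) : Continuous (fderiv ℝ f) := hf.1.continuous_fderiv (by simp)

lemma fderiv_apply (hf : IsBump f) (v : Space N) : IsBump fun x => fderiv ℝ f x v :=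
  ⟨(hf.1.fderiv_right (m := ∞) (by simp)).clm_apply contDiff_const, hf.2.fderiv_apply (𝕜 := ℝ) v⟩

lemma pd (hf : IsBump f) (i : Fin N) : IsBump (pd i f) := hf.fderiv_apply _

lemma add (hf : IsBump f) (hg : IsBump g) : IsBump fun x => f x + g x :=
  ⟨hf.1.add hg.1, hf.2.add hg.2⟩

lemma const_mul (hf : IsBump f) (c : ℝ) : IsBump fun x => c * f x :=
  ⟨contDiff_const.mul hf.1, hf.2.mul_left⟩

lemma mul (hf : IsBump f) (hg : ContDiff ℝ ∞ g) : IsBump fun x => f x * g x :=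
  ⟨hf.1.mul hg, hf.2.mul_right⟩

lemma sum {ι : Type*} (s : Finset ι) {F : ι → Space N → ℝ} (h : ∀ i ∈ s, IsBump (F i)) :
    IsBump fun x => ∑ i ∈ s, F i x := by
  classical
  induction s using Finset.induction_on with
  | empty => exact ⟨by simpa using contDiff_const, by simpa using! HasCompactSupport.zero⟩
  | insert a s ha ih =>
    simp only [Finset.sum_insert ha]
    exact (h a (by simp)).add (ih fun i hi => h i (by simp [hi]))

lemma lap (hf : IsBump f) : IsBump (lap f) := sum _ fun i _ => (hf.pd i).pd i

lemma exists_bound (hf : IsBump f) : ∃ C, 0 ≤ C ∧ ∀ x, |f x| ≤ C := by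
  obtain ⟨C, hC⟩ := hf.2.exists_bound_of_continuous hf.continuous
  exact ⟨C, (norm_nonneg _).trans (hC 0), hC⟩

lemma exists_bound_fderiv (hf : IsBump f) : ∃ C, 0 ≤ C ∧ ∀ x, ‖fderiv ℝ f x‖ ≤ C := by
  obtain ⟨C, hC⟩ := (hf.2.fderiv (𝕜 := ℝ)).exists_bound_of_continuous hf.continuous_fderiv
  exact ⟨C, (norm_nonneg _).trans (hC 0), hC⟩

end IsBump

/-- The standard Gaussian density on `ℝ^N`. -/
def gauss (y : Space N) : ℝ :=
  (∫ z : Space N, Real.exp (-(1 / 2) * ‖z‖ ^ 2))⁻¹ * Real.exp (-(1 / 2) * ‖y‖ ^ 2)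

lemma integral_exp_pos {b : ℝ} (hb : 0 < b) : 0 < ∫ z : Space N, Real.exp (-b * ‖z‖ ^ 2) := by
  rw [GaussianFourier.integral_rexp_neg_mul_sq_norm hb]
  have := Real.pi_pos
  positivity

lemma integrable_exp {b : ℝ} (hb : 0 < b) :
    Integrable fun z : Space N => Real.exp (-b * ‖z‖ ^ 2) :=
  .of_integral_ne_zero (integral_exp_pos hb).ne'

lemma gauss_pos (y : Space N) : 0 < gauss y :=
  mul_pos (inv_pos.2 (integral_exp_pos (by norm_num))) (Real.exp_pos _)

lemma integrable_gauss : Integrable (gauss (N := N)) := (integrable_exp (by norm_num)).const_mul _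

lemma integral_gauss : ∫ y, gauss (N := N) y = 1 := by
  unfold gauss
  rw [integral_const_mul, inv_mul_cancel₀ (integral_exp_pos (by norm_num)).ne']

lemma contDiff_gauss : ContDiff ℝ ∞ (gauss (N := N)) := by
  unfold gauss
  exact contDiff_const.mul (Real.contDiff_exp.comp (contDiff_const.mul (contDiff_norm_sq ℝ)))

lemma continuous_gauss : Continuous (gauss (N := N)) := contDiff_gauss.continuous

lemma fderiv_gauss (y v : Space N) : fderiv ℝ gauss y v = - (inner ℝ y v * gauss y) := by
  have h : HasFDerivAt (fun y : Space N => ‖y‖ ^ 2) (2 • innerSL ℝ y) y :=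
    (hasStrictFDerivAt_norm_sq y).hasFDerivAt
  have h2 := ((h.const_mul (-(1 / 2) : ℝ)).exp).const_mul
    (∫ z : Space N, Real.exp (-(1 / 2) * ‖z‖ ^ 2))⁻¹
  have h3 : HasFDerivAt (gauss (N := N)) _ y := h2
  rw [h3.fderiv]
  simp [gauss]
  ring

/-- Half of the Gaussian exponent is spent on the factor: ‖y‖ ≤ 2 exp(‖y‖²/4). -/
lemma integrable_norm_mul_gauss : Integrable fun y : Space N => ‖y‖ * gauss y := by
  have h := (integrable_exp (N := N) (b := 1 / 4) (by norm_num)).const_mul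
    (2 * (∫ z : Space N, Real.exp (-(1 / 2) * ‖z‖ ^ 2))⁻¹)
  refine h.mono' (by have := continuous_gauss (N := N); fun_prop) (ae_of_all _ fun y => ?_)
  have hZ := inv_pos.2 (integral_exp_pos (N := N) (b := 1 / 2) (by norm_num))
  rw [Real.norm_of_nonneg (mul_nonneg (norm_nonneg _) (gauss_pos y).le), gauss]
  have h1 : ‖y‖ ≤ 2 * Real.exp (1 / 4 * ‖y‖ ^ 2) := by
    have := Real.add_one_le_exp (1 / 4 * ‖y‖ ^ 2)
    nlinarith [sq_nonneg (‖y‖ - 1)]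
  have h2 : Real.exp (-(1 / 4) * ‖y‖ ^ 2) =
      Real.exp (1 / 4 * ‖y‖ ^ 2) * Real.exp (-(1 / 2) * ‖y‖ ^ 2) := by
    rw [← Real.exp_add]; congr 1; ring
  rw [h2]
  calc _ = ‖y‖ * ((∫ z : Space N, Real.exp (-(1 / 2) * ‖z‖ ^ 2))⁻¹ *
        Real.exp (-(1 / 2) * ‖y‖ ^ 2)) := rfl
    _ ≤ 2 * Real.exp (1 / 4 * ‖y‖ ^ 2) * ((∫ z : Space N, Real.exp (-(1 / 2) * ‖z‖ ^ 2))⁻¹ *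
        Real.exp (-(1 / 2) * ‖y‖ ^ 2)) := by gcongr
    _ = _ := by ring

/-- The heat semigroup, `e^{tΔ} f`, for `t ≥ 0`. -/
def heat (t : ℝ) (f : Space N → ℝ) (x : Space N) : ℝ :=
  ∫ y, gauss y * f (x + √(2 * t) • y)

section Heat

variable {f g : Space N → ℝ}

/-- The square root vanishes on nonpositive reals and the Gaussian has mass one, so the defining
formula also covers the initial time without a separate case. -/
lemma heat_of_nonpos {t : ℝ} (ht : t ≤ 0) (f : Space N → ℝ) : heat t f = f := by
  ext x
  have : √(2 * t) = 0 := Real.sqrt_eq_zero_of_nonpos (by linarith)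
  simp [heat, this, integral_mul_const, integral_gauss]

lemma integrable_gauss_mul (hf : Continuous f) {C : ℝ} (hC : ∀ x, |f x| ≤ C) (s : ℝ) (x : Space N) :
    Integrable fun y => gauss y * f (x + s • y) := by
  refine (integrable_gauss.mul_const C).mono'
    (by have := continuous_gauss (N := N); fun_prop) (ae_of_all _ fun y => ?_)
  rw [Real.norm_eq_abs, abs_mul, abs_of_pos (gauss_pos y)]
  exact mul_le_mul_of_nonneg_left (hC _) (gauss_pos y).le

lemma abs_heat_le {C : ℝ} (hC : ∀ x, |f x| ≤ C) (t : ℝ) (x : Space N) : |heat t f x| ≤ C := by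
  rw [← Real.norm_eq_abs]
  refine (norm_integral_le_of_norm_le (integrable_gauss.mul_const C) (ae_of_all _ fun y => ?_)).trans
    (by rw [integral_mul_const, integral_gauss, one_mul])
  rw [Real.norm_eq_abs, abs_mul, abs_of_pos (gauss_pos y)]
  exact mul_le_mul_of_nonneg_left (hC _) (gauss_pos y).le

lemma continuous_heat (hf : IsBump f) : Continuous fun z : ℝ × Space N => heat z.1 f z.2 := by
  obtain ⟨C, -, hC⟩ := hf.exists_bound
  have hc := hf.continuous
  have hg := continuous_gauss (N := N)
  refine continuous_of_dominated (bound := fun y => gauss y * C) (fun z => ?_)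
    (fun z => ae_of_all _ fun y => ?_) (integrable_gauss.mul_const C) (ae_of_all _ fun y => ?_)
  · exact (by fun_prop : Continuous fun y => gauss y * f (z.2 + √(2 * z.1) • y)).aestronglyMeasurable
  · rw [Real.norm_eq_abs, abs_mul, abs_of_pos (gauss_pos y)]
    exact mul_le_mul_of_nonneg_left (hC _) (gauss_pos y).le
  · fun_prop

lemma hasFDerivAt_heat (hf : IsBump f) (t : ℝ) (x : Space N) :
    HasFDerivAt (heat t f) (∫ y, gauss y • fderiv ℝ f (x + √(2 * t) • y)) x := by
  obtain ⟨C, -, hC⟩ := hf.exists_bound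
  obtain ⟨D, -, hD⟩ := hf.exists_bound_fderiv
  have hc := hf.continuous
  have hd := hf.continuous_fderiv
  have hg := continuous_gauss (N := N)
  refine hasFDerivAt_integral_of_dominated_of_fderiv_le (s := univ)
    (bound := fun y => gauss y * D)
    (F' := fun x y => gauss y • fderiv ℝ f (x + √(2 * t) • y)) univ_mem (.of_forall fun z => ?_)
    (integrable_gauss_mul hc hC _ x) ?_ (ae_of_all _ fun y z _ => ?_)
    (integrable_gauss.mul_const D) (ae_of_all _ fun y z _ => ?_)
  · exact (integrable_gauss_mul hc hC _ z).aestronglyMeasurable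
  · exact (by fun_prop : Continuous fun y =>
      gauss y • fderiv ℝ f (x + √(2 * t) • y)).aestronglyMeasurable
  · rw [norm_smul, Real.norm_of_nonneg (gauss_pos y).le]
    exact mul_le_mul_of_nonneg_left (hD _) (gauss_pos y).le
  · have h := (hf.differentiable (z + √(2 * t) • y)).hasFDerivAt.comp z
      ((hasFDerivAt_id z).add_const (√(2 * t) • y))
    simpa using h.const_mul (gauss y)

/-- The flow is an average of translates of f, hence commutes with derivatives. All derivatives fall
on f, so no singularity at time 0 appears. -/
lemma fderiv_heat (hf : IsBump f) (t : ℝ) (x v : Space N) :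
    fderiv ℝ (heat t f) x v = heat t (fun z => fderiv ℝ f z v) x := by
  rw [(hasFDerivAt_heat hf t x).fderiv]
  obtain ⟨D, -, hD⟩ := hf.exists_bound_fderiv
  have hd := hf.continuous_fderiv
  have hg := continuous_gauss (N := N)
  rw [ContinuousLinearMap.integral_apply]
  · rfl
  · refine (integrable_gauss.mul_const D).mono'
      (by fun_prop : Continuous fun y =>
        gauss y • fderiv ℝ f (x + √(2 * t) • y)).aestronglyMeasurable (ae_of_all _ fun y => ?_)
    rw [norm_smul, Real.norm_of_nonneg (gauss_pos y).le]
    exact mul_le_mul_of_nonneg_left (hD _) (gauss_pos y).le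

lemma differentiable_heat (hf : IsBump f) (t : ℝ) : Differentiable ℝ (heat t f) :=
  fun x => (hasFDerivAt_heat hf t x).differentiableAt

lemma pd_heat (hf : IsBump f) (t : ℝ) (i : Fin N) : pd i (heat t f) = heat t (pd i f) :=
  funext fun x => fderiv_heat hf t x _

lemma heat_sum {ι : Type*} (s : Finset ι) {F : ι → Space N → ℝ} (h : ∀ i ∈ s, IsBump (F i)) (t : ℝ)
    (x : Space N) : heat t (fun x => ∑ i ∈ s, F i x) x = ∑ i ∈ s, heat t (F i) x := by
  simp only [heat, Finset.mul_sum]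
  rw [integral_finsetSum]
  intro i hi
  obtain ⟨C, -, hC⟩ := (h i hi).exists_bound
  exact integrable_gauss_mul (h i hi).continuous hC _ x

/-- Gaussian integration by parts. -/
lemma integral_gauss_coord (hf : IsBump f) (s : ℝ) (x : Space N) (i : Fin N) :
    ∫ y, gauss y * (y i * f (x + s • y)) = s * ∫ y, gauss y * pd i f (x + s • y) := by
  obtain ⟨C, -, hC⟩ := hf.exists_bound
  obtain ⟨D, -, hD⟩ := (hf.pd i).exists_bound
  have hc := hf.continuous
  have hg := continuous_gauss (N := N)
  have hder (y : Space N) : HasFDerivAt (fun y => f (x + s • y)) (s • fderiv ℝ f (x + s • y)) y := by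
    have h := (hf.differentiable (x + s • y)).hasFDerivAt.comp y
      (((hasFDerivAt_id y).const_smul s).const_add x)
    refine h.congr_fderiv ?_
    ext v
    simp
  have hi (y : Space N) : fderiv ℝ gauss y (basisVec i) = - (y i * gauss y) := by
    rw [fderiv_gauss]; simp [basisVec, EuclideanSpace.inner_single_right]
  have e (y : Space N) : fderiv ℝ (fun y => f (x + s • y)) y (basisVec i) = s * pd i f (x + s • y) := by
    rw [(hder y).fderiv]; simp [pd]
  have h := integral_mul_fderiv_eq_neg_fderiv_mul_of_integrable (μ := volume) (f := gauss (N := N))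
    (g := fun y => f (x + s • y)) (v := basisVec i) ?_ ?_ (integrable_gauss_mul hc hC s x)
    (fun y _ => contDiff_gauss.differentiable (by simp) y) (fun y _ => (hder y).differentiableAt)
  · simp only [e, hi] at h
    rw [← integral_const_mul, ← integral_neg] at *
    calc _ = ∫ y, -(-(y i * gauss y) * f (x + s • y)) := by congr 1; ext y; ring
      _ = ∫ y, gauss y * (s * pd i f (x + s • y)) := h.symm
      _ = _ := by congr 1; ext y; ring
  · simp only [hi]
    refine (integrable_norm_mul_gauss.mul_const C).mono'
      (by fun_prop : Continuous fun y : Space N =>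
        -(y i * gauss y) * f (x + s • y)).aestronglyMeasurable (ae_of_all _ fun y => ?_)
    rw [Real.norm_eq_abs, abs_mul, abs_neg, abs_mul, abs_of_pos (gauss_pos y)]
    have := gauss_pos y
    gcongr
    · exact PiLp.norm_apply_le y i
    · exact hC _
  · simp only [e]
    simpa only [mul_left_comm] using (integrable_gauss_mul (hf.pd i).continuous hD s x).const_mul s

/-- The heat equation. -/
lemma hasDerivAt_heat (hf : IsBump f) {t : ℝ} (ht : 0 < t) (x : Space N) :
    HasDerivAt (fun t => heat t f x) (heat t (lap f) x) t := by
  obtain ⟨C, -, hC⟩ := hf.exists_bound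
  obtain ⟨D, hD0, hD⟩ := hf.exists_bound_fderiv
  have hc := hf.continuous
  have hd := hf.continuous_fderiv
  have hg := continuous_gauss (N := N)
  -- For s > t/2 one has 1/√(2s) ≤ 1/√t, which makes the dominating function independent of s.
  have hmem : Ioi (t / 2) ∈ 𝓝 t := Ioi_mem_nhds (by linarith)
  have h := hasDerivAt_integral_of_dominated_loc_of_deriv_le (μ := volume) (𝕜 := ℝ)
    (F := fun t y => gauss y * f (x + √(2 * t) • y)) (x₀ := t)
    (F' := fun t y => gauss y * (fderiv ℝ f (x + √(2 * t) • y) ((√(2 * t))⁻¹ • y)))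
    (s := Ioi (t / 2)) (bound := fun y => ‖y‖ * gauss y * (D * (√t)⁻¹)) hmem
    (.of_forall fun s => (integrable_gauss_mul hc hC _ x).aestronglyMeasurable)
    (integrable_gauss_mul hc hC _ x)
    (by fun_prop : Continuous fun y => gauss y *
      (fderiv ℝ f (x + √(2 * t) • y) ((√(2 * t))⁻¹ • y))).aestronglyMeasurable
    (ae_of_all _ fun y s hs => ?_) (integrable_norm_mul_gauss.mul_const _)
    (ae_of_all _ fun y s hs => ?_)
  · refine h.2.congr_deriv ?_
    have hs0 : 0 < √(2 * t) := Real.sqrt_pos.2 (by linarith)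
    -- Differentiating √(2t) produces the factor 1/√(2t). Gaussian integration by parts replaces
    -- each coordinate yᵢ by √(2t)∂ᵢ; the two factors cancel and the Laplacian remains.
    have e1 (y : Space N) : gauss y * (fderiv ℝ f (x + √(2 * t) • y) ((√(2 * t))⁻¹ • y)) =
        ∑ i, (√(2 * t))⁻¹ * (gauss y * (y i * pd i f (x + √(2 * t) • y))) := by
      rw [fderiv_apply_eq_sum, Finset.mul_sum]
      refine Finset.sum_congr rfl fun i _ => ?_
      simp only [PiLp.smul_apply, smul_eq_mul]
      ring
    simp only [e1]
    rw [integral_finsetSum]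
    · simp only [integral_const_mul, integral_gauss_coord (hf.pd _)]
      have e2 : heat t (lap f) x = ∑ i, heat t (pd i (pd i f)) x :=
        heat_sum _ (fun i _ => (hf.pd i).pd i) t x
      rw [e2]
      refine Finset.sum_congr rfl fun i _ => ?_
      rw [← mul_assoc, inv_mul_cancel₀ hs0.ne', one_mul]
      rfl
    · intro i _
      obtain ⟨D', -, hD'⟩ := (hf.pd i).exists_bound
      have hc' := (hf.pd i).continuous
      refine ((integrable_norm_mul_gauss.mul_const D').mono' (by fun_prop : Continuous
        fun y : Space N => gauss y * (y i * pd i f (x + √(2 * t) • y))).aestronglyMeasurable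
          (ae_of_all _ fun y => ?_)).const_mul _
      rw [Real.norm_eq_abs, abs_mul, abs_mul, abs_of_pos (gauss_pos y), mul_comm ‖y‖, mul_assoc]
      have := gauss_pos y
      gcongr
      · exact PiLp.norm_apply_le y i
      · exact hD' _
  · have hs' : t < 2 * s := by have := mem_Ioi.1 hs; linarith
    rw [Real.norm_eq_abs, abs_mul, abs_of_pos (gauss_pos y), mul_comm ‖y‖, mul_assoc]
    have := gauss_pos y
    gcongr
    calc |fderiv ℝ f (x + √(2 * s) • y) ((√(2 * s))⁻¹ • y)| ≤ D * ‖(√(2 * s))⁻¹ • y‖ :=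
          ((fderiv ℝ f _).le_opNorm _).trans (by gcongr; exact hD _)
      _ = ‖y‖ * (D * (√(2 * s))⁻¹) := by
        rw [norm_smul, Real.norm_of_nonneg (by positivity)]; ring
      _ ≤ _ := by
        have : 0 < √t := Real.sqrt_pos.2 ht
        gcongr
  · have hs' : 0 < 2 * s := by have := mem_Ioi.1 hs; linarith
    have h1 : HasDerivAt (fun s : ℝ => x + √(2 * s) • y) ((√(2 * s))⁻¹ • y) s := by
      have h2 : HasDerivAt (fun s : ℝ => √(2 * s)) ((√(2 * s))⁻¹) s := by
        refine (((hasDerivAt_id s).const_mul 2).sqrt hs'.ne').congr_deriv ?_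
        simp only [id_eq, mul_one]
        rw [div_mul_eq_div_div, div_self two_ne_zero, one_div]
      simpa using (h2.smul_const y).const_add x
    exact ((hf.differentiable _).hasFDerivAt.comp_hasDerivAt s h1).const_mul _

lemma integrable_heat_prod (hf : Integrable f) (hc : Continuous f) (t : ℝ) :
    Integrable (Function.uncurry fun x y : Space N => gauss y * f (x + √(2 * t) • y))
      (volume.prod volume) := by
  have hg := continuous_gauss (N := N)
  have hm : Continuous (Function.uncurry fun x y : Space N => gauss y * f (x + √(2 * t) • y)) := by
    unfold Function.uncurry; fun_prop
  rw [integrable_prod_iff' hm.aestronglyMeasurable]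
  refine ⟨ae_of_all _ fun y => (hf.comp_add_right (√(2 * t) • y)).const_mul (gauss y), ?_⟩
  have (y : Space N) : ∫ x, ‖Function.uncurry (fun x y : Space N =>
      gauss y * f (x + √(2 * t) • y)) (x, y)‖ = gauss y * ∫ x, ‖f x‖ := by
    simp only [Function.uncurry, norm_mul, Real.norm_of_nonneg (gauss_pos y).le]
    rw [integral_const_mul, integral_add_right_eq_self (fun x => ‖f x‖)]
  simp only [this]
  exact integrable_gauss.mul_const _

lemma integrable_heat (hf : IsBump f) (t : ℝ) : Integrable (heat t f) :=
  (integrable_heat_prod hf.integrable hf.continuous t).integral_prod_left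

lemma integral_abs_heat_le (hf : IsBump f) (t : ℝ) : ∫ x, |heat t f x| ≤ ∫ x, |f x| := by
  have h := (integrable_heat_prod hf.integrable hf.continuous t)
  have e (y : Space N) : ∫ x, |gauss y * f (x + √(2 * t) • y)| = gauss y * ∫ x, |f x| := by
    simp only [abs_mul, abs_of_pos (gauss_pos y)]
    rw [integral_const_mul, integral_add_right_eq_self (fun x => |f x|)]
  calc ∫ x, |heat t f x| ≤ ∫ x, ∫ y, |gauss y * f (x + √(2 * t) • y)| := by
        refine integral_mono (integrable_heat hf t).abs h.abs.integral_prod_left fun x => ?_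
        exact abs_integral_le_integral_abs
    _ = ∫ y, ∫ x, |gauss y * f (x + √(2 * t) • y)| := integral_integral_swap h.abs
    _ = ∫ x, |f x| := by simp only [e]; rw [integral_mul_const, integral_gauss, one_mul]

/-- Here the supremum is taken of the kernel and the integral of f. The decay in t is what removes
the remainder e^{τΔ} as τ → ∞. -/
lemma abs_heat_le_decay (hf : IsBump f) {t : ℝ} (ht : 0 < t) (x : Space N) :
    |heat t f x| ≤ gauss (0 : Space N) * (∫ x, |f x|) * (√(2 * t) ^ N)⁻¹ := by
  have hs : 0 < √(2 * t) := Real.sqrt_pos.2 (by linarith)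
  obtain ⟨C, -, hC⟩ := hf.exists_bound
  have hle (y : Space N) : gauss y ≤ gauss (0 : Space N) := by
    unfold gauss
    have := integral_exp_pos (N := N) (b := 1 / 2) (by norm_num)
    refine mul_le_mul_of_nonneg_left (Real.exp_le_exp.2 ?_) (inv_pos.2 this).le
    simp only [norm_zero]
    nlinarith [sq_nonneg ‖y‖]
  have hi : Integrable fun y => |f (x + √(2 * t) • y)| := by
    have := (hf.integrable.abs.comp_add_left x).comp_smul (R := √(2 * t)) hs.ne'
    exact this
  calc |heat t f x| ≤ ∫ y, |gauss y * f (x + √(2 * t) • y)| := abs_integral_le_integral_abs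
    _ ≤ ∫ y, gauss (0 : Space N) * |f (x + √(2 * t) • y)| := by
      refine integral_mono (integrable_gauss_mul hf.continuous hC _ x).abs (hi.const_mul _)
        fun y => ?_
      simp only [abs_mul, abs_of_pos (gauss_pos y)]
      have := hle y
      gcongr
    _ = _ := by
      rw [integral_const_mul, Measure.integral_comp_smul volume (fun y => |f (x + y)|),
        integral_add_left_eq_self (fun y => |f y|)]
      simp only [finrank_euclideanSpace, Fintype.card_fin, smul_eq_mul]
      rw [abs_of_pos (by positivity)]
      ring

end Heat

end DensityEuler
end

noncomputable section
namespace DensityEuler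

variable {N : ℕ}

/-! ### The bilinear embedding for the heat semigroup -/

lemma integrable_prod_of_bound {k : ℝ → Space N → ℝ} {τ M : ℝ}
    (hk : AEStronglyMeasurable (Function.uncurry k) ((volume.restrict (Ioc 0 τ)).prod volume))
    (hi : ∀ t, Integrable (k t)) (hM : ∀ t, ∫ x, |k t x| ≤ M) :
    Integrable (Function.uncurry k) ((volume.restrict (Ioc 0 τ)).prod volume) := by
  rw [integrable_prod_iff hk]
  refine ⟨ae_of_all _ hi, ?_⟩
  refine Integrable.mono' (g := fun _ => M) (integrable_const _) hk.norm.integral_prod_right'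
    (ae_of_all _ fun t => ?_)
  rw [Real.norm_of_nonneg (integral_nonneg fun _ => norm_nonneg _)]
  exact hM t

/-- The fundamental theorem of calculus in time, integrated in space. -/
lemma integral_sub_eq_integral_deriv {h k : ℝ → Space N → ℝ} {τ : ℝ} (hτ : 0 ≤ τ)
    (hcont : ∀ x, ContinuousOn (fun t => h t x) (Icc 0 τ))
    (hder : ∀ x, ∀ t ∈ Ioo 0 τ, HasDerivAt (fun t => h t x) (k t x) t)
    (hk : Integrable (Function.uncurry k) ((volume.restrict (Ioc 0 τ)).prod volume)) :
    Integrable (fun x => h τ x - h 0 x) ∧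
      ∫ x, (h τ x - h 0 x) = ∫ t in Ioc 0 τ, ∫ x, k t x := by
  have e : (fun x => h τ x - h 0 x) =ᵐ[volume] fun x => ∫ t in Ioc 0 τ, k t x := by
    filter_upwards [hk.prod_left_ae] with x hx
    rw [← intervalIntegral.integral_of_le hτ]
    refine (intervalIntegral.integral_eq_sub_of_hasDerivAt_of_le hτ (hcont x) (hder x) ?_).symm
    rw [intervalIntegrable_iff_integrableOn_Ioc_of_le hτ]
    exact hx
  refine ⟨hk.integral_prod_right.congr e.symm, ?_⟩
  rw [integral_congr_ae e]
  exact (integral_integral_swap hk).symm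

lemma heat_lap {f : Space N → ℝ} (hf : IsBump f) (t : ℝ) (x : Space N) :
    heat t (lap f) x = ∑ i, heat t (pd i (pd i f)) x :=
  heat_sum _ (fun i _ => (hf.pd i).pd i) t x

lemma hasLineDerivAt_heat {f : Space N → ℝ} (hf : IsBump f) (t : ℝ) (i : Fin N) (x : Space N) :
    HasDerivAt (fun s : ℝ => heat t f (x + s • basisVec i)) (heat t (pd i f) x) 0 := by
  have h := (differentiable_heat hf t x).hasFDerivAt.hasLineDerivAt (basisVec i)
  rw [fderiv_heat hf] at h
  exact h

section Bilinear

variable {f g : Space N → ℝ} {ε A p q : ℝ}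

/-- By the maximum principle the pair of heat flows stays in a fixed compact rectangle, on which φ
is bounded. -/
lemma exists_bound_comp {φ : ℝ × ℝ → ℝ} (hφ : Continuous φ) (hf : IsBump f) (hg : IsBump g) :
    ∃ M, 0 ≤ M ∧ ∀ t x, |φ (heat t f x, heat t g x)| ≤ M := by
  obtain ⟨C, -, hC⟩ := hf.exists_bound
  obtain ⟨D, -, hD⟩ := hg.exists_bound
  obtain ⟨M, hM⟩ := ((isCompact_Icc (a := -C) (b := C)).prod
    (isCompact_Icc (a := -D) (b := D))).exists_bound_of_continuousOn hφ.continuousOn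
  have h (t : ℝ) (x : Space N) : |φ (heat t f x, heat t g x)| ≤ M :=
    hM _ ⟨abs_le.1 (abs_heat_le hC t x), abs_le.1 (abs_heat_le hD t x)⟩
  exact ⟨M, (abs_nonneg _).trans (h 0 0), h⟩

lemma integrable_bdd_mul_heat {G : ℝ → Space N → ℝ} (hG : Continuous (Function.uncurry G)) {M : ℝ}
    (hM : ∀ t x, |G t x| ≤ M) (hf : IsBump f) (t : ℝ) :
    Integrable fun x => G t x * heat t f x := by
  refine (integrable_heat hf t).bdd_mul (c := M) ?_ (ae_of_all _ fun x => hM t x)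
  exact (hG.comp (by fun_prop : Continuous fun x : Space N => (t, x))).aestronglyMeasurable

lemma integral_abs_bdd_mul_heat_le {G : ℝ → Space N → ℝ} (hG : Continuous (Function.uncurry G))
    {M : ℝ} (hM : ∀ t x, |G t x| ≤ M) (hf : IsBump f) (t : ℝ) :
    ∫ x, |G t x * heat t f x| ≤ M * ∫ x, |f x| := by
  have hM0 : 0 ≤ M := (abs_nonneg _).trans (hM 0 0)
  calc ∫ x, |G t x * heat t f x| ≤ ∫ x, M * |heat t f x| := by
        refine integral_mono (integrable_bdd_mul_heat hG hM hf t).abs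
          ((integrable_heat hf t).abs.const_mul M) fun x => ?_
        simp only [abs_mul]
        have := hM t x
        gcongr
    _ ≤ _ := by
      rw [integral_const_mul]
      have := integral_abs_heat_le hf t
      gcongr

lemma integrable_prod_bdd_mul_heat {G : ℝ → Space N → ℝ} (hG : Continuous (Function.uncurry G))
    {M : ℝ} (hM : ∀ t x, |G t x| ≤ M) (hf : IsBump f) (τ : ℝ) :
    Integrable (Function.uncurry fun t x => G t x * heat t f x)
      ((volume.restrict (Ioc 0 τ)).prod volume) := by
  refine integrable_prod_of_bound ?_ (integrable_bdd_mul_heat hG hM hf)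
    (integral_abs_bdd_mul_heat_le hG hM hf)
  have := continuous_heat hf
  exact (hG.mul this).aestronglyMeasurable

/-- Integration by parts against a function of two solutions of the heat equation. -/
lemma integral_comp_mul_heat_pd {φ φ₁ φ₂ : ℝ × ℝ → ℝ} (hφ : Continuous φ) (hφ₁ : Continuous φ₁)
    (hφ₂ : Continuous φ₂)
    (hd : ∀ (u v : ℝ → ℝ) (u' v' s : ℝ), HasDerivAt u u' s → HasDerivAt v v' s →
      HasDerivAt (fun s => φ (u s, v s)) (φ₁ (u s, v s) * u' + φ₂ (u s, v s) * v') s)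
    (hf : IsBump f) (hg : IsBump g) {k : Space N → ℝ} (hk : IsBump k) (i : Fin N) (t : ℝ) :
    ∫ x, φ (heat t f x, heat t g x) * heat t (pd i k) x =
      - ∫ x, (φ₁ (heat t f x, heat t g x) * heat t (pd i f) x +
        φ₂ (heat t f x, heat t g x) * heat t (pd i g) x) * heat t k x := by
  have cf := continuous_heat hf
  have cg := continuous_heat hg
  have cfi := continuous_heat (hf.pd i)
  have cgi := continuous_heat (hg.pd i)
  have hpair : Continuous fun z : ℝ × Space N => (heat z.1 f z.2, heat z.1 g z.2) := cf.prodMk cg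
  obtain ⟨M, hM0, hM⟩ := exists_bound_comp hφ hf hg
  obtain ⟨M₁, hM₁0, hM₁⟩ := exists_bound_comp hφ₁ hf hg
  obtain ⟨M₂, hM₂0, hM₂⟩ := exists_bound_comp hφ₂ hf hg
  obtain ⟨C, hC0, hC⟩ := (hf.pd i).exists_bound
  obtain ⟨D, hD0, hD⟩ := (hg.pd i).exists_bound
  refine integral_bilinear_hasLineDerivAt_right_eq_neg_left_of_integrable (μ := volume)
    (v := basisVec i) (B := ContinuousLinearMap.mul ℝ ℝ)
    (f := fun x => φ (heat t f x, heat t g x)) (g := heat t k)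
    (f' := fun x => φ₁ (heat t f x, heat t g x) * heat t (pd i f) x +
        φ₂ (heat t f x, heat t g x) * heat t (pd i g) x) (g' := heat t (pd i k)) ?_ ?_ ?_ ?_ ?_
  · refine integrable_bdd_mul_heat (M := M₁ * C + M₂ * D) (G := fun t x =>
      φ₁ (heat t f x, heat t g x) * heat t (pd i f) x +
        φ₂ (heat t f x, heat t g x) * heat t (pd i g) x) ?_ (fun t x => ?_) hk t
    · exact ((hφ₁.comp hpair).mul cfi).add ((hφ₂.comp hpair).mul cgi)
    · refine (abs_add_le _ _).trans ?_
      rw [abs_mul, abs_mul]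
      have h1 := hM₁ t x
      have h2 := hM₂ t x
      have h3 := abs_heat_le hC t x
      have h4 := abs_heat_le hD t x
      gcongr
  · exact integrable_bdd_mul_heat (G := fun t x => φ (heat t f x, heat t g x))
      (hφ.comp hpair) hM (hk.pd i) t
  · exact integrable_bdd_mul_heat (G := fun t x => φ (heat t f x, heat t g x))
      (hφ.comp hpair) hM hk t
  · intro x _
    have h := hd _ _ _ _ 0 (hasLineDerivAt_heat hf t i x) (hasLineDerivAt_heat hg t i x)
    simp only [zero_smul, add_zero] at h
    exact h
  · intro x _
    exact hasLineDerivAt_heat hk t i x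

/-- Passage from scalars to gradients: the binary inequality is applied to the lengths X, ±Y of the
two vectors. By Cauchy–Schwarz the sum of the mixed terms lies between −XY and XY, so according to
the sign of β one of the two choices is the worst case. -/
lemma two_mul_abs_le_sum_form {α β γ : ℝ}
    (h : ∀ x y : ℝ, 2 * |x * y| ≤ α * x ^ 2 + 2 * β * (x * y) + γ * y ^ 2)
    (x y : Fin N → ℝ) (i j : Fin N) :
    2 * |x i * y j| ≤ ∑ k, (α * x k ^ 2 + 2 * β * (x k * y k) + γ * y k ^ 2) := by
  set X := √(∑ k, x k ^ 2) with hX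
  set Y := √(∑ k, y k ^ 2) with hY
  have hX2 : X ^ 2 = ∑ k, x k ^ 2 := Real.sq_sqrt (Finset.sum_nonneg fun _ _ => sq_nonneg _)
  have hY2 : Y ^ 2 = ∑ k, y k ^ 2 := Real.sq_sqrt (Finset.sum_nonneg fun _ _ => sq_nonneg _)
  have hX0 : 0 ≤ X := Real.sqrt_nonneg _
  have hY0 : 0 ≤ Y := Real.sqrt_nonneg _
  have hxi : |x i| ≤ X := Real.abs_le_sqrt
    (Finset.single_le_sum (f := fun k => x k ^ 2) (fun _ _ => sq_nonneg _) (Finset.mem_univ i))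
  have hyj : |y j| ≤ Y := Real.abs_le_sqrt
    (Finset.single_le_sum (f := fun k => y k ^ 2) (fun _ _ => sq_nonneg _) (Finset.mem_univ j))
  have hxy : |∑ k, x k * y k| ≤ X * Y := by
    rw [← abs_of_nonneg (mul_nonneg hX0 hY0), ← sq_le_sq, mul_pow, hX2, hY2]
    exact Finset.sum_mul_sq_le_sq_mul_sq _ _ _
  have e : ∑ k, (α * x k ^ 2 + 2 * β * (x k * y k) + γ * y k ^ 2) =
      α * X ^ 2 + 2 * β * (∑ k, x k * y k) + γ * Y ^ 2 := by
    rw [hX2, hY2, Finset.sum_add_distrib, Finset.sum_add_distrib, Finset.mul_sum, Finset.mul_sum,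
      Finset.mul_sum]
  have h1 := h X Y
  have h2 := h X (-Y)
  have h3 : |x i * y j| ≤ X * Y := by rw [abs_mul]; gcongr
  have h4 : |X * Y| = X * Y := abs_of_nonneg (mul_nonneg hX0 hY0)
  have h5 : |X * -Y| = X * Y := by rw [mul_neg, abs_neg, h4]
  have h6 := abs_le.1 hxy
  rw [e]
  rcases le_total 0 β with hβ | hβ
  · have := mul_le_mul_of_nonneg_left h6.1 hβ
    nlinarith
  · have := mul_le_mul_of_nonpos_left h6.2 hβ
    nlinarith

/-- The Bellman argument. The time derivative of B(e^{tΔ}f, e^{tΔ}g) contains Laplacians; after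
integration by parts in space it becomes minus the Hessian of B evaluated on the two gradients.
Integrating in time, the accumulated Hessian is at most the initial value of the integral. -/
lemma integral_abs_heat_mul_heat_le_bell (hε : 0 < ε) (hpq : p.HolderConjugate q) (hp : 2 ≤ p)
    (hA : 45 ≤ A * (q * (q - 1))) (hf : IsBump f) (hg : IsBump g) {τ : ℝ} (hτ : 0 ≤ τ)
    (i j : Fin N) :
    2 * ∫ t in Ioc 0 τ, ∫ x, |heat t (pd i f) x * heat t (pd j g) x| ≤
      ∫ x, (bell ε A p q (f x) (g x) - bell ε A p q 0 0) := by
  obtain ⟨c0, cU, cV, cUU, cUV, cVV⟩ := continuous_bells hε A p q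
  have hq1 : 1 < q := hpq.symm.lt
  have hA0 : 0 ≤ A := by
    have : 0 < q * (q - 1) := by nlinarith
    by_contra h; push Not at h; nlinarith
  have cf := continuous_heat hf
  have cg := continuous_heat hg
  have hpair : Continuous fun z : ℝ × Space N => (heat z.1 f z.2, heat z.1 g z.2) := cf.prodMk cg
  obtain ⟨MU, -, hMU⟩ := exists_bound_comp cU hf hg
  obtain ⟨MV, -, hMV⟩ := exists_bound_comp cV hf hg
  obtain ⟨MUU, hMUU0, hMUU⟩ := exists_bound_comp cUU hf hg
  obtain ⟨MUV, hMUV0, hMUV⟩ := exists_bound_comp cUV hf hg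
  obtain ⟨MVV, hMVV0, hMVV⟩ := exists_bound_comp cVV hf hg
  -- the time derivative
  have hkU := integrable_prod_bdd_mul_heat (G := fun t x => bellU ε p q (heat t f x) (heat t g x))
    (cU.comp hpair) hMU hf.lap τ
  have hkV := integrable_prod_bdd_mul_heat (G := fun t x => bellV ε A p q (heat t f x) (heat t g x))
    (cV.comp hpair) hMV hg.lap τ
  have hmain := integral_sub_eq_integral_deriv
    (h := fun t x => bell ε A p q (heat t f x) (heat t g x))
    (k := fun t x => bellU ε p q (heat t f x) (heat t g x) * heat t (lap f) x +
      bellV ε A p q (heat t f x) (heat t g x) * heat t (lap g) x) hτ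
    (fun x => ((c0.comp hpair).comp
      (by fun_prop : Continuous fun t : ℝ => (t, x))).continuousOn)
    (fun x t ht => hasDerivAt_bell hε A p q (hasDerivAt_heat hf ht.1 x) (hasDerivAt_heat hg ht.1 x))
    (hkU.add hkV)
  simp only [heat_of_nonpos le_rfl] at hmain
  -- the Hessian
  let H (t : ℝ) (x : Space N) (k : Fin N) : ℝ :=
    bellUU ε p q (heat t f x) (heat t g x) * heat t (pd k f) x ^ 2 +
      2 * bellUV ε p q (heat t f x) (heat t g x) * (heat t (pd k f) x * heat t (pd k g) x) +
      bellVV ε A p q (heat t f x) (heat t g x) * heat t (pd k g) x ^ 2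
  -- The Hessian form in direction k is split as G₁·∂ₖe^{tΔ}f + G₂·∂ₖe^{tΔ}g: these are the two
  -- terms produced by integrating by parts against ∂_uB and ∂_vB.
  have hH : ∀ k, ∃ G₁ G₂ : ℝ → Space N → ℝ, ∃ M₁ M₂ : ℝ,
      Continuous (Function.uncurry G₁) ∧ Continuous (Function.uncurry G₂) ∧
      (∀ t x, |G₁ t x| ≤ M₁) ∧ (∀ t x, |G₂ t x| ≤ M₂) ∧
      (∀ t, ∫ x, bellU ε p q (heat t f x) (heat t g x) * heat t (pd k (pd k f)) x =
        - ∫ x, G₁ t x * heat t (pd k f) x) ∧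
      (∀ t, ∫ x, bellV ε A p q (heat t f x) (heat t g x) * heat t (pd k (pd k g)) x =
        - ∫ x, G₂ t x * heat t (pd k g) x) ∧
      ∀ t x, H t x k = G₁ t x * heat t (pd k f) x + G₂ t x * heat t (pd k g) x := by
    intro k
    obtain ⟨C, hC0, hC⟩ := (hf.pd k).exists_bound
    obtain ⟨D, hD0, hD⟩ := (hg.pd k).exists_bound
    have cfk := continuous_heat (hf.pd k)
    have cgk := continuous_heat (hg.pd k)
    refine ⟨fun t x => bellUU ε p q (heat t f x) (heat t g x) * heat t (pd k f) x +
        bellUV ε p q (heat t f x) (heat t g x) * heat t (pd k g) x,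
      fun t x => bellUV ε p q (heat t f x) (heat t g x) * heat t (pd k f) x +
        bellVV ε A p q (heat t f x) (heat t g x) * heat t (pd k g) x,
      MUU * C + MUV * D, MUV * C + MVV * D,
      ((cUU.comp hpair).mul cfk).add ((cUV.comp hpair).mul cgk),
      ((cUV.comp hpair).mul cfk).add ((cVV.comp hpair).mul cgk), fun t x => ?_, fun t x => ?_,
      fun t => ?_, fun t => ?_, fun t x => ?_⟩
    · refine (abs_add_le _ _).trans ?_
      rw [abs_mul, abs_mul]
      have h1 := hMUU t x
      have h2 := hMUV t x
      have h3 := abs_heat_le hC t x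
      have h4 := abs_heat_le hD t x
      gcongr
    · refine (abs_add_le _ _).trans ?_
      rw [abs_mul, abs_mul]
      have h1 := hMUV t x
      have h2 := hMVV t x
      have h3 := abs_heat_le hC t x
      have h4 := abs_heat_le hD t x
      gcongr
    · exact integral_comp_mul_heat_pd cU cUU cUV
        (fun u v u' v' s hu hv => hasDerivAt_bellU hε p q hu hv) hf hg (hf.pd k) k t
    · exact integral_comp_mul_heat_pd cV cUV cVV
        (fun u v u' v' s hu hv => hasDerivAt_bellV hε A p q hu hv) hf hg (hg.pd k) k t
    · simp only [H]; ring
  choose G₁ G₂ M₁ M₂ hG₁ hG₂ hM₁ hM₂ hI₁ hI₂ hHG using hH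
  have hHint (k : Fin N) (t : ℝ) : Integrable fun x => H t x k := by
    simp only [hHG]
    exact (integrable_bdd_mul_heat (hG₁ k) (hM₁ k) (hf.pd k) t).add
      (integrable_bdd_mul_heat (hG₂ k) (hM₂ k) (hg.pd k) t)
  have hHprod (k : Fin N) : Integrable (Function.uncurry fun t x => H t x k)
      ((volume.restrict (Ioc 0 τ)).prod volume) := by
    simp only [hHG]
    exact (integrable_prod_bdd_mul_heat (hG₁ k) (hM₁ k) (hf.pd k) τ).add
      (integrable_prod_bdd_mul_heat (hG₂ k) (hM₂ k) (hg.pd k) τ)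
  have hkey (t : ℝ) : ∫ x, (bellU ε p q (heat t f x) (heat t g x) * heat t (lap f) x +
      bellV ε A p q (heat t f x) (heat t g x) * heat t (lap g) x) = - ∫ x, ∑ k, H t x k := by
    have iU (k : Fin N) := integrable_bdd_mul_heat
      (G := fun t x => bellU ε p q (heat t f x) (heat t g x)) (cU.comp hpair) hMU
      ((hf.pd k).pd k) t
    have iV (k : Fin N) := integrable_bdd_mul_heat
      (G := fun t x => bellV ε A p q (heat t f x) (heat t g x)) (cV.comp hpair) hMV
      ((hg.pd k).pd k) t
    have e1 (x : Space N) : bellU ε p q (heat t f x) (heat t g x) * heat t (lap f) x +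
        bellV ε A p q (heat t f x) (heat t g x) * heat t (lap g) x =
        ∑ k, (bellU ε p q (heat t f x) (heat t g x) * heat t (pd k (pd k f)) x +
          bellV ε A p q (heat t f x) (heat t g x) * heat t (pd k (pd k g)) x) := by
      rw [heat_lap hf, heat_lap hg, Finset.mul_sum, Finset.mul_sum, Finset.sum_add_distrib]
    simp only [e1]
    have iUV (k : Fin N) : Integrable fun x =>
        bellU ε p q (heat t f x) (heat t g x) * heat t (pd k (pd k f)) x +
          bellV ε A p q (heat t f x) (heat t g x) * heat t (pd k (pd k g)) x := (iU k).add (iV k)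
    rw [integral_finsetSum _ (fun k _ => iUV k),
      integral_finsetSum _ (fun k _ => hHint k t), ← Finset.sum_neg_distrib]
    refine Finset.sum_congr rfl fun k _ => ?_
    rw [integral_add (iU k) (iV k), hI₁, hI₂, ← neg_add, ← integral_add
      (integrable_bdd_mul_heat (hG₁ k) (hM₁ k) (hf.pd k) t)
      (integrable_bdd_mul_heat (hG₂ k) (hM₂ k) (hg.pd k) t)]
    simp only [hHG]
  simp only [hkey] at hmain
  rw [integral_neg] at hmain
  obtain ⟨Ci, -, hCi⟩ := (hf.pd i).exists_bound
  have hprod := integrable_prod_bdd_mul_heat (G := fun t x => heat t (pd i f) x)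
    (continuous_heat (hf.pd i)) (fun t x => abs_heat_le hCi t x) (hg.pd j) τ
  have hle : 2 * ∫ t in Ioc 0 τ, ∫ x, |heat t (pd i f) x * heat t (pd j g) x| ≤
      ∫ t in Ioc 0 τ, ∫ x, ∑ k, H t x k := by
    rw [← integral_const_mul]
    refine integral_mono (hprod.abs.integral_prod_left.const_mul 2) ?_ fun t => ?_
    · exact Integrable.integral_prod_left (f := Function.uncurry fun t x => ∑ k, H t x k)
        (integrable_finsetSum Finset.univ fun k _ => hHprod k)
    · simp only
      rw [← integral_const_mul]
      refine integral_mono ?_ (integrable_finsetSum _ fun k _ => hHint k t) fun x => ?_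
      · exact ((integrable_bdd_mul_heat (G := fun t x => heat t (pd i f) x)
          (continuous_heat (hf.pd i)) (fun t x => abs_heat_le hCi t x) (hg.pd j) t).abs).const_mul 2
      · exact two_mul_abs_le_sum_form (fun x' y' => bell_hessian_ge hε hpq hp hA _ _ x' y')
          (fun k => heat t (pd k f) x) (fun k => heat t (pd k g) x) i j
  -- integrability at time `0`
  have hB0 : Integrable fun x => bell ε A p q (f x) (g x) - bell ε A p q 0 0 := by
    refine Continuous.integrable_of_hasCompactSupport ?_ ?_
    · have := c0.comp (hf.continuous.prodMk hg.continuous)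
      exact this.sub continuous_const
    · exact HasCompactSupport.comp₂_left (m := fun u v => bell ε A p q u v - bell ε A p q 0 0)
        hf.2 hg.2 (by simp)
  have hBτ : Integrable fun x => bell ε A p q (heat τ f x) (heat τ g x) - bell ε A p q 0 0 := by
    refine (hmain.1.add hB0).congr (ae_of_all _ fun x => ?_)
    simp
  -- The value at the final time is nonnegative and can be dropped, so the bound is uniform in τ.
  have h0 : 0 ≤ ∫ x, (bell ε A p q (heat τ f x) (heat τ g x) - bell ε A p q 0 0) :=
    integral_nonneg fun x => sub_nonneg.2 (bell_zero_le hε hA0 (by linarith) _ _)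
  have hsub : ∫ x, (bell ε A p q (heat τ f x) (heat τ g x) - bell ε A p q (f x) (g x)) =
      (∫ x, (bell ε A p q (heat τ f x) (heat τ g x) - bell ε A p q 0 0)) -
      ∫ x, (bell ε A p q (f x) (g x) - bell ε A p q 0 0) := by
    rw [← integral_sub hBτ hB0]
    congr 1; ext x; ring
  rw [hsub] at hmain
  linarith [hmain.2]

end Bilinear

end DensityEuler
end

noncomputable section
namespace DensityEuler

variable {N : ℕ}

/-! ### Hölder's inequality and its converse -/

section Holder

variable {p q : ℝ≥0∞}

lemma integrable_mul_of_memLp (hpq : p.HolderConjugate q) {f g : Space N → ℝ} (hf : MemLp f p)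
    (hg : MemLp g q) : Integrable fun x => f x * g x := hf.integrable_mul hg

lemma abs_integral_mul_le (hpq : p.HolderConjugate q) {f g : Space N → ℝ} (hf : MemLp f p)
    (hg : MemLp g q) : |∫ x, f x * g x| ≤ lpNorm f p volume * lpNorm g q volume := by
  have hi : Integrable (f • g) := integrable_mul_of_memLp hpq hf hg
  have h1 : |∫ x, f x * g x| ≤ lpNorm (f • g) 1 volume := by
    rw [lpNorm_one_eq_integral_norm hi.aestronglyMeasurable]
    exact abs_integral_le_integral_abs
  refine h1.trans ?_
  rw [← ENNReal.ofReal_le_ofReal_iff (mul_nonneg lpNorm_nonneg lpNorm_nonneg), ENNReal.ofReal_mul lpNorm_nonneg,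
    ofReal_lpNorm hf, ofReal_lpNorm hg, ofReal_lpNorm (memLp_one_iff_integrable.2 hi)]
  exact eLpNorm_smul_le_mul_eLpNorm hg.1 hf.1

lemma lpNorm_rpow_eq_integral {p : ℝ≥0∞} (hp0 : p ≠ 0) (hp : p ≠ ⊤) {F : Type*}
    [NormedAddCommGroup F] {f : Space N → F} (hf : AEStronglyMeasurable f volume) :
    lpNorm f p volume ^ p.toReal = ∫ x, ‖f x‖ ^ p.toReal := by
  rw [lpNorm_eq_integral_norm_rpow_toReal hp0 hp hf, ← Real.rpow_mul
    (integral_nonneg fun _ => by positivity), inv_mul_cancel₀ (ENNReal.toReal_pos hp0 hp).ne',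
    Real.rpow_one]

/-- An `L^p` function whose pairings with smooth compactly supported functions are bounded by the
`L^q` norm is bounded in `L^p`. -/
lemma lpNorm_le_of_forall_bump (hpq : p.HolderConjugate q) (hp1 : 1 < p) (hp : p ≠ ⊤)
    {f : Space N → ℝ} (hf : MemLp f p) {M : ℝ} (hM0 : 0 ≤ M)
    (h : ∀ ψ, IsBump ψ → |∫ x, f x * ψ x| ≤ M * lpNorm ψ q volume) :
    lpNorm f p volume ≤ M := by
  have hr1 : 1 < p.toReal := by
    rw [← ENNReal.toReal_one]; exact (ENNReal.toReal_lt_toReal (by simp) hp).2 hp1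
  have hrs : p.toReal.HolderConjugate q.toReal := ENNReal.HolderConjugate.toReal hr1
  set r := p.toReal with hr
  set s := q.toReal with hs
  have hs1 : 1 < s := hrs.symm.lt
  have hq0 : q ≠ 0 := by rintro rfl; simp [hs] at hs1; linarith
  have hqt : q ≠ ⊤ := by rintro rfl; simp [hs] at hs1; linarith
  have hq1 : 1 ≤ q := by
    rw [← ENNReal.ofReal_toReal hqt, ← ENNReal.ofReal_one]
    exact ENNReal.ofReal_le_ofReal hs1.le
  have hp0 : p ≠ 0 := (zero_lt_one.trans hp1).ne'
  have hrs' : (r - 1) * s = r := hrs.sub_one_mul_conj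
  -- the extremal function
  set H : Space N → ℝ := fun x => |f x| ^ (r - 2) * f x with hH
  have hHn (x : Space N) : ‖H x‖ = ‖f x‖ ^ (r - 1) := by
    simp only [hH, Real.norm_eq_abs, abs_mul]
    rw [abs_of_nonneg (by positivity : 0 ≤ |f x| ^ (r - 2))]
    rcases (abs_nonneg (f x)).eq_or_lt with h0 | h0
    · rw [← h0, Real.zero_rpow (by linarith : r - 1 ≠ 0), mul_zero]
    · rw [show r - 1 = r - 2 + 1 by ring, Real.rpow_add_one h0.ne']
  have hfH (x : Space N) : f x * H x = ‖f x‖ ^ r := by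
    simp only [hH, Real.norm_eq_abs]
    rcases (abs_nonneg (f x)).eq_or_lt with h0 | h0
    · rw [← h0, Real.zero_rpow (by linarith : r ≠ 0), abs_eq_zero.1 h0.symm, zero_mul]
    · have e : |f x| ^ r = |f x| ^ (r - 2) * (|f x| * |f x|) := by
        rw [← mul_assoc, ← Real.rpow_add_one h0.ne', ← Real.rpow_add_one h0.ne']
        congr 1; ring
      rw [e, abs_mul_abs_self]
      ring
  have hHm : AEStronglyMeasurable H volume := by
    have h1 : AEMeasurable f volume := hf.1.aemeasurable
    have h2 : AEMeasurable H volume := by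
      have := h1.norm.pow_const (r - 2)
      exact this.mul h1
    exact h2.aestronglyMeasurable
  have hHint : Integrable fun x => ‖H x‖ ^ s := by
    refine (hf.integrable_norm_rpow hp0 hp).congr (ae_of_all _ fun x => ?_)
    simp only [hHn]
    rw [← Real.rpow_mul (norm_nonneg _), hrs']
  have hHq : MemLp H q := (integrable_norm_rpow_iff hHm hq0 hqt).1 hHint
  set F := lpNorm f p volume with hF
  have hF0 : 0 ≤ F := lpNorm_nonneg
  have hHnorm : lpNorm H q volume ^ s = F ^ r := by
    rw [hs, lpNorm_rpow_eq_integral hq0 hqt hHm, lpNorm_rpow_eq_integral hp0 hp hf.1]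
    congr 1; ext x
    rw [hHn, ← Real.rpow_mul (norm_nonneg _), hrs']
  have hHnorm' : lpNorm H q volume = F ^ (r - 1) := by
    have h1 : (lpNorm H q volume ^ s) ^ s⁻¹ = lpNorm H q volume :=
      Real.rpow_rpow_inv lpNorm_nonneg (by linarith)
    rw [← h1, hHnorm, ← Real.rpow_mul hF0]
    congr 1
    rw [mul_inv_eq_iff_eq_mul₀ (by linarith), hrs']
  -- the bound extends to the extremal function
  have hext : ∀ δ > 0, |∫ x, f x * H x| ≤ M * (lpNorm H q volume + δ) + F * δ := by
    intro δ hδ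
    obtain ⟨ψ, hψc, hψs, hψ⟩ := hHq.exist_eLpNorm_sub_le hqt hq1 hδ
    have hψB : IsBump ψ := ⟨hψs, hψc⟩
    have hψq := hψB.memLp q
    have hd : lpNorm (H - ψ) q volume ≤ δ := by
      rw [← ENNReal.ofReal_le_ofReal_iff hδ.le, ofReal_lpNorm (hHq.sub hψq)]
      exact hψ
    have e : ∫ x, f x * H x = (∫ x, f x * ψ x) + ∫ x, f x * (H - ψ) x := by
      rw [← integral_add (integrable_mul_of_memLp hpq hf hψq)
        (integrable_mul_of_memLp hpq hf (hHq.sub hψq))]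
      congr 1; ext x; simp only [Pi.sub_apply]; ring
    have h1 : lpNorm ψ q volume ≤ lpNorm H q volume + δ := by
      have := lpNorm_le_lpNorm_add_lpNorm_sub (f := ψ) (g := H) hHq hq1 (p := q) (μ := volume)
      linarith
    rw [e]
    refine (abs_add_le _ _).trans (add_le_add ((h ψ hψB).trans (by gcongr)) ?_)
    exact (abs_integral_mul_le hpq hf (hHq.sub hψq)).trans (by gcongr)
  have hlim : |∫ x, f x * H x| ≤ M * lpNorm H q volume := by
    have h1 : Tendsto (fun δ : ℝ => M * (lpNorm H q volume + δ) + F * δ) (𝓝[>] 0)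
        (𝓝 (M * (lpNorm H q volume + 0) + F * 0)) := by
      apply Tendsto.mono_left _ nhdsWithin_le_nhds
      exact (by fun_prop : Continuous fun δ : ℝ =>
        M * (lpNorm H q volume + δ) + F * δ).tendsto 0
    have := ge_of_tendsto h1 (eventually_mem_nhdsWithin.mono hext)
    simpa using this
  have e : ∫ x, f x * H x = F ^ r := by
    simp only [hfH]
    rw [hF, lpNorm_rpow_eq_integral hp0 hp hf.1]
  rw [e, hHnorm', abs_of_nonneg (by positivity)] at hlim
  rcases hF0.eq_or_lt with h0 | h0
  · rw [← h0]; exact hM0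
  · rw [show r = r - 1 + 1 by ring, Real.rpow_add_one h0.ne', mul_comm M] at hlim
    simp only [add_sub_cancel_right] at hlim
    exact le_of_mul_le_mul_left hlim (by positivity)

end Holder

/-! ### Second order Riesz transforms on test functions -/

section Riesz

variable {f g : Space N → ℝ}

/-- For ε > 0 the regularised power is positive off the support and not integrable over the whole
space. The limit ε → 0 is therefore taken on a compact set containing the supports. -/
lemma continuous_integral_regPow {r : ℝ} (hr : 0 ≤ r) (hf : Continuous f) {K : Set (Space N)}
    (hK : IsCompact K) : Continuous fun ε : ℝ => ∫ x in K, regPow ε r (f x) := by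
  refine continuous_parametric_integral_of_continuous ?_ hK
  have : Continuous fun z : ℝ × Space N => f z.2 ^ 2 + z.1 := by fun_prop
  exact this.rpow_const fun z => Or.inr (by positivity)

lemma regPow_zero_eps (r u : ℝ) : regPow 0 r u = |u| ^ r := by
  rw [regPow, add_zero, ← sq_abs, ← Real.rpow_natCast, ← Real.rpow_mul (abs_nonneg u)]
  congr 1; push_cast; ring

/-- The Bellman bound with ε → 0, still as a sum of powers of norms; the product form follows by
homogeneity. -/
lemma exists_integral_abs_heat_mul_heat_le_add {p q : ℝ} (hpq : p.HolderConjugate q) (hp : 2 ≤ p) :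
    ∃ C, 0 ≤ C ∧ ∀ (f g : Space N → ℝ), IsBump f → IsBump g → ∀ τ, 0 ≤ τ → ∀ i j : Fin N,
      ∫ t in Ioc 0 τ, ∫ x, |heat t (pd i f) x * heat t (pd j g) x| ≤
        C * ((∫ x, |f x| ^ p) + ∫ x, |g x| ^ q) := by
  have hq1 : 1 < q := hpq.symm.lt
  have hqq : 0 < q * (q - 1) := by nlinarith
  -- The smallest value allowed by `bell_hessian_ge`; it depends on q alone.
  set A := 45 / (q * (q - 1)) with hA
  have hA0 : 0 ≤ A := by positivity
  refine ⟨A + 1, by positivity, fun f g hf hg τ hτ i j => ?_⟩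
  set K := tsupport f ∪ tsupport g with hK
  have hKc : IsCompact K := hf.2.isCompact.union hg.2.isCompact
  have hfK : ∀ x ∉ K, f x = 0 := fun x hx => image_eq_zero_of_notMem_tsupport fun h => hx (Or.inl h)
  have hgK : ∀ x ∉ K, g x = 0 := fun x hx => image_eq_zero_of_notMem_tsupport fun h => hx (Or.inr h)
  set I := ∫ t in Ioc 0 τ, ∫ x, |heat t (pd i f) x * heat t (pd j g) x| with hI
  have hI0 : 0 ≤ I := integral_nonneg fun t => integral_nonneg fun x => abs_nonneg _
  have key : ∀ ε > 0, I ≤ (∫ x in K, regPow ε p (f x)) + (A + 1) * ∫ x in K, regPow ε q (g x) := by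
    intro ε hε
    have h := integral_abs_heat_mul_heat_le_bell hε hpq hp (A := A)
      (by rw [hA, div_mul_cancel₀ _ hqq.ne']) hf hg hτ i j
    have e : ∫ x, (bell ε A p q (f x) (g x) - bell ε A p q 0 0) =
        ∫ x in K, (bell ε A p q (f x) (g x) - bell ε A p q 0 0) := by
      refine (setIntegral_eq_integral_of_forall_compl_eq_zero fun x hx => ?_).symm
      rw [hfK x hx, hgK x hx, sub_self]
    have hc := (continuous_bells hε A p q).1.comp (hf.continuous.prodMk hg.continuous)
    have hcf : Continuous fun x => regPow ε p (f x) := (continuous_regPow hε p).comp hf.continuous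
    have hcg : Continuous fun x => regPow ε q (g x) := (continuous_regPow hε q).comp hg.continuous
    have h2 : ∫ x in K, (bell ε A p q (f x) (g x) - bell ε A p q 0 0) ≤
        ∫ x in K, (regPow ε p (f x) + (A + 1) * regPow ε q (g x)) := by
      refine setIntegral_mono ((hc.sub continuous_const).continuousOn.integrableOn_compact hKc)
        ((hcf.add (continuous_const.mul hcg)).continuousOn.integrableOn_compact hKc) fun x => ?_
      have h3 := bell_le (A := A) (q := q) hε hp (f x) (g x)
      have h4 : 0 ≤ bell ε A p q 0 0 := by
        have := regPow_pos hε q 0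
        have h5 := mul_nonneg hA0 this.le
        simpa [bell] using h5
      simp only; linarith
    rw [integral_add (hcf.continuousOn.integrableOn_compact hKc)
      ((hcg.continuousOn.integrableOn_compact hKc).const_mul _), integral_const_mul] at h2
    change 2 * I ≤ _ at h
    linarith
  have hlim : Tendsto (fun ε : ℝ => (∫ x in K, regPow ε p (f x)) +
      (A + 1) * ∫ x in K, regPow ε q (g x)) (𝓝[>] 0)
      (𝓝 ((∫ x in K, regPow 0 p (f x)) + (A + 1) * ∫ x in K, regPow 0 q (g x))) := by
    apply Tendsto.mono_left _ nhdsWithin_le_nhds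
    exact ((continuous_integral_regPow (by linarith) hf.continuous hKc).add (continuous_const.mul
      (continuous_integral_regPow (by linarith) hg.continuous hKc))).tendsto 0
  have h := ge_of_tendsto hlim (eventually_mem_nhdsWithin.mono key)
  simp only [regPow_zero_eps] at h
  rw [setIntegral_eq_integral_of_forall_compl_eq_zero (fun x hx => by
      rw [hfK x hx, abs_zero, Real.zero_rpow (by linarith)]),
    setIntegral_eq_integral_of_forall_compl_eq_zero (fun x hx => by
      rw [hgK x hx, abs_zero, Real.zero_rpow (by linarith)])] at h
  have : 0 ≤ ∫ x, |f x| ^ p := integral_nonneg fun x => by positivity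
  nlinarith

lemma pd_const_mul (hf : IsBump f) (c : ℝ) (i : Fin N) :
    pd i (fun x => c * f x) = fun x => c * pd i f x := by
  ext x
  simp [pd, fderiv_const_mul (hf.differentiable x)]

lemma heat_const_mul (f : Space N → ℝ) (c t : ℝ) (x : Space N) :
    heat t (fun x => c * f x) x = c * heat t f x := by
  simp only [heat, mul_left_comm _ c]
  rw [integral_const_mul]

lemma toReal_holderConjugate {p q : ℝ≥0∞} (hpq : p.HolderConjugate q) (hp1 : 1 < p) (hp : p ≠ ⊤) :
    p.toReal.HolderConjugate q.toReal := by
  refine ENNReal.HolderConjugate.toReal ?_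
  rw [← ENNReal.toReal_one]; exact (ENNReal.toReal_lt_toReal (by simp) hp).2 hp1

lemma holderConjugate_facts {p q : ℝ≥0∞} (hpq : p.HolderConjugate q) (hp1 : 1 < p) (hp : p ≠ ⊤) :
    p ≠ 0 ∧ q ≠ 0 ∧ q ≠ ⊤ ∧ 1 < q := by
  have hs1 := (toReal_holderConjugate hpq hp1 hp).symm.lt
  have hqt : q ≠ ⊤ := by rintro rfl; simp at hs1; linarith
  refine ⟨(zero_lt_one.trans hp1).ne', ?_, hqt, ?_⟩
  · rintro rfl; simp at hs1; linarith
  · rw [← ENNReal.ofReal_toReal hqt, ← ENNReal.ofReal_one]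
    exact (ENNReal.ofReal_lt_ofReal_iff (by linarith)).2 hs1

/-- The bilinear embedding theorem for the heat semigroup. -/
theorem exists_integral_abs_heat_mul_heat_le {p q : ℝ≥0∞} (hpq : p.HolderConjugate q) (hp1 : 1 < p)
    (hp : p ≠ ⊤) :
    ∃ C, 0 ≤ C ∧ ∀ (f g : Space N → ℝ), IsBump f → IsBump g → ∀ τ, 0 ≤ τ → ∀ i j : Fin N,
      ∫ t in Ioc 0 τ, ∫ x, |heat t (pd i f) x * heat t (pd j g) x| ≤
        C * (lpNorm f p volume * lpNorm g q volume) := by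
  -- The statement is symmetric under exchange of (p, f, i) and (q, g, j), and one of two conjugate
  -- exponents is at least 2.
  wlog h2 : 2 ≤ p.toReal generalizing p q with H
  · obtain ⟨hp0, hq0, hqt, hq1⟩ := holderConjugate_facts hpq hp1 hp
    have hrs := toReal_holderConjugate hpq hp1 hp
    have h2' : 2 ≤ q.toReal := by
      have h := hrs.inv_add_inv_eq_one
      have hp0 := hrs.pos
      have hq0 := hrs.symm.pos
      field_simp at h
      push Not at h2
      nlinarith [hrs.lt, hrs.symm.lt]
    obtain ⟨C, hC0, hC⟩ := H (p := q) (q := p) hpq.symm hq1 hqt h2'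
    refine ⟨C, hC0, fun f g hf hg τ hτ i j => ?_⟩
    have := hC g f hg hf τ hτ j i
    simpa only [mul_comm] using this
  obtain ⟨hp0, hq0, hqt, hq1⟩ := holderConjugate_facts hpq hp1 hp
  have hrs := toReal_holderConjugate hpq hp1 hp
  obtain ⟨C, hC0, hC⟩ := exists_integral_abs_heat_mul_heat_le_add (N := N) hrs h2
  refine ⟨C * 2, by positivity, fun f g hf hg τ hτ i j => ?_⟩
  set I := ∫ t in Ioc 0 τ, ∫ x, |heat t (pd i f) x * heat t (pd j g) x| with hI
  -- The left side is bilinear, so f and g may be normalised. Dividing by numbers strictly above the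
  -- norms avoids the case of a vanishing norm; the gap is removed in the limit.
  have scaled : ∀ a b : ℝ, lpNorm f p volume < a → lpNorm g q volume < b → I ≤ C * 2 * (a * b) := by
    intro a b ha hb
    have ha0 : 0 < a := lpNorm_nonneg.trans_lt ha
    have hb0 : 0 < b := lpNorm_nonneg.trans_lt hb
    have h := hC _ _ (hf.const_mul a⁻¹) (hg.const_mul b⁻¹) τ hτ i j
    simp only [pd_const_mul hf, pd_const_mul hg, heat_const_mul] at h
    have e1 (t : ℝ) (x : Space N) : |a⁻¹ * heat t (pd i f) x * (b⁻¹ * heat t (pd j g) x)| =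
        (a * b)⁻¹ * |heat t (pd i f) x * heat t (pd j g) x| := by
      rw [show a⁻¹ * heat t (pd i f) x * (b⁻¹ * heat t (pd j g) x) =
        (a * b)⁻¹ * (heat t (pd i f) x * heat t (pd j g) x) by rw [mul_inv]; ring, abs_mul,
        abs_of_pos (by positivity : 0 < (a * b)⁻¹)]
    have unit {r : ℝ≥0∞} (hr0 : r ≠ 0) (hr : r ≠ ⊤) {k : Space N → ℝ} (hk : IsBump k) {c : ℝ}
        (hc : lpNorm k r volume < c) : ∫ x, |c⁻¹ * k x| ^ r.toReal ≤ 1 := by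
      have hc0 : 0 < c := lpNorm_nonneg.trans_lt hc
      simp only [abs_mul, abs_of_pos (inv_pos.2 hc0)]
      simp only [Real.mul_rpow (inv_pos.2 hc0).le (abs_nonneg _)]
      have e := lpNorm_rpow_eq_integral hr0 hr (hk.memLp r).1
      simp only [Real.norm_eq_abs] at e
      rw [integral_const_mul, ← e, ← Real.mul_rpow (inv_pos.2 hc0).le lpNorm_nonneg]
      refine Real.rpow_le_one (mul_nonneg (inv_pos.2 hc0).le lpNorm_nonneg) ?_ (by positivity)
      rw [inv_mul_le_one₀ hc0]; exact hc.le
    simp only [e1, integral_const_mul] at h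
    rw [inv_mul_le_iff₀ (by positivity)] at h
    have h3 := unit hp0 hp hf ha
    have h4 := unit hq0 hqt hg hb
    calc I ≤ a * b * (C * ((∫ x, |a⁻¹ * f x| ^ p.toReal) + ∫ x, |b⁻¹ * g x| ^ q.toReal)) := h
      _ ≤ a * b * (C * (1 + 1)) := by gcongr
      _ = _ := by ring
  have hlim : Tendsto (fun δ : ℝ => C * 2 * ((lpNorm f p volume + δ) * (lpNorm g q volume + δ)))
      (𝓝[>] 0) (𝓝 (C * 2 * ((lpNorm f p volume + 0) * (lpNorm g q volume + 0)))) := by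
    apply Tendsto.mono_left _ nhdsWithin_le_nhds
    exact (by fun_prop : Continuous fun δ : ℝ =>
      C * 2 * ((lpNorm f p volume + δ) * (lpNorm g q volume + δ))).tendsto 0
  have h := ge_of_tendsto hlim (eventually_mem_nhdsWithin.mono fun δ (hδ : 0 < δ) =>
    scaled _ _ (lt_add_of_pos_right _ hδ) (lt_add_of_pos_right _ hδ))
  simpa using h

/-- The heat semigroup is symmetric, in the form `∫ f e^{tΔ}g = ∫ (e^{sΔ}f) (e^{(t-s)Δ}g)`. -/
lemma integral_heat_mul_heat_sub (hf : IsBump f) (hg : IsBump g) {s t : ℝ} (hs : 0 ≤ s)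
    (hst : s ≤ t) : ∫ x, heat s f x * heat (t - s) g x = ∫ x, f x * heat t g x := by
  obtain ⟨C, -, hC⟩ := hf.exists_bound
  obtain ⟨D, -, hD⟩ := hg.exists_bound
  obtain ⟨C', -, hC'⟩ := hf.lap.exists_bound
  obtain ⟨D', -, hD'⟩ := hg.lap.exists_bound
  have cf := continuous_heat hf
  have cg := continuous_heat hg
  have shift {k : Space N → ℝ} (hk : IsBump k) :
      Continuous (Function.uncurry fun r x => heat (t - r) k x) :=
    (continuous_heat hk).comp (by fun_prop : Continuous fun z : ℝ × Space N => (t - z.1, z.2))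
  have h1 := integrable_prod_bdd_mul_heat (G := fun r x => heat (t - r) g x) (shift hg)
    (fun r x => abs_heat_le hD _ x) hf.lap s
  have h2 := integrable_prod_bdd_mul_heat (G := fun r x => heat (t - r) (lap g) x) (shift hg.lap)
    (fun r x => abs_heat_le hD' _ x) hf s
  -- The pairing of e^{rΔ}f with e^{(t−r)Δ}g does not depend on r: its derivative vanishes because
  -- the Laplacian is symmetric.
  have hmain := integral_sub_eq_integral_deriv (h := fun r x => heat r f x * heat (t - r) g x)
    (k := fun r x => heat (t - r) g x * heat r (lap f) x - heat (t - r) (lap g) x * heat r f x) hs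
    (fun x => ((cf.mul (shift hg)).comp
      (by fun_prop : Continuous fun r : ℝ => (r, x))).continuousOn)
    (fun x r hr => ?_) (h1.sub h2)
  · have hzero (r : ℝ) : ∫ x, (heat (t - r) g x * heat r (lap f) x -
        heat (t - r) (lap g) x * heat r f x) = 0 := by
      have i1 := integrable_bdd_mul_heat (G := fun r x => heat (t - r) g x) (shift hg)
        (fun r x => abs_heat_le hD _ x) hf.lap r
      have i2 := integrable_bdd_mul_heat (G := fun r x => heat (t - r) (lap g) x) (shift hg.lap)
        (fun r x => abs_heat_le hD' _ x) hf r
      rw [integral_sub i1 i2, sub_eq_zero]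
      have bdd {k l : Space N → ℝ} (hk : IsBump k) (hl : IsBump l) :
          Integrable fun x => heat (t - r) k x * heat r l x := by
        obtain ⟨B, -, hB⟩ := hk.exists_bound
        exact integrable_bdd_mul_heat (G := fun r x => heat (t - r) k x) (shift hk)
          (fun r x => abs_heat_le hB _ x) hl r
      have ibp {k l : Space N → ℝ} (hk : IsBump k) (hl : IsBump l) (i : Fin N) :
          ∫ x, heat (t - r) k x * heat r (pd i l) x = - ∫ x, heat (t - r) (pd i k) x * heat r l x :=
        integral_bilinear_hasLineDerivAt_right_eq_neg_left_of_integrable (μ := volume)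
          (v := basisVec i) (B := ContinuousLinearMap.mul ℝ ℝ) (f := heat (t - r) k)
          (f' := heat (t - r) (pd i k)) (g := heat r l) (g' := heat r (pd i l))
          (bdd (hk.pd i) hl) (bdd hk (hl.pd i)) (bdd hk hl)
          (fun x _ => hasLineDerivAt_heat hk _ i x) (fun x _ => hasLineDerivAt_heat hl _ i x)
      simp only [heat_lap hf, heat_lap hg, Finset.mul_sum, Finset.sum_mul]
      rw [integral_finsetSum _ fun i _ => bdd hg ((hf.pd i).pd i),
        integral_finsetSum _ fun i _ => bdd ((hg.pd i).pd i) hf]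
      refine Finset.sum_congr rfl fun i _ => ?_
      rw [ibp hg (hf.pd i), ← neg_eq_iff_eq_neg.2 (ibp (hg.pd i) hf i)]
    simp only [hzero, integral_zero] at hmain
    simp only [heat_of_nonpos le_rfl, sub_zero] at hmain
    have b1 : Integrable fun x => f x * heat t g x := by
      refine (integrable_heat hg t).bdd_mul (c := C) hf.continuous.aestronglyMeasurable
        (ae_of_all _ fun x => hC x)
    have b2 : Integrable fun x => heat s f x * heat (t - s) g x := by
      refine (hmain.1.add b1).congr (ae_of_all _ fun x => ?_)
      simp
    rw [integral_sub b2 b1] at hmain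
    linarith [hmain.2]
  · have hd1 := hasDerivAt_heat hf hr.1 x
    have hd2 : HasDerivAt (fun r => heat (t - r) g x) (-heat (t - r) (lap g) x) r := by
      have h0 : 0 < t - r := by linarith [hr.2]
      have h3 := (hasDerivAt_heat hg h0 x).comp r ((hasDerivAt_id r).const_sub t)
      simpa using! h3
    refine (hd1.mul hd2).congr_deriv ?_
    ring

end Riesz

end DensityEuler
end

noncomputable section
namespace DensityEuler

variable {N : ℕ}

/-! ### Cut-off functions -/

/-- A smooth cut-off, equal to `1` on the ball of radius `1`. -/
def unitBump (N : ℕ) : ContDiffBump (0 : Space N) := ⟨1, 2, zero_lt_one, one_lt_two⟩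

/-- A smooth cut-off, equal to `1` on the ball of radius `R` and to `0` off the ball of radius
`2 R`. -/
def cutoff (R : ℝ) (x : Space N) : ℝ := unitBump N (R⁻¹ • x)

lemma cutoff_mem_Icc (R : ℝ) (x : Space N) : cutoff R x ∈ Icc (0 : ℝ) 1 :=
  ⟨(unitBump N).nonneg, (unitBump N).le_one⟩

lemma cutoff_eq_one {R : ℝ} (hR : 0 < R) {x : Space N} (hx : ‖x‖ ≤ R) : cutoff R x = 1 := by
  apply (unitBump N).one_of_mem_closedBall
  rw [mem_closedBall_zero_iff, norm_smul, Real.norm_of_nonneg (by positivity)]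
  change R⁻¹ * ‖x‖ ≤ 1
  rw [inv_mul_le_one₀ hR]; exact hx

lemma cutoff_eq_zero {R : ℝ} (hR : 0 < R) {x : Space N} (hx : 2 * R ≤ ‖x‖) : cutoff R x = 0 := by
  apply (unitBump N).zero_of_le_dist
  rw [dist_zero_right, norm_smul, Real.norm_of_nonneg (by positivity)]
  change 2 ≤ R⁻¹ * ‖x‖
  rw [le_inv_mul_iff₀ hR]; linarith

lemma isBump_cutoff {R : ℝ} (hR : 0 < R) : IsBump (cutoff R : Space N → ℝ) := by
  refine ⟨(unitBump N).contDiff.comp (by fun_prop), ?_⟩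
  refine HasCompactSupport.intro (isCompact_closedBall (0 : Space N) (2 * R)) fun x hx => ?_
  rw [mem_closedBall_zero_iff, not_le] at hx
  exact cutoff_eq_zero hR hx.le

lemma exists_norm_fderiv_cutoff_le (N : ℕ) :
    ∃ C, 0 ≤ C ∧ ∀ R, 0 < R → ∀ x : Space N, ‖fderiv ℝ (cutoff R) x‖ ≤ C / R := by
  obtain ⟨C, hC0, hC⟩ := IsBump.exists_bound_fderiv (f := unitBump N)
    ⟨(unitBump N).contDiff, (unitBump N).hasCompactSupport⟩
  refine ⟨C, hC0, fun R hR x => ?_⟩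
  have h : HasFDerivAt (cutoff R) (R⁻¹ • fderiv ℝ (unitBump N) (R⁻¹ • x)) x := by
    have h1 := ((((unitBump N).contDiff (n := 1)).differentiable (by simp)) (R⁻¹ • x)).hasFDerivAt.comp x
      ((hasFDerivAt_id x).const_smul R⁻¹)
    refine h1.congr_fderiv ?_
    ext v
    simp
  rw [h.fderiv, norm_smul, Real.norm_of_nonneg (by positivity), div_eq_inv_mul]
  gcongr
  exact hC _

lemma fderiv_cutoff_of_lt {R : ℝ} (hR : 0 < R) {x : Space N} (hx : ‖x‖ < R) :
    fderiv ℝ (cutoff R) x = 0 := by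
  have : cutoff R =ᶠ[𝓝 x] fun _ => (1 : ℝ) := by
    filter_upwards [(isOpen_lt continuous_norm continuous_const).mem_nhds hx] with y hy
    exact cutoff_eq_one hR (le_of_lt hy)
  rw [this.fderiv_eq]; simp

lemma fderiv_cutoff_of_gt {R : ℝ} (hR : 0 < R) {x : Space N} (hx : 2 * R < ‖x‖) :
    fderiv ℝ (cutoff R) x = 0 := by
  have : cutoff R =ᶠ[𝓝 x] fun _ => (0 : ℝ) := by
    filter_upwards [(isOpen_lt continuous_const continuous_norm).mem_nhds hx] with y hy
    exact cutoff_eq_zero hR (le_of_lt hy)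
  rw [this.fderiv_eq]; simp

/-! ### Auxiliary facts on `L^p` norms -/

lemma lpNorm_mono_of_norm_le {p : ℝ≥0∞} {F G : Type*} [NormedAddCommGroup F] [NormedAddCommGroup G]
    {f : Space N → F} {g : Space N → G} (hf : AEStronglyMeasurable f volume) (hg : MemLp g p)
    (h : ∀ x, ‖f x‖ ≤ ‖g x‖) : lpNorm f p volume ≤ lpNorm g p volume := by
  rw [← ENNReal.ofReal_le_ofReal_iff lpNorm_nonneg, ofReal_lpNorm hg,
    ofReal_lpNorm (hg.mono hf (ae_of_all _ h))]
  exact eLpNorm_mono h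

lemma memLp_apply {p : ℝ≥0∞} {Q : Space N → Space N} (hQ : MemLp Q p) (i : Fin N) :
    MemLp (fun x => Q x i) p :=
  (EuclideanSpace.proj (𝕜 := ℝ) i).comp_memLp' hQ

lemma lpNorm_apply_le {p : ℝ≥0∞} {Q : Space N → Space N} (hQ : MemLp Q p) (i : Fin N) :
    lpNorm (fun x => Q x i) p volume ≤ lpNorm Q p volume :=
  lpNorm_mono_of_norm_le (memLp_apply hQ i).1 hQ fun x => PiLp.norm_apply_le (Q x) i

lemma norm_le_sum_abs (v : Space N) : ‖v‖ ≤ ∑ i, |v i| := by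
  conv_lhs => rw [← sum_smul_basisVec v]
  refine (norm_sum_le _ _).trans (Finset.sum_le_sum fun i _ => ?_)
  simp [norm_smul, basisVec]

lemma lpNorm_le_sum_apply {p : ℝ≥0∞} (hp : 1 ≤ p) {Q : Space N → Space N} (hQ : MemLp Q p) :
    lpNorm Q p volume ≤ ∑ i, lpNorm (fun x => Q x i) p volume := by
  have h := lpNorm_sum_le (s := Finset.univ) (f := fun i x => |Q x i|) (p := p)
    (fun i _ => (memLp_apply hQ i).abs) hp
  have hm := memLp_finsetSum' (μ := volume) (s := Finset.univ) (f := fun i x => |Q x i|) (p := p)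
    (fun i _ => (memLp_apply hQ i).abs)
  refine (lpNorm_mono_of_norm_le hQ.1 hm fun x => ?_).trans (h.trans_eq ?_)
  · rw [Finset.sum_apply, Real.norm_of_nonneg (Finset.sum_nonneg fun _ _ => abs_nonneg _)]
    exact norm_le_sum_abs _
  · refine Finset.sum_congr rfl fun i _ => ?_
    exact lpNorm_fun_abs (memLp_apply hQ i).1 p

/-- Interpolation between L¹ and L^∞, the only integrability available for heat flows of test
functions before the Riesz bounds. -/
lemma integral_rpow_le_of_bound {f : Space N → ℝ} (hf : Integrable f) {C r : ℝ} (hr : 1 ≤ r)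
    (hC : ∀ x, |f x| ≤ C) :
    Integrable (fun x => ‖f x‖ ^ r) ∧ ∫ x, ‖f x‖ ^ r ≤ C ^ (r - 1) * ∫ x, |f x| := by
  have h (x : Space N) : ‖f x‖ ^ r ≤ C ^ (r - 1) * |f x| := by
    rcases (abs_nonneg (f x)).eq_or_lt with h0 | h0
    · rw [Real.norm_eq_abs, ← h0, Real.zero_rpow (by linarith), mul_zero]
    · rw [Real.norm_eq_abs]
      calc |f x| ^ r = |f x| ^ (r - 1) * |f x| := by rw [← Real.rpow_add_one h0.ne']; simp
        _ ≤ _ := by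
          gcongr
          exact hC x
  have hi : Integrable fun x => ‖f x‖ ^ r := by
    refine (hf.abs.const_mul (C ^ (r - 1))).mono' (hf.1.norm.aemeasurable.pow_const r).aestronglyMeasurable
      (ae_of_all _ fun x => ?_)
    rw [Real.norm_of_nonneg (by positivity)]
    exact h x
  refine ⟨hi, ?_⟩
  rw [← integral_const_mul]
  exact integral_mono hi (hf.abs.const_mul _) h

lemma memLp_of_integrable_of_bound {f : Space N → ℝ} (hf : Integrable f) {C : ℝ}
    (hC : ∀ x, |f x| ≤ C) {q : ℝ≥0∞} (hq1 : 1 < q) (hq : q ≠ ⊤) : MemLp f q := by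
  have hr1 : 1 < q.toReal := by
    rw [← ENNReal.toReal_one]; exact (ENNReal.toReal_lt_toReal (by simp) hq).2 hq1
  exact (integrable_norm_rpow_iff hf.1 (zero_lt_one.trans hq1).ne' hq).1
    (integral_rpow_le_of_bound hf hr1.le hC).1

/-! ### Weak formulations tested with functions without compact support -/

/-- A divergence free field in `L^p` is orthogonal to gradients of smooth functions that lie in
`L^q` together with their first derivatives. -/
lemma integral_fderiv_apply_eq_zero {p q : ℝ≥0∞} (hpq : p.HolderConjugate q) {G : Space N → Space N}
    (hG : MemLp G p) (h : ∀ θ, IsBump θ → ∫ x, fderiv ℝ θ x (G x) = 0) {ψ : Space N → ℝ}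
    (hψ : ContDiff ℝ ∞ ψ) (hψq : MemLp ψ q) (hψ' : ∀ i, MemLp (pd i ψ) q) :
    ∫ x, fderiv ℝ ψ x (G x) = 0 := by
  obtain ⟨C, hC0, hC⟩ := exists_norm_fderiv_cutoff_le N
  have hd (x : Space N) := hψ.differentiable (by simp) x
  have hi1 : Integrable fun x => fderiv ℝ ψ x (G x) := by
    simp only [fderiv_apply_eq_sum]
    exact integrable_finsetSum _ fun i _ => integrable_mul_of_memLp hpq (memLp_apply hG i) (hψ' i)
  have hi2 : Integrable fun x => ‖G x‖ * |ψ x| := integrable_mul_of_memLp hpq hG.norm hψq.abs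
  have hR (n : ℕ) : (0 : ℝ) < n + 1 := by positivity
  have e (n : ℕ) (x : Space N) : fderiv ℝ (fun x => cutoff (n + 1) x * ψ x) x (G x) =
      cutoff (n + 1) x * fderiv ℝ ψ x (G x) + ψ x * fderiv ℝ (cutoff (n + 1)) x (G x) := by
    rw [fderiv_fun_mul ((isBump_cutoff (hR n)).differentiable x) (hd x)]
    simp
  -- The term with the gradient of the cut-off is dominated by C‖G‖|ψ|, integrable by Hölder's
  -- inequality, and vanishes at x as soon as n + 1 > ‖x‖.
  have hlim : Tendsto (fun n : ℕ => ∫ x, fderiv ℝ (fun x => cutoff (n + 1) x * ψ x) x (G x)) atTop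
      (𝓝 (∫ x, fderiv ℝ ψ x (G x))) := by
    refine tendsto_integral_of_dominated_convergence
      (fun x => |fderiv ℝ ψ x (G x)| + C * (‖G x‖ * |ψ x|)) (fun n => ?_)
      (hi1.abs.add (hi2.const_mul C)) (fun n => ae_of_all _ fun x => ?_) (ae_of_all _ fun x => ?_)
    · simp only [e]
      have hc : AEStronglyMeasurable (fun x => fderiv ℝ (cutoff (n + 1)) x (G x)) volume := by
        have h1 := (isBump_cutoff (N := N) (hR n)).continuous_fderiv
        exact (ContinuousLinearMap.apply ℝ ℝ |>.flip).aestronglyMeasurable_comp₂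
          h1.aestronglyMeasurable hG.1
      exact ((isBump_cutoff (hR n)).continuous.aestronglyMeasurable.mul hi1.1).add
        (hψq.1.mul hc)
    · rw [e, Real.norm_eq_abs]
      refine (abs_add_le _ _).trans ?_
      rw [abs_mul, abs_mul]
      have h1 := cutoff_mem_Icc (n + 1 : ℝ) x
      have h2 : |fderiv ℝ (cutoff (n + 1)) x (G x)| ≤ C * ‖G x‖ := by
        refine ((fderiv ℝ (cutoff (n + 1)) x).le_opNorm _).trans ?_
        gcongr
        refine (hC _ (hR n) x).trans (div_le_self hC0 ?_)
        linarith [Nat.cast_nonneg (α := ℝ) n]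
      have h3 : |cutoff (n + 1 : ℝ) x| ≤ 1 := abs_le.2 ⟨by linarith [h1.1], h1.2⟩
      have h4 := mul_le_of_le_one_left (abs_nonneg (fderiv ℝ ψ x (G x))) h3
      have h5 := mul_le_mul_of_nonneg_left h2 (abs_nonneg (ψ x))
      linarith
    · refine tendsto_const_nhds.congr' ?_
      filter_upwards [eventually_gt_atTop ⌈‖x‖⌉₊] with n hn
      have hxn : ‖x‖ < n + 1 := by
        have := (Nat.le_ceil ‖x‖).trans (Nat.cast_le.2 hn.le)
        linarith
      rw [e, cutoff_eq_one (hR n) hxn.le, fderiv_cutoff_of_lt (hR n) hxn]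
      simp
  refine tendsto_nhds_unique hlim (tendsto_const_nhds.congr fun n => ?_)
  exact (h _ ((isBump_cutoff (hR n)).mul hψ)).symm

/-! ### Time integrals of the heat semigroup -/

/-- `∫₀^τ e^{tΔ} h dt`. -/
def heatInt (τ : ℝ) (h : Space N → ℝ) (x : Space N) : ℝ := ∫ t in Ioc 0 τ, heat t h x

section HeatInt

variable {h : Space N → ℝ}

lemma integrable_prod_heat (hh : IsBump h) (τ : ℝ) :
    Integrable (Function.uncurry fun t x => heat t h x) ((volume.restrict (Ioc 0 τ)).prod volume) := by
  have := integrable_prod_bdd_mul_heat (G := fun _ _ => (1 : ℝ)) (M := 1)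
    (by unfold Function.uncurry; fun_prop) (fun t x => by simp) hh τ
  simpa using this

lemma integrable_heatInt (hh : IsBump h) (τ : ℝ) : Integrable (heatInt τ h) :=
  (integrable_prod_heat hh τ).integral_prod_right

lemma continuous_heat_left (hh : IsBump h) (x : Space N) : Continuous fun t => heat t h x :=
  (continuous_heat hh).comp (by fun_prop : Continuous fun t : ℝ => (t, x))

lemma exists_abs_heatInt_le (hh : IsBump h) (τ : ℝ) : ∃ C, ∀ x, |heatInt τ h x| ≤ C := by
  obtain ⟨C, -, hC⟩ := hh.exists_bound
  exact ⟨C * volume.real (Ioc 0 τ), fun x => by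
    rw [heatInt, ← Real.norm_eq_abs]
    exact norm_setIntegral_le_of_norm_le_const measure_Ioc_lt_top fun t _ => abs_heat_le hC t x⟩

lemma memLp_heatInt (hh : IsBump h) (τ : ℝ) {q : ℝ≥0∞} (hq1 : 1 < q) (hq : q ≠ ⊤) :
    MemLp (heatInt τ h) q := by
  obtain ⟨C, hC⟩ := exists_abs_heatInt_le hh τ
  exact memLp_of_integrable_of_bound (integrable_heatInt hh τ) hC hq1 hq

lemma fderiv_eq_sum_smul {f : Space N → ℝ} (x : Space N) :
    fderiv ℝ f x = ∑ i, pd i f x • EuclideanSpace.proj (𝕜 := ℝ) i := by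
  ext v
  rw [fderiv_apply_eq_sum]
  simp [mul_comm]

lemma hasFDerivAt_heatInt (hh : IsBump h) (τ : ℝ) (x : Space N) :
    HasFDerivAt (heatInt τ h) (∑ i, heatInt τ (pd i h) x • EuclideanSpace.proj (𝕜 := ℝ) i) x := by
  obtain ⟨C, -, hC⟩ := hh.exists_bound
  have hb : ∀ i, ∃ C, 0 ≤ C ∧ ∀ x, |pd i h x| ≤ C := fun i => (hh.pd i).exists_bound
  choose D hD0 hD using hb
  have h1 := hasFDerivAt_integral_of_dominated_of_fderiv_le (μ := volume.restrict (Ioc 0 τ))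
    (F := fun x t => heat t h x) (F' := fun x t => ∑ i, heat t (pd i h) x •
      (EuclideanSpace.proj (𝕜 := ℝ) i : Space N →L[ℝ] ℝ)) (x₀ := x) (s := univ)
    (bound := fun _ => ∑ i, D i * ‖(EuclideanSpace.proj (𝕜 := ℝ) i : Space N →L[ℝ] ℝ)‖) univ_mem
    (.of_forall fun y => (continuous_heat_left hh y).aestronglyMeasurable)
    ((continuous_heat_left hh x).integrableOn_Ioc)
    (by
      have := fun i => continuous_heat_left (hh.pd i) x
      exact (by fun_prop : Continuous fun t => ∑ i, heat t (pd i h) x •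
        (EuclideanSpace.proj (𝕜 := ℝ) i : Space N →L[ℝ] ℝ)).aestronglyMeasurable)
    (ae_of_all _ fun t y _ => ?_) (integrable_const _) (ae_of_all _ fun t y _ => ?_)
  · refine h1.congr_fderiv ?_
    rw [integral_finsetSum]
    · refine Finset.sum_congr rfl fun i _ => ?_
      rw [integral_smul_const]; rfl
    · intro i _
      exact ((continuous_heat_left (hh.pd i) x).integrableOn_Ioc).smul_const _
  · refine (norm_sum_le _ _).trans (Finset.sum_le_sum fun i _ => ?_)
    rw [norm_smul]
    gcongr
    exact abs_heat_le (hD i) t y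
  · have h2 := (differentiable_heat hh t y).hasFDerivAt
    rw [fderiv_eq_sum_smul] at h2
    simp only [pd_heat hh] at h2
    exact h2

lemma pd_heatInt (hh : IsBump h) (τ : ℝ) (i : Fin N) : pd i (heatInt τ h) = heatInt τ (pd i h) := by
  ext x
  rw [pd, (hasFDerivAt_heatInt hh τ x).fderiv]
  simp [basisVec]

lemma contDiff_heatInt (hh : IsBump h) (τ : ℝ) : ContDiff ℝ ∞ (heatInt τ h) := by
  rw [contDiff_infty]
  intro n
  induction n generalizing h with
  | zero =>
    rw [Nat.cast_zero, contDiff_zero]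
    exact continuous_iff_continuousAt.2 fun x => (hasFDerivAt_heatInt hh τ x).continuousAt
  | succ n ih =>
    rw [Nat.cast_succ, contDiff_succ_iff_hasFDerivAt]
    exact ⟨_, ContDiff.sum fun i _ => (ih (hh.pd i)).smul contDiff_const, hasFDerivAt_heatInt hh τ⟩

lemma heatInt_sum {ι : Type*} (s : Finset ι) {F : ι → Space N → ℝ} (hF : ∀ i ∈ s, IsBump (F i))
    (τ : ℝ) (x : Space N) : heatInt τ (fun x => ∑ i ∈ s, F i x) x = ∑ i ∈ s, heatInt τ (F i) x := by
  simp only [heatInt]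
  rw [← integral_finsetSum _ fun i hi => (continuous_heat_left (hF i hi) x).integrableOn_Ioc]
  simp only [heat_sum s hF]

/-- The heat equation integrated in time: `heatInt τ` inverts −Δ up to the remainder e^{τΔ}, which
avoids Newtonian potentials altogether. -/
lemma heatInt_lap (hh : IsBump h) {τ : ℝ} (hτ : 0 ≤ τ) (x : Space N) :
    heatInt τ (lap h) x = heat τ h x - h x := by
  have := intervalIntegral.integral_eq_sub_of_hasDerivAt_of_le hτ
    (continuous_heat_left hh x).continuousOn (fun t ht => hasDerivAt_heat hh ht.1 x)
    ((continuous_heat_left hh.lap x).intervalIntegrable _ _)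
  rw [intervalIntegral.integral_of_le hτ, heat_of_nonpos le_rfl] at this
  exact this

lemma two_le_infty : (2 : WithTop ℕ∞) ≤ ((⊤ : ℕ∞) : WithTop ℕ∞) :=
  WithTop.coe_le_coe.2 (le_top (a := (2 : ℕ∞)))

lemma pd_comm (hh : IsBump h) (i j : Fin N) : pd i (pd j h) = pd j (pd i h) := by
  ext x
  have hd : DifferentiableAt ℝ (fderiv ℝ h) x :=
    (hh.1.fderiv_right (m := 1) (by norm_cast)).differentiable (by simp) x
  have e (i j : Fin N) : pd i (pd j h) x = fderiv ℝ (fderiv ℝ h) x (basisVec i) (basisVec j) := by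
    have h1 := (hd.hasFDerivAt.clm_apply (hasFDerivAt_const (basisVec j) x)).fderiv
    have h2 : fderiv ℝ (pd j h) x = _ := h1
    rw [pd, h2]
    simp
  rw [e, e]
  exact (hh.1.contDiffAt.isSymmSndFDerivAt (by simpa using two_le_infty)) _ _

/-- The `L^q` bound for the (truncated) second order Riesz transforms. -/
theorem exists_lpNorm_heatInt_le {p q : ℝ≥0∞} (hpq : p.HolderConjugate q) (hp1 : 1 < p)
    (hp : p ≠ ⊤) :
    ∃ C, 0 ≤ C ∧ ∀ h : Space N → ℝ, IsBump h → ∀ τ, 0 ≤ τ → ∀ i j : Fin N,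
      lpNorm (heatInt τ (pd i (pd j h))) q volume ≤ C * lpNorm h q volume := by
  obtain ⟨hp0, hq0, hqt, hq1⟩ := holderConjugate_facts hpq hp1 hp
  obtain ⟨C, hC0, hC⟩ := exists_integral_abs_heat_mul_heat_le (N := N) hpq hp1 hp
  refine ⟨2 * C, by positivity, fun h hh τ hτ i j => ?_⟩
  have hij := (hh.pd j).pd i
  refine lpNorm_le_of_forall_bump hpq.symm hq1 hqt (memLp_heatInt hij τ hq1 hqt)
    (mul_nonneg (by positivity) lpNorm_nonneg) fun ψ hψ => ?_
  obtain ⟨M, -, hM⟩ := hψ.exists_bound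
  have hprod := integrable_prod_bdd_mul_heat (G := fun _ x => ψ x) (τ := τ)
    (hψ.continuous.comp continuous_snd) (fun _ x => hM x) hij
  have e1 : ∫ x, heatInt τ (pd i (pd j h)) x * ψ x =
      ∫ t in Ioc 0 τ, ∫ x, ψ x * heat t (pd i (pd j h)) x := by
    rw [integral_integral_swap hprod]
    congr 1; ext x
    rw [heatInt, mul_comm, ← integral_const_mul]
  -- Half of the flow is moved onto ψ by symmetry, and one of the two derivatives by parts, giving
  -- the bilinear form of the embedding at time t/2.
  have e2 (t : ℝ) (ht : t ∈ Ioc 0 τ) : ∫ x, ψ x * heat t (pd i (pd j h)) x =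
      - ∫ x, heat (t / 2) (pd i ψ) x * heat (t / 2) (pd j h) x := by
    rw [← integral_heat_mul_heat_sub hψ hij (s := t / 2) (by linarith [ht.1]) (by linarith [ht.1]),
      show t - t / 2 = t / 2 by ring]
    have := integral_comp_mul_heat_pd (φ := fun z => z.1) (φ₁ := fun _ => 1) (φ₂ := fun _ => 0)
      continuous_fst continuous_const continuous_const
      (fun u v u' v' s hu hv => by simpa using hu) hψ hψ (hh.pd j) i (t / 2)
    simpa using this
  obtain ⟨B, -, hB⟩ := (hψ.pd i).exists_bound
  -- Rescaling time by 2 accounts for the factor 2 in the constant.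
  rw [e1, setIntegral_congr_fun measurableSet_Ioc e2, integral_neg, abs_neg,
    ← intervalIntegral.integral_of_le hτ,
    intervalIntegral.integral_comp_div (fun t => ∫ x, heat t (pd i ψ) x * heat t (pd j h) x)
      two_ne_zero, zero_div, intervalIntegral.integral_of_le (by positivity), smul_eq_mul, abs_mul,
    abs_two]
  have h3 : |∫ t in Ioc 0 (τ / 2), ∫ x, heat t (pd i ψ) x * heat t (pd j h) x| ≤
      ∫ t in Ioc 0 (τ / 2), ∫ x, |heat t (pd i ψ) x * heat t (pd j h) x| := by
    rw [← Real.norm_eq_abs]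
    refine norm_integral_le_of_norm_le (g := fun t =>
      ∫ x, |heat t (pd i ψ) x * heat t (pd j h) x|) ?_ (ae_of_all _ fun t => ?_)
    · exact (integrable_prod_bdd_mul_heat (G := fun t x => heat t (pd i ψ) x)
        (continuous_heat (hψ.pd i)) (fun t x => abs_heat_le hB t x) (hh.pd j)
          (τ / 2)).abs.integral_prod_left
    · exact abs_integral_le_integral_abs
  calc _ ≤ 2 * (C * (lpNorm ψ p volume * lpNorm h q volume)) := by
        gcongr
        exact h3.trans (hC ψ h hψ hh _ (by positivity) i j)
    _ = _ := by ring

/-- Interpolation between the L¹ contraction and the decay of the supremum; q > 1 and N > 0 make the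
exponent of decay positive. -/
lemma tendsto_lpNorm_heat (hh : IsBump h) (hN : 0 < N) {q : ℝ≥0∞} (hq1 : 1 < q) (hq : q ≠ ⊤) :
    Tendsto (fun τ => lpNorm (heat τ h) q volume) atTop (𝓝 0) := by
  have hr1 : 1 < q.toReal := by
    rw [← ENNReal.toReal_one]; exact (ENNReal.toReal_lt_toReal (by simp) hq).2 hq1
  set r := q.toReal with hr
  have hq0 : q ≠ 0 := (zero_lt_one.trans hq1).ne'
  set A := gauss (0 : Space N) * ∫ x, |h x| with hA
  have hA0 : 0 ≤ A := mul_nonneg (gauss_pos _).le (integral_nonneg fun _ => abs_nonneg _)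
  have hdec : Tendsto (fun τ : ℝ => A * (√(2 * τ) ^ N)⁻¹) atTop (𝓝 0) := by
    rw [← mul_zero A]
    refine Tendsto.const_mul _ (tendsto_inv_atTop_zero.comp ?_)
    exact (tendsto_pow_atTop hN.ne').comp (Real.tendsto_sqrt_atTop.comp
      (tendsto_id.const_mul_atTop two_pos))
  have h1 : Tendsto (fun τ : ℝ => ((A * (√(2 * τ) ^ N)⁻¹) ^ (r - 1) * ∫ x, |h x|) ^ r⁻¹) atTop
      (𝓝 0) := by
    have h2 := ((hdec.rpow_const (p := r - 1) (Or.inr (by linarith))).mul_const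
      (∫ x, |h x|)).rpow_const (p := r⁻¹) (Or.inr (by positivity))
    rwa [Real.zero_rpow (by linarith), zero_mul, Real.zero_rpow (by positivity)] at h2
  refine squeeze_zero' (.of_forall fun _ => lpNorm_nonneg) ?_ h1
  filter_upwards [eventually_gt_atTop 0] with τ hτ
  have hi := integrable_heat hh τ
  have hb := abs_heat_le_decay hh hτ
  rw [lpNorm_eq_integral_norm_rpow_toReal hq0 hq hi.1]
  refine Real.rpow_le_rpow (integral_nonneg fun _ => by positivity) ?_ (by positivity)
  refine (integral_rpow_le_of_bound hi hr1.le hb).2.trans ?_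
  have := integral_abs_heat_le hh τ
  gcongr

end HeatInt

/-! ### The elliptic estimate -/

/-- If `Q` is a gradient in `L^p` and `div Q = div F` then `‖Q‖_{L^p} ≤ K ‖F‖_{L^p}`. -/
theorem exists_lpNorm_gradient_le (hN : 0 < N) {p : ℝ≥0∞} (hp1 : 1 < p) (hp : p ≠ ⊤) :
    ∃ K, 0 < K ∧ ∀ Q F : Space N → Space N, MemLp Q p → MemLp F p →
      (∀ i j θ, IsBump θ → ∫ x, Q x i * pd j θ x = ∫ x, Q x j * pd i θ x) →
      (∀ θ, IsBump θ → ∫ x, fderiv ℝ θ x (Q x) = ∫ x, fderiv ℝ θ x (F x)) →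
      lpNorm Q p volume ≤ K * lpNorm F p volume := by
  obtain ⟨q, hpq⟩ : ∃ q : ℝ≥0∞, p.HolderConjugate q :=
    ⟨_, ENNReal.HolderConjugate.conjExponent hp1.le⟩
  obtain ⟨hp0, hq0, hqt, hq1⟩ := holderConjugate_facts hpq hp1 hp
  obtain ⟨C, hC0, hC⟩ := exists_lpNorm_heatInt_le (N := N) hpq hp1 hp
  -- One factor N sums the components of Q, the other those of F; the summand 1 keeps the constant
  -- positive.
  refine ⟨N * (N * C) + 1, by positivity, fun Q F hQ hF hcurl hdiv => ?_⟩
  have hQi (i : Fin N) := memLp_apply hQ i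
  have hFi (i : Fin N) := memLp_apply hF i
  have hpdint (i j : Fin N) {k θ : Space N → ℝ} (hk : MemLp k p) (hθ : IsBump θ) :
      Integrable fun x => k x * pd j θ x := integrable_mul_of_memLp hpq hk ((hθ.pd j).memLp q)
  have hmemS {k : Space N → ℝ} (hk : IsBump k) (τ : ℝ) : MemLp (heatInt τ k) q :=
    memLp_heatInt hk τ hq1 hqt
  have hmemS' {k : Space N → ℝ} (hk : IsBump k) (τ : ℝ) (i : Fin N) :
      MemLp (pd i (heatInt τ k)) q := by
    rw [pd_heatInt hk]; exact hmemS (hk.pd i) τ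
  -- the extended curl identity
  have hcurl' (i j : Fin N) {k : Space N → ℝ} (hk : IsBump k) (τ : ℝ) :
      ∫ x, Q x i * heatInt τ (pd j k) x = ∫ x, Q x j * heatInt τ (pd i k) x := by
    -- The curl condition for the pair (i, j) says that Qᵢeⱼ − Qⱼeᵢ is divergence free, so the
    -- extension to noncompact test functions is the same as for the divergence.
    have hG : MemLp (fun x => Q x i • basisVec j - Q x j • basisVec i) p := by
      refine MemLp.sub ?_ ?_
      · exact (ContinuousLinearMap.toSpanSingleton ℝ (basisVec j)).comp_memLp' (hQi i)
      · exact (ContinuousLinearMap.toSpanSingleton ℝ (basisVec i)).comp_memLp' (hQi j)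
    have e (θ : Space N → ℝ) (x : Space N) : fderiv ℝ θ x (Q x i • basisVec j - Q x j • basisVec i) =
        Q x i * pd j θ x - Q x j * pd i θ x := by simp [pd]
    have h := integral_fderiv_apply_eq_zero hpq hG (fun θ hθ => ?_) (contDiff_heatInt hk τ)
      (hmemS hk τ) (hmemS' hk τ)
    · simp only [e] at h
      simp only [pd_heatInt hk] at h
      rw [integral_sub (integrable_mul_of_memLp hpq (hQi i) (hmemS (hk.pd j) τ))
        (integrable_mul_of_memLp hpq (hQi j) (hmemS (hk.pd i) τ))] at h
      exact sub_eq_zero.1 h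
    · simp only [e]
      rw [integral_sub (hpdint i j (hQi i) hθ) (hpdint i i (hQi j) hθ), hcurl i j θ hθ, sub_self]
  -- the extended divergence identity
  have hdivint {W : Space N → Space N} (hW : MemLp W p) {θ : Space N → ℝ} (hθ : IsBump θ) :
      Integrable fun x => fderiv ℝ θ x (W x) := by
    simp only [fderiv_apply_eq_sum]
    exact integrable_finsetSum _ fun i _ => hpdint i i (memLp_apply hW i) hθ
  have hdiv' {k : Space N → ℝ} (hk : IsBump k) (τ : ℝ) :
      ∑ j, ∫ x, Q x j * heatInt τ (pd j k) x = ∑ j, ∫ x, F x j * heatInt τ (pd j k) x := by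
    have h := integral_fderiv_apply_eq_zero hpq (hQ.sub hF) (fun θ hθ => ?_) (contDiff_heatInt hk τ)
      (hmemS hk τ) (hmemS' hk τ)
    · simp only [fderiv_apply_eq_sum, pd_heatInt hk] at h
      have hi (j : Fin N) := integrable_mul_of_memLp hpq (hQi j) (hmemS (hk.pd j) τ)
      have hi' (j : Fin N) := integrable_mul_of_memLp hpq (hFi j) (hmemS (hk.pd j) τ)
      rw [integral_finsetSum] at h
      · rw [← sub_eq_zero, ← h, ← Finset.sum_sub_distrib]
        refine Finset.sum_congr rfl fun j _ => ?_
        rw [← integral_sub (hi j) (hi' j)]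
        congr 1; ext x; simp only [Pi.sub_apply, PiLp.sub_apply]; ring
      · intro j _
        refine ((hi j).sub (hi' j)).congr (ae_of_all _ fun x => ?_)
        simp only [Pi.sub_apply, PiLp.sub_apply]; ring
    · simp only [Pi.sub_apply, map_sub]
      rw [integral_sub (hdivint hQ hθ) (hdivint hF hθ), hdiv θ hθ, sub_self]
  -- duality
  have hcomp (i : Fin N) : lpNorm (fun x => Q x i) p volume ≤ N * C * lpNorm F p volume := by
    refine lpNorm_le_of_forall_bump hpq hp1 hp (hQi i)
      (mul_nonneg (by positivity) lpNorm_nonneg) fun ψ hψ => ?_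
    have hheat (τ : ℝ) : MemLp (heat τ ψ) q := by
      obtain ⟨B, -, hB⟩ := hψ.exists_bound
      exact memLp_of_integrable_of_bound (integrable_heat hψ τ) (abs_heat_le hB τ) hq1 hqt
    -- Write ψ = e^{τΔ}ψ − ∫₀^τ e^{tΔ}Δψ dt. In the pairing of Qᵢ with ∂ⱼ∂ⱼψ the curl condition
    -- exchanges Qᵢ∂ⱼ for Qⱼ∂ᵢ; summed over j this is the divergence of Q tested against ∂ᵢψ, where
    -- Q may be replaced by F. The first term disappears as τ → ∞.
    have key : ∀ τ, 0 ≤ τ → |∫ x, Q x i * ψ x| ≤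
        lpNorm (fun x => Q x i) p volume * lpNorm (heat τ ψ) q volume +
          N * C * lpNorm F p volume * lpNorm ψ q volume := by
      intro τ hτ
      have e1 : ∫ x, Q x i * heatInt τ (lap ψ) x = ∑ j, ∫ x, F x j * heatInt τ (pd j (pd i ψ)) x := by
        have e2 (x : Space N) : heatInt τ (lap ψ) x = ∑ j, heatInt τ (pd j (pd j ψ)) x :=
          heatInt_sum _ (fun j _ => (hψ.pd j).pd j) τ x
        simp only [e2, Finset.mul_sum]
        rw [integral_finsetSum _ fun j _ => integrable_mul_of_memLp hpq (hQi i)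
          (hmemS ((hψ.pd j).pd j) τ), ← hdiv' (hψ.pd i) τ]
        refine Finset.sum_congr rfl fun j _ => ?_
        rw [hcurl' i j (hψ.pd j) τ, pd_comm hψ]
      have e3 : ∫ x, Q x i * ψ x = (∫ x, Q x i * heat τ ψ x) - ∫ x, Q x i * heatInt τ (lap ψ) x := by
        rw [← integral_sub (integrable_mul_of_memLp hpq (hQi i) (hheat τ))
          (integrable_mul_of_memLp hpq (hQi i) (hmemS hψ.lap τ))]
        congr 1; ext x
        rw [heatInt_lap hψ hτ]; ring
      rw [e3, e1]
      refine (abs_sub _ _).trans (add_le_add (abs_integral_mul_le hpq (hQi i) (hheat τ)) ?_)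
      refine (Finset.abs_sum_le_sum_abs _ _).trans ?_
      calc ∑ j, |∫ x, F x j * heatInt τ (pd j (pd i ψ)) x|
          ≤ ∑ j : Fin N, lpNorm F p volume * (C * lpNorm ψ q volume) := by
            refine Finset.sum_le_sum fun j _ => ?_
            refine (abs_integral_mul_le hpq (hFi j) (hmemS ((hψ.pd i).pd j) τ)).trans ?_
            have h1 := lpNorm_apply_le hF j
            have h2 := hC ψ hψ τ hτ j i
            have h3 : 0 ≤ lpNorm F p volume := lpNorm_nonneg
            have h4 : 0 ≤ lpNorm (heatInt τ (pd j (pd i ψ))) q volume := lpNorm_nonneg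
            gcongr
        _ = _ := by simp; ring
    have hlim := ((tendsto_lpNorm_heat hψ hN hq1 hqt).const_mul
      (lpNorm (fun x => Q x i) p volume)).add_const (N * C * lpNorm F p volume * lpNorm ψ q volume)
    have := ge_of_tendsto hlim ((eventually_ge_atTop 0).mono key)
    simpa using this
  calc lpNorm Q p volume ≤ ∑ i, lpNorm (fun x => Q x i) p volume := lpNorm_le_sum_apply hp1.le hQ
    _ ≤ ∑ _i : Fin N, N * C * lpNorm F p volume := Finset.sum_le_sum fun i _ => hcomp i
    _ = N * (N * C) * lpNorm F p volume := by simp; ring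
    _ ≤ _ := by
      have h3 : 0 ≤ lpNorm F p volume := lpNorm_nonneg
      gcongr
      linarith

end DensityEuler
end

noncomputable section
namespace DensityEuler
set_option linter.unusedSectionVars false

/-! ### Functions of time with weak derivatives -/

section Time

variable {F : Type*} [NormedAddCommGroup F] [NormedSpace ℝ F]

/-- Integrability on the compact subintervals of `(0,T)`. -/
def TimeInt (T : ℝ) (γ : ℝ → F) : Prop := ∀ s t, 0 < s → t < T → IntegrableOn γ (Icc s t)

/-- Test functions on `(0,T)`. -/
structure IsTimeTest (T : ℝ) (φ : ℝ → ℝ) : Prop where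
  contDiff : ContDiff ℝ ∞ φ
  compact : HasCompactSupport φ
  subset : tsupport φ ⊆ Ioo 0 T

/-- `g` is the weak derivative of `γ` on `(0,T)`. -/
def HasWeakDeriv (T : ℝ) (γ g : ℝ → F) : Prop :=
  TimeInt T γ ∧ TimeInt T g ∧ ∀ φ, IsTimeTest T φ → ∫ t, deriv φ t • γ t = - ∫ t, φ t • g t

/-- `γ` is a primitive of `g` on `(0,T)`. -/
def IsPrimitive (T : ℝ) (γ g : ℝ → F) : Prop :=
  TimeInt T g ∧ ∀ s t, 0 < s → s ≤ t → t < T → γ t - γ s = ∫ τ in s..t, g τ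

lemma absolutelyContinuousOnInterval_of_norm_sub_le {X : Type*} [PseudoMetricSpace X] {f : ℝ → X}
    {h : ℝ → ℝ} {a b : ℝ} (hh : AbsolutelyContinuousOnInterval h a b)
    (hf : ∀ s ∈ uIcc a b, ∀ t ∈ uIcc a b, dist (f s) (f t) ≤ dist (h s) (h t)) :
    AbsolutelyContinuousOnInterval f a b := by
  rw [absolutelyContinuousOnInterval_iff] at hh ⊢
  intro ε hε
  obtain ⟨δ, hδ, h1⟩ := hh ε hε
  refine ⟨δ, hδ, fun E hE hE' => lt_of_le_of_lt (Finset.sum_le_sum fun i hi => ?_) (h1 E hE hE')⟩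
  have := hE.1 i hi
  exact hf _ this.1 _ this.2

lemma norm_sub_le_integral_norm {γ g : ℝ → F} {a b : ℝ} (hg : IntervalIntegrable g volume a b)
    (hγ : ∀ t ∈ Icc a b, γ t = γ a + ∫ τ in a..t, g τ) {s t : ℝ} (hs : s ∈ Icc a b)
    (ht : t ∈ Icc a b) :
    dist (γ s) (γ t) ≤ dist (∫ τ in a..s, ‖g τ‖) (∫ τ in a..t, ‖g τ‖) := by
  have hab : a ≤ b := hs.1.trans hs.2
  have h1 (r : ℝ) (hr : r ∈ Icc a b) : IntervalIntegrable g volume a r :=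
    hg.mono_set (by rw [uIcc_of_le hab, uIcc_of_le hr.1]; exact Icc_subset_Icc_right hr.2)
  rw [hγ s hs, hγ t ht, dist_add_left, dist_eq_norm, dist_eq_norm,
    intervalIntegral.integral_interval_sub_left (h1 s hs) (h1 t ht),
    intervalIntegral.integral_interval_sub_left (h1 s hs).norm (h1 t ht).norm]
  exact intervalIntegral.norm_integral_le_abs_integral_norm

/-- The chain rule for absolutely continuous curves. -/
lemma comp_sub_eq_integral [CompleteSpace F] {γ g : ℝ → F} {a b : ℝ} (hab : a ≤ b)
    (hg : IntervalIntegrable g volume a b) (hγ : ∀ t ∈ Icc a b, γ t = γ a + ∫ τ in a..t, g τ)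
    {Φ : F → ℝ} {Φ' : ℝ → F →L[ℝ] ℝ} {K : NNReal} (hK : LipschitzOnWith K Φ (γ '' Icc a b))
    (hΦ : ∀ t ∈ Icc a b, HasFDerivAt Φ (Φ' t) (γ t)) :
    IntervalIntegrable (fun t => Φ' t (g t)) volume a b ∧
      Φ (γ b) - Φ (γ a) = ∫ t in a..b, Φ' t (g t) := by
  have hu : uIcc a b = Icc a b := uIcc_of_le hab
  -- The increments of Φ ∘ γ are bounded by K times those of the primitive of ‖g‖, so Φ ∘ γ is
  -- absolutely continuous and is the integral of its almost everywhere derivative.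
  have hac : AbsolutelyContinuousOnInterval (fun t => Φ (γ t)) a b := by
    refine absolutelyContinuousOnInterval_of_norm_sub_le
      ((hg.norm.absolutelyContinuousOnInterval_intervalIntegral left_mem_uIcc).const_mul K)
      fun s hs t ht => ?_
    rw [hu] at hs ht
    refine (hK.dist_le_mul _ (mem_image_of_mem _ hs) _ (mem_image_of_mem _ ht)).trans ?_
    refine (mul_le_mul_of_nonneg_left (norm_sub_le_integral_norm hg hγ hs ht) K.2).trans_eq ?_
    rw [Real.dist_eq, Real.dist_eq, ← mul_sub, abs_mul, abs_of_nonneg K.coe_nonneg]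
    rfl
  have hd : ∀ᵐ t, t ∈ Ioo a b → HasDerivAt (fun t => Φ (γ t)) (Φ' t (g t)) t := by
    filter_upwards [hg.ae_hasDerivAt_integral] with t ht htab
    have h1 := (ht (hu ▸ Ioo_subset_Icc_self htab) a left_mem_uIcc).const_add (γ a)
    have h2 : HasDerivAt γ (g t) t := h1.congr_of_eventuallyEq <|
      (Icc_mem_nhds htab.1 htab.2 |> fun h => by
        filter_upwards [h] with r hr using hγ r hr)
    exact (hΦ t (Ioo_subset_Icc_self htab)).comp_hasDerivAt t h2
  have hd' : ∀ᵐ t, t ∈ uIoc a b → deriv (fun t => Φ (γ t)) t = Φ' t (g t) := by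
    have hb : ∀ᵐ t : ℝ, t ≠ b := by simp [ae_iff, measure_singleton]
    filter_upwards [hd, hb] with t ht htb htab
    rw [uIoc_of_le hab] at htab
    exact (ht ⟨htab.1, lt_of_le_of_ne htab.2 htb⟩).deriv
  refine ⟨hac.intervalIntegrable_deriv.congr_ae ?_, ?_⟩
  · rw [EventuallyEq, ae_restrict_iff' measurableSet_uIoc]; exact hd'
  · rw [← hac.integral_deriv_eq_sub]
    exact intervalIntegral.integral_congr_ae hd'

lemma lipschitzOnWith_of_contDiff [FiniteDimensional ℝ F] {Φ : F → ℝ} (hΦ : ContDiff ℝ 1 Φ)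
    {s : Set F} (hs : IsCompact s) : ∃ K, LipschitzOnWith K Φ s := by
  obtain ⟨R, hR⟩ := hs.isBounded.subset_closedBall 0
  have hc : IsCompact (Metric.closedBall (0 : F) R) := isCompact_closedBall 0 R
  obtain ⟨C, hC⟩ := hc.exists_bound_of_continuousOn (hΦ.continuous_fderiv (by simp)).continuousOn
  refine ⟨C.toNNReal, LipschitzOnWith.mono ?_ hR⟩
  refine (convex_closedBall 0 R).lipschitzOnWith_of_nnnorm_fderiv_le
    (fun x _ => hΦ.differentiable (by simp) x) fun x hx => ?_
  rw [← NNReal.coe_le_coe, coe_nnnorm]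
  exact (hC x hx).trans (Real.le_coe_toNNReal C)

lemma TimeInt.intervalIntegrable {T : ℝ} {γ : ℝ → F} (h : TimeInt T γ) {s t : ℝ} (hs : 0 < s)
    (hst : s ≤ t) (ht : t < T) : IntervalIntegrable γ volume s t :=
  (intervalIntegrable_iff_integrableOn_Icc_of_le hst).2 (h s t hs ht)

lemma TimeInt.locallyIntegrableOn {T : ℝ} {k : ℝ → F} (hk : TimeInt T k) :
    LocallyIntegrableOn k (Ioo 0 T) := by
  rw [locallyIntegrableOn_iff isOpen_Ioo.isLocallyClosed]
  intro K hK hKc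
  rcases K.eq_empty_or_nonempty with rfl | hne
  · simp
  obtain ⟨x, hx, hx'⟩ := hKc.exists_isMinOn hne continuousOn_id
  obtain ⟨y, hy, hy'⟩ := hKc.exists_isMaxOn hne continuousOn_id
  exact (hk x y (hK hx).1 (hK hy).2).mono_set fun z hz => ⟨hx' hz, hy' hz⟩

lemma continuousOn_of_eq_integral {γ g : ℝ → F} {a b : ℝ} (hab : a ≤ b)
    (hg : IntervalIntegrable g volume a b) (hγ : ∀ t ∈ Icc a b, γ t = γ a + ∫ τ in a..t, g τ) :
    ContinuousOn γ (Icc a b) := by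
  have := intervalIntegral.continuousOn_primitive_interval
    (((intervalIntegrable_iff_integrableOn_Icc_of_le hab).1 hg).mono_set (uIcc_of_le hab).le)
  rw [uIcc_of_le hab] at this
  exact (this.const_add (γ a)).congr hγ

lemma IsPrimitive.eq_add {T : ℝ} {γ g : ℝ → F} (h : IsPrimitive T γ g) {a b : ℝ} (ha : 0 < a)
    (hb : b < T) : ∀ t ∈ Icc a b, γ t = γ a + ∫ τ in a..t, g τ := fun t ht => by
  rw [← h.2 a t ha ht.1 (ht.2.trans_lt hb), add_sub_cancel]

lemma IsPrimitive.continuousOn {T : ℝ} {γ g : ℝ → F} (h : IsPrimitive T γ g) {a b : ℝ} (ha : 0 < a)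
    (hab : a ≤ b) (hb : b < T) : ContinuousOn γ (Icc a b) :=
  continuousOn_of_eq_integral hab (h.1.intervalIntegrable ha hab hb) (h.eq_add ha hb)

lemma IsPrimitive.comp [FiniteDimensional ℝ F] {T : ℝ} {γ g : ℝ → F} (h : IsPrimitive T γ g)
    {Φ : F → ℝ} (hΦ : ContDiff ℝ 1 Φ) :
    IsPrimitive T (fun t => Φ (γ t)) (fun t => fderiv ℝ Φ (γ t) (g t)) := by
  have : CompleteSpace F := FiniteDimensional.complete ℝ F
  have key (s t : ℝ) (hs : 0 < s) (hst : s ≤ t) (ht : t < T) :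
      IntervalIntegrable (fun t => fderiv ℝ Φ (γ t) (g t)) volume s t ∧
        Φ (γ t) - Φ (γ s) = ∫ t in s..t, fderiv ℝ Φ (γ t) (g t) := by
    obtain ⟨K, hK⟩ := lipschitzOnWith_of_contDiff hΦ
      (isCompact_Icc.image_of_continuousOn (h.continuousOn hs hst ht))
    exact comp_sub_eq_integral hst (h.1.intervalIntegrable hs hst ht) (h.eq_add hs ht) hK
      fun r _ => (hΦ.differentiable (by simp) (γ r)).hasFDerivAt
  refine ⟨fun s t hs ht => ?_, fun s t hs hst ht => (key s t hs hst ht).2⟩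
  rcases le_or_gt s t with hst | hst
  · exact (intervalIntegrable_iff_integrableOn_Icc_of_le hst).1 (key s t hs hst ht).1
  · simp [Icc_eq_empty_of_lt hst]

lemma IsTimeTest.exists_Icc {T : ℝ} {φ : ℝ → ℝ} (hφ : IsTimeTest T φ) (hT : 0 < T) :
    ∃ a b, 0 < a ∧ a ≤ b ∧ b < T ∧ tsupport φ ⊆ Ioo a b := by
  rcases (tsupport φ).eq_empty_or_nonempty with h | h
  · exact ⟨T / 2, T / 2, by linarith, le_rfl, by linarith, by simp [h]⟩
  · obtain ⟨x, hx, hx'⟩ := hφ.compact.exists_isMinOn h continuousOn_id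
    obtain ⟨y, hy, hy'⟩ := hφ.compact.exists_isMaxOn h continuousOn_id
    have hx0 := hφ.subset hx
    have hy0 := hφ.subset hy
    have hxy : x ≤ y := hy' hx
    refine ⟨x / 2, (y + T) / 2, by linarith [hx0.1], by linarith [hx0.1, hy0.2], by linarith [hy0.2],
      fun z hz => ⟨?_, ?_⟩⟩
    · have : x ≤ z := hx' hz
      linarith [hx0.1]
    · have : z ≤ y := hy' hz
      linarith [hy0.2]

lemma IsTimeTest.deriv_test {T : ℝ} {φ : ℝ → ℝ} (hφ : IsTimeTest T φ) : IsTimeTest T (deriv φ) :=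
  ⟨hφ.contDiff.deriv' , hφ.compact.deriv, (tsupport_deriv_subset).trans hφ.subset⟩

lemma integral_eq_integral_Icc {φ : ℝ → ℝ} {a b : ℝ} (hφ : tsupport φ ⊆ Ioo a b) (γ : ℝ → F) :
    ∫ t, φ t • γ t = ∫ t in Icc a b, φ t • γ t := by
  refine (setIntegral_eq_integral_of_forall_compl_eq_zero fun t ht => ?_).symm
  rw [image_eq_zero_of_notMem_tsupport fun h => ht (Ioo_subset_Icc_self (hφ h)), zero_smul]

lemma TimeInt.integrable_smul {T : ℝ} (hT : 0 < T) {γ : ℝ → F} (hγ : TimeInt T γ) {φ : ℝ → ℝ}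
    (hφ : IsTimeTest T φ) : Integrable fun t => φ t • γ t := by
  obtain ⟨a, b, ha, -, hb, hab⟩ := hφ.exists_Icc hT
  obtain ⟨C, hC⟩ := hφ.compact.exists_bound_of_continuous hφ.contDiff.continuous
  rw [← integrableOn_iff_integrable_of_support_subset (s := Icc a b)]
  · exact (hγ a b ha hb).bdd_smul C
      hφ.contDiff.continuous.aestronglyMeasurable (ae_of_all _ hC)
  · intro t ht
    by_contra h
    exact ht (by
      simp only [image_eq_zero_of_notMem_tsupport fun h' => h (Ioo_subset_Icc_self (hab h')),
        zero_smul])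

lemma IsPrimitive.prod {G : Type*} [NormedAddCommGroup G] [NormedSpace ℝ G] [CompleteSpace F]
    [CompleteSpace G] {T : ℝ} {γ g : ℝ → F}
    {γ' g' : ℝ → G} (h : IsPrimitive T γ g) (h' : IsPrimitive T γ' g') :
    IsPrimitive T (fun t => (γ t, γ' t)) (fun t => (g t, g' t)) := by
  refine ⟨fun s t hs ht => (h.1 s t hs ht).prodMk (h'.1 s t hs ht), fun s t hs hst ht => ?_⟩
  rw [intervalIntegral.integral_of_le hst, integral_pair
    ((h.1 s t hs ht).mono_set Ioc_subset_Icc_self) ((h'.1 s t hs ht).mono_set Ioc_subset_Icc_self),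
    ← intervalIntegral.integral_of_le hst, ← intervalIntegral.integral_of_le hst, ← h.2 s t hs hst ht,
    ← h'.2 s t hs hst ht]
  rfl

lemma isPrimitive_deriv (T : ℝ) {φ : ℝ → ℝ} (hφ : ContDiff ℝ 1 φ) :
    IsPrimitive T φ (deriv φ) := by
  have hc : Continuous (deriv φ) := hφ.continuous_deriv le_rfl
  refine ⟨fun s t _ _ => hc.integrableOn_Icc, fun s t _ _ _ => ?_⟩
  exact (intervalIntegral.integral_deriv_eq_sub (fun x _ => hφ.differentiable (by simp) x)
    (hc.intervalIntegrable _ _)).symm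

lemma isPrimitive_integral {T : ℝ} {g : ℝ → F} (hg : TimeInt T g) {t₀ : ℝ} (h0 : 0 < t₀)
    (hT : t₀ < T) : IsPrimitive T (fun t => ∫ τ in t₀..t, g τ) g := by
  have hi (r : ℝ) (hr : 0 < r) (hrT : r < T) : IntervalIntegrable g volume t₀ r := by
    rcases le_total t₀ r with h | h
    · exact hg.intervalIntegrable h0 h hrT
    · exact (hg.intervalIntegrable hr h hT).symm
  refine ⟨hg, fun s t hs hst ht => ?_⟩
  exact intervalIntegral.integral_interval_sub_left (hi t (hs.trans_le hst) ht)
    (hi s hs (hst.trans_lt ht))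

/-- Integration by parts as a chain rule: for a functional ℓ, apply (y, z) ↦ y·ℓ(z) to the curve (φ,
γ), whose image vanishes at both ends. -/
lemma IsPrimitive.hasWeakDeriv [FiniteDimensional ℝ F] {T : ℝ} (hT : 0 < T) {γ g : ℝ → F}
    (h : IsPrimitive T γ g) : HasWeakDeriv T γ g := by
  have : CompleteSpace F := FiniteDimensional.complete ℝ F
  have hγ : TimeInt T γ := fun s t hs ht => by
    rcases le_or_gt s t with hst | hst
    · exact (h.continuousOn hs hst ht).integrableOn_Icc
    · simp [Icc_eq_empty_of_lt hst]
  refine ⟨hγ, h.1, fun φ hφ => ?_⟩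
  have i1 := hγ.integrable_smul hT hφ.deriv_test
  have i2 := h.1.integrable_smul hT hφ
  refine (SeparatingDual.eq_iff_forall_dual_eq (R := ℝ)).2 fun ℓ => ?_
  rw [map_neg, ← ℓ.integral_comp_comm i1, ← ℓ.integral_comp_comm i2]
  obtain ⟨a, b, ha, hab, hb, hs⟩ := hφ.exists_Icc hT
  have hsd : tsupport (deriv φ) ⊆ Ioo a b := tsupport_deriv_subset.trans hs
  have hφ1 : ContDiff ℝ 1 φ := hφ.contDiff.of_le (by simp)
  have hΦ : ContDiff ℝ 1 fun z : ℝ × F => z.1 * ℓ z.2 :=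
    contDiff_fst.mul (ℓ.contDiff.comp contDiff_snd)
  have h1 := ((isPrimitive_deriv T hφ1).prod h).comp hΦ
  have hz (r : ℝ) (hr : r ∉ Ioo a b) : φ r = 0 :=
    image_eq_zero_of_notMem_tsupport fun h' => hr (hs h')
  have hd (t : ℝ) : fderiv ℝ (fun z : ℝ × F => z.1 * ℓ z.2) (φ t, γ t) (deriv φ t, g t) =
      φ t • ℓ (g t) + deriv φ t • ℓ (γ t) := by
    have e := (hasFDerivAt_fst (𝕜 := ℝ) (p := (φ t, γ t))).mul
      ((ℓ.hasFDerivAt (x := γ t)).comp (φ t, γ t) hasFDerivAt_snd)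
    have e' : fderiv ℝ (fun z : ℝ × F => z.1 * ℓ z.2) (φ t, γ t) = _ := e.fderiv
    rw [e']
    simp [mul_comm]
  have h2 := h1.2 a b ha hab hb
  simp only [hd] at h2
  rw [hz b (by simp), hz a (by simp), zero_mul, zero_mul, sub_zero,
    intervalIntegral.integral_of_le hab, ← integral_Icc_eq_integral_Ioc] at h2
  have j1 := (ℓ.integrable_comp i1).integrableOn (s := Icc a b)
  have j2 := (ℓ.integrable_comp i2).integrableOn (s := Icc a b)
  simp only [map_smul] at j1 j2 ⊢
  rw [integral_add j2 j1] at h2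
  rw [integral_eq_integral_Icc hs, integral_eq_integral_Icc hsd]
  linarith

/-- The lemma of du Bois-Reymond. -/
lemma exists_ae_eq_const {T : ℝ} (hT : 0 < T) {k : ℝ → F} [CompleteSpace F] (hk : TimeInt T k)
    (h : ∀ φ, IsTimeTest T φ → ∫ t, deriv φ t • k t = 0) :
    ∃ c, ∀ᵐ t ∂volume.restrict (Ioo 0 T), k t = c := by
  let B : ContDiffBump (T / 2) := ⟨T / 8, T / 4, by positivity, by linarith⟩
  have hB : IsTimeTest T (B.normed volume) := by
    refine ⟨B.contDiff_normed, B.hasCompactSupport_normed, ?_⟩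
    rw [B.tsupport_normed_eq]
    intro x hx
    rw [Metric.mem_closedBall, Real.dist_eq, abs_le] at hx
    simp only [B] at hx
    constructor <;> linarith [hx.1, hx.2]
  set c := ∫ t, B.normed volume t • k t with hc
  have hint {φ : ℝ → ℝ} (hφ : IsTimeTest T φ) : Integrable φ :=
    hφ.contDiff.continuous.integrable_of_hasCompactSupport hφ.compact
  refine ⟨c, ?_⟩
  have hkc : TimeInt T fun t => k t - c := fun s t hs ht =>
    (hk s t hs ht).sub (continuous_const.integrableOn_Icc)
  have key : ∀ φ : ℝ → ℝ, IsTimeTest T φ → ∫ t, φ t • (k t - c) = 0 := by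
    intro φ hφ
    set I := ∫ t, φ t with hI
    -- Subtracting a multiple of a fixed test function of mass one makes the mean zero, so that the
    -- primitive Ψ of θ is again a test function; c is the pairing of k with that fixed function.
    let θ : ℝ → ℝ := fun t => φ t - I * B.normed volume t
    have hθc : ContDiff ℝ ∞ θ := hφ.contDiff.sub (contDiff_const.mul hB.contDiff)
    obtain ⟨a₁, b₁, ha₁, hab₁, hb₁, hs₁⟩ := hφ.exists_Icc hT
    obtain ⟨a₂, b₂, ha₂, hab₂, hb₂, hs₂⟩ := hB.exists_Icc hT
    set a := min a₁ a₂
    set b := max b₁ b₂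
    have hab : a ≤ b := (min_le_left _ _).trans (hab₁.trans (le_max_left _ _))
    have hθ0 (t : ℝ) (ht : t ∉ Ioo a b) : θ t = 0 := by
      have h1 : φ t = 0 := image_eq_zero_of_notMem_tsupport fun h' =>
        ht (Ioo_subset_Ioo (min_le_left _ _) (le_max_left _ _) (hs₁ h'))
      have h2 : B.normed volume t = 0 := image_eq_zero_of_notMem_tsupport fun h' =>
        ht (Ioo_subset_Ioo (min_le_right _ _) (le_max_right _ _) (hs₂ h'))
      simp [θ, h1, h2]
    have hθi : Integrable θ := (hint hφ).sub ((hint hB).const_mul I)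
    have hθI : ∫ t, θ t = 0 := by
      simp only [θ]
      rw [integral_sub (hint hφ) ((hint hB).const_mul I), integral_const_mul, B.integral_normed,
        mul_one, sub_self]
    let Ψ : ℝ → ℝ := fun t => ∫ τ in a..t, θ τ
    have hΨd (t : ℝ) : HasDerivAt Ψ (θ t) t :=
      intervalIntegral.integral_hasDerivAt_right (hθc.continuous.intervalIntegrable _ _)
        (hθc.continuous.stronglyMeasurableAtFilter _ _) hθc.continuous.continuousAt
    have hΨ' : deriv Ψ = θ := funext fun t => (hΨd t).deriv
    have hΨ0 (t : ℝ) (ht : t ∉ Icc a b) : Ψ t = 0 := by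
      rcases lt_or_ge t a with h' | h'
      · refine intervalIntegral.integral_zero_ae (ae_of_all _ fun r hr => hθ0 r fun hr' => ?_)
        rw [uIoc_of_ge h'.le] at hr
        exact absurd hr.2 (not_le.2 hr'.1)
      · have hbt : b < t := not_le.1 fun h'' => ht ⟨h', h''⟩
        simp only [Ψ]
        rw [intervalIntegral.integral_of_le h', ← hθI]
        refine setIntegral_eq_integral_of_forall_compl_eq_zero fun r hr => hθ0 r fun hr' => hr ?_
        exact ⟨hr'.1, hr'.2.le.trans hbt.le⟩
    have hΨs : tsupport Ψ ⊆ Icc a b :=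
      closure_minimal (fun t ht => by_contra fun h' => ht (hΨ0 t h')) isClosed_Icc
    have hΨ : IsTimeTest T Ψ := by
      refine ⟨?_, HasCompactSupport.of_support_subset_isCompact isCompact_Icc
        ((subset_tsupport _).trans hΨs), hΨs.trans (Icc_subset_Ioo (lt_min ha₁ ha₂) (max_lt hb₁ hb₂))⟩
      rw [contDiff_infty_iff_deriv, hΨ']
      exact ⟨fun t => (hΨd t).differentiableAt, hθc⟩
    have h1 := h Ψ hΨ
    rw [hΨ'] at h1
    simp only [θ, sub_smul, mul_smul] at h1
    have j : Integrable fun t => I • B.normed volume t • k t := (hk.integrable_smul hT hB).smul I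
    rw [integral_sub (hk.integrable_smul hT hφ) j, integral_smul, ← hc] at h1
    simp only [smul_sub]
    rw [integral_sub (hk.integrable_smul hT hφ) ((hint hφ).smul_const c), integral_smul_const, ← hI, h1]
  have := isOpen_Ioo.ae_eq_zero_of_integral_contDiff_smul_eq_zero hkc.locallyIntegrableOn fun φ h1 h2 h3 =>
    key φ ⟨h1, h2, h3⟩
  rw [ae_restrict_iff' measurableSet_Ioo]
  filter_upwards [this] with t ht ht'
  exact sub_eq_zero.1 (ht ht')

lemma HasWeakDeriv.exists_isPrimitive [FiniteDimensional ℝ F] {T : ℝ} (hT : 0 < T) {γ g : ℝ → F}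
    (h : HasWeakDeriv T γ g) :
    ∃ γ', IsPrimitive T γ' g ∧ ∀ᵐ t ∂volume.restrict (Ioo 0 T), γ t = γ' t := by
  have : CompleteSpace F := FiniteDimensional.complete ℝ F
  have h0 := isPrimitive_integral h.2.1 (half_pos hT) (half_lt_self hT)
  have h1 := h0.hasWeakDeriv hT
  obtain ⟨c, hc⟩ := exists_ae_eq_const hT
    (k := fun t => γ t - ∫ τ in (T / 2)..t, g τ) (fun s t hs ht => (h.1 s t hs ht).sub (h1.1 s t hs ht))
    (fun φ hφ => by
      simp only [smul_sub]
      rw [integral_sub (h.1.integrable_smul hT hφ.deriv_test) (h1.1.integrable_smul hT hφ.deriv_test),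
        h.2.2 φ hφ, h1.2.2 φ hφ, sub_self])
  refine ⟨fun t => c + ∫ τ in (T / 2)..t, g τ, ⟨h.2.1, fun s t hs hst ht => ?_⟩, ?_⟩
  · rw [add_sub_add_left_eq_sub, ← h0.2 s t hs hst ht]
  · filter_upwards [hc] with t ht
    rw [← ht, sub_add_cancel]

lemma ae_restrict_Icc_of_Ioo {T s t : ℝ} {p : ℝ → Prop} (h : ∀ᵐ r ∂volume.restrict (Ioo 0 T), p r)
    (hs : 0 < s) (ht : t < T) : ∀ᵐ r ∂volume.restrict (Icc s t), p r :=
  ae_restrict_of_ae_restrict_of_subset (Icc_subset_Ioo hs ht) h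

lemma TimeInt.congr {T : ℝ} {γ γ' : ℝ → F} (h : TimeInt T γ)
    (he : ∀ᵐ t ∂volume.restrict (Ioo 0 T), γ t = γ' t) : TimeInt T γ' := fun s t hs ht =>
  (h s t hs ht).congr (ae_restrict_Icc_of_Ioo he hs ht)

lemma integral_test_congr {T : ℝ} {γ γ' : ℝ → F} {φ : ℝ → ℝ} (hφ : IsTimeTest T φ)
    (he : ∀ᵐ t ∂volume.restrict (Ioo 0 T), γ t = γ' t) :
    ∫ t, φ t • γ t = ∫ t, φ t • γ' t := by
  refine integral_congr_ae ?_
  rw [ae_restrict_iff' measurableSet_Ioo] at he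
  filter_upwards [he] with t ht
  by_cases h : t ∈ Ioo 0 T
  · simp only [ht h]
  · simp only [image_eq_zero_of_notMem_tsupport fun h' => h (hφ.subset h'), zero_smul]

lemma HasWeakDeriv.congr {T : ℝ} {γ γ' g g' : ℝ → F} (h : HasWeakDeriv T γ g)
    (he : ∀ᵐ t ∂volume.restrict (Ioo 0 T), γ t = γ' t)
    (he' : ∀ᵐ t ∂volume.restrict (Ioo 0 T), g t = g' t) : HasWeakDeriv T γ' g' :=
  ⟨h.1.congr he, h.2.1.congr he', fun φ hφ => by
    rw [← integral_test_congr hφ he', ← integral_test_congr hφ.deriv_test he, h.2.2 φ hφ]⟩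

/-- The chain rule holds for the absolutely continuous representative, and the weak formulation does
not see the null set where it differs. -/
lemma HasWeakDeriv.comp [FiniteDimensional ℝ F] {T : ℝ} (hT : 0 < T) {γ g : ℝ → F}
    (h : HasWeakDeriv T γ g) {Φ : F → ℝ} (hΦ : ContDiff ℝ 1 Φ) :
    HasWeakDeriv T (fun t => Φ (γ t)) (fun t => fderiv ℝ Φ (γ t) (g t)) := by
  obtain ⟨γ', h1, h2⟩ := h.exists_isPrimitive hT
  exact ((h1.comp hΦ).hasWeakDeriv hT).congr (h2.mono fun t ht => by simp only [ht])
    (h2.mono fun t ht => by simp only [ht])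

end Time

/-! ### Differential inequalities -/

lemma hasFDerivAt_mul_exp_neg (z : ℝ × ℝ) :
    HasFDerivAt (fun z : ℝ × ℝ => z.1 * Real.exp (-z.2))
      (Real.exp (-z.2) • ContinuousLinearMap.fst ℝ ℝ ℝ -
        (z.1 * Real.exp (-z.2)) • ContinuousLinearMap.snd ℝ ℝ ℝ) z := by
  have e := (hasFDerivAt_fst (𝕜 := ℝ) (p := z)).mul (hasFDerivAt_snd (𝕜 := ℝ) (p := z)).neg.exp
  refine e.congr_fderiv ?_
  ext <;> simp

/-- Grönwall's inequality in integral form. -/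
lemma gronwall_integral {S v φ : ℝ → ℝ} {C s t : ℝ} (hst : s ≤ t) (hC : 0 ≤ C)
    (hS : ContinuousOn S (Icc s t)) (hv : IntervalIntegrable v volume s t) (hv0 : ∀ r, 0 ≤ v r)
    (hφ : IntervalIntegrable φ volume s t)
    (h : ∀ r ∈ Icc s t, S r ≤ S s + ∫ τ in s..r, (C * v τ * S τ + C * φ τ)) :
    S t ≤ Real.exp (C * ∫ τ in s..t, v τ) *
      (S s + C * ∫ τ in s..t, Real.exp (-(C * ∫ r in s..τ, v r)) * φ τ) := by
  set g₁ : ℝ → ℝ := fun τ => C * v τ * S τ + C * φ τ with hg₁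
  have hS' : ContinuousOn S (uIcc s t) := by rwa [uIcc_of_le hst]
  have i₁ : IntervalIntegrable g₁ volume s t := ((hv.const_mul C).mul_continuousOn hS').add (hφ.const_mul C)
  have i₂ : IntervalIntegrable (fun τ => C * v τ) volume s t := hv.const_mul C
  have sub {k : ℝ → ℝ} (hk : IntervalIntegrable k volume s t) (r : ℝ) (hr : r ∈ Icc s t) :
      IntervalIntegrable k volume s r :=
    hk.mono_set (by rw [uIcc_of_le hst, uIcc_of_le hr.1]; exact Icc_subset_Icc_right hr.2)
  have ig : IntervalIntegrable (fun τ => (g₁ τ, C * v τ)) volume s t := by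
    rw [intervalIntegrable_iff_integrableOn_Ioc_of_le hst] at i₁ i₂ ⊢
    exact i₁.prodMk i₂
  -- S itself is only continuous. The majorant in the first component and the exponent in the second
  -- are absolutely continuous, so the chain rule applies to (y, z) ↦ y·exp(−z) along this curve.
  let γ : ℝ → ℝ × ℝ := fun r => (S s + ∫ τ in s..r, g₁ τ, C * ∫ τ in s..r, v τ)
  have hγ : ∀ r ∈ Icc s t, γ r = γ s + ∫ τ in s..r, (g₁ τ, C * v τ) := by
    intro r hr
    have j₁ := sub i₁ r hr
    have j₂ := sub i₂ r hr
    rw [intervalIntegrable_iff_integrableOn_Ioc_of_le hr.1] at j₁ j₂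
    rw [intervalIntegral.integral_of_le hr.1, integral_pair j₁ j₂,
      ← intervalIntegral.integral_of_le hr.1, ← intervalIntegral.integral_of_le hr.1,
      intervalIntegral.integral_const_mul]
    simp [γ]
  obtain ⟨K, hK⟩ := lipschitzOnWith_of_contDiff
    (Φ := fun z : ℝ × ℝ => z.1 * Real.exp (-z.2)) (by fun_prop)
    (isCompact_Icc.image_of_continuousOn (continuousOn_of_eq_integral hst ig hγ))
  obtain ⟨i₃, e⟩ := comp_sub_eq_integral hst ig hγ hK fun r _ => hasFDerivAt_mul_exp_neg (γ r)
  have cA : ContinuousOn (fun r => ∫ τ in s..r, v τ) (uIcc s t) :=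
    intervalIntegral.continuousOn_primitive_interval
      ((intervalIntegrable_iff_integrableOn_Icc_of_le hst).1 hv |>.mono_set (uIcc_of_le hst).le)
  have i₄ : IntervalIntegrable (fun τ => C * (Real.exp (-(C * ∫ r in s..τ, v r)) * φ τ)) volume s t :=
    (hφ.continuousOn_mul (((cA.const_mul C).neg).rexp)).const_mul C
  have hle := intervalIntegral.integral_mono_on hst i₃ i₄ fun r hr => by
    have h1 := h r hr
    simp only [sub_apply, smul_apply,
      ContinuousLinearMap.coe_fst', ContinuousLinearMap.coe_snd', smul_eq_mul, γ]
    set E := Real.exp (-(C * ∫ τ in s..r, v τ))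
    -- S lies below its majorant; replacing one by the other in the term with v is the only loss.
    have h2 : 0 ≤ E * (C * v r) * ((S s + ∫ τ in s..r, g₁ τ) - S r) :=
      mul_nonneg (mul_nonneg (Real.exp_pos _).le (mul_nonneg hC (hv0 r))) (sub_nonneg.2 h1)
    simp only [hg₁] at h2 ⊢
    nlinarith
  rw [← e, intervalIntegral.integral_const_mul] at hle
  simp only [γ, intervalIntegral.integral_same, mul_zero, neg_zero, Real.exp_zero, mul_one,
    add_zero] at hle
  have h3 := h t ⟨hst, le_rfl⟩
  set A := C * ∫ τ in s..t, v τ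
  calc S t ≤ S s + ∫ τ in s..t, g₁ τ := h3
    _ = Real.exp A * ((S s + ∫ τ in s..t, g₁ τ) * Real.exp (-A)) := by
      rw [mul_comm (S s + _), ← mul_assoc, ← Real.exp_add]; simp
    _ ≤ _ := mul_le_mul_of_nonneg_left (by linarith) (Real.exp_pos _).le

/-- Formally, divide d(X^p) ≤ pX^(p−1)G by pX^(p−1). Since z ↦ z^(1/p) is not Lipschitz at 0, it is
applied to the majorant of X^p raised by δ, and δ → 0 at the end. -/
lemma le_add_integral_of_rpow_le {X G : ℝ → ℝ} {p s t : ℝ} (hst : s ≤ t) (hp : 1 < p)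
    (hX : ContinuousOn X (Icc s t)) (hX0 : ∀ r, 0 ≤ X r) (hG : IntervalIntegrable G volume s t)
    (hG0 : ∀ r, 0 ≤ G r)
    (h : ∀ r ∈ Icc s t, X r ^ p ≤ X s ^ p + ∫ τ in s..r, p * X τ ^ (p - 1) * G τ) :
    X t ≤ X s + ∫ τ in s..t, G τ := by
  have hp0 : 0 < p := by linarith
  set g : ℝ → ℝ := fun τ => p * X τ ^ (p - 1) * G τ with hg
  have hg0 (r : ℝ) : 0 ≤ g r := by have := hX0 r; have := hG0 r; positivity
  have ig : IntervalIntegrable g volume s t := by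
    refine hG.continuousOn_mul ?_
    rw [uIcc_of_le hst]
    exact (hX.rpow_const fun r _ => Or.inr (by linarith)).const_mul p
  have key : ∀ δ > 0, X t ≤ (X s ^ p + δ) ^ p⁻¹ + ∫ τ in s..t, G τ := by
    intro δ hδ
    let Z : ℝ → ℝ := fun r => X s ^ p + δ + ∫ τ in s..r, g τ
    have hZδ (r : ℝ) (hr : r ∈ Icc s t) : δ ≤ Z r := by
      have h1 : 0 ≤ X s ^ p := Real.rpow_nonneg (hX0 s) _
      have h2 : 0 ≤ ∫ τ in s..r, g τ := intervalIntegral.integral_nonneg hr.1 fun τ _ => hg0 τ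
      simp only [Z]; linarith
    have hXZ (r : ℝ) (hr : r ∈ Icc s t) : X r ^ p ≤ Z r := by
      have := h r hr
      simp only [Z]; linarith
    have hd (z : ℝ) (hz : 0 < z) : HasDerivAt (fun z : ℝ => z ^ p⁻¹) (p⁻¹ * z ^ (p⁻¹ - 1)) z :=
      Real.hasDerivAt_rpow_const (Or.inl hz.ne')
    have hexp : p⁻¹ - 1 ≤ 0 := by
      have := inv_lt_one_of_one_lt₀ hp; linarith
    have hLip : LipschitzOnWith (p⁻¹ * δ ^ (p⁻¹ - 1)).toNNReal (fun z : ℝ => z ^ p⁻¹) (Ici δ) := by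
      refine (convex_Ici δ).lipschitzOnWith_of_nnnorm_hasDerivWithin_le
        (fun z hz => (hd z (hδ.trans_le hz)).hasDerivWithinAt) fun z hz => ?_
      have hz0 : 0 < z := hδ.trans_le hz
      rw [← NNReal.coe_le_coe, coe_nnnorm, Real.norm_of_nonneg (by positivity),
        Real.coe_toNNReal _ (by positivity)]
      exact mul_le_mul_of_nonneg_left (Real.rpow_le_rpow_of_nonpos hδ hz hexp) (by positivity)
    obtain ⟨i, e⟩ := comp_sub_eq_integral (γ := Z) hst ig (fun r _ => by simp [Z])
      (hLip.mono (by rintro _ ⟨r, hr, rfl⟩; exact hZδ r hr))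
      (fun r hr => (hd (Z r) (hδ.trans_le (hZδ r hr))).hasFDerivAt)
    have hle := intervalIntegral.integral_mono_on hst i hG fun r hr => by
      have hZ0 := hδ.trans_le (hZδ r hr)
      have h1 : X r ^ (p - 1) ≤ Z r ^ (1 - p⁻¹) := by
        calc X r ^ (p - 1) = (X r ^ p) ^ (1 - p⁻¹) := by
              rw [← Real.rpow_mul (hX0 r)]; congr 1; field_simp
          _ ≤ _ := Real.rpow_le_rpow (Real.rpow_nonneg (hX0 r) _) (hXZ r hr) (by linarith)
      have h2 : Z r ^ (p⁻¹ - 1) * Z r ^ (1 - p⁻¹) = 1 := by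
        rw [← Real.rpow_add hZ0]; simp
      have h3 : 0 < Z r ^ (p⁻¹ - 1) := Real.rpow_pos_of_pos hZ0 _
      simp only [ContinuousLinearMap.toSpanSingleton_apply, smul_eq_mul, hg]
      calc p * X r ^ (p - 1) * G r * (p⁻¹ * Z r ^ (p⁻¹ - 1))
          = (Z r ^ (p⁻¹ - 1) * X r ^ (p - 1)) * G r := by field_simp
        _ ≤ (Z r ^ (p⁻¹ - 1) * Z r ^ (1 - p⁻¹)) * G r := by have := hG0 r; gcongr
        _ = G r := by rw [h2, one_mul]
    rw [← e] at hle
    have h4 : Z s = X s ^ p + δ := by simp [Z]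
    have h5 : X t ≤ Z t ^ p⁻¹ := by
      calc X t = (X t ^ p) ^ p⁻¹ := by rw [← Real.rpow_mul (hX0 t), mul_inv_cancel₀ hp0.ne', Real.rpow_one]
        _ ≤ _ := Real.rpow_le_rpow (Real.rpow_nonneg (hX0 t) _) (hXZ t ⟨hst, le_rfl⟩) (by positivity)
    rw [h4] at hle
    linarith
  have hlim : Tendsto (fun δ : ℝ => (X s ^ p + δ) ^ p⁻¹ + ∫ τ in s..t, G τ) (𝓝[>] 0)
      (𝓝 ((X s ^ p + 0) ^ p⁻¹ + ∫ τ in s..t, G τ)) := by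
    refine Tendsto.mono_left (Continuous.tendsto ?_ 0) nhdsWithin_le_nhds
    exact ((continuous_const.add continuous_id).rpow_const fun _ => Or.inr (by positivity)).add
      continuous_const
  have := ge_of_tendsto hlim (eventually_nhdsWithin_of_forall key)
  rwa [add_zero, ← Real.rpow_mul (hX0 s), mul_inv_cancel₀ hp0.ne', Real.rpow_one] at this

end DensityEuler
end

noncomputable section
namespace DensityEuler
set_option linter.unusedSectionVars false

variable {N : ℕ}

/-! ### Mollifiers -/

section Mollifier

variable {F : Type*} [NormedAddCommGroup F] [NormedSpace ℝ F]

lemma IsBump.contDiff_one {ψ : Space N → ℝ} (hψ : IsBump ψ) : ContDiff ℝ 1 ψ := hψ.1.of_le (by simp)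

lemma integrable_smul_of_locallyIntegrable {f : Space N → F} (hf : LocallyIntegrable f)
    {k : Space N → ℝ} (hk : Continuous k) (hkc : HasCompactSupport k) :
    Integrable fun y => k y • f y :=
  hf.integrable_smul_left_of_hasCompactSupport hk hkc

lemma locallyIntegrable_norm {f : Space N → F} (hf : LocallyIntegrable f) :
    LocallyIntegrable fun x => ‖f x‖ :=
  locallyIntegrableOn_univ.1 (locallyIntegrableOn_univ.2 hf).norm

lemma aestronglyMeasurable_clm_apply {E α : Type*} [NormedAddCommGroup E] [NormedSpace ℝ E]
    [MeasurableSpace α] {μ : Measure α} {k : α → E →L[ℝ] F} {f : α → E}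
    (hk : AEStronglyMeasurable k μ) (hf : AEStronglyMeasurable f μ) :
    AEStronglyMeasurable (fun x => k x (f x)) μ :=
  (ContinuousLinearMap.id ℝ (E →L[ℝ] F)).aestronglyMeasurable_comp₂ hk hf

lemma integrable_bilin_of_locallyIntegrable {E : Type*} [NormedAddCommGroup E] [NormedSpace ℝ E]
    {f : Space N → E} (hf : LocallyIntegrable f) {k : Space N → E →L[ℝ] F} (hk : Continuous k)
    (hkc : HasCompactSupport k) : Integrable fun y => k y (f y) := by
  have h1 := integrable_smul_of_locallyIntegrable (locallyIntegrable_norm hf) hk.norm hkc.norm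
  refine h1.mono' ?_ (ae_of_all _ fun y => (k y).le_opNorm _)
  exact aestronglyMeasurable_clm_apply hk.aestronglyMeasurable hf.aestronglyMeasurable

lemma integrable_fderiv_apply {ψ : Space N → ℝ} (hψ : ContDiff ℝ 1 ψ) (hc : HasCompactSupport ψ)
    {w : Space N → Space N} (hw : LocallyIntegrable w) : Integrable fun y => fderiv ℝ ψ y (w y) :=
  integrable_bilin_of_locallyIntegrable hw (hψ.continuous_fderiv (by simp)) (hc.fderiv ℝ)

lemma integrable_fderiv_smul {ψ : Space N → ℝ} (hψ : ContDiff ℝ 1 ψ) (hc : HasCompactSupport ψ)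
    {f : Space N → F} (hf : LocallyIntegrable f) (v : Space N) :
    Integrable fun y => fderiv ℝ ψ y v • f y :=
  integrable_smul_of_locallyIntegrable hf
    ((hψ.continuous_fderiv (by simp)).clm_apply continuous_const) (hc.fderiv_apply ℝ v)

/-- Bumps of radius `1 / (n + 1)`. -/
def mollBump (N n : ℕ) : ContDiffBump (0 : Space N) :=
  ⟨1 / (2 * (n + 1)), 1 / (n + 1), by positivity, by
    apply one_div_lt_one_div_of_lt <;> linarith [(n.cast_nonneg : (0 : ℝ) ≤ n)]⟩

/-- The standard mollifier. -/
def moll (n : ℕ) : Space N → ℝ := (mollBump N n).normed volume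

lemma isBump_moll (n : ℕ) : IsBump (moll n : Space N → ℝ) :=
  ⟨(mollBump N n).contDiff_normed, (mollBump N n).hasCompactSupport_normed⟩

lemma moll_nonneg (n : ℕ) (x : Space N) : 0 ≤ moll n x := (mollBump N n).nonneg_normed x

lemma integral_moll (n : ℕ) : ∫ x : Space N, moll n x = 1 := (mollBump N n).integral_normed

lemma tsupport_moll (n : ℕ) :
    tsupport (moll n : Space N → ℝ) = Metric.closedBall 0 (1 / (n + 1)) :=
  (mollBump N n).tsupport_normed_eq

lemma radius_le_one (n : ℕ) : 1 / ((n : ℝ) + 1) ≤ 1 := by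
  rw [div_le_one (by positivity)]; linarith [(n.cast_nonneg : (0 : ℝ) ≤ n)]

lemma moll_eq_zero {n : ℕ} {x : Space N} (hx : 1 / ((n : ℝ) + 1) < ‖x‖) : moll n x = 0 :=
  image_eq_zero_of_notMem_tsupport (by rw [tsupport_moll]; simpa using hx)

lemma fderiv_moll_eq_zero {n : ℕ} {x : Space N} (hx : 1 / ((n : ℝ) + 1) < ‖x‖) :
    fderiv ℝ (moll n) x = 0 :=
  image_eq_zero_of_notMem_tsupport fun h => by
    have := tsupport_fderiv_subset ℝ h
    rw [tsupport_moll, mem_closedBall_zero_iff] at this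
    linarith

lemma isBump_moll_sub (n : ℕ) (x : Space N) : IsBump fun y => moll n (x - y) :=
  ⟨(isBump_moll n).1.comp (by fun_prop),
    (isBump_moll n).2.comp_homeomorph (Homeomorph.subLeft x)⟩

lemma fderiv_moll_sub (n : ℕ) (x y v : Space N) :
    fderiv ℝ (fun y => moll n (x - y)) y v = - fderiv ℝ (moll n) (x - y) v := by
  have h := ((isBump_moll n).differentiable (x - y)).hasFDerivAt.comp y
    ((hasFDerivAt_id y).const_sub x)
  have h' : fderiv ℝ (fun y => moll n (x - y)) y = _ := h.fderiv
  rw [h']; simp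

lemma continuous_fderiv_moll_sub (n : ℕ) (x : Space N) :
    Continuous fun y => fderiv ℝ (moll n) (x - y) :=
  (isBump_moll n).continuous_fderiv.comp (by fun_prop)

lemma hasCompactSupport_fderiv_moll_sub (n : ℕ) (x : Space N) :
    HasCompactSupport fun y => fderiv ℝ (moll n) (x - y) :=
  ((isBump_moll n).2.fderiv ℝ).comp_homeomorph (Homeomorph.subLeft x)

/-- The mollification of a function. -/
def mollify (n : ℕ) (f : Space N → F) (x : Space N) : F := ∫ y, moll n (x - y) • f y

open scoped Convolution in
lemma convolution_moll (n : ℕ) (f : Space N → F) :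
    (moll n ⋆[ContinuousLinearMap.lsmul ℝ ℝ, volume] f) = mollify n f := by
  ext x
  rw [convolution_eq_swap]; rfl

lemma contDiff_mollify {f : Space N → F} (hf : LocallyIntegrable f) (n : ℕ) :
    ContDiff ℝ ∞ (mollify n f) := by
  rw [← convolution_moll]
  exact (isBump_moll n).2.contDiff_convolution_left _ (isBump_moll n).1 hf

lemma fderiv_mollify {f : Space N → F} (hf : LocallyIntegrable f) (n : ℕ) (x v : Space N) :
    fderiv ℝ (mollify n f) x v = ∫ y, fderiv ℝ (moll n) (x - y) v • f y := by
  rw [← convolution_moll, ((isBump_moll n).2.hasFDerivAt_convolution_left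
    (ContinuousLinearMap.lsmul ℝ ℝ) (isBump_moll n).contDiff_one hf x).fderiv, convolution_eq_swap,
    ContinuousLinearMap.integral_apply]
  · rfl
  · refine Integrable.congr (integrable_bilin_of_locallyIntegrable (F := Space N →L[ℝ] F)
      (k := fun y => ((ContinuousLinearMap.lsmul ℝ ℝ : ℝ →L[ℝ] F →L[ℝ] F).precompL (Space N))
        (fderiv ℝ (moll n) (x - y))) hf
      ((ContinuousLinearMap.continuous _).comp (continuous_fderiv_moll_sub n x)) ?_) ?_
    · exact (hasCompactSupport_fderiv_moll_sub n x).comp_left (map_zero _)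
    · exact ae_of_all _ fun y => rfl

lemma ae_tendsto_mollify {f : Space N → F} [FiniteDimensional ℝ F] (hf : LocallyIntegrable f) :
    ∀ᵐ x, Tendsto (fun n => mollify n f x) atTop (𝓝 (f x)) := by
  have : CompleteSpace F := FiniteDimensional.complete ℝ F
  have h := ContDiffBump.ae_convolution_tendsto_right_of_locallyIntegrable (μ := volume)
    (φ := fun n => mollBump N n) (l := atTop) (K := 2) tendsto_one_div_add_atTop_nhds_zero_nat
    (.of_forall fun n => by
      simp only [mollBump]
      have : (0 : ℝ) < n + 1 := by positivity
      field_simp; norm_num) hf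
  filter_upwards [h] with x hx
  simpa only [← convolution_moll, moll] using hx

/-- All mollifiers are supported in the unit ball, so a bound near x is enough. This matters for
functions with linear growth. -/
lemma norm_mollify_le {f : Space N → F} {M : ℝ} {x : Space N} (_ : 0 ≤ M)
    (h : ∀ᵐ y, ‖x - y‖ ≤ 1 → ‖f y‖ ≤ M) (n : ℕ) : ‖mollify n f x‖ ≤ M := by
  have e : ∫ y, moll n (x - y) * M = M := by
    rw [integral_mul_const, integral_sub_left_eq_self (moll n) volume x, integral_moll, one_mul]
  rw [← e]
  refine norm_integral_le_of_norm_le ((isBump_moll_sub n x).integrable.mul_const M) ?_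
  filter_upwards [h] with y hy
  rw [norm_smul, Real.norm_of_nonneg (moll_nonneg _ _)]
  by_cases hxy : ‖x - y‖ ≤ 1
  · exact mul_le_mul_of_nonneg_left (hy hxy) (moll_nonneg _ _)
  · rw [moll_eq_zero ((radius_le_one n).trans_lt (not_le.1 hxy))]; simp

/-- Only the ratio 2 of the radii enters the profile of a bump, so mollifiers are rescalings of one
cut-off and inherit its gradient bound. -/
lemma mollBump_eq_cutoff (n : ℕ) : ⇑(mollBump N n) = cutoff (1 / (2 * (n + 1))) := by
  ext x
  have : (1 / ((n : ℝ) + 1)) / (1 / (2 * (n + 1))) = 2 / 1 := by field_simp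
  simp only [cutoff, unitBump, mollBump, ContDiffBump.apply, this, sub_zero, inv_one, one_smul]

/-- The gradient of the mollifier scales correctly. -/
lemma exists_norm_mul_norm_fderiv_moll_le (N : ℕ) : ∃ C, 0 ≤ C ∧ ∀ (n : ℕ) (z : Space N),
    ‖z‖ * ‖fderiv ℝ (moll n) z‖ ≤ C * (volume.real (Metric.closedBall (0 : Space N) (1 / (n + 1))))⁻¹ := by
  obtain ⟨C, hC0, hC⟩ := exists_norm_fderiv_cutoff_le N
  refine ⟨2 * C * 2 ^ N, by positivity, fun n z => ?_⟩
  have hr : (0 : ℝ) < 1 / (2 * (n + 1)) := by positivity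
  have hI := (mollBump N n).measure_closedBall_le_integral volume
  -- The normalising integral is at least the volume of the ball of half the support radius;
  -- comparison with the full support ball costs 2^N.
  have hv : volume.real (Metric.closedBall (0 : Space N) (1 / (n + 1))) =
      2 ^ N * volume.real (Metric.closedBall (0 : Space N) (1 / (2 * (n + 1)))) := by
    rw [show (1 / ((n : ℝ) + 1)) = 2 * (1 / (2 * (n + 1))) by field_simp,
      Measure.real, Measure.addHaar_closedBall_mul _ _ two_pos.le hr.le, finrank_euclideanSpace_fin,
      ENNReal.toReal_mul, ENNReal.toReal_ofReal (by positivity), Measure.real]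
  set A := volume.real (Metric.closedBall (0 : Space N) (1 / (2 * (n + 1)))) with hA
  have hA0 : 0 < A := by
    rw [hA, Measure.real, ENNReal.toReal_pos_iff]
    exact ⟨Metric.measure_closedBall_pos _ _ hr, measure_closedBall_lt_top⟩
  rw [hv]
  have hd : fderiv ℝ (moll n) z =
      (∫ x : Space N, mollBump N n x)⁻¹ • fderiv ℝ (cutoff (1 / (2 * (n + 1)))) z := by
    have : (moll n : Space N → ℝ) =
        fun x => (∫ x : Space N, mollBump N n x)⁻¹ • cutoff (1 / (2 * (n + 1))) x := by
      ext x
      rw [← mollBump_eq_cutoff, moll, ContDiffBump.normed_def, smul_eq_mul, div_eq_inv_mul]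
    rw [this]
    exact fderiv_fun_const_smul ((isBump_cutoff hr).differentiable z) _
  rcases le_or_gt ‖z‖ (1 / ((n : ℝ) + 1)) with hz | hz
  · rw [hd, norm_smul, Real.norm_of_nonneg (inv_nonneg.2 (hA0.le.trans hI))]
    calc ‖z‖ * ((∫ x : Space N, mollBump N n x)⁻¹ * ‖fderiv ℝ (cutoff (1 / (2 * (n + 1)))) z‖)
        ≤ 1 / (n + 1) * (A⁻¹ * (C / (1 / (2 * (n + 1))))) := by
          have h1 := hC _ hr z
          have h2 : A ≤ ∫ x : Space N, mollBump N n x := hI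
          have h3 := inv_anti₀ hA0 h2
          have h4 := (inv_pos.2 (hA0.trans_le h2)).le
          gcongr
      _ = _ := by field_simp
  · rw [fderiv_moll_eq_zero hz]; simp; positivity

end Mollifier

/-! ### Weak derivatives in the space variable -/

/-- `w` is divergence free in the sense of distributions. -/
def WeakDivFree (w : Space N → Space N) : Prop :=
  LocallyIntegrable w ∧ ∀ ψ, IsBump ψ → ∫ x, fderiv ℝ ψ x (w x) = 0

/-- `G` is the derivative of `g` in the sense of distributions. -/
def HasWeakFDeriv {F : Type*} [NormedAddCommGroup F] [NormedSpace ℝ F] (g : Space N → F)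
    (G : Space N → Space N →L[ℝ] F) : Prop :=
  LocallyIntegrable g ∧ LocallyIntegrable G ∧ ∀ ψ, IsBump ψ → ∀ v,
    ∫ x, fderiv ℝ ψ x v • g x = - ∫ x, ψ x • G x v

section WeakFDeriv

variable {F : Type*} [NormedAddCommGroup F] [NormedSpace ℝ F]

lemma LocallyIntegrable.clm_apply_const {G : Space N → Space N →L[ℝ] F} (hG : LocallyIntegrable G)
    (v : Space N) : LocallyIntegrable fun x => G x v := fun x => by
  obtain ⟨s, hs, h⟩ := hG x
  exact ⟨s, hs, (ContinuousLinearMap.apply ℝ F v).integrable_comp h⟩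

lemma HasWeakFDeriv.fderiv_mollify {g : Space N → F} {G : Space N → Space N →L[ℝ] F}
    (h : HasWeakFDeriv g G) (n : ℕ) (x v : Space N) :
    fderiv ℝ (mollify n g) x v = mollify n (fun y => G y v) x := by
  rw [DensityEuler.fderiv_mollify h.1]
  have := h.2.2 _ (isBump_moll_sub n x) v
  simp only [fderiv_moll_sub, neg_smul, integral_neg, neg_inj] at this
  rw [this]; rfl

lemma hasWeakFDeriv_of_contDiff [FiniteDimensional ℝ F] {g : Space N → F} (hg : ContDiff ℝ 1 g) :
    HasWeakFDeriv g (fderiv ℝ g) := by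
  have hd := hg.continuous_fderiv (by simp)
  refine ⟨hg.continuous.locallyIntegrable, hd.locallyIntegrable, fun ψ hψ v => ?_⟩
  have := integral_bilinear_hasFDerivAt_right_eq_neg_left_of_integrable (μ := volume)
    (B := (ContinuousLinearMap.lsmul ℝ ℝ).flip) (f := g) (g := ψ) (f' := fderiv ℝ g) (g' := fderiv ℝ ψ)
    (v := v) ?_ ?_ ?_ (fun x _ => (hg.differentiable (by simp) x).hasFDerivAt)
    (fun x _ => (hψ.differentiable x).hasFDerivAt)
  · simpa using this
  · exact integrable_smul_of_locallyIntegrable (hd.clm_apply continuous_const).locallyIntegrable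
      hψ.continuous hψ.2
  · exact integrable_fderiv_smul hψ.contDiff_one hψ.2 hg.continuous.locallyIntegrable v
  · exact integrable_smul_of_locallyIntegrable hg.continuous.locallyIntegrable hψ.continuous hψ.2

/-- A function with bounded weak derivative is Lipschitz off a null set. -/
lemma HasWeakFDeriv.exists_lipschitz [FiniteDimensional ℝ F] {g : Space N → F}
    {G : Space N → Space N →L[ℝ] F} (h : HasWeakFDeriv g G) {L : ℝ} (hL : 0 ≤ L)
    (hG : ∀ᵐ x, ‖G x‖ ≤ L) :
    ∃ S : Set (Space N), (∀ᵐ x, x ∈ S) ∧ ∀ x ∈ S, ∀ y ∈ S, ‖g x - g y‖ ≤ L * ‖x - y‖ := by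
  -- The mollifications are Lipschitz with constant L everywhere, and the inequality survives in the
  -- limit at all points where they converge to g.
  refine ⟨{x | Tendsto (fun n => mollify n g x) atTop (𝓝 (g x))}, ae_tendsto_mollify h.1,
    fun x hx y hy => ?_⟩
  have hn (n : ℕ) : ‖mollify n g x - mollify n g y‖ ≤ L * ‖x - y‖ := by
    refine convex_univ.norm_image_sub_le_of_norm_fderiv_le (𝕜 := ℝ)
      (fun z _ => ((contDiff_mollify h.1 n).differentiable (by simp)) z) (fun z _ => ?_)
      (mem_univ y) (mem_univ x)
    refine ContinuousLinearMap.opNorm_le_bound _ hL fun v => ?_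
    rw [h.fderiv_mollify]
    refine norm_mollify_le (by positivity) ?_ n
    filter_upwards [hG] with y hy _
    exact ((G y).le_opNorm v).trans (by gcongr)
  exact le_of_tendsto (hx.sub hy).norm (.of_forall hn)

/-- Dominated convergence against functions supported in a common ball. -/
lemma tendsto_integral_of_bdd_support {f : ℕ → Space N → F} {f₀ : Space N → F} {k : Space N → ℝ} {R : ℝ}
    (hm : ∀ n, AEStronglyMeasurable (f n)) (hk : LocallyIntegrable k)
    (hs : ∀ n, ∀ᵐ x, R < ‖x‖ → f n x = 0) (hb : ∀ n, ∀ᵐ x, ‖x‖ ≤ R → ‖f n x‖ ≤ k x)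
    (hlim : ∀ᵐ x, Tendsto (fun n => f n x) atTop (𝓝 (f₀ x))) :
    Tendsto (fun n => ∫ x, f n x) atTop (𝓝 (∫ x, f₀ x)) := by
  refine tendsto_integral_of_dominated_convergence ((Metric.closedBall 0 R).indicator k) hm ?_ ?_ hlim
  · rw [integrable_indicator_iff measurableSet_closedBall]
    exact hk.integrableOn_isCompact (isCompact_closedBall _ _)
  · intro n
    filter_upwards [hs n, hb n] with x h1 h2
    by_cases hx : ‖x‖ ≤ R
    · rw [indicator_of_mem (mem_closedBall_zero_iff.2 hx)]; exact h2 hx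
    · rw [h1 (not_le.1 hx), indicator_of_notMem (by rwa [mem_closedBall_zero_iff]), norm_zero]

lemma exists_radius {X : Type*} [Zero X] {θ : Space N → X} (h : HasCompactSupport θ) :
    ∃ R, 0 < R ∧ ∀ x, R < ‖x‖ → θ x = 0 := by
  obtain ⟨R, hR, h'⟩ := h.isBounded.subset_closedBall_lt 0 0
  refine ⟨R, hR, fun x hx => image_eq_zero_of_notMem_tsupport fun hx' => ?_⟩
  have := h' hx'
  rw [mem_closedBall_zero_iff] at this
  linarith

lemma fderiv_eq_zero_of_radius {θ : Space N → ℝ} {R : ℝ} (h : ∀ x, R < ‖x‖ → θ x = 0) {x : Space N}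
    (hx : R < ‖x‖) : fderiv ℝ θ x = 0 := by
  have : θ =ᶠ[𝓝 x] fun _ => 0 := by
    filter_upwards [(isOpen_lt continuous_const continuous_norm).mem_nhds hx] with z hz using h z hz
  rw [this.fderiv_eq]; simp

lemma mollify_eq_zero {θ : Space N → F} {R : ℝ} (h : ∀ x, R < ‖x‖ → θ x = 0) (n : ℕ) {x : Space N}
    (hx : R + 1 < ‖x‖) : mollify n θ x = 0 := by
  refine integral_eq_zero_of_ae (ae_of_all _ fun y => ?_)
  by_cases hy : R < ‖y‖
  · simp [h y hy]
  · have h1 : 1 < ‖x - y‖ := by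
      have := norm_sub_norm_le x y
      linarith [not_lt.1 hy]
    simp [moll_eq_zero ((radius_le_one n).trans_lt h1)]

lemma tendsto_mollify_of_continuous [CompleteSpace F] {θ : Space N → F} (hθ : Continuous θ) (x : Space N) :
    Tendsto (fun n => mollify n θ x) atTop (𝓝 (θ x)) := by
  have := ContDiffBump.convolution_tendsto_right_of_continuous (μ := volume)
    (φ := fun n => mollBump N n) (l := atTop) tendsto_one_div_add_atTop_nhds_zero_nat hθ x
  simpa only [← convolution_moll, moll] using this

/-- The divergence free condition may be tested with `C^1` functions. -/
lemma WeakDivFree.integral_fderiv_eq_zero {w : Space N → Space N} (hw : WeakDivFree w)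
    {θ : Space N → ℝ} (hθ : ContDiff ℝ 1 θ) (hc : HasCompactSupport θ) :
    ∫ x, fderiv ℝ θ x (w x) = 0 := by
  obtain ⟨R, hR, hR'⟩ := exists_radius hc
  obtain ⟨C, hC⟩ := (hc.fderiv ℝ).exists_bound_of_continuous (hθ.continuous_fderiv (by simp))
  have hC0 : 0 ≤ C := (norm_nonneg _).trans (hC 0)
  have hwd := hasWeakFDeriv_of_contDiff hθ
  have hb (n : ℕ) : IsBump (mollify n θ) :=
    ⟨contDiff_mollify hwd.1 n, HasCompactSupport.intro (isCompact_closedBall (0 : Space N) (R + 1))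
      fun x hx => mollify_eq_zero hR' n (by simpa using hx)⟩
  have hlim : Tendsto (fun n => ∫ x, fderiv ℝ (mollify n θ) x (w x)) atTop
      (𝓝 (∫ x, fderiv ℝ θ x (w x))) := by
    refine tendsto_integral_of_bdd_support (R := R + 1) (k := fun x => C * ‖w x‖)
      (fun n => aestronglyMeasurable_clm_apply (hb n).continuous_fderiv.aestronglyMeasurable
        hw.1.aestronglyMeasurable)
      ((locallyIntegrable_norm hw.1).smul C) (fun n => ae_of_all _ fun x hx => ?_)
      (fun n => ae_of_all _ fun x _ => ?_) (ae_of_all _ fun x => ?_)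
    · rw [hwd.fderiv_mollify, mollify_eq_zero (R := R) _ n hx]
      intro y hy
      simp [fderiv_eq_zero_of_radius hR' hy]
    · rw [hwd.fderiv_mollify]
      refine norm_mollify_le (by positivity) (ae_of_all _ fun y _ => ?_) n
      exact ((fderiv ℝ θ y).le_opNorm _).trans (mul_le_mul_of_nonneg_right (hC y) (norm_nonneg _))
    · simp only [hwd.fderiv_mollify]
      exact tendsto_mollify_of_continuous
        ((hθ.continuous_fderiv (by simp)).clm_apply continuous_const) x
  refine tendsto_nhds_unique hlim ?_
  simp only [fun n => hw.2 _ (hb n)]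
  exact tendsto_const_nhds

/-- Integration by parts for a Lipschitz function along a divergence free field. -/
lemma WeakDivFree.integral_mul_fderiv {w : Space N → Space N} (hw : WeakDivFree w)
    {g : Space N → ℝ} {G : Space N → Space N →L[ℝ] ℝ} (h : HasWeakFDeriv g G) {L : ℝ} (hL : 0 ≤ L)
    (hG : ∀ᵐ x, ‖G x‖ ≤ L) {ψ : Space N → ℝ} (hψ : IsBump ψ) :
    ∫ x, g x * fderiv ℝ ψ x (w x) = - ∫ x, ψ x * G x (w x) := by
  obtain ⟨S, hS, hlip⟩ := h.exists_lipschitz hL hG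
  obtain ⟨x₀, hx₀⟩ : S.Nonempty := by
    by_contra hne
    rw [not_nonempty_iff_eq_empty] at hne
    have h0 : (volume : Measure (Space N)) = 0 := by simpa [hne] using hS
    exact NeZero.ne _ h0
  obtain ⟨R, hR, hR'⟩ := exists_radius hψ.2
  obtain ⟨C, hC0, hC⟩ := hψ.exists_bound_fderiv
  obtain ⟨C', hC0', hC'⟩ := hψ.exists_bound
  -- Mollification at a point of the ball of radius R sees g only on the ball of radius R + 1, where
  -- the Lipschitz bound from x₀ applies.
  set M := ‖g x₀‖ + L * (R + 1 + ‖x₀‖) with hM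
  have hM0 : 0 ≤ M := by positivity
  have hgM (n : ℕ) (x : Space N) (hx : ‖x‖ ≤ R) : ‖mollify n g x‖ ≤ M := by
    refine norm_mollify_le hM0 ?_ n
    filter_upwards [hS] with y hy hxy
    have h1 := hlip y hy x₀ hx₀
    have h2 : ‖y‖ ≤ R + 1 := by
      have := norm_sub_norm_le y x
      rw [norm_sub_rev] at this; linarith
    have h3 := norm_sub_le y x₀
    have h4 := norm_sub_norm_le (g y) (g x₀)
    have h5 : L * ‖y - x₀‖ ≤ L * (R + 1 + ‖x₀‖) := by gcongr; linarith
    linarith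
  have hsm (n : ℕ) := contDiff_mollify h.1 n
  have hlim : Tendsto (fun n => ∫ x, mollify n g x * fderiv ℝ ψ x (w x)) atTop
      (𝓝 (∫ x, g x * fderiv ℝ ψ x (w x))) := by
    refine tendsto_integral_of_bdd_support (R := R) (k := fun x => M * C * ‖w x‖)
      (fun n => (hsm n).continuous.aestronglyMeasurable.mul
        (aestronglyMeasurable_clm_apply hψ.continuous_fderiv.aestronglyMeasurable hw.1.aestronglyMeasurable))
      ((locallyIntegrable_norm hw.1).smul (M * C)) (fun n => ae_of_all _ fun x hx => ?_)
      (fun n => ae_of_all _ fun x hx => ?_) ?_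
    · simp [fderiv_eq_zero_of_radius hR' hx]
    · rw [norm_mul, mul_assoc]
      exact mul_le_mul (hgM n x hx) (((fderiv ℝ ψ x).le_opNorm _).trans (by gcongr; exact hC x))
        (norm_nonneg _) hM0
    · filter_upwards [ae_tendsto_mollify h.1] with x hx using hx.mul_const _
  have hGi : ∀ᵐ x, ∀ i : Fin N, Tendsto (fun n => mollify n (fun y => G y (basisVec i)) x) atTop
      (𝓝 (G x (basisVec i))) :=
    ae_all_iff.2 fun i => ae_tendsto_mollify (LocallyIntegrable.clm_apply_const h.2.1 _)
  have hlim' : Tendsto (fun n => ∫ x, ψ x * fderiv ℝ (mollify n g) x (w x)) atTop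
      (𝓝 (∫ x, ψ x * G x (w x))) := by
    refine tendsto_integral_of_bdd_support (R := R) (k := fun x => C' * L * ‖w x‖)
      (fun n => hψ.continuous.aestronglyMeasurable.mul
        (aestronglyMeasurable_clm_apply
          ((hsm n).continuous_fderiv (by simp)).aestronglyMeasurable hw.1.aestronglyMeasurable))
      ((locallyIntegrable_norm hw.1).smul (C' * L)) (fun n => ae_of_all _ fun x hx => ?_)
      (fun n => ae_of_all _ fun x hx => ?_) ?_
    · simp [hR' x hx]
    · rw [norm_mul, mul_assoc]
      refine mul_le_mul (hC' x) ?_ (norm_nonneg _) hC0'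
      rw [h.fderiv_mollify]
      refine norm_mollify_le (by positivity) ?_ n
      filter_upwards [hG] with y hy _
      exact ((G y).le_opNorm _).trans (by gcongr)
    · filter_upwards [hGi] with x hx
      refine Tendsto.const_mul _ ?_
      have e (ℓ : Space N →L[ℝ] ℝ) : ℓ (w x) = ∑ i, w x i * ℓ (basisVec i) := by
        conv_lhs => rw [← sum_smul_basisVec (w x)]
        simp
      simp only [e, h.fderiv_mollify]
      exact tendsto_finsetSum _ fun i _ => (hx i).const_mul _
  have hz (n : ℕ) : (∫ x, mollify n g x * fderiv ℝ ψ x (w x)) =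
      - ∫ x, ψ x * fderiv ℝ (mollify n g) x (w x) := by
    have h1 := hw.2 _ (hψ.mul (hsm n))
    have e (x : Space N) : fderiv ℝ (fun x => ψ x * mollify n g x) x (w x) =
        ψ x * fderiv ℝ (mollify n g) x (w x) + mollify n g x * fderiv ℝ ψ x (w x) := by
      rw [fderiv_fun_mul (hψ.differentiable x) ((hsm n).differentiable (by simp) x)]
      simp
    simp only [e] at h1
    rw [integral_add] at h1
    · linarith
    · exact integrable_bilin_of_locallyIntegrable (F := ℝ) hw.1
        (k := fun x => ψ x • fderiv ℝ (mollify n g) x)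
        (hψ.continuous.smul ((hsm n).continuous_fderiv (by simp))) (hψ.2.mono fun x hx h0 => hx (by simp [h0]))
    · exact integrable_bilin_of_locallyIntegrable (F := ℝ) hw.1
        (k := fun x => mollify n g x • fderiv ℝ ψ x)
        ((hsm n).continuous.smul hψ.continuous_fderiv) ((hψ.2.fderiv ℝ).mono fun x hx h0 => hx (by simp [h0]))
  simp only [hz] at hlim
  exact tendsto_nhds_unique hlim hlim'.neg

end WeakFDeriv

end DensityEuler
end

noncomputable section
namespace DensityEuler
set_option linter.unusedSectionVars false

variable {N : ℕ}

/-! ### Time slices -/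

section Slices

variable {F E : Type*} [NormedAddCommGroup F] [NormedSpace ℝ F] [NormedAddCommGroup E]
  [NormedSpace ℝ E] {T : ℝ}

/-- Local integrability on the slab. -/
abbrev LocInt (T : ℝ) (f : ℝ → Space N → F) : Prop :=
  LocallyIntegrableOn (Function.uncurry f) (slab N T)

/-- Integrability on `[s,t] × ℝ^N` for `[s,t]` in `(0,T)`. -/
def SlabInt (T : ℝ) (K : ℝ → Space N → F) : Prop :=
  ∀ s t, 0 < s → t < T → IntegrableOn (Function.uncurry K) (Icc s t ×ˢ univ)

lemma volume_restrict_prod_univ (I : Set ℝ) :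
    (volume : Measure (ℝ × Space N)).restrict (I ×ˢ univ) = (volume.restrict I).prod volume := by
  rw [Measure.volume_eq_prod, ← Measure.prod_restrict, Measure.restrict_univ]

lemma LocInt.aestronglyMeasurable {f : ℝ → Space N → F} (hf : LocInt T f) :
    AEStronglyMeasurable (Function.uncurry f)
      ((volume.restrict (Ioo 0 T)).prod (volume : Measure (Space N))) := by
  rw [← volume_restrict_prod_univ]
  exact LocallyIntegrableOn.aestronglyMeasurable hf

lemma LocInt.integrableOn {f : ℝ → Space N → F} (hf : LocInt T f) {s t : ℝ} (hs : 0 < s)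
    (ht : t < T) (R : ℝ) :
    IntegrableOn (Function.uncurry f) (Icc s t ×ˢ Metric.closedBall (0 : Space N) R) :=
  LocallyIntegrableOn.integrableOn_compact_subset hf
    (prod_mono (Icc_subset_Ioo hs ht) (subset_univ _)) (isCompact_Icc.prod (isCompact_closedBall _ _))

lemma ae_restrict_Ioo_of_forall_Icc {p : ℝ → Prop}
    (h : ∀ s t, 0 < s → t < T → ∀ᵐ r ∂volume.restrict (Icc s t), p r) :
    ∀ᵐ r ∂volume.restrict (Ioo 0 T), p r := by
  have e : Ioo 0 T ⊆ ⋃ n : ℕ, Icc (1 / ((n : ℝ) + 1)) (T - 1 / ((n : ℝ) + 1)) := by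
    intro t ht
    obtain ⟨n, hn⟩ := exists_nat_one_div_lt (show 0 < min t (T - t) from lt_min ht.1 (by linarith [ht.2]))
    rw [mem_iUnion]
    exact ⟨n, (hn.trans_le (min_le_left _ _)).le, by linarith [hn.trans_le (min_le_right _ _)]⟩
  refine ae_restrict_of_ae_restrict_of_subset e ((ae_restrict_iUnion_iff _ _).2 fun n => ?_)
  have : (0 : ℝ) < 1 / ((n : ℝ) + 1) := by positivity
  exact h _ _ this (by linarith)

lemma LocInt.ae_locallyIntegrable {f : ℝ → Space N → F} (hf : LocInt T f) :
    ∀ᵐ t ∂volume.restrict (Ioo 0 T), LocallyIntegrable (f t) := by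
  refine ae_restrict_Ioo_of_forall_Icc fun s t hs ht => ?_
  have h : ∀ n : ℕ, ∀ᵐ r ∂volume.restrict (Icc s t),
      IntegrableOn (f r) (Metric.closedBall (0 : Space N) n) := fun n => by
    have := hf.integrableOn hs ht n
    rw [IntegrableOn, Measure.volume_eq_prod, ← Measure.prod_restrict] at this
    exact this.prod_right_ae
  filter_upwards [ae_all_iff.2 h] with r hr x
  obtain ⟨n, hn⟩ := exists_nat_gt ‖x‖
  exact ⟨Metric.closedBall 0 n, Metric.closedBall_mem_nhds_of_mem (by simpa using hn), hr n⟩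

lemma LocInt.slabInt {f : ℝ → Space N → E} (hf : LocInt T f) {k : Space N → E →L[ℝ] F}
    (hk : Continuous k) (hkc : HasCompactSupport k) : SlabInt T fun t x => k x (f t x) := by
  intro s t hs ht
  obtain ⟨R, -, hR⟩ := exists_radius hkc
  obtain ⟨C, hC⟩ := hkc.exists_bound_of_continuous hk
  have h1 : IntegrableOn (fun z : ℝ × Space N => k z.2 (f z.1 z.2))
      (Icc s t ×ˢ Metric.closedBall (0 : Space N) R) := by
    have := hf.integrableOn hs ht R
    refine (this.norm.const_mul C).mono' (aestronglyMeasurable_clm_apply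
      (hk.comp continuous_snd).aestronglyMeasurable this.1) (ae_of_all _ fun z => ?_)
    exact ((k z.2).le_opNorm _).trans (mul_le_mul_of_nonneg_right (hC _) (norm_nonneg _))
  refine h1.of_forall_sdiff_eq_zero (measurableSet_Icc.prod MeasurableSet.univ) fun z hz => ?_
  have : R < ‖z.2‖ := by
    by_contra h
    exact hz.2 ⟨hz.1.1, by simpa using not_lt.1 h⟩
  simp [hR _ this]

lemma SlabInt.ae_integrable {K : ℝ → Space N → F} (hK : SlabInt T K) :
    ∀ᵐ t ∂volume.restrict (Ioo 0 T), Integrable (K t) := by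
  refine ae_restrict_Ioo_of_forall_Icc fun s t hs ht => ?_
  have := hK s t hs ht
  rw [IntegrableOn, volume_restrict_prod_univ] at this
  exact this.prod_right_ae

lemma SlabInt.timeInt {K : ℝ → Space N → F} (hK : SlabInt T K) : TimeInt T fun t => ∫ x, K t x := by
  intro s t hs ht
  have := hK s t hs ht
  rw [IntegrableOn, volume_restrict_prod_univ] at this
  exact this.integral_prod_left

lemma SlabInt.integrable_test {K : ℝ → Space N → F} (hT : 0 < T) (hK : SlabInt T K) {φ : ℝ → ℝ}
    (hφ : IsTimeTest T φ) : Integrable fun z : ℝ × Space N => φ z.1 • K z.1 z.2 := by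
  obtain ⟨a, b, ha, -, hb, hab⟩ := hφ.exists_Icc hT
  obtain ⟨C, hC⟩ := hφ.compact.exists_bound_of_continuous hφ.contDiff.continuous
  rw [← integrableOn_iff_integrable_of_support_subset (s := Icc a b ×ˢ univ)]
  · exact (hK a b ha hb).bdd_smul C
      (hφ.contDiff.continuous.comp continuous_fst).aestronglyMeasurable (ae_of_all _ fun z => hC z.1)
  · intro z hz
    by_contra h
    refine hz ?_
    have : φ z.1 = 0 := image_eq_zero_of_notMem_tsupport fun h' =>
      h ⟨Ioo_subset_Icc_self (hab h'), mem_univ _⟩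
    simp [this]

lemma SlabInt.integral_test {K : ℝ → Space N → F} (hT : 0 < T) (hK : SlabInt T K) {φ : ℝ → ℝ}
    (hφ : IsTimeTest T φ) :
    ∫ z : ℝ × Space N, φ z.1 • K z.1 z.2 = ∫ t, φ t • ∫ x, K t x := by
  rw [Measure.volume_eq_prod, integral_prod _ (hK.integrable_test hT hφ)]
  simp only [integral_smul]

/-- Products of test functions in time and in space. -/
lemma isTestFunction_mul {φ : ℝ → ℝ} (hφ : IsTimeTest T φ) {ψ : Space N → ℝ} (hψ : IsBump ψ) :
    IsTestFunction T fun z : ℝ × Space N => φ z.1 * ψ z.2 := by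
  have hsub : tsupport (fun z : ℝ × Space N => φ z.1 * ψ z.2) ⊆ tsupport φ ×ˢ tsupport ψ := by
    refine closure_minimal (fun z hz => ⟨subset_tsupport _ fun h => hz ?_,
      subset_tsupport _ fun h => hz ?_⟩) ((isClosed_tsupport _).prod (isClosed_tsupport _)) <;> simp [h]
  exact ⟨(hφ.contDiff.comp contDiff_fst).mul (hψ.1.comp contDiff_snd),
    (hφ.compact.isCompact.prod hψ.2.isCompact).of_isClosed_subset (isClosed_tsupport _) hsub,
    hsub.trans (prod_mono hφ.subset (subset_univ _))⟩

lemma fderiv_mul_apply {φ : ℝ → ℝ} (hφ : IsTimeTest T φ) {ψ : Space N → ℝ} (hψ : IsBump ψ)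
    (z : ℝ × Space N) (a : ℝ) (v : Space N) :
    fderiv ℝ (fun z : ℝ × Space N => φ z.1 * ψ z.2) z (a, v) =
      deriv φ z.1 * (a * ψ z.2) + φ z.1 * fderiv ℝ ψ z.2 v := by
  have h1 := (((hφ.contDiff.differentiable (by simp)) z.1).hasDerivAt.hasFDerivAt.comp z
    (hasFDerivAt_fst (𝕜 := ℝ)))
  have h2 := (hψ.differentiable z.2).hasFDerivAt.comp z (hasFDerivAt_snd (𝕜 := ℝ))
  have h3 : fderiv ℝ (fun z : ℝ × Space N => φ z.1 * ψ z.2) z = _ := (h1.mul h2).fderiv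
  rw [h3]
  simp
  ring

/-! ### Simultaneous slicing for all test functions -/

/-- The `1`-jet of a test function. -/
def jet (ψ : Space N → ℝ) (x : Space N) : ℝ × (Space N →L[ℝ] ℝ) := (ψ x, fderiv ℝ ψ x)

lemma IsBump.continuous_jet {ψ : Space N → ℝ} (hψ : IsBump ψ) : Continuous (jet ψ) :=
  hψ.continuous.prodMk hψ.continuous_fderiv

lemma jet_eq_zero {ψ : Space N → ℝ} {R : ℝ} (h : ∀ x, R < ‖x‖ → ψ x = 0) {x : Space N}
    (hx : R < ‖x‖) : jet ψ x = 0 := by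
  rw [jet, h x hx, fderiv_eq_zero_of_radius h hx]; rfl

lemma IsBump.hasCompactSupport_jet {ψ : Space N → ℝ} (hψ : IsBump ψ) : HasCompactSupport (jet ψ) := by
  obtain ⟨R, -, hR⟩ := exists_radius hψ.2
  exact HasCompactSupport.intro (isCompact_closedBall (0 : Space N) R) fun x hx =>
    jet_eq_zero hR (by simpa using hx)

/-- The exceptional null set of times must not depend on the test function. For each m, the 1-jets
of bumps supported in the ball of radius m form a subset of the space of continuous maps with the
compact-open topology, where subsets are separable. Convergence there is uniform on the ball, which
yields the common bound on the jets. -/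
lemma exists_countable_dense_bumps (N : ℕ) : ∃ 𝒞 : Set (Space N → ℝ), 𝒞.Countable ∧
    (∀ ψ ∈ 𝒞, IsBump ψ) ∧ ∀ ψ : Space N → ℝ, IsBump ψ → ∃ (R M : ℝ) (u : ℕ → Space N → ℝ),
      (∀ k, u k ∈ 𝒞 ∧ (∀ x, R < ‖x‖ → u k x = 0) ∧ ∀ x, ‖jet (u k) x‖ ≤ M) ∧
      ∀ x, Tendsto (fun k => jet (u k) x) atTop (𝓝 (jet ψ x)) := by
  let I : ℕ → Set C(Space N, ℝ × (Space N →L[ℝ] ℝ)) := fun m =>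
    {h | ∃ ψ : Space N → ℝ, IsBump ψ ∧ (∀ x, (m : ℝ) < ‖x‖ → ψ x = 0) ∧ ⇑h = jet ψ}
  have hD (m : ℕ) : ∃ s : Set (I m), s.Countable ∧ Dense s := TopologicalSpace.exists_countable_dense _
  choose D hDc hDd using hD
  let pick (m : ℕ) (h : I m) : Space N → ℝ := h.2.choose
  have hpick (m : ℕ) (h : I m) : IsBump (pick m h) ∧ (∀ x, (m : ℝ) < ‖x‖ → pick m h x = 0) ∧
      ⇑h.1 = jet (pick m h) := h.2.choose_spec
  refine ⟨⋃ m, pick m '' D m, countable_iUnion fun m => (hDc m).image _, ?_, fun ψ hψ => ?_⟩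
  · intro ψ hψ
    obtain ⟨m, h, -, rfl⟩ := mem_iUnion.1 hψ
    exact (hpick m h).1
  · obtain ⟨R, hR, hR'⟩ := exists_radius hψ.2
    obtain ⟨m, hm⟩ := exists_nat_gt R
    let h₀ : I m := ⟨⟨jet ψ, hψ.continuous_jet⟩, ψ, hψ, fun x hx => hR' x (hm.trans hx), rfl⟩
    obtain ⟨h, hhD, hh⟩ := mem_closure_iff_seq_limit.1 (hDd m h₀)
    have hlim : Tendsto (fun k => (h k).1) atTop (𝓝 h₀.1) := (continuous_subtype_val.tendsto h₀).comp hh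
    have hpt (x : Space N) : Tendsto (fun k => jet (pick m (h k)) x) atTop (𝓝 (jet ψ x)) := by
      have := ((ContinuousEvalConst.continuous_eval_const x).tendsto h₀.1).comp hlim
      exact this.congr fun k => congrFun (hpick m (h k)).2.2 x
    have hunif := (ContinuousMap.tendsto_iff_forall_isCompact_tendstoUniformlyOn.1 hlim)
      _ (isCompact_closedBall (0 : Space N) m)
    rw [Metric.tendstoUniformlyOn_iff] at hunif
    obtain ⟨k₀, hk₀⟩ := eventually_atTop.1 (hunif 1 one_pos)
    obtain ⟨C, hC⟩ := hψ.hasCompactSupport_jet.exists_bound_of_continuous hψ.continuous_jet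
    refine ⟨m, C + 1, fun k => pick m (h (k + k₀)), fun k => ⟨mem_iUnion.2 ⟨m, mem_image_of_mem _
      (hhD _)⟩, (hpick m _).2.1, fun x => ?_⟩, fun x => (hpt x).comp (tendsto_add_atTop_nat k₀)⟩
    rcases lt_or_ge (m : ℝ) ‖x‖ with hx | hx
    · rw [jet_eq_zero (hpick m _).2.1 hx, norm_zero]
      linarith [(norm_nonneg _).trans (hC 0)]
    · have h1 := hk₀ (k + k₀) (by omega) x (by simpa using hx)
      rw [congrFun (hpick m (h (k + k₀))).2.2 x, dist_eq_norm] at h1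
      have h2 := norm_sub_norm_le (jet (pick m (h (k + k₀))) x) (jet ψ x)
      rw [norm_sub_rev] at h2
      have h3 := hC x
      change ‖jet ψ x - jet (pick m (h (k + k₀))) x‖ < 1 at h1
      linarith

/-- If a first order linear identity holds for all products of test functions, it holds at almost
every time for all test functions in space. -/
theorem ae_forall_bump_integral_eq_zero [FiniteDimensional ℝ F] {f : ℝ → Space N → E} (hf : LocInt T f) {A : ℝ × (Space N →L[ℝ] ℝ) → E →L[ℝ] F}
    (hA : Continuous A) (hA0 : A 0 = 0)
    (h : ∀ φ, IsTimeTest T φ → ∀ ψ, IsBump ψ → ∫ t, φ t • ∫ x, A (jet ψ x) (f t x) = 0) :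
    ∀ᵐ t ∂volume.restrict (Ioo 0 T), ∀ ψ, IsBump ψ → ∫ x, A (jet ψ x) (f t x) = 0 := by
  have : CompleteSpace F := FiniteDimensional.complete ℝ F
  obtain ⟨𝒞, hcount, hbump, hdense⟩ := exists_countable_dense_bumps N
  have hone (ψ : Space N → ℝ) (hψ : IsBump ψ) :
      ∀ᵐ t ∂volume.restrict (Ioo 0 T), ∫ x, A (jet ψ x) (f t x) = 0 := by
    have hti := (hf.slabInt (hA.comp hψ.continuous_jet)
      (hψ.hasCompactSupport_jet.comp_left hA0)).timeInt
    have := isOpen_Ioo.ae_eq_zero_of_integral_contDiff_smul_eq_zero (U := Ioo 0 T)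
      hti.locallyIntegrableOn fun φ h1 h2 h3 => h φ ⟨h1, h2, h3⟩ ψ hψ
    rwa [ae_restrict_iff' measurableSet_Ioo]
  have hall : ∀ᵐ t ∂volume.restrict (Ioo 0 T), ∀ ψ ∈ 𝒞, ∫ x, A (jet ψ x) (f t x) = 0 :=
    (ae_ball_iff hcount).2 fun ψ hψ => hone ψ (hbump ψ hψ)
  filter_upwards [hall, hf.ae_locallyIntegrable] with t ht hft ψ hψ
  obtain ⟨R, M, u, hu, hlim⟩ := hdense ψ hψ
  obtain ⟨C, hC⟩ := (isCompact_closedBall (0 : ℝ × (Space N →L[ℝ] ℝ)) M).exists_bound_of_continuousOn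
    hA.continuousOn
  have key : Tendsto (fun k => ∫ x, A (jet (u k) x) (f t x)) atTop (𝓝 (∫ x, A (jet ψ x) (f t x))) := by
    refine tendsto_integral_of_bdd_support (R := R) (k := fun x => C * ‖f t x‖)
      (fun k => aestronglyMeasurable_clm_apply
        (hA.comp (hbump _ (hu k).1).continuous_jet).aestronglyMeasurable hft.aestronglyMeasurable)
      ((locallyIntegrable_norm hft).smul C) (fun k => ae_of_all _ fun x hx => ?_)
      (fun k => ae_of_all _ fun x _ => ?_) (ae_of_all _ fun x => ?_)
    · rw [jet_eq_zero (hu k).2.1 hx, hA0]; simp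
    · exact ((A _).le_opNorm _).trans (mul_le_mul_of_nonneg_right
        (hC _ (by simpa using (hu k).2.2 x)) (norm_nonneg _))
    · exact ((hA.clm_apply continuous_const).tendsto _).comp (hlim x)
  refine tendsto_nhds_unique key ?_
  simp only [fun k => ht _ (hu k).1]
  exact tendsto_const_nhds

end Slices

end DensityEuler
end

noncomputable section
namespace DensityEuler
set_option linter.unusedSectionVars false

variable {N : ℕ}

/-! ### The equations and weak derivatives at almost every time -/

section SliceApplications

variable {F E : Type*} [NormedAddCommGroup F] [NormedSpace ℝ F] [NormedAddCommGroup E]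
  [NormedSpace ℝ E] {T : ℝ}

lemma LocInt.prodMk {f : ℝ → Space N → F} {g : ℝ → Space N → E} (hf : LocInt T f) (hg : LocInt T g) :
    LocInt T fun t x => (f t x, g t x) := fun z hz => by
  obtain ⟨u, hu, hfu⟩ := hf z hz
  obtain ⟨w, hw, hgw⟩ := hg z hz
  exact ⟨u ∩ w, inter_mem hu hw, (hfu.mono_set inter_subset_left).prodMk
    (hgw.mono_set inter_subset_right)⟩

lemma locallyIntegrable_prodMk {f : Space N → F} {g : Space N → E} (hf : LocallyIntegrable f)
    (hg : LocallyIntegrable g) : LocallyIntegrable fun x => (f x, g x) := fun x => by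
  obtain ⟨u, hu, hfu⟩ := hf x
  obtain ⟨w, hw, hgw⟩ := hg x
  exact ⟨u ∩ w, inter_mem hu hw, (hfu.mono_set inter_subset_left).prodMk
    (hgw.mono_set inter_subset_right)⟩

lemma proj_apply (i : Fin N) (v : Space N) :
    (EuclideanSpace.proj i : Space N →L[ℝ] ℝ) v = v i := rfl

lemma LocInt.slabInt_smul {f : ℝ → Space N → F} (hf : LocInt T f) {k : Space N → ℝ}
    (hk : Continuous k) (hkc : HasCompactSupport k) : SlabInt T fun t x => k x • f t x :=
  hf.slabInt (k := fun x => k x • ContinuousLinearMap.id ℝ F) (hk.smul continuous_const)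
    (hkc.mono fun x hx h0 => hx (by simp [h0]))

lemma HasWeakSpaceDeriv.locInt {g : ℝ → Space N → F} {G : ℝ → Space N → Space N →L[ℝ] F}
    (h : HasWeakSpaceDeriv T g G) : LocInt T g := (h.2 0).1

/-- The pairing of a `1`-jet with a function and its derivative that vanishes in the mean. -/
def jetPairing (F : Type*) [NormedAddCommGroup F] [NormedSpace ℝ F] (z : ℝ × (Space N →L[ℝ] ℝ)) :
    (F × (Space N →L[ℝ] F)) →L[ℝ] (Space N →L[ℝ] F) :=
  (ContinuousLinearMap.smulRightL ℝ (Space N) F z.2).comp (ContinuousLinearMap.fst ℝ _ _) +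
    z.1 • ContinuousLinearMap.snd ℝ _ _

lemma continuous_jetPairing : Continuous (jetPairing (N := N) F) := by
  refine Continuous.add ?_ (continuous_fst.smul continuous_const)
  exact ((ContinuousLinearMap.smulRightL ℝ (Space N) F).continuous.comp continuous_snd).clm_comp
    continuous_const

lemma jetPairing_apply (z : ℝ × (Space N →L[ℝ] ℝ)) (y : F) (Y : Space N →L[ℝ] F) (v : Space N) :
    jetPairing F z (y, Y) v = z.2 v • y + z.1 • Y v := by
  simp [jetPairing]

lemma jetPairing_zero : jetPairing (N := N) F 0 = 0 :=
  ContinuousLinearMap.ext fun y => ContinuousLinearMap.ext fun v => by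
    obtain ⟨y, Y⟩ := y
    rw [jetPairing_apply]; simp

/-- The pairing takes values in linear maps, so its vanishing encodes every direction v at once and
no further null sets arise from varying v. -/
lemma hasWeakFDeriv_of_jetPairing [FiniteDimensional ℝ F] {g : Space N → F}
    {G : Space N → Space N →L[ℝ] F} (h1 : LocallyIntegrable g) (h2 : LocallyIntegrable G)
    (h : ∀ ψ, IsBump ψ → ∫ x, jetPairing F (jet ψ x) (g x, G x) = 0) : HasWeakFDeriv g G := by
  refine ⟨h1, h2, fun ψ hψ v => ?_⟩
  have hi : Integrable fun x => jetPairing F (jet ψ x) (g x, G x) :=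
    integrable_bilin_of_locallyIntegrable (F := Space N →L[ℝ] F) (E := F × (Space N →L[ℝ] F))
      (f := fun x => (g x, G x)) (k := fun x => jetPairing F (jet ψ x))
      (locallyIntegrable_prodMk h1 h2) (continuous_jetPairing.comp hψ.continuous_jet)
      (hψ.hasCompactSupport_jet.comp_left jetPairing_zero)
  have h4 : (∫ x, jetPairing F (jet ψ x) (g x, G x)) v = (0 : Space N →L[ℝ] F) v := by
    rw [h ψ hψ]
  rw [ContinuousLinearMap.integral_apply hi] at h4
  simp only [jetPairing_apply, zero_apply, jet] at h4
  rw [integral_add (integrable_fderiv_smul hψ.contDiff_one hψ.2 h1 v)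
    (integrable_smul_of_locallyIntegrable (LocallyIntegrable.clm_apply_const h2 v)
      hψ.continuous hψ.2)] at h4
  exact eq_neg_of_add_eq_zero_left h4

lemma HasWeakSpaceDeriv.slabInt_jetPairing {g : ℝ → Space N → F}
    {G : ℝ → Space N → Space N →L[ℝ] F} (h : HasWeakSpaceDeriv T g G) {ψ : Space N → ℝ}
    (hψ : IsBump ψ) : SlabInt T fun t x => jetPairing F (jet ψ x) (g t x, G t x) :=
  (h.locInt.prodMk h.1).slabInt (continuous_jetPairing.comp hψ.continuous_jet)
    (hψ.hasCompactSupport_jet.comp_left jetPairing_zero)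

lemma HasWeakSpaceDeriv.integral_jetPairing [FiniteDimensional ℝ F] (hT : 0 < T) {g : ℝ → Space N → F}
    {G : ℝ → Space N → Space N →L[ℝ] F} (h : HasWeakSpaceDeriv T g G) {φ : ℝ → ℝ}
    (hφ : IsTimeTest T φ) {ψ : Space N → ℝ} (hψ : IsBump ψ) :
    ∫ t, φ t • ∫ x, jetPairing F (jet ψ x) (g t x, G t x) = 0 := by
  rw [← (h.slabInt_jetPairing hψ).integral_test hT hφ]
  refine ContinuousLinearMap.ext fun v => ?_
  rw [ContinuousLinearMap.integral_apply ((h.slabInt_jetPairing hψ).integrable_test hT hφ)]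
  simp only [smul_apply, zero_apply, jetPairing_apply, jet]
  have h1 := (h.2 v).2.2 _ (isTestFunction_mul hφ hψ)
  simp only [fderiv_mul_apply hφ hψ, zero_mul, mul_zero, zero_add] at h1
  have i1 := (h.locInt.slabInt_smul (hψ.fderiv_apply v).continuous
    (hψ.fderiv_apply v).2).integrable_test hT hφ
  have i2 := (LocInt.slabInt_smul (h.2 v).2.1 hψ.continuous hψ.2).integrable_test hT hφ
  simp only [smul_add]
  rw [integral_add i1 i2]
  simp only [mul_smul] at h1
  rw [h1]; simp

/-- Weak space derivatives restrict to almost every time. -/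
lemma HasWeakSpaceDeriv.ae_hasWeakFDeriv [FiniteDimensional ℝ F] (hT : 0 < T) {g : ℝ → Space N → F}
    {G : ℝ → Space N → Space N →L[ℝ] F} (h : HasWeakSpaceDeriv T g G) :
    ∀ᵐ t ∂volume.restrict (Ioo 0 T), HasWeakFDeriv (g t) (G t) := by
  have key := ae_forall_bump_integral_eq_zero (h.locInt.prodMk h.1) continuous_jetPairing
    jetPairing_zero fun φ hφ ψ hψ => h.integral_jetPairing hT hφ hψ
  filter_upwards [key, h.locInt.ae_locallyIntegrable, LocInt.ae_locallyIntegrable h.1] with t ht h1 h2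
    using hasWeakFDeriv_of_jetPairing h1 h2 ht

lemma HasWeakTimeDeriv.hasWeakDeriv (hT : 0 < T) {g h : ℝ → Space N → F}
    (H : HasWeakTimeDeriv T g h) {ψ : Space N → ℝ} (hψ : IsBump ψ) :
    HasWeakDeriv T (fun t => ∫ x, ψ x • g t x) (fun t => ∫ x, ψ x • h t x) := by
  have i1 := LocInt.slabInt_smul H.1 hψ.continuous hψ.2
  have i2 := LocInt.slabInt_smul H.2.1 hψ.continuous hψ.2
  refine ⟨i1.timeInt, i2.timeInt, fun φ hφ => ?_⟩
  rw [← i1.integral_test hT hφ.deriv_test, ← i2.integral_test hT hφ]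
  have h1 := H.2.2 _ (isTestFunction_mul hφ hψ)
  simp only [fderiv_mul_apply hφ hψ, one_mul, map_zero, mul_zero, add_zero, mul_smul] at h1
  exact h1

/-- The equation `∂ₜ b + U · ∇ b = h`, tested with functions of the space variable. -/
def TransportEq (T : ℝ) (U : ℝ → Space N → Space N) (b h : ℝ → Space N → F) : Prop :=
  ∀ ψ, IsBump ψ → HasWeakDeriv T (fun t => ∫ x, ψ x • b t x)
    (fun t => ∫ x, (fderiv ℝ ψ x (U t x) • b t x + ψ x • h t x))

lemma IsEulerSolution.transportEq (hT : 0 < T) {ρ : ℝ → Space N → ℝ} {u P f : ℝ → Space N → Space N}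
    {Du : ℝ → Space N → Space N →L[ℝ] Space N} (H : IsEulerSolution T ρ u P f Du) :
    TransportEq T u ρ 0 := by
  intro ψ hψ
  have i1 := LocInt.slabInt_smul (f := ρ) H.density hψ.continuous hψ.2
  have i2 := LocInt.slabInt (f := fun t x => ρ t x • u t x) H.flux hψ.continuous_fderiv
    (hψ.2.fderiv ℝ)
  simp only [map_smul] at i2
  have e (t : ℝ) (x : Space N) : fderiv ℝ ψ x (u t x) • ρ t x + ψ x • (0 : ℝ → Space N → ℝ) t x =
      ρ t x • fderiv ℝ ψ x (u t x) := by simp [mul_comm]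
  simp only [e]
  refine ⟨i1.timeInt, i2.timeInt, fun φ hφ => ?_⟩
  rw [← i1.integral_test hT hφ.deriv_test, ← i2.integral_test hT hφ, ← add_eq_zero_iff_eq_neg,
    ← integral_add (i1.integrable_test hT hφ.deriv_test) (i2.integrable_test hT hφ)]
  rw [← H.mass _ (isTestFunction_mul hφ hψ)]
  refine integral_congr_ae (ae_of_all _ fun z => ?_)
  simp only [fderiv_mul_apply hφ hψ, smul_eq_mul]
  ring

lemma ae_ae_of_ae_slab {p : ℝ × Space N → Prop} (h : ∀ᵐ z ∂volume.restrict (slab N T), p z) :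
    ∀ᵐ t ∂volume.restrict (Ioo 0 T), ∀ᵐ x : Space N, p (t, x) := by
  rw [slab, volume_restrict_prod_univ] at h
  exact Measure.ae_ae_of_ae_prod h

lemma HasWeakFDeriv.weakDivFree {u : Space N → Space N} {Du : Space N → Space N →L[ℝ] Space N}
    (h : HasWeakFDeriv u Du) (htr : ∀ᵐ x, ∑ i : Fin N, Du x (EuclideanSpace.single i (1 : ℝ)) i = 0) :
    WeakDivFree u := by
  refine ⟨h.1, fun ψ hψ => ?_⟩
  have h1 (i : Fin N) : ∫ x, pd i ψ x * u x i = - ∫ x, ψ x * Du x (basisVec i) i := by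
    have h2 := congrArg (fun w : Space N => w i) (h.2.2 ψ hψ (basisVec i))
    have j1 := integrable_fderiv_smul hψ.contDiff_one hψ.2 h.1 (basisVec i)
    have j2 := integrable_smul_of_locallyIntegrable (LocallyIntegrable.clm_apply_const h.2.1
      (basisVec i)) hψ.continuous hψ.2
    have e1 := (EuclideanSpace.proj (𝕜 := ℝ) i).integral_comp_comm j1
    have e2 := (EuclideanSpace.proj (𝕜 := ℝ) i).integral_comp_comm j2
    simp only [proj_apply, PiLp.smul_apply, smul_eq_mul] at e1 e2
    simp only [PiLp.neg_apply] at h2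
    rw [← e1, ← e2] at h2
    exact h2
  have hui (i : Fin N) : LocallyIntegrable fun x => u x i := fun x => by
    obtain ⟨s, hs, hsu⟩ := h.1 x
    exact ⟨s, hs, (EuclideanSpace.proj (𝕜 := ℝ) i).integrable_comp hsu⟩
  have hDi (i : Fin N) : LocallyIntegrable fun x => Du x (basisVec i) i := fun x => by
    obtain ⟨s, hs, hsu⟩ := LocallyIntegrable.clm_apply_const h.2.1 (basisVec i) x
    exact ⟨s, hs, (EuclideanSpace.proj (𝕜 := ℝ) i).integrable_comp hsu⟩
  calc ∫ x, fderiv ℝ ψ x (u x) = ∫ x, ∑ i, pd i ψ x * u x i := by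
        simp only [fderiv_apply_eq_sum, mul_comm]
    _ = ∑ i, ∫ x, pd i ψ x * u x i := integral_finsetSum _ fun i _ =>
        integrable_smul_of_locallyIntegrable (hui i) (hψ.pd i).continuous (hψ.pd i).2
    _ = - ∑ i, ∫ x, ψ x * Du x (basisVec i) i := by simp only [h1, Finset.sum_neg_distrib]
    _ = - ∫ x, ∑ i, ψ x * Du x (basisVec i) i := by
        have := integral_finsetSum Finset.univ fun i (_ : i ∈ Finset.univ) =>
          integrable_smul_of_locallyIntegrable (hDi i) hψ.continuous hψ.2
        simp only [smul_eq_mul] at this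
        rw [this]
    _ = 0 := by
        rw [neg_eq_zero]
        refine integral_eq_zero_of_ae ?_
        filter_upwards [htr] with x hx
        rw [← Finset.mul_sum]
        exact mul_eq_zero_of_right _ hx

lemma HasWeakDeriv.clm_comp [CompleteSpace F] [CompleteSpace E] (hT : 0 < T) {γ g : ℝ → F}
    (h : HasWeakDeriv T γ g) (ℓ : F →L[ℝ] E) : HasWeakDeriv T (fun t => ℓ (γ t)) (fun t => ℓ (g t)) := by
  refine ⟨fun s t hs ht => ℓ.integrable_comp (h.1 s t hs ht),
    fun s t hs ht => ℓ.integrable_comp (h.2.1 s t hs ht), fun φ hφ => ?_⟩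
  have h1 := congrArg ℓ (h.2.2 φ hφ)
  rw [map_neg, ← ℓ.integral_comp_comm (h.1.integrable_smul hT hφ.deriv_test),
    ← ℓ.integral_comp_comm (h.2.1.integrable_smul hT hφ)] at h1
  simpa only [map_smul] using h1

lemma HasWeakDeriv.finset_sum (hT : 0 < T) {ι : Type*} (s : Finset ι) {γ g : ι → ℝ → F}
    (h : ∀ i ∈ s, HasWeakDeriv T (γ i) (g i)) :
    HasWeakDeriv T (fun t => ∑ i ∈ s, γ i t) (fun t => ∑ i ∈ s, g i t) := by
  refine ⟨fun a b ha hb => integrable_finsetSum _ fun i hi => (h i hi).1 a b ha hb,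
    fun a b ha hb => integrable_finsetSum _ fun i hi => (h i hi).2.1 a b ha hb, fun φ hφ => ?_⟩
  simp only [Finset.smul_sum]
  rw [integral_finsetSum _ fun i hi => (h i hi).1.integrable_smul hT hφ.deriv_test,
    integral_finsetSum _ fun i hi => (h i hi).2.1.integrable_smul hT hφ, ← Finset.sum_neg_distrib]
  exact Finset.sum_congr rfl fun i hi => (h i hi).2.2 φ hφ

/-- The time derivative of a divergence free field is divergence free. -/
lemma HasWeakTimeDeriv.ae_weakDivFree (hT : 0 < T) {u ut : ℝ → Space N → Space N}
    (h : HasWeakTimeDeriv T u ut) (hdiv : ∀ᵐ t ∂volume.restrict (Ioo 0 T), WeakDivFree (u t)) :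
    ∀ᵐ t ∂volume.restrict (Ioo 0 T), WeakDivFree (ut t) := by
  have hsum {w : ℝ → Space N → Space N} (hw : LocInt T w) {ψ : Space N → ℝ} (hψ : IsBump ψ) :
      ∀ᵐ t ∂volume.restrict (Ioo 0 T),
        ∑ i, (EuclideanSpace.proj (𝕜 := ℝ) i : Space N →L[ℝ] ℝ) (∫ x, pd i ψ x • w t x) =
          ∫ x, fderiv ℝ ψ x (w t x) := by
    filter_upwards [hw.ae_locallyIntegrable] with t ht
    have j (i : Fin N) := integrable_smul_of_locallyIntegrable ht (hψ.pd i).continuous (hψ.pd i).2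
    simp only [← fun i => (EuclideanSpace.proj (𝕜 := ℝ) i : Space N →L[ℝ] ℝ).integral_comp_comm (j i)]
    rw [← integral_finsetSum _ fun i _ => (EuclideanSpace.proj (𝕜 := ℝ) i).integrable_comp (j i)]
    simp only [fderiv_apply_eq_sum, proj_apply, PiLp.smul_apply, smul_eq_mul, mul_comm]
  have hd {ψ : Space N → ℝ} (hψ : IsBump ψ) :
      HasWeakDeriv T (fun t => ∫ x, fderiv ℝ ψ x (u t x)) (fun t => ∫ x, fderiv ℝ ψ x (ut t x)) :=
    (HasWeakDeriv.finset_sum hT Finset.univ fun i _ => (h.hasWeakDeriv hT (hψ.pd i)).clm_comp hT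
      (EuclideanSpace.proj (𝕜 := ℝ) i)).congr (hsum h.1 hψ) (hsum h.2.1 hψ)
  have key := ae_forall_bump_integral_eq_zero (F := ℝ) (A := fun z => z.2) h.2.1 continuous_snd rfl
    fun φ hφ ψ hψ => by
      have h1 := (hd hψ).2.2 φ hφ
      rw [integral_test_congr hφ.deriv_test (γ' := fun _ => 0)
        (hdiv.mono fun t ht => ht.2 ψ hψ)] at h1
      simp only [smul_zero, integral_zero] at h1
      exact neg_eq_zero.1 h1.symm
  filter_upwards [key, LocInt.ae_locallyIntegrable h.2.1] with t ht h1 using ⟨h1, ht⟩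

/-- Gradients are curl free at almost every time. -/
lemma HasWeakGradient.ae_curl (hT : 0 < T) {g : ℝ → Space N → ℝ} {P : ℝ → Space N → Space N}
    (h : HasWeakGradient T g P) (hP : LocInt T P) :
    ∀ᵐ t ∂volume.restrict (Ioo 0 T), ∀ i j θ, IsBump θ →
      ∫ x, P t x i * pd j θ x = ∫ x, P t x j * pd i θ x := by
  have hproj (i : Fin N) : LocInt T fun t x => P t x i := fun z hz => by
    obtain ⟨s, hs, hsu⟩ := hP z hz
    exact ⟨s, hs, (EuclideanSpace.proj (𝕜 := ℝ) i).integrable_comp hsu⟩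
  have hinner (t : ℝ) (x : Space N) (i : Fin N) : innerSL ℝ (P t x) (basisVec i) = P t x i := by
    simp [basisVec, EuclideanSpace.inner_single_right]
  -- Two integrations by parts rewrite the pairing as minus the integral of g against ∂ᵢ∂ⱼθ, which
  -- is symmetric in i and j.
  have one (i j : Fin N) {φ : ℝ → ℝ} (hφ : IsTimeTest T φ) {θ : Space N → ℝ} (hθ : IsBump θ) :
      ∫ t, φ t • ∫ x, pd j θ x • P t x i =
        - ∫ z : ℝ × Space N, (φ z.1 * pd i (pd j θ) z.2) • g z.1 z.2 := by
    rw [← ((hproj i).slabInt_smul (hθ.pd j).continuous (hθ.pd j).2).integral_test hT hφ]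
    have h1 := (h.2 (basisVec i)).2.2 _ (isTestFunction_mul hφ (hθ.pd j))
    simp only [fderiv_mul_apply hφ (hθ.pd j), zero_mul, mul_zero, zero_add, hinner, mul_smul] at h1
    simp only [mul_smul, pd] at h1 ⊢
    rw [h1, neg_neg]
  have key (i j : Fin N) : ∀ᵐ t ∂volume.restrict (Ioo 0 T), ∀ θ, IsBump θ →
      ∫ x, P t x i * pd j θ x = ∫ x, P t x j * pd i θ x := by
    let A : ℝ × (Space N →L[ℝ] ℝ) → Space N →L[ℝ] ℝ := fun z =>
      z.2 (basisVec j) • EuclideanSpace.proj i - z.2 (basisVec i) • EuclideanSpace.proj j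
    have hA : Continuous A := by
      refine Continuous.sub ?_ ?_ <;>
      exact (continuous_snd.clm_apply continuous_const).smul continuous_const
    have e (θ : Space N → ℝ) (t : ℝ) (x : Space N) : A (jet θ x) (P t x) =
        pd j θ x • P t x i - pd i θ x • P t x j := by simp [A, jet, pd]
    have i1 {θ : Space N → ℝ} (hθ : IsBump θ) (i j : Fin N) :=
      (hproj i).slabInt_smul (hθ.pd j).continuous (hθ.pd j).2
    have h2 := ae_forall_bump_integral_eq_zero (A := A) hP hA (by simp [A]) fun φ hφ θ hθ => by
      have h3 : ∀ᵐ t ∂volume.restrict (Ioo 0 T), ∫ x, A (jet θ x) (P t x) =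
          (∫ x, pd j θ x • P t x i) - ∫ x, pd i θ x • P t x j := by
        filter_upwards [(i1 hθ i j).ae_integrable, (i1 hθ j i).ae_integrable] with t h4 h5
        simp only [e]
        rw [integral_sub h4 h5]
      rw [integral_test_congr hφ h3]
      simp only [smul_sub]
      rw [integral_sub ((i1 hθ i j).timeInt.integrable_smul hT hφ)
        ((i1 hθ j i).timeInt.integrable_smul hT hφ), one i j hφ hθ, one j i hφ hθ, pd_comm hθ i j,
        sub_self]
    filter_upwards [h2, (hproj i).ae_locallyIntegrable, (hproj j).ae_locallyIntegrable] with t ht h4 h5 θ hθ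
    have h6 := ht θ hθ
    simp only [e] at h6
    rw [integral_sub (integrable_smul_of_locallyIntegrable h4 (hθ.pd j).continuous (hθ.pd j).2)
      (integrable_smul_of_locallyIntegrable h5 (hθ.pd i).continuous (hθ.pd i).2), sub_eq_zero] at h6
    simpa only [smul_eq_mul, mul_comm] using h6
  filter_upwards [ae_all_iff.2 fun i => ae_all_iff.2 fun j => key i j] with t ht i j θ hθ
    using ht i j θ hθ

/-- Local integrability is given for the functional x ↦ ⟨G, ·⟩; the vector field is recovered from
its values on the basis. -/
lemma HasWeakGradient.locInt {g : ℝ → Space N → ℝ} {P : ℝ → Space N → Space N}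
    (h : HasWeakGradient T g P) : LocInt T P := fun z hz => by
  obtain ⟨s, hs, hsu⟩ := h.1 z hz
  refine ⟨s, hs, ?_⟩
  have := (∑ i : Fin N, (ContinuousLinearMap.apply ℝ ℝ (basisVec i)).smulRight (basisVec i) :
    (Space N →L[ℝ] ℝ) →L[ℝ] Space N).integrable_comp hsu
  refine this.congr (ae_of_all _ fun w => ?_)
  conv_rhs => rw [Function.uncurry, ← sum_smul_basisVec (P w.1 w.2)]
  simp [Function.uncurry, basisVec, EuclideanSpace.inner_single_right]

end SliceApplications

end DensityEuler
end

noncomputable section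
namespace DensityEuler
set_option linter.unusedSectionVars false

variable {N : ℕ}

/-! ### Measurability of norms of slices -/

section Measurability

variable {F : Type*} [NormedAddCommGroup F] {α : Type*} [MeasurableSpace α] {μ : Measure α} [SFinite μ]

lemma ae_slice_eq_mk {f : α → Space N → F}
    (hf : AEStronglyMeasurable (Function.uncurry f) (μ.prod (volume : Measure (Space N)))) :
    ∀ᵐ t ∂μ, f t =ᵐ[volume] fun x => hf.mk _ (t, x) :=
  Measure.ae_ae_of_ae_prod hf.ae_eq_mk

/-- After passage to a measurable representative, finite exponents follow from Tonelli. For p = ∞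
the norm of a slice exceeds c exactly when the superlevel set of the slice has positive measure, and
that measure depends measurably on t. -/
lemma aemeasurable_eLpNorm_slice {f : α → Space N → F}
    (hf : AEStronglyMeasurable (Function.uncurry f) (μ.prod (volume : Measure (Space N)))) {p : ℝ≥0∞}
    (hp : p ≠ 0) : AEMeasurable (fun t => eLpNorm (f t) p volume) μ := by
  have h1 : (fun t => eLpNorm (f t) p volume) =ᵐ[μ]
      fun t => eLpNorm (fun x => hf.mk _ (t, x)) p volume := by
    filter_upwards [ae_slice_eq_mk hf] with t ht using eLpNorm_congr_ae ht
  refine AEMeasurable.congr (Measurable.aemeasurable ?_) h1.symm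
  have hm : Measurable fun z => ‖hf.mk _ z‖ₑ := hf.stronglyMeasurable_mk.enorm
  by_cases hpt : p = ⊤
  · subst hpt
    refine measurable_of_Ioi fun c => ?_
    have : (fun t => eLpNorm (fun x => hf.mk _ (t, x)) ⊤ volume) ⁻¹' Ioi c =
        (fun t => volume (Prod.mk t ⁻¹' {z : α × Space N | c < ‖hf.mk _ z‖ₑ})) ⁻¹' Ioi 0 := by
      ext t
      simp only [mem_preimage, mem_Ioi, eLpNorm_exponent_top, eLpNormEssSup]
      rw [← not_le, ← not_le (b := (0 : ℝ≥0∞)), not_iff_not, nonpos_iff_eq_zero]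
      constructor
      · intro h
        have := ENNReal.ae_le_essSup (μ := volume) fun x : Space N => ‖hf.mk _ (t, x)‖ₑ
        refine measure_mono_null (fun x hx => ?_) this
        simp only [mem_preimage, mem_ofPred_eq] at hx
        exact not_le.2 (h.trans_lt hx)
      · intro h
        refine essSup_le_of_ae_le _ ?_
        refine measure_mono_null (fun x hx => ?_) h
        simpa using hx
    rw [this]
    exact (measurable_measure_prodMk_left (measurableSet_lt measurable_const hm)) measurableSet_Ioi
  · simp only [eLpNorm_eq_lintegral_rpow_enorm_toReal hp hpt]
    exact (Measurable.lintegral_prod_right' (hm.pow_const _)).pow_const _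

lemma timeInt_toReal {g : ℝ → ℝ≥0∞} {T : ℝ} (hm : AEMeasurable g (volume.restrict (Ioo 0 T)))
    (hg : ∫⁻ t in Ioo 0 T, g t ≠ ⊤) : IntegrableOn (fun t => (g t).toReal) (Ioo 0 T) :=
  integrable_toReal_of_lintegral_ne_top hm hg

lemma ae_norm_le_toReal_eLpNorm {f : Space N → F} (h : eLpNorm f ⊤ volume ≠ ⊤) :
    ∀ᵐ x, ‖f x‖ ≤ (eLpNorm f ⊤ volume).toReal := by
  filter_upwards [ae_le_eLpNormEssSup (f := f) (μ := volume)] with x hx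
  rw [← toReal_enorm]
  exact ENNReal.toReal_mono h hx

end Measurability

/-! ### Velocity fields with bounded gradient -/

section Flow

variable {F : Type*} [NormedAddCommGroup F] [NormedSpace ℝ F] {T : ℝ}

/-- A divergence free velocity field that is Lipschitz in space, with linear growth. -/
structure LipFlow (T : ℝ) (U : ℝ → Space N → Space N) (m L : ℝ → ℝ) : Prop where
  locInt : LocInt T U
  timeInt_m : TimeInt T m
  timeInt_L : TimeInt T L
  nonneg_m : ∀ t, 0 ≤ m t
  nonneg_L : ∀ t, 0 ≤ L t
  divFree : ∀ᵐ t ∂volume.restrict (Ioo 0 T), WeakDivFree (U t)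
  lipschitz : ∀ᵐ t ∂volume.restrict (Ioo 0 T), ∃ S : Set (Space N), (∀ᵐ x, x ∈ S) ∧
    ∀ x ∈ S, ∀ y ∈ S, ‖U t x - U t y‖ ≤ L t * ‖x - y‖
  growth : ∀ᵐ t ∂volume.restrict (Ioo 0 T), ∀ᵐ x, ‖U t x‖ ≤ m t + L t * ‖x‖

lemma TimeInt.add {γ γ' : ℝ → F} (h : TimeInt T γ) (h' : TimeInt T γ') :
    TimeInt T fun t => γ t + γ' t := fun s t hs ht => (h s t hs ht).add (h' s t hs ht)

lemma TimeInt.const_mul {γ : ℝ → ℝ} (h : TimeInt T γ) (c : ℝ) : TimeInt T fun t => c * γ t :=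
  fun s t hs ht => (h s t hs ht).const_mul c

lemma timeInt_of_integrableOn {γ : ℝ → F} (h : IntegrableOn γ (Ioo 0 T)) : TimeInt T γ :=
  fun _ _ hs ht => h.mono_set (Icc_subset_Ioo hs ht)

/-- The growth bound needs a reference value of U at each time that is integrable in time. Point
values are not available, so an average of ‖U‖ over the unit ball is used; the Lipschitz estimate
compares U(x) with it. -/
lemma exists_lipFlow (hT : 0 < T) {U : ℝ → Space N → Space N}
    {DU : ℝ → Space N → Space N →L[ℝ] Space N} (h : HasWeakSpaceDeriv T U DU)
    (htr : ∀ᵐ z : ℝ × Space N ∂(volume.restrict (slab N T)),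
      ∑ i : Fin N, DU z.1 z.2 (EuclideanSpace.single i (1 : ℝ)) i = 0)
    (hV : ∫⁻ t in Ioo 0 T, eLpNorm (DU t) ⊤ volume ≠ ⊤) :
    ∃ m, LipFlow T U m fun t => (eLpNorm (DU t) ⊤ volume).toReal := by
  set L : ℝ → ℝ := fun t => (eLpNorm (DU t) ⊤ volume).toReal with hL
  have hmeas := aemeasurable_eLpNorm_slice (LocInt.aestronglyMeasurable h.1) (p := ⊤) (by simp)
  have hLi : TimeInt T L := timeInt_of_integrableOn (timeInt_toReal hmeas hV)
  have hL0 (t : ℝ) : 0 ≤ L t := ENNReal.toReal_nonneg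
  have hfin : ∀ᵐ t ∂volume.restrict (Ioo 0 T), eLpNorm (DU t) ⊤ volume < ⊤ :=
    ae_lt_top' hmeas hV
  have hlip : ∀ᵐ t ∂volume.restrict (Ioo 0 T), ∃ S : Set (Space N), (∀ᵐ x, x ∈ S) ∧
      ∀ x ∈ S, ∀ y ∈ S, ‖U t x - U t y‖ ≤ L t * ‖x - y‖ := by
    filter_upwards [h.ae_hasWeakFDeriv hT, hfin] with t ht hft
    exact ht.exists_lipschitz (hL0 t) (ae_norm_le_toReal_eLpNorm hft.ne)
  have hs : SlabInt T fun t x => moll 0 x • ‖U t x‖ :=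
    LocInt.slabInt_smul (f := fun t x => ‖U t x‖) (LocallyIntegrableOn.norm h.locInt)
      (isBump_moll 0).continuous (isBump_moll 0).2
  refine ⟨fun t => (∫ x, moll 0 x • ‖U t x‖) + L t, h.locInt, hs.timeInt.add hLi, hLi, fun t => ?_, hL0,
    ?_, hlip, ?_⟩
  · exact add_nonneg (integral_nonneg fun x => mul_nonneg (moll_nonneg 0 x) (norm_nonneg _)) (hL0 t)
  · filter_upwards [h.ae_hasWeakFDeriv hT, ae_ae_of_ae_slab htr] with t ht htt
    exact ht.weakDivFree htt
  · filter_upwards [hlip, hs.ae_integrable] with t ⟨S, hS, hS'⟩ hint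
    filter_upwards [hS] with x hx
    have h1 : ∫ y : Space N, moll 0 y * ‖U t x‖ = ‖U t x‖ := by
      rw [integral_mul_const, integral_moll, one_mul]
    have h2 : ∫ y : Space N, moll 0 y * (L t * (‖x‖ + 1)) = L t * (‖x‖ + 1) := by
      rw [integral_mul_const, integral_moll, one_mul]
    have i1 (c : ℝ) : Integrable fun y : Space N => moll 0 y * c := (isBump_moll 0).integrable.mul_const c
    have h3 : ‖U t x‖ ≤ (∫ y, moll 0 y • ‖U t y‖) + L t * (‖x‖ + 1) := by
      rw [← h1]
      conv_rhs => rw [← h2]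
      rw [← integral_add hint (i1 _)]
      refine integral_mono_ae (i1 _) (hint.add (i1 _)) ?_
      filter_upwards [hS] with y hy
      rw [smul_eq_mul, ← mul_add]
      by_cases hy1 : ‖y‖ ≤ 1
      · refine mul_le_mul_of_nonneg_left ?_ (moll_nonneg 0 y)
        have h4 := hS' x hx y hy
        have h5 := norm_sub_norm_le (U t x) (U t y)
        have h6 : L t * ‖x - y‖ ≤ L t * (‖x‖ + 1) := by
          have := norm_sub_le x y
          have := hL0 t
          gcongr; linarith
        linarith
      · rw [moll_eq_zero ((radius_le_one 0).trans_lt (not_le.1 hy1)), zero_mul, zero_mul]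
    linarith

end Flow

/-! ### Mollified slices -/

section MollifiedSlices

variable {F : Type*} [NormedAddCommGroup F] [NormedSpace ℝ F] {T : ℝ}

/-- Functions that are locally integrable in space, uniformly up to a factor integrable in time. -/
structure UnifLoc (T : ℝ) (b : ℝ → Space N → F) (k : ℝ → ℝ) : Prop where
  aesm : AEStronglyMeasurable (Function.uncurry b)
    ((volume.restrict (Ioo 0 T)).prod (volume : Measure (Space N)))
  timeInt : TimeInt T k
  ae : ∀ᵐ t ∂volume.restrict (Ioo 0 T), LocallyIntegrable (b t) ∧
    ∀ x, ∫ y in Metric.closedBall x 1, ‖b t y‖ ≤ k t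

lemma aestronglyMeasurable_lift {α E : Type*} [NormedAddCommGroup E] [MeasurableSpace α]
    {μ : Measure α} [SFinite μ] {b : α → Space N → E}
    (hb : AEStronglyMeasurable (Function.uncurry b) (μ.prod (volume : Measure (Space N)))) :
    AEStronglyMeasurable (fun w : (α × Space N) × Space N => b w.1.1 w.2)
      ((μ.prod (volume : Measure (Space N))).prod (volume : Measure (Space N))) :=
  hb.comp_quasiMeasurePreserving
    (QuasiMeasurePreserving.prodMap Measure.quasiMeasurePreserving_fst
      (Measure.QuasiMeasurePreserving.id volume))

lemma aestronglyMeasurable_kernel {α E : Type*} [NormedAddCommGroup E] [MeasurableSpace α]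
    {μ : Measure α} [SFinite μ] {k : Space N → E} (hk : Continuous k) :
    AEStronglyMeasurable (fun w : (α × Space N) × Space N => k (w.1.2 - w.2))
      ((μ.prod (volume : Measure (Space N))).prod (volume : Measure (Space N))) := by
  exact (hk.stronglyMeasurable.comp_measurable
    (by fun_prop : Measurable fun w : (α × Space N) × Space N => w.1.2 - w.2)).aestronglyMeasurable

lemma norm_integral_le_of_ball {f : Space N → F} {g : Space N → ℝ} (hg : LocallyIntegrable g)
    {x : Space N} {D : ℝ} (h0 : ∀ y, 1 < ‖x - y‖ → f y = 0) (h : ∀ᵐ y, ‖x - y‖ ≤ 1 → ‖f y‖ ≤ D * g y) :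
    ‖∫ y, f y‖ ≤ D * ∫ y in Metric.closedBall x 1, g y := by
  have e : ∫ y, f y = ∫ y in Metric.closedBall x 1, f y := by
    refine (setIntegral_eq_integral_of_forall_compl_eq_zero fun y hy => h0 y ?_).symm
    rw [Metric.mem_closedBall, dist_comm, dist_eq_norm, not_le] at hy
    exact hy
  rw [e, ← integral_const_mul]
  refine norm_integral_le_of_norm_le ((hg.integrableOn_isCompact (isCompact_closedBall x 1)).const_mul D) ?_
  rw [ae_restrict_iff' measurableSet_closedBall]
  filter_upwards [h] with y hy hxy
  exact hy (by rwa [Metric.mem_closedBall, dist_comm, dist_eq_norm] at hxy)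

lemma slabInt_of_bound {K : ℝ → Space N → F} {κ : ℝ → ℝ} {R : ℝ}
    (hm : AEStronglyMeasurable (Function.uncurry K)
      ((volume.restrict (Ioo 0 T)).prod (volume : Measure (Space N)))) (hκ : TimeInt T κ)
    (h0 : ∀ t x, R < ‖x‖ → K t x = 0)
    (h : ∀ᵐ t ∂volume.restrict (Ioo 0 T), ∀ᵐ x, ‖x‖ ≤ R → ‖K t x‖ ≤ κ t) : SlabInt T K := by
  intro s t hs ht
  rw [IntegrableOn, volume_restrict_prod_univ]
  have hac : (volume.restrict (Icc s t)).prod (volume : Measure (Space N)) ≪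
      (volume.restrict (Ioo 0 T)).prod (volume : Measure (Space N)) :=
    (Measure.absolutelyContinuous_of_le (Measure.restrict_mono (Icc_subset_Ioo hs ht) le_rfl)).prod
      Measure.AbsolutelyContinuous.rfl
  have hm' := hm.mono_ac hac
  have hball : Integrable ((Metric.closedBall (0 : Space N) R).indicator fun _ => (1 : ℝ)) :=
    (integrable_indicator_iff measurableSet_closedBall).2
      (integrableOn_const (measure_closedBall_lt_top.ne))
  refine ((hκ s t hs ht).norm.mul_prod hball).mono' hm' ?_
  have h1 : ∀ᵐ z ∂(volume.restrict (Icc s t)).prod (volume : Measure (Space N)),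
      ‖z.2‖ ≤ R → ‖Function.uncurry K z‖ ≤ |κ z.1| := by
    -- A statement valid almost everywhere on almost every slice passes to the product measure only
    -- for measurable sets, hence the measurable representatives of K and κ.
    obtain ⟨K', hK', he⟩ := hm'
    obtain ⟨κ', hκ', heκ⟩ := (hκ s t hs ht).1
    have e2 : ∀ᵐ z ∂(volume.restrict (Icc s t)).prod (volume : Measure (Space N)),
        κ z.1 = κ' z.1 := Measure.quasiMeasurePreserving_fst.ae heκ
    have hset : MeasurableSet {z : ℝ × Space N | ‖z.2‖ ≤ R → ‖K' z‖ ≤ |κ' z.1|} := by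
      have a1 : MeasurableSet {z : ℝ × Space N | ‖z.2‖ ≤ R} :=
        measurableSet_le (by fun_prop) measurable_const
      have a2 : MeasurableSet {z : ℝ × Space N | ‖K' z‖ ≤ |κ' z.1|} :=
        measurableSet_le hK'.norm.measurable
          ((hκ'.measurable.comp measurable_fst).norm)
      have : {z : ℝ × Space N | ‖z.2‖ ≤ R → ‖K' z‖ ≤ |κ' z.1|} =
          {z : ℝ × Space N | ‖z.2‖ ≤ R}ᶜ ∪ {z : ℝ × Space N | ‖K' z‖ ≤ |κ' z.1|} := by
        ext z; simp only [mem_ofPred_eq, mem_union, mem_compl_iff]; tauto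
      rw [this]; exact a1.compl.union a2
    have h2 : ∀ᵐ z ∂(volume.restrict (Icc s t)).prod (volume : Measure (Space N)),
        ‖z.2‖ ≤ R → ‖K' z‖ ≤ |κ' z.1| := by
      rw [Measure.ae_prod_iff_ae_ae hset]
      filter_upwards [ae_restrict_Icc_of_Ioo h hs ht, Measure.ae_ae_of_ae_prod he, heκ] with r hr h3 h4
      filter_upwards [hr, h3] with x hx h5 hxR
      simp only [Function.uncurry] at h5
      rw [← h5, ← h4]
      exact (hx hxR).trans (le_abs_self _)
    filter_upwards [h2, he, e2] with z hz h3 h4 hzR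
    rw [h3, h4]; exact hz hzR
  filter_upwards [h1] with z hz
  by_cases hzR : ‖z.2‖ ≤ R
  · rw [indicator_of_mem (mem_closedBall_zero_iff.2 hzR), mul_one, Real.norm_eq_abs]; exact hz hzR
  · have : Function.uncurry K z = 0 := h0 _ _ (not_le.1 hzR)
    rw [this, norm_zero]
    exact mul_nonneg (norm_nonneg _) (indicator_nonneg (fun _ _ => zero_le_one) _)

end MollifiedSlices

end DensityEuler
end

noncomputable section
namespace DensityEuler
set_option linter.unusedSectionVars false

variable {N : ℕ}

/-! ### Renormalisation of the transport equation -/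

section Renormalisation

variable {F : Type*} [NormedAddCommGroup F] [NormedSpace ℝ F] {T : ℝ}

/-- The commutator of mollification and transport. -/
def commut (n : ℕ) (U : Space N → Space N) (b : Space N → F) (x : Space N) : F :=
  ∫ y, fderiv ℝ (moll n) (x - y) (U x - U y) • b y

/-- The time derivative of the mollified solution of a transport equation. -/
def mollRate (n : ℕ) (U : Space N → Space N) (b h : Space N → F) (x : Space N) : F :=
  mollify n h x - ∫ y, fderiv ℝ (moll n) (x - y) (U y) • b y

lemma integrable_apply_smul {U : Space N → Space N} (hU : AEStronglyMeasurable U) {m L : ℝ}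
    (hgr : ∀ᵐ x, ‖U x‖ ≤ m + L * ‖x‖) {b : Space N → F}
    (hb : LocallyIntegrable b) {k : Space N → Space N →L[ℝ] ℝ} (hk : Continuous k)
    (hkc : HasCompactSupport k) : Integrable fun y => k y (U y) • b y := by
  have h1 := integrable_smul_of_locallyIntegrable (locallyIntegrable_norm hb)
    (k := fun y => ‖k y‖ * (m + L * ‖y‖)) (by fun_prop)
    (hkc.norm.mono fun x hx h0 => hx (by
      have h0' : ‖k x‖ = 0 := h0
      simp only [h0', zero_mul]))
  refine h1.mono' ((aestronglyMeasurable_clm_apply hk.aestronglyMeasurable hU).smul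
    hb.aestronglyMeasurable) ?_
  filter_upwards [hgr] with y hy
  rw [norm_smul, smul_eq_mul]
  have h2 : ‖k y (U y)‖ ≤ ‖k y‖ * (m + L * ‖y‖) :=
    ((k y).le_opNorm _).trans (mul_le_mul_of_nonneg_left hy (norm_nonneg _))
  exact mul_le_mul_of_nonneg_right h2 (norm_nonneg _)

/-- Replacing U(y) by U(x) under the kernel gives the transport term of the mollified function; the
commutator is the price. -/
lemma mollRate_eq {U : Space N → Space N} (hU : AEStronglyMeasurable U) {m L : ℝ}
    (hgr : ∀ᵐ x, ‖U x‖ ≤ m + L * ‖x‖) {b : Space N → F}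
    (hb : LocallyIntegrable b) (h : Space N → F) (n : ℕ) (x : Space N) :
    mollRate n U b h x =
      mollify n h x + commut n U b x - fderiv ℝ (mollify n b) x (U x) := by
  have i1 := integrable_apply_smul hU hgr hb (continuous_fderiv_moll_sub n x)
    (hasCompactSupport_fderiv_moll_sub n x)
  have i2 : Integrable fun y => fderiv ℝ (moll n) (x - y) (U x) • b y :=
    integrable_smul_of_locallyIntegrable hb
      ((continuous_fderiv_moll_sub n x).clm_apply continuous_const)
      ((hasCompactSupport_fderiv_moll_sub n x).mono fun y hy h0 => hy (by simp [h0]))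
  rw [mollRate, commut, fderiv_mollify hb]
  simp only [map_sub, sub_smul]
  rw [integral_sub i2 i1]
  abel

/-- The equation is tested with the mollifier centred at the fixed point x. This gives a function of
time alone, to which the chain rule applies. -/
lemma hasWeakDeriv_mollify {U : ℝ → Space N → Space N} {m L : ℝ → ℝ} (hU : LipFlow T U m L)
    {b h : ℝ → Space N → F} {k k' : ℝ → ℝ} (hb : UnifLoc T b k) (hh : UnifLoc T h k')
    (heq : TransportEq T U b h) (n : ℕ) (x : Space N) :
    HasWeakDeriv T (fun t => mollify n (b t) x) (fun t => mollRate n (U t) (b t) (h t) x) := by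
  refine (heq _ (isBump_moll_sub n x)).congr (ae_of_all _ fun t => rfl) ?_
  filter_upwards [hU.growth, hb.ae, hh.ae, hU.divFree] with t h1 h2 h3 h4
  have i1 := integrable_apply_smul h4.1.aestronglyMeasurable h1 h2.1
    (continuous_fderiv_moll_sub n x) (hasCompactSupport_fderiv_moll_sub n x)
  have i2 := integrable_smul_of_locallyIntegrable h3.1 (isBump_moll_sub n x).continuous
    (isBump_moll_sub n x).2
  have i3 : Integrable fun y => -(fderiv ℝ (moll n) (x - y) (U t y) • b t y) := i1.neg
  simp only [fderiv_moll_sub, neg_smul]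
  rw [integral_add i3 i2, integral_neg, mollRate, mollify]
  abel

lemma norm_mollify_le_integral {b : Space N → F} (hb : LocallyIntegrable b) {n : ℕ} {C : ℝ}
    (hC : ∀ z : Space N, ‖moll n z‖ ≤ C) (x : Space N) :
    ‖mollify n b x‖ ≤ C * ∫ y in Metric.closedBall x 1, ‖b y‖ := by
  refine norm_integral_le_of_ball (locallyIntegrable_norm hb) (fun y hy => ?_)
    (ae_of_all _ fun y _ => ?_)
  · rw [moll_eq_zero ((radius_le_one n).trans_lt hy), zero_smul]
  · rw [norm_smul]; exact mul_le_mul_of_nonneg_right (hC _) (norm_nonneg _)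

lemma norm_mollRate_le {U : Space N → Space N} {m L : ℝ}
    (hL : 0 ≤ L) (hgr : ∀ᵐ x, ‖U x‖ ≤ m + L * ‖x‖) {b h : Space N → F}
    (hb : LocallyIntegrable b) (hh : LocallyIntegrable h) {n : ℕ} {C D : ℝ} (hD : 0 ≤ D)
    (hC : ∀ z : Space N, ‖moll n z‖ ≤ C) (hCD : ∀ z : Space N, ‖fderiv ℝ (moll n) z‖ ≤ D) {R : ℝ}
    {x : Space N} (hx : ‖x‖ ≤ R) :
    ‖mollRate n U b h x‖ ≤ C * (∫ y in Metric.closedBall x 1, ‖h y‖) +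
      D * (m + L * (R + 1)) * ∫ y in Metric.closedBall x 1, ‖b y‖ := by
  refine (norm_sub_le _ _).trans (add_le_add (norm_mollify_le_integral hh hC x) ?_)
  refine norm_integral_le_of_ball (locallyIntegrable_norm hb) (fun y hy => ?_) ?_
  · rw [fderiv_moll_eq_zero ((radius_le_one n).trans_lt hy)]; simp
  · filter_upwards [hgr] with y hy hxy
    rw [norm_smul]
    refine mul_le_mul_of_nonneg_right (((fderiv ℝ (moll n) (x - y)).le_opNorm _).trans ?_)
      (norm_nonneg _)
    have h1 : ‖y‖ ≤ R + 1 := by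
      have := norm_sub_norm_le y x
      rw [norm_sub_rev] at this; linarith
    exact mul_le_mul (hCD _) (hy.trans (by gcongr)) (norm_nonneg _) hD

lemma aestronglyMeasurable_mollify {b : ℝ → Space N → F}
    (hb : AEStronglyMeasurable (Function.uncurry b)
      ((volume.restrict (Ioo 0 T)).prod (volume : Measure (Space N)))) (n : ℕ) :
    AEStronglyMeasurable (fun z : ℝ × Space N => mollify n (b z.1) z.2)
      ((volume.restrict (Ioo 0 T)).prod volume) :=
  ((aestronglyMeasurable_kernel (isBump_moll n).continuous).smul
    (aestronglyMeasurable_lift hb)).integral_prod_right'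

lemma aestronglyMeasurable_mollRate {U : ℝ → Space N → Space N} (hU : LocInt T U)
    {b h : ℝ → Space N → F} (hb : AEStronglyMeasurable (Function.uncurry b)
      ((volume.restrict (Ioo 0 T)).prod (volume : Measure (Space N))))
    (hh : AEStronglyMeasurable (Function.uncurry h)
      ((volume.restrict (Ioo 0 T)).prod (volume : Measure (Space N)))) (n : ℕ) :
    AEStronglyMeasurable (fun z : ℝ × Space N => mollRate n (U z.1) (b z.1) (h z.1) z.2)
      ((volume.restrict (Ioo 0 T)).prod volume) :=
  (aestronglyMeasurable_mollify hh n).sub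
    ((aestronglyMeasurable_clm_apply (aestronglyMeasurable_kernel (isBump_moll n).continuous_fderiv)
      (aestronglyMeasurable_lift hU.aestronglyMeasurable)).smul
      (aestronglyMeasurable_lift hb)).integral_prod_right'

lemma timeInt_const (T : ℝ) (c : F) : TimeInt T fun _ => c := fun _ _ _ _ =>
  continuous_const.integrableOn_Icc

lemma exists_bound_comp_mollify [FiniteDimensional ℝ F] {b : ℝ → Space N → F} {M : ℝ}
    (hb : UnifLoc T b fun _ => M) (n : ℕ) {G : Type*} [NormedAddCommGroup G] {Ψ : F → G}
    (hΨ : Continuous Ψ) :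
    ∃ C, 0 ≤ C ∧ ∀ᵐ t ∂volume.restrict (Ioo 0 T), ∀ x, ‖Ψ (mollify n (b t) x)‖ ≤ C := by
  obtain ⟨C, hC0, hC⟩ := (isBump_moll (N := N) n).exists_bound
  obtain ⟨C', hC'⟩ := (isCompact_closedBall (0 : F) (C * M)).exists_bound_of_continuousOn
    hΨ.continuousOn
  refine ⟨max C' 0, le_max_right _ _, ?_⟩
  filter_upwards [hb.ae] with t ht x
  refine (hC' _ ?_).trans (le_max_left _ _)
  rw [mem_closedBall_zero_iff]
  exact (norm_mollify_le_integral ht.1 hC x).trans (mul_le_mul_of_nonneg_left (ht.2 x) hC0)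

/-- The equation satisfied by functions of the mollified solution. -/
theorem hasWeakDeriv_integral_comp_mollify [FiniteDimensional ℝ F] (hT : 0 < T)
    {U : ℝ → Space N → Space N} {m L : ℝ → ℝ} (hU : LipFlow T U m L) {b h : ℝ → Space N → F} {M : ℝ}
    {k : ℝ → ℝ} (hb : UnifLoc T b fun _ => M) (hh : UnifLoc T h k) (heq : TransportEq T U b h)
    {Φ : F → ℝ} (hΦ : ContDiff ℝ 1 Φ) {ψ : Space N → ℝ} (hψ : IsBump ψ) (n : ℕ) :
    HasWeakDeriv T (fun t => ∫ x, ψ x * Φ (mollify n (b t) x))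
      (fun t => ∫ x, (ψ x * fderiv ℝ Φ (mollify n (b t) x)
        (mollify n (h t) x + commut n (U t) (b t) x) +
          Φ (mollify n (b t) x) * fderiv ℝ ψ x (U t x))) := by
  have hΦd : Continuous (fderiv ℝ Φ) := hΦ.continuous_fderiv (by simp)
  obtain ⟨R, hR, hR'⟩ := exists_radius hψ.2
  obtain ⟨Cψ, hCψ0, hCψ⟩ := hψ.exists_bound
  obtain ⟨C, hC0, hC⟩ := (isBump_moll (N := N) n).exists_bound
  obtain ⟨D, hD0, hD⟩ := (isBump_moll (N := N) n).exists_bound_fderiv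
  obtain ⟨B₀, hB₀0, hB₀⟩ := exists_bound_comp_mollify hb n hΦ.continuous
  obtain ⟨B₁, hB₁0, hB₁⟩ := exists_bound_comp_mollify hb n hΦd
  have mb := aestronglyMeasurable_mollify hb.aesm n
  have mr := aestronglyMeasurable_mollRate hU.locInt hb.aesm hh.aesm n
  have mψ : AEStronglyMeasurable (fun z : ℝ × Space N => ψ z.2)
      ((volume.restrict (Ioo 0 T)).prod (volume : Measure (Space N))) :=
    (hψ.continuous.comp continuous_snd).aestronglyMeasurable
  have s0 : SlabInt T fun t x => ψ x * Φ (mollify n (b t) x) := by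
    refine slabInt_of_bound (R := R) (κ := fun _ => Cψ * B₀)
      (mψ.mul (hΦ.continuous.comp_aestronglyMeasurable mb)) (timeInt_const T _)
      (fun t x hx => by rw [hR' x hx, zero_mul]) ?_
    filter_upwards [hB₀] with t ht
    refine ae_of_all _ fun x _ => ?_
    rw [norm_mul]
    exact mul_le_mul (hCψ x) (ht x) (norm_nonneg _) hCψ0
  have s1 : SlabInt T fun t x => ψ x * fderiv ℝ Φ (mollify n (b t) x)
      (mollRate n (U t) (b t) (h t) x) := by
    refine slabInt_of_bound (R := R)
      (κ := fun t => Cψ * (B₁ * (C * k t + D * M * (m t + (R + 1) * L t))))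
      (mψ.mul (aestronglyMeasurable_clm_apply (hΦd.comp_aestronglyMeasurable mb) mr)) ?_
      (fun t x hx => by rw [hR' x hx, zero_mul]) ?_
    · exact ((((hh.timeInt.const_mul C).add ((hU.timeInt_m.add
        (hU.timeInt_L.const_mul (R + 1))).const_mul (D * M))).const_mul B₁).const_mul Cψ)
    · filter_upwards [hB₁, hU.growth, hb.ae, hh.ae] with t ht h1 h2 h3
      refine ae_of_all _ fun x hx => ?_
      rw [norm_mul]
      refine mul_le_mul (hCψ x) (((fderiv ℝ Φ _).le_opNorm _).trans ?_) (norm_nonneg _) hCψ0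
      refine mul_le_mul (ht x) ?_ (norm_nonneg _) hB₁0
      refine (norm_mollRate_le (hU.nonneg_L t) h1 h2.1 h3.1 hD0 hC hD hx).trans ?_
      have h4 : 0 ≤ D * (m t + L t * (R + 1)) := by
        have := hU.nonneg_m t; have := hU.nonneg_L t; positivity
      have h5 := mul_le_mul_of_nonneg_left (h2.2 x) h4
      have h6 := mul_le_mul_of_nonneg_left (h3.2 x) hC0
      calc _ ≤ C * k t + D * (m t + L t * (R + 1)) * M := add_le_add h6 h5
        _ = _ := by ring
  -- For each x the chain rule in time is applied to t ↦ mollify n (b t) x; Fubini then integrates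
  -- the identity against ψ.
  have main : HasWeakDeriv T (fun t => ∫ x, ψ x * Φ (mollify n (b t) x))
      (fun t => ∫ x, ψ x * fderiv ℝ Φ (mollify n (b t) x) (mollRate n (U t) (b t) (h t) x)) := by
    refine ⟨s0.timeInt, s1.timeInt, fun φ hφ => ?_⟩
    rw [← s0.integral_test hT hφ.deriv_test, ← s1.integral_test hT hφ, Measure.volume_eq_prod,
      integral_prod_symm _ (s0.integrable_test hT hφ.deriv_test),
      integral_prod_symm _ (s1.integrable_test hT hφ), ← integral_neg]
    congr 1; ext x
    have h1 := ((hasWeakDeriv_mollify hU hb hh heq n x).comp hT hΦ).2.2 φ hφ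
    simp only [smul_eq_mul] at h1 ⊢
    simp only [mul_left_comm _ (ψ x), integral_const_mul, h1]
    ring
  -- The transport part of the rate is −U·∇(Φ ∘ bₙ), bₙ being the mollified function. As U is
  -- divergence free, testing with ψ·Φ(bₙ) moves the derivative onto ψ; this product is only C¹,
  -- which `WeakDivFree.integral_fderiv_eq_zero` allows.
  refine main.congr (ae_of_all _ fun t => rfl) ?_
  filter_upwards [hU.growth, hU.divFree, hb.ae, s1.ae_integrable] with t h1 h2 h3 h4
  have hsm : ContDiff ℝ 1 (mollify n (b t)) := (contDiff_mollify h3.1 n).of_le (by simp)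
  have hθ : ContDiff ℝ 1 fun x => ψ x * Φ (mollify n (b t) x) := hψ.contDiff_one.mul (hΦ.comp hsm)
  have hθc : HasCompactSupport fun x => ψ x * Φ (mollify n (b t) x) := hψ.2.mul_right
  have h5 := h2.integral_fderiv_eq_zero hθ hθc
  have i5 := integrable_fderiv_apply hθ hθc h2.1
  have e (x : Space N) : fderiv ℝ (fun x => ψ x * Φ (mollify n (b t) x)) x (U t x) =
      ψ x * fderiv ℝ Φ (mollify n (b t) x) (fderiv ℝ (mollify n (b t)) x (U t x)) +
        Φ (mollify n (b t) x) * fderiv ℝ ψ x (U t x) := by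
    have d1 := (hΦ.differentiable (by simp) (mollify n (b t) x)).hasFDerivAt.comp x
      (hsm.differentiable (by simp) x).hasFDerivAt
    have d2 : fderiv ℝ (fun x => ψ x * Φ (mollify n (b t) x)) x = _ :=
      ((hψ.differentiable x).hasFDerivAt.mul d1).fderiv
    rw [d2]; simp
  simp only [e] at h5 i5
  rw [← add_zero (∫ x, ψ x * _), ← h5, ← integral_add h4 i5]
  congr 1; ext x
  rw [mollRate_eq h2.1.aestronglyMeasurable h1 h3.1, map_sub]
  ring

end Renormalisation

end DensityEuler
end

noncomputable section
namespace DensityEuler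
set_option linter.unusedSectionVars false

variable {N : ℕ}

/-! ### Functions of a bounded solution of the transport equation -/

section BoundedRenormalisation

variable {F : Type*} [NormedAddCommGroup F] [NormedSpace ℝ F] {T : ℝ}

lemma mollify_const [CompleteSpace F] (n : ℕ) (c : F) : mollify n (fun _ : Space N => c) = fun _ => c := by
  ext x
  rw [mollify, integral_smul_const, integral_sub_left_eq_self (moll n) volume x, integral_moll,
    one_smul]

lemma mollify_zero (n : ℕ) : mollify n (0 : Space N → F) = 0 := by
  ext x; simp [mollify]

/-- Constants have zero commutator: the mollification of a constant has zero derivative, and the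
other term vanishes because U is divergence free. -/
lemma commut_eq_sub [CompleteSpace F] {U : Space N → Space N} (hU : WeakDivFree U) {b : Space N → F}
    {m L : ℝ} (hgr : ∀ᵐ x, ‖U x‖ ≤ m + L * ‖x‖) (hb : LocallyIntegrable b) (n : ℕ) (c : F) (x : Space N) :
    commut n U b x = commut n U (fun y => b y - c) x := by
  have i1 := integrable_apply_smul hU.1.aestronglyMeasurable hgr hb (continuous_fderiv_moll_sub n x)
    (hasCompactSupport_fderiv_moll_sub n x)
  have i2 (f : Space N → F) (hf : LocallyIntegrable f) :
      Integrable fun y => fderiv ℝ (moll n) (x - y) (U x) • f y :=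
    integrable_smul_of_locallyIntegrable hf
      ((continuous_fderiv_moll_sub n x).clm_apply continuous_const)
      ((hasCompactSupport_fderiv_moll_sub n x).mono fun y hy h0 => hy (by simp [h0]))
  have hc : LocallyIntegrable fun _ : Space N => c := continuous_const.locallyIntegrable
  have i3 := integrable_apply_smul hU.1.aestronglyMeasurable hgr hc (continuous_fderiv_moll_sub n x)
    (hasCompactSupport_fderiv_moll_sub n x)
  have e1 : ∫ y, fderiv ℝ (moll n) (x - y) (U x) • c = 0 := by
    rw [← fderiv_mollify hc, mollify_const]; simp
  have e2 : ∫ y, fderiv ℝ (moll n) (x - y) (U y) • c = 0 := by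
    have := hU.2 _ (isBump_moll_sub n x)
    simp only [fderiv_moll_sub] at this
    rw [integral_neg, neg_eq_zero] at this
    rw [integral_smul_const, this, zero_smul]
  have e3 : commut n U (fun _ => c) x = 0 := by
    simp only [commut, map_sub, sub_smul]
    rw [integral_sub (i2 _ hc) i3, e1, e2, sub_zero]
  rw [← sub_zero (commut n U b x), ← e3]
  simp only [commut, map_sub, sub_smul, smul_sub]
  exact (integral_sub ((i2 _ hb).sub i1) ((i2 _ hc).sub i3)).symm

lemma aestronglyMeasurable_commut {U : Space N → Space N} (hU : AEStronglyMeasurable U)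
    {b : Space N → F} (hb : AEStronglyMeasurable b) (n : ℕ) : AEStronglyMeasurable (commut n U b) := by
  have hk : AEStronglyMeasurable (fun z : Space N × Space N => fderiv ℝ (moll n) (z.1 - z.2))
      ((volume : Measure (Space N)).prod volume) :=
    ((isBump_moll n).continuous_fderiv.comp (by fun_prop)).aestronglyMeasurable
  exact ((aestronglyMeasurable_clm_apply hk (hU.comp_fst.sub hU.comp_snd)).smul
    hb.comp_snd).integral_prod_right'

/-- The commutator is controlled by averages over small balls. -/
lemma norm_commut_le {C : ℝ} (hC : ∀ (n : ℕ) (z : Space N), ‖z‖ * ‖fderiv ℝ (moll n) z‖ ≤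
      C * (volume.real (Metric.closedBall (0 : Space N) (1 / (n + 1))))⁻¹)
    {U : Space N → Space N} {L : ℝ} (hL : 0 ≤ L) {S : Set (Space N)} (hS : ∀ᵐ x, x ∈ S)
    (hSL : ∀ x ∈ S, ∀ y ∈ S, ‖U x - U y‖ ≤ L * ‖x - y‖) {b : Space N → F}
    (hb : LocallyIntegrable b) (n : ℕ) {x : Space N} (hx : x ∈ S) :
    ‖commut n U b x‖ ≤ L * C * ⨍ y in Metric.closedBall x (1 / (n + 1)), ‖b y‖ := by
  set B := Metric.closedBall x (1 / ((n : ℝ) + 1)) with hB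
  have hv : volume.real B = volume.real (Metric.closedBall (0 : Space N) (1 / (n + 1))) := by
    rw [Measure.real, Measure.real, hB, Measure.addHaar_closedBall_center]
  have e : commut n U b x = ∫ y in B, fderiv ℝ (moll n) (x - y) (U x - U y) • b y := by
    refine (setIntegral_eq_integral_of_forall_compl_eq_zero fun y hy => ?_).symm
    rw [hB, Metric.mem_closedBall, dist_comm, dist_eq_norm, not_le] at hy
    rw [fderiv_moll_eq_zero hy]; simp
  rw [e, setAverage_eq, smul_eq_mul, hv, ← mul_assoc, ← integral_const_mul]
  refine norm_integral_le_of_norm_le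
    (((locallyIntegrable_norm hb).integrableOn_isCompact (isCompact_closedBall _ _)).const_mul _) ?_
  filter_upwards [ae_restrict_of_ae hS] with y hy
  rw [norm_smul]
  refine mul_le_mul_of_nonneg_right (((fderiv ℝ (moll n) (x - y)).le_opNorm _).trans ?_) (norm_nonneg _)
  calc _ ≤ ‖fderiv ℝ (moll n) (x - y)‖ * (L * ‖x - y‖) :=
        mul_le_mul_of_nonneg_left (hSL x hx y hy) (norm_nonneg _)
    _ = L * (‖x - y‖ * ‖fderiv ℝ (moll n) (x - y)‖) := by ring
    _ ≤ _ := by rw [mul_assoc]; exact mul_le_mul_of_nonneg_left (hC n _) hL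

/-- Subtracting the constant b(x) makes the bound of `norm_commut_le` the mean oscillation of b
around x, which tends to zero at Lebesgue points. The limit of the kernel integrals themselves is
never needed. -/
lemma ae_tendsto_commut [FiniteDimensional ℝ F] {U : Space N → Space N} (hU : WeakDivFree U) {m L : ℝ}
    (hgr : ∀ᵐ x, ‖U x‖ ≤ m + L * ‖x‖) (hL : 0 ≤ L) {S : Set (Space N)} (hS : ∀ᵐ x, x ∈ S)
    (hSL : ∀ x ∈ S, ∀ y ∈ S, ‖U x - U y‖ ≤ L * ‖x - y‖) {b : Space N → F}
    (hb : LocallyIntegrable b) :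
    ∀ᵐ x, Tendsto (fun n => commut n U b x) atTop (𝓝 0) := by
  obtain ⟨C, -, hC⟩ := exists_norm_mul_norm_fderiv_moll_le N
  filter_upwards [hS, (Besicovitch.vitaliFamily volume).ae_tendsto_average_norm_sub hb] with x hx hx'
  have hr : Tendsto (fun n : ℕ => 1 / ((n : ℝ) + 1)) atTop (𝓝[>] 0) :=
    tendsto_nhdsWithin_iff.2 ⟨tendsto_one_div_add_atTop_nhds_zero_nat,
      Eventually.of_forall fun n => by simp only [mem_Ioi]; positivity⟩
  have h1 := (hx'.comp ((Besicovitch.tendsto_filterAt volume x).comp hr)).const_mul (L * C)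
  rw [mul_zero] at h1
  refine squeeze_zero_norm (fun n => ?_) h1
  have := FiniteDimensional.complete ℝ F
  rw [commut_eq_sub hU hgr hb n (b x) x]
  exact norm_commut_le hC hL hS hSL (hb.sub continuous_const.locallyIntegrable) n hx

lemma HasWeakDeriv.of_tendsto (hT : 0 < T) {γ g : ℕ → ℝ → F} {γ₀ g₀ : ℝ → F} {κ : ℝ → ℝ}
    (h : ∀ n, HasWeakDeriv T (γ n) (g n)) (hκ : TimeInt T κ)
    (hγ : ∀ n, ∀ᵐ t ∂volume.restrict (Ioo 0 T), ‖γ n t‖ ≤ κ t)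
    (hg : ∀ n, ∀ᵐ t ∂volume.restrict (Ioo 0 T), ‖g n t‖ ≤ κ t)
    (hγ₀ : ∀ᵐ t ∂volume.restrict (Ioo 0 T), Tendsto (fun n => γ n t) atTop (𝓝 (γ₀ t)))
    (hg₀ : ∀ᵐ t ∂volume.restrict (Ioo 0 T), Tendsto (fun n => g n t) atTop (𝓝 (g₀ t))) :
    HasWeakDeriv T γ₀ g₀ := by
  have key {f : ℕ → ℝ → F} {f₀ : ℝ → F} (hf : ∀ n, TimeInt T (f n))
      (hb : ∀ n, ∀ᵐ t ∂volume.restrict (Ioo 0 T), ‖f n t‖ ≤ κ t)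
      (hl : ∀ᵐ t ∂volume.restrict (Ioo 0 T), Tendsto (fun n => f n t) atTop (𝓝 (f₀ t))) :
      TimeInt T f₀ ∧ ∀ φ, IsTimeTest T φ →
        Tendsto (fun n => ∫ t, φ t • f n t) atTop (𝓝 (∫ t, φ t • f₀ t)) := by
    refine ⟨fun s t hs ht => ?_, fun φ hφ => ?_⟩
    · refine (hκ s t hs ht).mono' (aestronglyMeasurable_of_tendsto_ae atTop
        (fun n => (hf n s t hs ht).1) (ae_restrict_Icc_of_Ioo hl hs ht)) ?_
      filter_upwards [ae_restrict_Icc_of_Ioo hl hs ht,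
        ae_all_iff.2 fun n => ae_restrict_Icc_of_Ioo (hb n) hs ht] with r h1 h2
      exact le_of_tendsto h1.norm (Eventually.of_forall h2)
    · have h0 (t : ℝ) (ht : t ∉ Ioo 0 T) : φ t = 0 :=
        image_eq_zero_of_notMem_tsupport fun h => ht (hφ.subset h)
      refine tendsto_integral_of_dominated_convergence (fun t => ‖φ t • κ t‖)
        (fun n => ((hf n).integrable_smul hT hφ).1) (hκ.integrable_smul hT hφ).norm (fun n => ?_) ?_
      · filter_upwards [(ae_restrict_iff' measurableSet_Ioo).1 (hb n)] with t ht
        by_cases htT : t ∈ Ioo 0 T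
        · rw [norm_smul, norm_smul]
          exact mul_le_mul_of_nonneg_left ((ht htT).trans (Real.le_norm_self _)) (norm_nonneg _)
        · simp [h0 t htT]
      · filter_upwards [(ae_restrict_iff' measurableSet_Ioo).1 hl] with t ht
        by_cases htT : t ∈ Ioo 0 T
        · exact (ht htT).const_smul _
        · simp [h0 t htT]
  obtain ⟨h1, h2⟩ := key (fun n => (h n).1) hγ hγ₀
  obtain ⟨h3, h4⟩ := key (fun n => (h n).2.1) hg hg₀
  refine ⟨h1, h3, fun φ hφ => ?_⟩
  refine tendsto_nhds_unique (h2 _ hφ.deriv_test) ?_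
  simp only [(h _).2.2 φ hφ]
  exact (h4 φ hφ).neg

lemma norm_integral_le_of_radius {f : Space N → F} {R κ : ℝ} (h0 : ∀ x, R < ‖x‖ → f x = 0)
    (h : ∀ᵐ x, ‖x‖ ≤ R → ‖f x‖ ≤ κ) :
    ‖∫ x, f x‖ ≤ κ * volume.real (Metric.closedBall (0 : Space N) R) := by
  rw [← setIntegral_eq_integral_of_forall_compl_eq_zero (s := Metric.closedBall (0 : Space N) R)
    fun x hx => h0 x (by simpa using hx)]
  refine norm_setIntegral_le_of_norm_le_const_ae measure_closedBall_lt_top ?_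
  rw [ae_restrict_iff' measurableSet_closedBall]
  filter_upwards [h] with x hx hxR
  exact hx (by simpa using hxR)

lemma unifLoc_of_bound {b : ℝ → Space N → F} (hb : LocInt T b) {M : ℝ}
    (hM : ∀ᵐ t ∂volume.restrict (Ioo 0 T), ∀ᵐ x, ‖b t x‖ ≤ M) :
    UnifLoc T b fun _ => M * volume.real (Metric.closedBall (0 : Space N) 1) := by
  refine ⟨hb.aestronglyMeasurable, timeInt_const T _, ?_⟩
  filter_upwards [hb.ae_locallyIntegrable, hM] with t h1 h2
  refine ⟨h1, fun x => ?_⟩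
  have := norm_setIntegral_le_of_norm_le_const_ae (f := fun y => ‖b t y‖) (C := M)
    (measure_closedBall_lt_top (μ := (volume : Measure (Space N))) (x := x) (r := 1))
    ((ae_restrict_of_ae h2).mono fun y hy => by rwa [norm_norm])
  refine (Real.le_norm_self _).trans (this.trans_eq ?_)
  rw [Measure.real, Measure.real, Measure.addHaar_closedBall_center]

lemma average_norm_le {b : Space N → F} {M : ℝ} (h : ∀ᵐ x, ‖b x‖ ≤ M)
    (x : Space N) {r : ℝ} (hr : 0 < r) : ⨍ y in Metric.closedBall x r, ‖b y‖ ≤ M := by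
  have hv : 0 < volume.real (Metric.closedBall x r) :=
    ENNReal.toReal_pos (Metric.measure_closedBall_pos _ _ hr).ne' measure_closedBall_lt_top.ne
  rw [setAverage_eq, smul_eq_mul, inv_mul_le_iff₀ hv]
  have := norm_setIntegral_le_of_norm_le_const_ae (f := fun y => ‖b y‖) (C := M)
    (measure_closedBall_lt_top (μ := (volume : Measure (Space N))) (x := x) (r := r))
    ((ae_restrict_of_ae h).mono fun y hy => by rwa [norm_norm])
  rw [mul_comm]
  exact (Real.le_norm_self _).trans this

/-- The equation for functions of the mollified solution is passed to the limit. The commutator is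
bounded by a multiple of L(t)M and tends to zero almost everywhere, so dominated convergence applies
in space and then in time. -/
theorem TransportEq.comp_of_bounded [FiniteDimensional ℝ F] (hT : 0 < T)
    {U : ℝ → Space N → Space N} {m L : ℝ → ℝ} (hU : LipFlow T U m L) {b : ℝ → Space N → F}
    (hb : LocInt T b) {M : ℝ} (hM0 : 0 ≤ M)
    (hM : ∀ᵐ t ∂volume.restrict (Ioo 0 T), ∀ᵐ x, ‖b t x‖ ≤ M)
    (heq : TransportEq T U b 0) {Φ : F → ℝ} (hΦ : ContDiff ℝ 1 Φ) :
    TransportEq T U (fun t x => Φ (b t x)) 0 := by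
  intro ψ hψ
  have hbU := unifLoc_of_bound hb hM
  have hh : UnifLoc T (0 : ℝ → Space N → F) fun _ => (0 : ℝ) :=
    ⟨aestronglyMeasurable_const (b := (0 : F)), timeInt_const T _, ae_of_all _ fun t =>
      ⟨locallyIntegrable_zero, fun x => by simp⟩⟩
  obtain ⟨C, hC0, hC⟩ := exists_norm_mul_norm_fderiv_moll_le N
  obtain ⟨R, hR, hR'⟩ := exists_radius hψ.2
  obtain ⟨Cψ, hCψ0, hCψ⟩ := hψ.exists_bound
  obtain ⟨D, hD0, hD⟩ := hψ.exists_bound_fderiv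
  have hΦd : Continuous (fderiv ℝ Φ) := hΦ.continuous_fderiv (by simp)
  obtain ⟨B₀, hB₀⟩ := (isCompact_closedBall (0 : F) M).exists_bound_of_continuousOn
    hΦ.continuous.continuousOn
  obtain ⟨B₁, hB₁⟩ := (isCompact_closedBall (0 : F) M).exists_bound_of_continuousOn
    hΦd.continuousOn
  have hB₀0 : 0 ≤ B₀ := (norm_nonneg _).trans (hB₀ 0 (by simpa using hM0))
  have hB₁0 : 0 ≤ B₁ := (norm_nonneg _).trans (hB₁ 0 (by simpa using hM0))
  set W := volume.real (Metric.closedBall (0 : Space N) R)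
  have hmol : ∀ᵐ t ∂volume.restrict (Ioo 0 T), ∀ n x, mollify n (b t) x ∈ Metric.closedBall (0 : F) M := by
    filter_upwards [hM] with t ht n x
    rw [mem_closedBall_zero_iff]
    exact norm_mollify_le hM0 (ht.mono fun y hy _ => hy) n
  have hcom : ∀ᵐ t ∂volume.restrict (Ioo 0 T), ∀ᵐ x, ∀ n, ‖commut n (U t) (b t) x‖ ≤ L t * C * M := by
    filter_upwards [hM, hU.lipschitz, hb.ae_locallyIntegrable] with t ht ⟨S, hS, hSL⟩ hbt
    filter_upwards [hS] with x hx n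
    refine (norm_commut_le hC (hU.nonneg_L t) hS hSL hbt n hx).trans ?_
    exact mul_le_mul_of_nonneg_left (average_norm_le ht x (by positivity))
      (mul_nonneg (hU.nonneg_L t) hC0)
  have hbd : ∀ᵐ t ∂volume.restrict (Ioo 0 T), ∀ᵐ x, ∀ n, ‖x‖ ≤ R →
      ‖ψ x * fderiv ℝ Φ (mollify n (b t) x) (commut n (U t) (b t) x) +
        Φ (mollify n (b t) x) * fderiv ℝ ψ x (U t x)‖ ≤
      Cψ * B₁ * C * M * L t + B₀ * D * (m t + R * L t) := by
    filter_upwards [hmol, hcom, hU.growth] with t h1 h2 h3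
    filter_upwards [h2, h3] with x h2 h3 n hx
    refine (norm_add_le _ _).trans (add_le_add ?_ ?_)
    · rw [norm_mul]
      calc _ ≤ Cψ * (B₁ * (L t * C * M)) := by
            refine mul_le_mul (hCψ x) (((fderiv ℝ Φ _).le_opNorm _).trans ?_) (norm_nonneg _) hCψ0
            exact mul_le_mul (hB₁ _ (h1 n x)) (h2 n) (norm_nonneg _) hB₁0
        _ = _ := by ring
    · rw [norm_mul, mul_assoc]
      refine mul_le_mul (hB₀ _ (h1 n x)) (((fderiv ℝ ψ x).le_opNorm _).trans ?_) (norm_nonneg _) hB₀0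
      refine mul_le_mul (hD x) (h3.trans ?_) (norm_nonneg _) hD0
      rw [mul_comm R]
      exact add_le_add_right (mul_le_mul_of_nonneg_left hx (hU.nonneg_L t)) _
  refine HasWeakDeriv.of_tendsto hT (κ := fun t => (Cψ * B₀ + (Cψ * B₁ * C * M * L t + B₀ * D * (m t + R * L t))) * W)
    (fun n => hasWeakDeriv_integral_comp_mollify hT hU hbU hh heq hΦ hψ n) ?_ (fun n => ?_) (fun n => ?_) ?_ ?_
  · have := ((((timeInt_const T (Cψ * B₀)).add ((hU.timeInt_L.const_mul (Cψ * B₁ * C * M)).add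
      ((hU.timeInt_m.add (hU.timeInt_L.const_mul R)).const_mul (B₀ * D))))).const_mul W)
    simpa only [mul_comm W] using this
  · filter_upwards [hmol] with t h1
    refine (norm_integral_le_of_radius (κ := Cψ * B₀) (fun x hx => by rw [hR' x hx, zero_mul])
      (ae_of_all _ fun x _ => ?_)).trans ?_
    · rw [norm_mul]; exact mul_le_mul (hCψ x) (hB₀ _ (h1 n x)) (norm_nonneg _) hCψ0
    · refine mul_le_mul_of_nonneg_right (le_add_of_nonneg_right ?_) measureReal_nonneg
      have := hU.nonneg_L t; have := hU.nonneg_m t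
      positivity
  · filter_upwards [hbd] with t h1
    simp only [Pi.zero_apply, show (0 : ℝ → Space N → F) t = 0 from rfl, mollify_zero, zero_add]
    refine (norm_integral_le_of_radius (fun x hx => ?_) (h1.mono fun x hx => hx n)).trans ?_
    · rw [hR' x hx, fderiv_eq_zero_of_radius hR' hx]; simp
    · exact mul_le_mul_of_nonneg_right (le_add_of_nonneg_left (by positivity)) measureReal_nonneg
  · filter_upwards [hmol, hb.ae_locallyIntegrable] with t h1 h2
    refine tendsto_integral_of_bdd_support (k := fun _ => Cψ * B₀) (R := R) (fun n => ?_)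
      continuous_const.locallyIntegrable (fun n => ae_of_all _ fun x hx => by rw [hR' x hx, zero_mul])
      (fun n => ae_of_all _ fun x _ => ?_) ?_
    · exact (hψ.continuous.mul (hΦ.continuous.comp (contDiff_mollify h2 n).continuous)).aestronglyMeasurable
    · rw [norm_mul]; exact mul_le_mul (hCψ x) (hB₀ _ (h1 n x)) (norm_nonneg _) hCψ0
    · filter_upwards [ae_tendsto_mollify h2] with x hx
      exact ((hΦ.continuous.tendsto _).comp hx).const_mul _
  · filter_upwards [hbd, hb.ae_locallyIntegrable, hU.divFree, hU.lipschitz, hU.growth]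
      with t h1 h2 h3 ⟨S, hS, hSL⟩ h5
    simp only [Pi.zero_apply, show (0 : ℝ → Space N → F) t = 0 from rfl, mollify_zero, zero_add]
    refine tendsto_integral_of_bdd_support
      (k := fun _ => Cψ * B₁ * C * M * L t + B₀ * D * (m t + R * L t)) (R := R) (fun n => ?_)
      continuous_const.locallyIntegrable (fun n => ae_of_all _ fun x hx => ?_)
      (fun n => h1.mono fun x hx => hx n) ?_
    · have hsm := (contDiff_mollify h2 n).continuous
      exact (hψ.continuous.aestronglyMeasurable.mul (aestronglyMeasurable_clm_apply
        (hΦd.comp hsm).aestronglyMeasurable (aestronglyMeasurable_commut h3.1.aestronglyMeasurable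
          h2.aestronglyMeasurable n))).add ((hΦ.continuous.comp hsm).aestronglyMeasurable.mul
        (aestronglyMeasurable_clm_apply hψ.continuous_fderiv.aestronglyMeasurable
          h3.1.aestronglyMeasurable))
    · rw [hR' x hx, fderiv_eq_zero_of_radius hR' hx]; simp
    · filter_upwards [ae_tendsto_mollify h2, ae_tendsto_commut h3 h5 (hU.nonneg_L t) hS hSL h2] with x h6 h7
      have h6' : Tendsto (fun n => fderiv ℝ Φ (mollify n (b t) x)) atTop (𝓝 (fderiv ℝ Φ (b t x))) :=
        (hΦd.tendsto _).comp h6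
      have h8 : Tendsto (fun n => fderiv ℝ Φ (mollify n (b t) x) (commut n (U t) (b t) x)) atTop
          (𝓝 (fderiv ℝ Φ (b t x) 0)) :=
        (isBoundedBilinearMap_apply.continuous.tendsto (fderiv ℝ Φ (b t x), (0 : F))).comp
          (h6'.prodMk_nhds h7)
      have h9 := (h8.const_mul (ψ x)).add (((hΦ.continuous.tendsto _).comp h6).mul_const
        (fderiv ℝ ψ x (U t x)))
      simpa [mul_comm] using h9

/-- Renormalisation requires a function that is C¹ on the whole line, while inversion is only needed
on the range of the density. The transition function switches inversion on between c/2 and c. -/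
lemma exists_contDiff_eq_inv {c : ℝ} (hc : 0 < c) :
    ∃ Φ : ℝ → ℝ, ContDiff ℝ 1 Φ ∧ ∀ r, c ≤ r → Φ r = 1 / r := by
  refine ⟨fun r => r⁻¹ * Real.smoothTransition (2 * r / c - 1), ?_, fun r hr => ?_⟩
  · rw [contDiff_iff_contDiffAt]
    intro r
    rcases lt_or_ge r (c / 2) with hr | hr
    · refine (contDiffAt_const (c := (0 : ℝ))).congr_of_eventuallyEq ?_
      filter_upwards [Iio_mem_nhds hr] with s hs
      rw [Real.smoothTransition.zero_of_nonpos, mul_zero]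
      rw [sub_nonpos, div_le_one hc]; linarith [mem_Iio.1 hs]
    · have hr0 : r ≠ 0 := by linarith
      exact (contDiffAt_inv ℝ hr0).mul
        (Real.smoothTransition.contDiffAt.comp r (by fun_prop))
  · simp only
    rw [Real.smoothTransition.one_of_one_le, mul_one, one_div]
    rw [le_sub_iff_add_le, le_div_iff₀ hc]; linarith

/-- The inverse of the density solves the transport equation. -/
theorem TransportEq.one_div (hT : 0 < T) {U : ℝ → Space N → Space N} {m L : ℝ → ℝ}
    (hU : LipFlow T U m L) {ρ : ℝ → Space N → ℝ} (hρ : LocInt T ρ) {c M : ℝ} (hc : 0 < c)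
    (hρb : ∀ᵐ t ∂volume.restrict (Ioo 0 T), ∀ᵐ x, c ≤ ρ t x ∧ ρ t x ≤ M)
    (heq : TransportEq T U ρ 0) : TransportEq T U (fun t x => 1 / ρ t x) 0 := by
  obtain ⟨Φ, hΦ, hΦ'⟩ := exists_contDiff_eq_inv hc
  have h1 : ∀ᵐ t ∂volume.restrict (Ioo 0 T), ∀ᵐ x, ‖ρ t x‖ ≤ max M 0 := by
    filter_upwards [hρb] with t ht
    filter_upwards [ht] with x hx
    rw [Real.norm_of_nonneg (hc.le.trans hx.1)]
    exact hx.2.trans (le_max_left _ _)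
  intro ψ hψ
  refine (heq.comp_of_bounded hT hU hρ (le_max_right _ _) h1 hΦ ψ hψ).congr ?_ ?_
  · filter_upwards [hρb] with t ht
    exact integral_congr_ae (ht.mono fun x hx => by simp only [hΦ' _ hx.1])
  · filter_upwards [hρb] with t ht
    exact integral_congr_ae (ht.mono fun x hx => by simp only [hΦ' _ hx.1])

end BoundedRenormalisation

end DensityEuler
end

noncomputable section
namespace DensityEuler
set_option linter.unusedSectionVars false

variable {N : ℕ}

/-! ### Young's inequality and its consequences -/

section Young

variable {F : Type*} [NormedAddCommGroup F] [NormedSpace ℝ F] {p q : ℝ≥0∞}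

/-- Hölder's inequality with k = k^(1/r)·k^(1/s): k serves as a weight of finite mass. -/
lemma lintegral_mul_rpow_le {α : Type*} [MeasurableSpace α] {μ : Measure α} {r : ℝ} (hr : 1 < r)
    {k f : α → ℝ≥0∞} (hk : AEMeasurable k μ) (hf : AEMeasurable f μ) :
    (∫⁻ y, k y * f y ∂μ) ^ r ≤ (∫⁻ y, k y ∂μ) ^ (r - 1) * ∫⁻ y, k y * f y ^ r ∂μ := by
  have hrs := Real.HolderConjugate.conjExponent hr
  set s := r.conjExponent
  have hr0 : 0 < r := by linarith
  have h1 := ENNReal.lintegral_mul_le_Lp_mul_Lq μ hrs ((hk.pow_const r⁻¹).mul hf) (hk.pow_const s⁻¹)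
  have e1 (y : α) : (k y ^ r⁻¹ * f y) ^ r = k y * f y ^ r := by
    rw [ENNReal.mul_rpow_of_nonneg _ _ hr0.le, ← ENNReal.rpow_mul, inv_mul_cancel₀ hr0.ne',
      ENNReal.rpow_one]
  have e2 (y : α) : (k y ^ s⁻¹) ^ s = k y := by
    rw [← ENNReal.rpow_mul, inv_mul_cancel₀ hrs.symm.ne_zero, ENNReal.rpow_one]
  have e3 (y : α) : k y ^ r⁻¹ * f y * k y ^ s⁻¹ = k y * f y := by
    rw [mul_right_comm, ← ENNReal.rpow_add_of_nonneg _ _ (by positivity)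
      (inv_nonneg.2 hrs.symm.nonneg), hrs.inv_add_inv_eq_one, ENNReal.rpow_one]
  simp only [Pi.mul_apply, e1, e2, e3] at h1
  refine (ENNReal.rpow_le_rpow h1 hr0.le).trans_eq ?_
  rw [ENNReal.mul_rpow_of_nonneg _ _ hr0.le, ← ENNReal.rpow_mul, ← ENNReal.rpow_mul, mul_comm,
    one_div_mul_cancel hr0.ne', ENNReal.rpow_one]
  congr 2
  rw [one_div, eq_sub_of_add_eq' hrs.inv_add_inv_eq_one, sub_mul, one_mul, inv_mul_cancel₀ hr0.ne']

/-- Young's inequality for an L¹ kernel, assuming only a pointwise domination of g. In this form it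
covers both mollification and the commutator, which is not itself a convolution. -/
lemma eLpNorm_le_of_kernel (hp1 : 1 < p) (hp : p ≠ ⊤) {k : Space N → ℝ≥0∞} (hk : Measurable k)
    {A : ℝ≥0∞} (hA : ∫⁻ z, k z ≤ A) {f : Space N → F} (hf : AEStronglyMeasurable f) {G : Type*}
    [NormedAddCommGroup G] {g : Space N → G} (h : ∀ᵐ x, ‖g x‖ₑ ≤ ∫⁻ y, k (x - y) * ‖f y‖ₑ) :
    eLpNorm g p volume ≤ A * eLpNorm f p volume := by
  have hp0 : p ≠ 0 := (zero_lt_one.trans hp1).ne'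
  have hr1 : 1 < p.toReal := by
    rw [← ENNReal.toReal_one]; exact (ENNReal.toReal_lt_toReal (by simp) hp).2 hp1
  rw [eLpNorm_eq_lintegral_rpow_enorm_toReal hp0 hp, eLpNorm_eq_lintegral_rpow_enorm_toReal hp0 hp]
  set r := p.toReal
  have hr0 : 0 < r := by linarith
  have hkm (x : Space N) : Measurable fun y => k (x - y) := hk.comp (by fun_prop)
  have hkx (x : Space N) : ∫⁻ y, k (x - y) ≤ A := by
    rw [lintegral_sub_left_eq_self k x]; exact hA
  have hkx' (y : Space N) : ∫⁻ x, k (x - y) ≤ A := by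
    rw [lintegral_sub_right_eq_self k y]; exact hA
  have h1 : ∫⁻ x, ‖g x‖ₑ ^ r ≤ A ^ r * ∫⁻ y, ‖f y‖ₑ ^ r := by
    calc ∫⁻ x, ‖g x‖ₑ ^ r ≤ ∫⁻ x, A ^ (r - 1) * ∫⁻ y, k (x - y) * ‖f y‖ₑ ^ r := by
          refine lintegral_mono_ae ?_
          filter_upwards [h] with x hx
          refine (ENNReal.rpow_le_rpow hx hr0.le).trans
            ((lintegral_mul_rpow_le hr1 (hkm x).aemeasurable hf.enorm).trans ?_)
          exact mul_le_mul_left (ENNReal.rpow_le_rpow (hkx x) (by linarith)) _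
      _ = A ^ (r - 1) * ∫⁻ x, ∫⁻ y, k (x - y) * ‖f y‖ₑ ^ r := by
          rw [lintegral_const_mul'']
          exact AEMeasurable.lintegral_prod_right' (f := fun z : Space N × Space N =>
            k (z.1 - z.2) * ‖f z.2‖ₑ ^ r) (((hk.comp (by fun_prop)).aemeasurable).mul
              (hf.enorm.pow_const r).comp_snd)
      _ = A ^ (r - 1) * ∫⁻ y, ‖f y‖ₑ ^ r * ∫⁻ x, k (x - y) := by
          congr 1
          rw [lintegral_lintegral_swap (((hk.comp (by fun_prop)).aemeasurable).mul
              (hf.enorm.pow_const r).comp_snd)]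
          congr 1; ext y
          have hky : Measurable fun x => k (x - y) := hk.comp (by fun_prop)
          rw [← lintegral_const_mul _ hky]
          simp only [mul_comm]
      _ ≤ A ^ (r - 1) * ∫⁻ y, ‖f y‖ₑ ^ r * A := by gcongr with y; exact hkx' y
      _ = A ^ r * ∫⁻ y, ‖f y‖ₑ ^ r := by
          rw [lintegral_mul_const'' _ (hf.enorm.pow_const r), mul_comm _ A, ← mul_assoc]
          congr 1
          conv_lhs => rw [← ENNReal.rpow_one A, ← ENNReal.rpow_mul, mul_comm (1 : ℝ), mul_one]
          rw [← ENNReal.rpow_add_of_nonneg _ _ (by linarith) zero_le_one, sub_add_cancel]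
  refine (ENNReal.rpow_le_rpow h1 (by positivity)).trans_eq ?_
  rw [ENNReal.mul_rpow_of_nonneg _ _ (by positivity), ← ENNReal.rpow_mul, mul_one_div_cancel hr0.ne',
    ENNReal.rpow_one]

lemma eLpNorm_mollify_le (hp1 : 1 < p) (hp : p ≠ ⊤) {f : Space N → F} (hf : MemLp f p) (n : ℕ) :
    eLpNorm (mollify n f) p volume ≤ eLpNorm f p volume := by
  rw [← one_mul (eLpNorm f p volume)]
  refine eLpNorm_le_of_kernel hp1 hp (k := fun z => ‖moll n z‖ₑ)
    (isBump_moll n).continuous.enorm.measurable (le_of_eq ?_) hf.1 (ae_of_all _ fun x => ?_)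
  · have h1 := ofReal_integral_eq_lintegral_ofReal (isBump_moll (N := N) n).integrable
      (ae_of_all _ fun z => moll_nonneg n z)
    rw [integral_moll, ENNReal.ofReal_one] at h1
    rw [h1]
    exact lintegral_congr fun z => Real.enorm_of_nonneg (moll_nonneg n z)
  · refine (enorm_integral_le_lintegral_enorm _).trans_eq ?_
    simp only [enorm_smul]

lemma memLp_mollify (hp1 : 1 < p) (hp : p ≠ ⊤) {f : Space N → F} (hf : MemLp f p) (n : ℕ) :
    MemLp (mollify n f) p :=
  ⟨(contDiff_mollify (hf.locallyIntegrable hp1.le) n).continuous.aestronglyMeasurable,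
    (eLpNorm_mollify_le hp1 hp hf n).trans_lt hf.2⟩

lemma lpNorm_mollify_le (hp1 : 1 < p) (hp : p ≠ ⊤) {f : Space N → F} (hf : MemLp f p) (n : ℕ) :
    lpNorm (mollify n f) p volume ≤ lpNorm f p volume := by
  rw [← toReal_eLpNorm hf.1, ← toReal_eLpNorm (memLp_mollify hp1 hp hf n).1]
  exact ENNReal.toReal_mono hf.2.ne (eLpNorm_mollify_le hp1 hp hf n)

/-- The kernel is at most C over the volume of its support ball, so its mass is bounded
independently of the mollification scale. -/
lemma exists_lintegral_kernel_le (N : ℕ) : ∃ C, 0 ≤ C ∧ ∀ n : ℕ,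
    ∫⁻ z : Space N, ‖z‖ₑ * ‖fderiv ℝ (moll n) z‖ₑ ≤ ENNReal.ofReal C := by
  obtain ⟨C, hC0, hC⟩ := exists_norm_mul_norm_fderiv_moll_le N
  refine ⟨C, hC0, fun n => ?_⟩
  set B := Metric.closedBall (0 : Space N) (1 / ((n : ℝ) + 1)) with hB
  have hB0 : volume B ≠ 0 := (Metric.measure_closedBall_pos _ _ (by positivity)).ne'
  have hBt : volume B ≠ ⊤ := measure_closedBall_lt_top.ne
  calc _ ≤ ∫⁻ z, B.indicator (fun _ => ENNReal.ofReal (C * (volume.real B)⁻¹)) z := by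
        refine lintegral_mono fun z => ?_
        by_cases hz : z ∈ B
        · rw [indicator_of_mem hz, ← ofReal_norm, ← ofReal_norm, ← ENNReal.ofReal_mul (norm_nonneg _)]
          exact ENNReal.ofReal_le_ofReal (hC n z)
        · rw [hB, mem_closedBall_zero_iff, not_le] at hz
          rw [← ofReal_norm (fderiv ℝ (moll n) z), fderiv_moll_eq_zero hz, norm_zero,
            ENNReal.ofReal_zero, mul_zero]
          exact zero_le
    _ = ENNReal.ofReal C := by
        rw [lintegral_indicator_const measurableSet_closedBall, ENNReal.ofReal_mul hC0,
          ENNReal.ofReal_inv_of_pos (show 0 < volume.real B from ENNReal.toReal_pos hB0 hBt),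
          Measure.real, ENNReal.ofReal_toReal hBt, mul_assoc, ENNReal.inv_mul_cancel hB0 hBt, mul_one]

/-- The commutator is bounded in `L^p`. -/
lemma exists_eLpNorm_commut_le (N : ℕ) (hp1 : 1 < p) (hp : p ≠ ⊤) : ∃ C, 0 ≤ C ∧
    ∀ (U : Space N → Space N) (L : ℝ) (S : Set (Space N)) (b : Space N → F) (n : ℕ), 0 ≤ L →
      (∀ᵐ x, x ∈ S) → (∀ x ∈ S, ∀ y ∈ S, ‖U x - U y‖ ≤ L * ‖x - y‖) → AEStronglyMeasurable b →
      eLpNorm (commut n U b) p volume ≤ ENNReal.ofReal (C * L) * eLpNorm b p volume := by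
  obtain ⟨C, hC0, hC⟩ := exists_lintegral_kernel_le N
  refine ⟨C, hC0, fun U L S b n hL hS hSL hb => ?_⟩
  have hm : Measurable fun z : Space N => ‖z‖ₑ * ‖fderiv ℝ (moll n) z‖ₑ :=
    measurable_enorm.mul (isBump_moll n).continuous_fderiv.enorm.measurable
  refine eLpNorm_le_of_kernel hp1 hp (k := fun z => ENNReal.ofReal L * (‖z‖ₑ * ‖fderiv ℝ (moll n) z‖ₑ))
    (hm.const_mul _) ?_ hb ?_
  · rw [lintegral_const_mul _ hm, mul_comm C, ENNReal.ofReal_mul hL]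
    gcongr; exact hC n
  · filter_upwards [hS] with x hx
    refine (enorm_integral_le_lintegral_enorm _).trans (lintegral_mono_ae ?_)
    filter_upwards [hS] with y hy
    rw [enorm_smul]
    gcongr
    rw [← ofReal_norm, ← ofReal_norm, ← ofReal_norm, ← ENNReal.ofReal_mul (norm_nonneg _),
      ← ENNReal.ofReal_mul hL]
    refine ENNReal.ofReal_le_ofReal (((fderiv ℝ (moll n) (x - y)).le_opNorm _).trans ?_)
    calc _ ≤ ‖fderiv ℝ (moll n) (x - y)‖ * (L * ‖x - y‖) :=
          mul_le_mul_of_nonneg_left (hSL x hx y hy) (norm_nonneg _)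
      _ = _ := by ring

/-- Hölder's inequality on unit balls, all of the same volume: the constant does not depend on the
centre, as `UnifLoc` demands. -/
lemma exists_integral_ball_le (N : ℕ) (hp1 : 1 < p) : ∃ C, 0 ≤ C ∧ ∀ f : Space N → F, MemLp f p →
    ∀ x, ∫ y in Metric.closedBall x 1, ‖f y‖ ≤ C * lpNorm f p volume := by
  set e : ℝ := 1 / (1 : ℝ≥0∞).toReal - 1 / p.toReal with he
  set W := volume (Metric.closedBall (0 : Space N) 1) with hW
  have hW0 : W ≠ 0 := (Metric.measure_closedBall_pos _ _ one_pos).ne'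
  have hWt : W ≠ ⊤ := measure_closedBall_lt_top.ne
  refine ⟨(W ^ e).toReal, ENNReal.toReal_nonneg, fun f hf x => ?_⟩
  have h1 := eLpNorm_le_eLpNorm_mul_rpow_measure_univ
    (μ := volume.restrict (Metric.closedBall x 1)) hp1.le hf.1.restrict
  rw [Measure.restrict_apply_univ, Measure.addHaar_closedBall_center, ← hW, ← he] at h1
  have h2 : eLpNorm f p (volume.restrict (Metric.closedBall x 1)) ≤ eLpNorm f p volume :=
    eLpNorm_mono_measure _ Measure.restrict_le_self
  have h3 : eLpNorm f 1 (volume.restrict (Metric.closedBall x 1)) ≤ eLpNorm f p volume * W ^ e := by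
    refine h1.trans ?_
    gcongr
  rw [integral_norm_eq_lintegral_enorm hf.1.restrict, ← eLpNorm_one_eq_lintegral_enorm,
    ← toReal_eLpNorm hf.1, mul_comm, ← ENNReal.toReal_mul]
  exact ENNReal.toReal_mono (ENNReal.mul_ne_top hf.2.ne (ENNReal.rpow_ne_top_of_ne_zero hW0 hWt)) h3

/-- Hölder's inequality for `∫ ‖f‖^(p-1) ‖g‖`. -/
lemma integral_rpow_mul_le (hp1 : 1 < p) (hp : p ≠ ⊤) {f g : Space N → F} (hf : MemLp f p)
    (hg : MemLp g p) : (Integrable fun x => ‖f x‖ ^ (p.toReal - 1) * ‖g x‖) ∧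
      ∫ x, ‖f x‖ ^ (p.toReal - 1) * ‖g x‖ ≤
        lpNorm f p volume ^ (p.toReal - 1) * lpNorm g p volume := by
  obtain ⟨q, hpq⟩ : ∃ q, p.HolderConjugate q := ⟨ENNReal.conjExponent p, .conjExponent hp1.le⟩
  obtain ⟨hp0, hq0, hqt, hq1⟩ := holderConjugate_facts hpq hp1 hp
  have hrs := toReal_holderConjugate hpq hp1 hp
  set H : Space N → ℝ := fun x => ‖f x‖ ^ (p.toReal - 1) with hH
  have hHm : AEStronglyMeasurable H volume :=
    (hf.1.norm.aemeasurable.pow_const _).aestronglyMeasurable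
  have e (x : Space N) : ‖H x‖ ^ q.toReal = ‖f x‖ ^ p.toReal := by
    rw [hH, Real.norm_of_nonneg (by positivity), ← Real.rpow_mul (norm_nonneg _),
      hrs.sub_one_mul_conj]
  have hHq : MemLp H q := (integrable_norm_rpow_iff hHm hq0 hqt).1
    ((hf.integrable_norm_rpow hp0 hp).congr (ae_of_all _ fun x => (e x).symm))
  have hHn : lpNorm H q volume = lpNorm f p volume ^ (p.toReal - 1) := by
    have h1 : (lpNorm H q volume ^ q.toReal) ^ q.toReal⁻¹ = lpNorm H q volume :=
      Real.rpow_rpow_inv lpNorm_nonneg hrs.symm.ne_zero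
    rw [← h1, lpNorm_rpow_eq_integral hq0 hqt hHm]
    simp only [e]
    rw [← lpNorm_rpow_eq_integral hp0 hp hf.1, ← Real.rpow_mul lpNorm_nonneg]
    congr 1
    rw [mul_inv_eq_iff_eq_mul₀ hrs.symm.ne_zero, hrs.sub_one_mul_conj]
  refine ⟨integrable_mul_of_memLp hpq.symm hHq hg.norm, ?_⟩
  refine (le_abs_self _).trans ((abs_integral_mul_le hpq.symm hHq hg.norm).trans_eq ?_)
  rw [hHn, lpNorm_norm hg.1]

end Young

end DensityEuler
end

noncomputable section
namespace DensityEuler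
set_option linter.unusedSectionVars false

variable {N : ℕ}

/-! ### Monotonicity from weak differential inequalities -/

section Limits

variable {T : ℝ}

lemma TimeInt.continuousOn_mul {X G : ℝ → ℝ} (hX : ContinuousOn X (Ioo 0 T)) (hG : TimeInt T G) :
    TimeInt T fun t => X t * G t := fun s t hs ht =>
  (hG s t hs ht).continuousOn_mul (hX.mono (Icc_subset_Ioo hs ht)) isCompact_Icc

/-- The limit of localised inequalities. The rates have only upper bounds, so their excess over G is
measured by its positive part; this is dominated by |κ| and tends to zero. The set A consists of the
times at which all continuous representatives agree with the given functions and convergence holds.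
-/
lemma HasWeakDeriv.ae_le_add_integral (hT : 0 < T) {γ g : ℕ → ℝ → ℝ} {S G κ : ℝ → ℝ}
    (h : ∀ R, HasWeakDeriv T (γ R) (g R)) (hG : TimeInt T G) (hκ : TimeInt T κ)
    (hb : ∀ᵐ t ∂volume.restrict (Ioo 0 T), ∃ e : ℕ → ℝ, Tendsto e atTop (𝓝 0) ∧
      ∀ R, g R t ≤ G t + e R ∧ e R ≤ κ t)
    (hγ : ∀ᵐ t ∂volume.restrict (Ioo 0 T), Tendsto (fun R => γ R t) atTop (𝓝 (S t))) :
    ∃ A : Set ℝ, (∀ᵐ t ∂volume.restrict (Ioo 0 T), t ∈ A) ∧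
      ∀ s ∈ A, ∀ t ∈ A, 0 < s → s ≤ t → t < T → S t ≤ S s + ∫ τ in s..t, G τ := by
  choose γ' hγ'1 hγ'2 using fun R => (h R).exists_isPrimitive hT
  refine ⟨{t | (∀ R, γ R t = γ' R t) ∧ Tendsto (fun R => γ R t) atTop (𝓝 (S t))}, ?_, ?_⟩
  · filter_upwards [ae_all_iff.2 hγ'2, hγ] with t h1 h2 using ⟨h1, h2⟩
  rintro s ⟨hs1, hs2⟩ t ⟨ht1, ht2⟩ hs hst ht
  set d : ℕ → ℝ → ℝ := fun R τ => max (g R τ - G τ) 0 with hd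
  have ig (R : ℕ) := (h R).2.1.intervalIntegrable hs hst ht
  have iG := hG.intervalIntegrable hs hst ht
  have id' (R : ℕ) : IntervalIntegrable (d R) volume s t :=
    (intervalIntegrable_iff_integrableOn_Ioc_of_le hst).2
      ((intervalIntegrable_iff_integrableOn_Ioc_of_le hst).1 ((ig R).sub iG)).pos_part
  have hsub : Ioc s t ⊆ Ioo 0 T := fun τ hτ => ⟨hs.trans hτ.1, hτ.2.trans_lt ht⟩
  have hb' := ae_restrict_of_ae_restrict_of_subset hsub hb
  have hlim : Tendsto (fun R => ∫ τ in s..t, d R τ) atTop (𝓝 (∫ τ in s..t, 0)) := by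
    simp only [intervalIntegral.integral_of_le hst]
    refine tendsto_integral_of_dominated_convergence (fun τ => |κ τ|)
      (fun R => ((intervalIntegrable_iff_integrableOn_Ioc_of_le hst).1 (id' R)).1)
      (((hκ s t hs ht).mono_set Ioc_subset_Icc_self).norm) (fun R => ?_) ?_
    · filter_upwards [hb'] with τ ⟨e, _, he⟩
      rw [Real.norm_of_nonneg (le_max_right _ _)]
      refine max_le ?_ (abs_nonneg _)
      have := (he R).1; have := (he R).2; have := le_abs_self (κ τ)
      linarith
    · filter_upwards [hb'] with τ ⟨e, he0, he⟩
      refine squeeze_zero (fun R => le_max_right _ _) (fun R => ?_) (by simpa using he0.abs)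
      exact max_le ((by have := (he R).1; linarith : _ ≤ e R).trans (le_abs_self _)) (abs_nonneg _)
  rw [intervalIntegral.integral_zero] at hlim
  have hle (R : ℕ) : γ R t ≤ γ R s + (∫ τ in s..t, G τ) + ∫ τ in s..t, d R τ := by
    rw [hs1, ht1]
    have e := (hγ'1 R).2 s t hs hst ht
    have : ∫ τ in s..t, g R τ ≤ ∫ τ in s..t, (G τ + d R τ) := by
      refine intervalIntegral.integral_mono_on hst (ig R) (iG.add (id' R)) fun τ _ => ?_
      have := le_max_left (g R τ - G τ) 0
      simp only [hd]; linarith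
    rw [intervalIntegral.integral_add iG (id' R)] at this
    linarith
  have := le_of_tendsto_of_tendsto' ht2 ((hs2.add_const _).add hlim) hle
  simpa using this

lemma dense_of_ae_restrict {A : Set ℝ} (hA : ∀ᵐ t ∂volume.restrict (Ioo 0 T), t ∈ A) :
    Dense {t | t ∈ Ioo 0 T → t ∈ A} :=
  Measure.dense_of_ae (μ := volume) ((ae_restrict_iff' measurableSet_Ioo).1 hA)

/-- A set of full measure is dense, and continuity extends the comparison to all times, including
the end points. -/
lemma le_of_ae_antitone {A : Set ℝ} (hA : ∀ᵐ t ∂volume.restrict (Ioo 0 T), t ∈ A) {Z : ℝ → ℝ}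
    {s t : ℝ} (hs : 0 ≤ s) (hst : s ≤ t) (ht : t ≤ T) (hZ : ContinuousOn Z (Icc s t))
    (h : ∀ a ∈ A, ∀ b ∈ A, s < a → a ≤ b → b < t → Z b ≤ Z a) : Z t ≤ Z s := by
  rcases hst.eq_or_lt with rfl | hst'
  · exact le_rfl
  have hden := dense_of_ae_restrict hA
  have hcl {b : ℝ} (hsb : s < b) : ({s, b} : Set ℝ) ⊆ closure (Ioo s b ∩ {t | t ∈ Ioo 0 T → t ∈ A}) := by
    rw [← closure_closure]
    refine Subset.trans ?_ (closure_mono (hden.open_subset_closure_inter isOpen_Ioo))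
    rw [closure_Ioo hsb.ne]
    rintro x (rfl | rfl)
    · exact left_mem_Icc.2 hsb.le
    · exact right_mem_Icc.2 hsb.le
  have h1 : ∀ b ∈ A, s < b → b < t → Z b ≤ Z s := by
    intro b hb hsb hbt
    have hne := mem_closure_iff_nhdsWithin_neBot.1 (hcl hsb (show s ∈ ({s, b} : Set ℝ) by simp))
    have hc : Tendsto Z (𝓝[Ioo s b ∩ {t | t ∈ Ioo 0 T → t ∈ A}] s) (𝓝 (Z s)) :=
      (hZ s (left_mem_Icc.2 hst)).mono_left (nhdsWithin_mono _ fun x hx =>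
        ⟨hx.1.1.le, hx.1.2.le.trans hbt.le⟩)
    refine ge_of_tendsto hc ?_
    filter_upwards [self_mem_nhdsWithin] with a ha
    exact h a (ha.2 ⟨hs.trans_lt ha.1.1, ha.1.2.trans (hbt.trans_le ht)⟩) b hb ha.1.1 ha.1.2.le hbt
  have hne := mem_closure_iff_nhdsWithin_neBot.1 (hcl hst' (show t ∈ ({s, t} : Set ℝ) by simp))
  have hc : Tendsto Z (𝓝[Ioo s t ∩ {t | t ∈ Ioo 0 T → t ∈ A}] t) (𝓝 (Z t)) :=
    (hZ t (right_mem_Icc.2 hst)).mono_left (nhdsWithin_mono _ fun x hx => ⟨hx.1.1.le, hx.1.2.le⟩)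
  refine le_of_tendsto hc ?_
  filter_upwards [self_mem_nhdsWithin] with b hb
  exact h1 b (hb.2 ⟨hs.trans_lt hb.1.1, hb.1.2.trans_le ht⟩) hb.1.1 hb.1.2

lemma le_add_integral_of_ae {A : Set ℝ} (hA : ∀ᵐ t ∂volume.restrict (Ioo 0 T), t ∈ A) {S G : ℝ → ℝ}
    (hS : ContinuousOn S (Ioo 0 T)) (hG : TimeInt T G)
    (h : ∀ s ∈ A, ∀ t ∈ A, 0 < s → s ≤ t → t < T → S t ≤ S s + ∫ τ in s..t, G τ) {s t : ℝ}
    (hs : 0 < s) (hst : s ≤ t) (ht : t < T) : S t ≤ S s + ∫ τ in s..t, G τ := by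
  have iG := hG.intervalIntegrable hs hst ht
  have hJ : ContinuousOn (fun τ => ∫ σ in s..τ, G σ) (Icc s t) := by
    have := intervalIntegral.continuousOn_primitive_interval
      ((intervalIntegrable_iff' (μ := volume)).1 iG)
    rwa [uIcc_of_le hst] at this
  have := le_of_ae_antitone hA hs.le hst ht.le (Z := fun τ => S τ - ∫ σ in s..τ, G σ)
    ((hS.mono (Icc_subset_Ioo hs ht)).sub hJ) fun a ha b hb hsa hab hbt => by
      have h1 := h a ha b hb (hs.trans hsa) hab (hbt.trans ht)
      have h2 := intervalIntegral.integral_add_adjacent_intervals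
        (hG.intervalIntegrable hs hsa.le ((hab.trans_lt hbt).trans ht))
        (hG.intervalIntegrable (hs.trans hsa) hab (hbt.trans ht))
      linarith
  simp only [intervalIntegral.integral_same, sub_zero] at this
  linarith

end Limits

/-! ### The `L^p` estimate for the transport equation -/

section LpEstimate

variable {F : Type*} [NormedAddCommGroup F] [InnerProductSpace ℝ F] [FiniteDimensional ℝ F]
  {T : ℝ} {p : ℝ≥0∞}

lemma ContinuousInLp.continuousOn_lpNorm {b : ℝ → Space N → F} (hp1 : 1 ≤ p)
    (hb : ContinuousInLp T p b) : ContinuousOn (fun t => lpNorm (b t) p volume) (Icc 0 T) := by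
  intro t ht
  have h1 := (ENNReal.tendsto_toReal ENNReal.zero_ne_top).comp (hb.2 t ht)
  rw [ENNReal.toReal_zero] at h1
  refine tendsto_iff_norm_sub_tendsto_zero.2 (squeeze_zero' (.of_forall fun _ => norm_nonneg _) ?_ h1)
  filter_upwards [self_mem_nhdsWithin] with s hs
  have hbs := hb.1 s hs
  have hbt := hb.1 t ht
  simp only [Function.comp]
  rw [toReal_eLpNorm (hbs.sub hbt).1, Real.norm_eq_abs, abs_le]
  have h2 := lpNorm_le_lpNorm_add_lpNorm_sub' (f := b s) (g := b t) (μ := volume) hbt hp1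
  have h3 := lpNorm_le_lpNorm_add_lpNorm_sub' (f := b t) (g := b s) (μ := volume) hbs hp1
  have h4 := lpNorm_sub_comm (b s) (b t) p volume
  constructor <;> linarith

/-- Slicewise estimate of the rate of change of the localised `L^p` norm. -/
lemma exists_rate_bound (hp1 : 1 < p) (hp : p ≠ ⊤) {f k : Space N → F} (hf : MemLp f p)
    (hk : MemLp k p) {U : Space N → Space N} (hU : AEStronglyMeasurable U) {m L : ℝ} (hm : 0 ≤ m)
    (hL : 0 ≤ L) (hgr : ∀ᵐ x, ‖U x‖ ≤ m + L * ‖x‖) {D : ℝ} (hD0 : 0 ≤ D)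
    (hD : ∀ R, 0 < R → ∀ x : Space N, ‖fderiv ℝ (cutoff R) x‖ ≤ D / R) :
    ∃ e : ℕ → ℝ, Tendsto e atTop (𝓝 0) ∧ ∀ R : ℕ,
      ∫ x, (cutoff (R + 1) x * fderiv ℝ (fun y : F => ‖y‖ ^ p.toReal) (f x) (k x) +
        ‖f x‖ ^ p.toReal * fderiv ℝ (cutoff (R + 1)) x (U x)) ≤
      p.toReal * lpNorm f p volume ^ (p.toReal - 1) * lpNorm k p volume + e R ∧
      e R ≤ D * (m + 2 * L) * lpNorm f p volume ^ p.toReal := by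
  have hp0 : p ≠ 0 := (zero_lt_one.trans hp1).ne'
  have hr1 : 1 < p.toReal := by
    rw [← ENNReal.toReal_one]; exact (ENNReal.toReal_lt_toReal (by simp) hp).2 hp1
  have hfi := hf.integrable_norm_rpow hp0 hp
  obtain ⟨hi, hle⟩ := integral_rpow_mul_le hp1 hp hf hk
  have hfd : Continuous (fderiv ℝ fun y : F => ‖y‖ ^ p.toReal) :=
    (contDiff_norm_rpow hr1).continuous_fderiv (by simp)
  set I : ℕ → Space N → ℝ := fun R x =>
    ({x : Space N | (R : ℝ) + 1 ≤ ‖x‖}).indicator (fun x => ‖f x‖ ^ p.toReal) x with hI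
  have hIm (R : ℕ) : Integrable (I R) :=
    hfi.indicator (measurableSet_le measurable_const measurable_norm)
  have hI0 (R : ℕ) (x : Space N) : 0 ≤ I R x := indicator_nonneg (fun _ _ => by positivity) _
  have hIle (R : ℕ) (x : Space N) : I R x ≤ ‖f x‖ ^ p.toReal :=
    indicator_le_self' (fun _ _ => by positivity) _
  refine ⟨fun R => D * (m + 2 * L) * ∫ x, I R x, ?_, fun R => ⟨?_, ?_⟩⟩
  · have : Tendsto (fun R => ∫ x, I R x) atTop (𝓝 (∫ _x : Space N, (0 : ℝ))) := by
      refine tendsto_integral_of_dominated_convergence _ (fun R => (hIm R).1) hfi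
        (fun R => ae_of_all _ fun x => ?_) (ae_of_all _ fun x => ?_)
      · rw [Real.norm_of_nonneg (hI0 R x)]; exact hIle R x
      · refine tendsto_const_nhds.congr' ?_
        obtain ⟨R₀, hR₀⟩ := exists_nat_gt ‖x‖
        filter_upwards [eventually_ge_atTop R₀] with R hR
        rw [hI]
        refine (indicator_of_notMem ?_ _).symm
        simp only [mem_ofPred_eq, not_le]
        have : (R₀ : ℝ) ≤ R := by exact_mod_cast hR
        linarith
    simpa using this.const_mul (D * (m + 2 * L))
  · have hR : (0 : ℝ) < R + 1 := by positivity
    have hχ := isBump_cutoff (N := N) hR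
    have b1 (x : Space N) : ‖cutoff (R + 1) x * fderiv ℝ (fun y : F => ‖y‖ ^ p.toReal) (f x) (k x)‖ ≤
        p.toReal * (‖f x‖ ^ (p.toReal - 1) * ‖k x‖) := by
      have hc := cutoff_mem_Icc (R + 1) x
      rw [norm_mul, Real.norm_of_nonneg hc.1]
      refine (mul_le_of_le_one_left (norm_nonneg _) hc.2).trans
        ((ContinuousLinearMap.le_opNorm _ _).trans_eq ?_)
      rw [norm_fderiv_norm_id_rpow _ hr1, mul_assoc]
    have i1 : Integrable fun x =>
        cutoff (R + 1) x * fderiv ℝ (fun y : F => ‖y‖ ^ p.toReal) (f x) (k x) :=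
      (hi.const_mul p.toReal).mono' (hχ.continuous.aestronglyMeasurable.mul
        (aestronglyMeasurable_clm_apply (hfd.comp_aestronglyMeasurable hf.1) hk.1)) (ae_of_all _ b1)
    have b2 : ∀ᵐ x, ‖‖f x‖ ^ p.toReal * fderiv ℝ (cutoff ((R : ℝ) + 1)) x (U x)‖ ≤
        D * (m + 2 * L) * I R x := by
      filter_upwards [hgr] with x hx
      rcases lt_or_ge ‖x‖ (R + 1) with h1 | h1
      · rw [fderiv_cutoff_of_lt hR h1]
        simpa using mul_nonneg (by positivity) (hI0 R x)
      rcases lt_or_ge (2 * ((R : ℝ) + 1)) ‖x‖ with h2 | h2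
      · rw [fderiv_cutoff_of_gt hR h2]
        simpa using mul_nonneg (by positivity) (hI0 R x)
      · have e : I R x = ‖f x‖ ^ p.toReal := indicator_of_mem (s := {x : Space N | (R : ℝ) + 1 ≤ ‖x‖}) h1 _
        rw [e, norm_mul, Real.norm_of_nonneg (by positivity : 0 ≤ ‖f x‖ ^ p.toReal), mul_comm]
        refine mul_le_mul_of_nonneg_right (((fderiv ℝ (cutoff ((R : ℝ) + 1)) x).le_opNorm _).trans ?_)
          (by positivity)
        calc _ ≤ D / (R + 1) * (m + L * (2 * (R + 1))) := by
              refine mul_le_mul (hD _ hR x) (hx.trans (by gcongr)) (norm_nonneg _) (by positivity)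
          _ = D * (m / (R + 1) + 2 * L) := by field_simp
          _ ≤ D * (m + 2 * L) := by
              gcongr
              exact div_le_self hm (by linarith [(Nat.cast_nonneg R : (0 : ℝ) ≤ R)])
    have i2 : Integrable fun x => ‖f x‖ ^ p.toReal * fderiv ℝ (cutoff ((R : ℝ) + 1)) x (U x) :=
      ((hIm R).const_mul _).mono' (hfi.1.mul (aestronglyMeasurable_clm_apply
        hχ.continuous_fderiv.aestronglyMeasurable hU)) b2
    rw [integral_add i1 i2]
    refine add_le_add ?_ ?_
    · refine (integral_mono i1 (hi.const_mul p.toReal) fun x => (le_abs_self _).trans (b1 x)).trans ?_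
      rw [integral_const_mul, mul_assoc]
      exact mul_le_mul_of_nonneg_left hle (by linarith)
    · simp only [← integral_const_mul]
      exact integral_mono_ae i2 ((hIm R).const_mul _) (b2.mono fun x hx => (le_abs_self _).trans hx)
  · rw [lpNorm_rpow_eq_integral hp0 hp hf.1]
    exact mul_le_mul_of_nonneg_left (integral_mono (hIm R) hfi (hIle R)) (by positivity)

/-- The `L^p` estimate for the transport equation. -/
theorem exists_lpNorm_transport_le (N : ℕ) (F : Type*) [NormedAddCommGroup F] [InnerProductSpace ℝ F]
    [FiniteDimensional ℝ F] (hp1 : 1 < p) (hp : p ≠ ⊤) : ∃ C, 0 ≤ C ∧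
    ∀ (T : ℝ) (U : ℝ → Space N → Space N) (m L : ℝ → ℝ) (b h : ℝ → Space N → F), 0 < T →
      LipFlow T U m L → AEStronglyMeasurable (Function.uncurry b)
        ((volume.restrict (Ioo 0 T)).prod (volume : Measure (Space N))) → ContinuousInLp T p b → TransportEq T U b h →
      AEStronglyMeasurable (Function.uncurry h)
        ((volume.restrict (Ioo 0 T)).prod (volume : Measure (Space N))) →
      (∀ᵐ t ∂volume.restrict (Ioo 0 T), MemLp (h t) p) →
      TimeInt T (fun t => lpNorm (h t) p volume) → ∀ s t, 0 < s → s ≤ t → t < T →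
      lpNorm (b t) p volume ≤ lpNorm (b s) p volume +
        ∫ τ in s..t, (lpNorm (h τ) p volume + C * L τ * lpNorm (b τ) p volume) := by
  have hp0 : p ≠ 0 := (zero_lt_one.trans hp1).ne'
  have hr1 : 1 < p.toReal := by
    rw [← ENNReal.toReal_one]; exact (ENNReal.toReal_lt_toReal (by simp) hp).2 hp1
  obtain ⟨C, hC0, hC⟩ := exists_eLpNorm_commut_le (F := F) N hp1 hp
  obtain ⟨Cb, hCb0, hCb⟩ := exists_integral_ball_le (F := F) N hp1
  obtain ⟨D, hD0, hD⟩ := exists_norm_fderiv_cutoff_le N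
  refine ⟨C, hC0, fun T U m L b h hT hU hb hbp heq hhm hhp hhint s t hs hst ht => ?_⟩
  set X : ℝ → ℝ := fun t => lpNorm (b t) p volume with hX
  have hX0 (t : ℝ) : 0 ≤ X t := lpNorm_nonneg
  have hXc : ContinuousOn X (Icc 0 T) := hbp.continuousOn_lpNorm hp1.le
  obtain ⟨M, hM⟩ := isCompact_Icc.exists_bound_of_continuousOn hXc
  have hM' : ∀ t ∈ Icc 0 T, X t ≤ M := fun t ht => (le_abs_self _).trans (hM t ht)
  have hM0 : 0 ≤ M := (hX0 0).trans (hM' 0 ⟨le_rfl, hT.le⟩)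
  have hmem : ∀ᵐ t ∂volume.restrict (Ioo 0 T), t ∈ Icc 0 T :=
    (ae_restrict_mem measurableSet_Ioo).mono fun t ht => ⟨ht.1.le, ht.2.le⟩
  have hbU : UnifLoc T b fun _ => Cb * M := by
    refine ⟨hb, timeInt_const T _, ?_⟩
    filter_upwards [hmem] with t ht
    exact ⟨(hbp.1 t ht).locallyIntegrable hp1.le, fun x => (hCb _ (hbp.1 t ht) x).trans
      (mul_le_mul_of_nonneg_left (hM' t ht) hCb0)⟩
  have hhU : UnifLoc T h fun t => Cb * lpNorm (h t) p volume := by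
    refine ⟨hhm, hhint.const_mul Cb, ?_⟩
    filter_upwards [hhp] with t ht
    exact ⟨ht.locallyIntegrable hp1.le, hCb _ ht⟩
  set H : ℝ → ℝ := fun τ => lpNorm (h τ) p volume + C * L τ * X τ with hH
  have hH0 (t : ℝ) : 0 ≤ H t :=
    add_nonneg lpNorm_nonneg (mul_nonneg (mul_nonneg hC0 (hU.nonneg_L t)) (hX0 t))
  have hXo : ContinuousOn X (Ioo 0 T) := hXc.mono Ioo_subset_Icc_self
  have hHi : TimeInt T H := hhint.add (by
    have := TimeInt.continuousOn_mul hXo (hU.timeInt_L.const_mul C)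
    simpa only [mul_comm (X _)] using this)
  have hXr (q : ℝ) (hq : 0 ≤ q) : ContinuousOn (fun t => X t ^ q) (Ioo 0 T) :=
    hXo.rpow_const fun t _ => Or.inr hq
  have hG : TimeInt T fun τ => p.toReal * X τ ^ (p.toReal - 1) * H τ :=
    TimeInt.continuousOn_mul (continuousOn_const.mul (hXr _ (by linarith))) hHi
  -- The commutator is treated as part of the source. Its bound C·L·‖b‖ does not involve n and
  -- produces the last term of the estimate.
  have hcomL : ∀ᵐ t ∂volume.restrict (Ioo 0 T), ∀ n,
      MemLp (fun x => mollify n (h t) x + commut n (U t) (b t) x) p ∧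
      lpNorm (fun x => mollify n (h t) x + commut n (U t) (b t) x) p volume ≤ H t := by
    filter_upwards [hmem, hhp, hU.lipschitz, hU.divFree] with t ht hht ⟨S, hS, hSL⟩ hdiv n
    have hbt := hbp.1 t ht
    have h1 := hC (U t) (L t) S (b t) n (hU.nonneg_L t) hS hSL hbt.1
    have h2 : MemLp (commut n (U t) (b t)) p :=
      ⟨aestronglyMeasurable_commut hdiv.1.aestronglyMeasurable hbt.1 n,
        h1.trans_lt (ENNReal.mul_lt_top ENNReal.ofReal_lt_top hbt.2)⟩
    have h3 := memLp_mollify hp1 hp hht n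
    refine ⟨h3.add h2, (lpNorm_add_le h3 hp1.le).trans (add_le_add (lpNorm_mollify_le hp1 hp hht n) ?_)⟩
    rw [← toReal_eLpNorm h2.1, hX]
    simp only
    rw [← toReal_eLpNorm hbt.1, ← ENNReal.toReal_ofReal (mul_nonneg hC0 (hU.nonneg_L t)),
      ← ENNReal.toReal_mul]
    exact ENNReal.toReal_mono (ENNReal.mul_ne_top ENNReal.ofReal_ne_top hbt.2.ne) h1
  -- With n fixed, Φ = ‖·‖^p is applied to the mollified solution and the cut-off radius tends to
  -- infinity. The norms of the mollified quantities on the right are replaced by X and H, so the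
  -- right side is already free of n.
  have step (n : ℕ) : ∃ A : Set ℝ, (∀ᵐ t ∂volume.restrict (Ioo 0 T), t ∈ A) ∧
      ∀ s ∈ A, ∀ t ∈ A, 0 < s → s ≤ t → t < T → ∫ x, ‖mollify n (b t) x‖ ^ p.toReal ≤
        (∫ x, ‖mollify n (b s) x‖ ^ p.toReal) +
          ∫ τ in s..t, p.toReal * X τ ^ (p.toReal - 1) * H τ := by
    refine HasWeakDeriv.ae_le_add_integral hT (κ := fun t => D * M ^ p.toReal * (m t + 2 * L t))
      (fun R : ℕ => hasWeakDeriv_integral_comp_mollify hT hU hbU hhU heq (contDiff_norm_rpow hr1)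
        (isBump_cutoff (N := N) (R := (R : ℝ) + 1) (by positivity)) n) hG
      ((hU.timeInt_m.add (hU.timeInt_L.const_mul 2)).const_mul _) ?_ ?_
    · filter_upwards [hmem, hcomL, hU.growth, hU.divFree] with t ht hc hgr hdiv
      have hbt := hbp.1 t ht
      obtain ⟨e, he0, he⟩ := exists_rate_bound hp1 hp (memLp_mollify hp1 hp hbt n) (hc n).1
        hdiv.1.aestronglyMeasurable (hU.nonneg_m t) (hU.nonneg_L t) hgr hD0 hD
      have hmle : lpNorm (mollify n (b t)) p volume ≤ X t := lpNorm_mollify_le hp1 hp hbt n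
      refine ⟨e, he0, fun R => ⟨(he R).1.trans (add_le_add_left ?_ _), (he R).2.trans ?_⟩⟩
      · refine mul_le_mul ?_ (hc n).2 lpNorm_nonneg ?_
        · have := Real.rpow_le_rpow lpNorm_nonneg hmle (by linarith : 0 ≤ p.toReal - 1)
          exact mul_le_mul_of_nonneg_left this (by linarith)
        · have := hX0 t; positivity
      · have h1 : lpNorm (mollify n (b t)) p volume ^ p.toReal ≤ M ^ p.toReal :=
          Real.rpow_le_rpow lpNorm_nonneg (hmle.trans (hM' t ht)) (by linarith)
        have h2 : 0 ≤ D * (m t + 2 * L t) := by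
          have := hU.nonneg_m t; have := hU.nonneg_L t; positivity
        calc _ ≤ D * (m t + 2 * L t) * M ^ p.toReal := mul_le_mul_of_nonneg_left h1 h2
          _ = _ := by ring
    · filter_upwards [hmem] with t ht
      have hml := memLp_mollify hp1 hp (hbp.1 t ht) n
      have hi := hml.integrable_norm_rpow hp0 hp
      refine tendsto_integral_of_dominated_convergence _ (fun R => ?_) hi
        (fun R => ae_of_all _ fun x => ?_) (ae_of_all _ fun x => ?_)
      · exact (isBump_cutoff (by positivity)).continuous.aestronglyMeasurable.mul hi.1
      · have hc := cutoff_mem_Icc ((R : ℝ) + 1) x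
        rw [norm_mul, Real.norm_of_nonneg hc.1, Real.norm_of_nonneg (by positivity)]
        exact mul_le_of_le_one_left (by positivity) hc.2
      · refine tendsto_const_nhds.congr' ?_
        obtain ⟨R₀, hR₀⟩ := exists_nat_gt ‖x‖
        filter_upwards [eventually_ge_atTop R₀] with R hR
        have : (R₀ : ℝ) ≤ R := by exact_mod_cast hR
        rw [cutoff_eq_one (by positivity) (by linarith), one_mul]
  choose A hA hA' using step
  have hpow : ∀ s t, 0 < s → s ≤ t → t < T → X t ^ p.toReal ≤ X s ^ p.toReal +
      ∫ τ in s..t, p.toReal * X τ ^ (p.toReal - 1) * H τ := by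
    intro s t hs hst ht
    refine le_add_integral_of_ae (A := ⋂ n, A n) ?_ (hXr _ (by linarith)) hG ?_ hs hst ht
    · filter_upwards [ae_all_iff.2 hA] with t ht using mem_iInter.2 ht
    intro s hsA t htA hs hst ht
    have hst' : s ∈ Icc 0 T := ⟨hs.le, hst.trans ht.le⟩
    have htt' : t ∈ Icc 0 T := ⟨(hs.trans_le hst).le, ht.le⟩
    set B := X s ^ p.toReal + ∫ τ in s..t, p.toReal * X τ ^ (p.toReal - 1) * H τ with hB
    have hn (n : ℕ) : lpNorm (mollify n (b t)) p volume ^ p.toReal ≤ B := by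
      have h1 := hA' n s (mem_iInter.1 hsA n) t (mem_iInter.1 htA n) hs hst ht
      rw [← lpNorm_rpow_eq_integral hp0 hp (memLp_mollify hp1 hp (hbp.1 t htt') n).1,
        ← lpNorm_rpow_eq_integral hp0 hp (memLp_mollify hp1 hp (hbp.1 s hst') n).1] at h1
      refine h1.trans (add_le_add_left (Real.rpow_le_rpow lpNorm_nonneg
        (lpNorm_mollify_le hp1 hp (hbp.1 s hst') n) (by linarith)) _)
    have hB0 : 0 ≤ B := (Real.rpow_nonneg lpNorm_nonneg _).trans (hn 0)
    have hn' (n : ℕ) : eLpNorm (mollify n (b t)) p volume ≤ ENNReal.ofReal (B ^ p.toReal⁻¹) := by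
      rw [← ofReal_lpNorm (memLp_mollify hp1 hp (hbp.1 t htt') n)]
      refine ENNReal.ofReal_le_ofReal ?_
      rw [← Real.rpow_rpow_inv (x := lpNorm (mollify n (b t)) p volume) lpNorm_nonneg
        (by linarith : p.toReal ≠ 0)]
      exact Real.rpow_le_rpow (Real.rpow_nonneg lpNorm_nonneg _) (hn n) (by positivity)
    -- Now n → ∞. Lower semicontinuity of the norm under almost everywhere convergence is enough,
    -- because at time s the mollified norm is bounded by the full one.
    have hlim := Lp.eLpNorm_lim_le_liminf_eLpNorm (p := p) (μ := volume)
      (fun n => (memLp_mollify hp1 hp (hbp.1 t htt') n).1) (b t)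
      (ae_tendsto_mollify ((hbp.1 t htt').locallyIntegrable hp1.le))
    have h2 : eLpNorm (b t) p volume ≤ ENNReal.ofReal (B ^ p.toReal⁻¹) :=
      hlim.trans ((liminf_le_liminf (.of_forall hn')).trans_eq (by simp))
    rw [← ofReal_lpNorm (hbp.1 t htt'), ENNReal.ofReal_le_ofReal_iff (by positivity)] at h2
    calc X t ^ p.toReal ≤ (B ^ p.toReal⁻¹) ^ p.toReal :=
          Real.rpow_le_rpow lpNorm_nonneg h2 (by linarith)
      _ = B := Real.rpow_inv_rpow hB0 (by linarith)
  exact le_add_integral_of_rpow_le hst hr1 (hXc.mono (Icc_subset_Icc hs.le ht.le)) hX0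
    (hHi.intervalIntegrable hs hst ht) hH0 fun r hr => hpow s r hs hr.1 (hr.2.trans_lt ht)

end LpEstimate

end DensityEuler
end

noncomputable section
namespace DensityEuler
set_option linter.unusedSectionVars false

variable {N : ℕ}

/-! ### Restriction to a shorter time interval -/

section Mono

variable {F : Type*} [NormedAddCommGroup F] [NormedSpace ℝ F] {S T : ℝ}

lemma slab_mono (h : S ≤ T) : slab N S ⊆ slab N T :=
  prod_mono (Ioo_subset_Ioo_right h) Subset.rfl

lemma IsTestFunction.mono (h : S ≤ T) {φ : ℝ × Space N → ℝ} (hφ : IsTestFunction S φ) :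
    IsTestFunction T φ := ⟨hφ.1, hφ.2.1, hφ.2.2.trans (slab_mono h)⟩

lemma HasWeakDirDeriv.mono (h : S ≤ T) {e : ℝ × Space N} {g k : ℝ → Space N → F}
    (H : HasWeakDirDeriv T e g k) : HasWeakDirDeriv S e g k :=
  ⟨H.1.mono_set (slab_mono h), H.2.1.mono_set (slab_mono h), fun φ hφ => H.2.2 φ (hφ.mono h)⟩

lemma HasWeakSpaceDeriv.mono (h : S ≤ T) {g : ℝ → Space N → F} {G : ℝ → Space N → Space N →L[ℝ] F}
    (H : HasWeakSpaceDeriv T g G) : HasWeakSpaceDeriv S g G :=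
  ⟨H.1.mono_set (slab_mono h), fun v => (H.2 v).mono h⟩

lemma IsEulerSolution.mono (h : S ≤ T) {ρ : ℝ → Space N → ℝ} {u P f : ℝ → Space N → Space N}
    {Du : ℝ → Space N → Space N →L[ℝ] Space N} (H : IsEulerSolution T ρ u P f Du) :
    IsEulerSolution S ρ u P f Du where
  density := H.density.mono_set (slab_mono h)
  flux := H.flux.mono_set (slab_mono h)
  mass φ hφ := H.mass φ (hφ.mono h)
  jacobian := H.jacobian.mono h
  momentum := by
    obtain ⟨ut, h1, h2⟩ := H.momentum
    exact ⟨ut, h1.mono h, ae_restrict_of_ae_restrict_of_subset (slab_mono h) h2⟩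
  incompressible := ae_restrict_of_ae_restrict_of_subset (slab_mono h) H.incompressible
  pressure := by
    obtain ⟨Pr, h1⟩ := H.pressure
    exact ⟨Pr, HasWeakSpaceDeriv.mono h h1⟩

lemma ContinuousInLp.mono (h : S ≤ T) {p : ℝ≥0∞} {g : ℝ → Space N → F} (H : ContinuousInLp T p g) :
    ContinuousInLp S p g :=
  ⟨fun t ht => H.1 t ⟨ht.1, ht.2.trans h⟩, fun t ht => (H.2 t ⟨ht.1, ht.2.trans h⟩).mono_left
    (nhdsWithin_mono _ (Icc_subset_Icc_right h))⟩

end Mono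

/-! ### Identities at fixed time -/

section Steady

variable {F : Type*} [NormedAddCommGroup F] [NormedSpace ℝ F]

lemma WeakDivFree.sub {v w : Space N → Space N} (hv : WeakDivFree v) (hw : WeakDivFree w) :
    WeakDivFree (v - w) := by
  refine ⟨hv.1.sub hw.1, fun ψ hψ => ?_⟩
  simp only [Pi.sub_apply, map_sub]
  rw [integral_sub (integrable_fderiv_apply hψ.contDiff_one hψ.2 hv.1)
    (integrable_fderiv_apply hψ.contDiff_one hψ.2 hw.1), hv.2 ψ hψ, hw.2 ψ hψ, sub_zero]

lemma HasWeakFDeriv.sub {g k : Space N → F} {G K : Space N → Space N →L[ℝ] F}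
    (hg : HasWeakFDeriv g G) (hk : HasWeakFDeriv k K) : HasWeakFDeriv (g - k) (G - K) := by
  refine ⟨hg.1.sub hk.1, hg.2.1.sub hk.2.1, fun ψ hψ v => ?_⟩
  simp only [Pi.sub_apply, smul_sub, sub_apply]
  rw [integral_sub (integrable_fderiv_smul hψ.contDiff_one hψ.2 hg.1 v)
    (integrable_fderiv_smul hψ.contDiff_one hψ.2 hk.1 v),
    integral_sub (integrable_smul_of_locallyIntegrable (LocallyIntegrable.clm_apply_const hg.2.1 v) hψ.continuous hψ.2)
      (integrable_smul_of_locallyIntegrable (LocallyIntegrable.clm_apply_const hk.2.1 v) hψ.continuous hψ.2),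
    hg.2.2 ψ hψ v, hk.2.2 ψ hψ v]
  abel

lemma HasWeakFDeriv.clm_comp [CompleteSpace F] {E : Type*} [NormedAddCommGroup E] [NormedSpace ℝ E]
    [CompleteSpace E] {g : Space N → F} {G : Space N → Space N →L[ℝ] F} (hg : HasWeakFDeriv g G)
    (ℓ : F →L[ℝ] E) : HasWeakFDeriv (fun x => ℓ (g x)) (fun x => ℓ.comp (G x)) := by
  refine ⟨fun x => ?_, fun x => ?_, fun ψ hψ v => ?_⟩
  · obtain ⟨s, hs, h⟩ := hg.1 x
    exact ⟨s, hs, ℓ.integrable_comp h⟩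
  · obtain ⟨s, hs, h⟩ := hg.2.1 x
    exact ⟨s, hs, (ContinuousLinearMap.compL ℝ (Space N) F E ℓ).integrable_comp h⟩
  · have h1 := congrArg ℓ (hg.2.2 ψ hψ v)
    rw [map_neg, ← ℓ.integral_comp_comm (integrable_fderiv_smul hψ.contDiff_one hψ.2 hg.1 v),
      ← ℓ.integral_comp_comm (integrable_smul_of_locallyIntegrable (LocallyIntegrable.clm_apply_const hg.2.1 v)
        hψ.continuous hψ.2)] at h1
    simp only [map_smul] at h1
    exact h1

lemma locallyIntegrable_clm_apply {G : Space N → Space N →L[ℝ] F} (hG : AEStronglyMeasurable G) {L : ℝ}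
    (hGL : ∀ᵐ x, ‖G x‖ ≤ L) {w : Space N → Space N} (hw : LocallyIntegrable w) :
    LocallyIntegrable fun x => G x (w x) := by
  refine ((locallyIntegrable_norm hw).smul L).mono (aestronglyMeasurable_clm_apply hG
    hw.aestronglyMeasurable) ?_
  filter_upwards [hGL] with x hx
  refine ((G x).le_opNorm _).trans ?_
  simp only [Pi.smul_apply, smul_eq_mul, norm_mul, norm_norm]
  exact mul_le_mul_of_nonneg_right (hx.trans (Real.le_norm_self _)) (norm_nonneg _)

/-- Integration by parts along a divergence free vector field, for vector valued functions. -/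
lemma WeakDivFree.integral_fderiv_smul {w : Space N → Space N} (hw : WeakDivFree w) {m l : ℝ}
    (hgr : ∀ᵐ x, ‖w x‖ ≤ m + l * ‖x‖) {g : Space N → Space N}
    {G : Space N → Space N →L[ℝ] Space N} (h : HasWeakFDeriv g G) {L : ℝ} (hL : 0 ≤ L)
    (hG : ∀ᵐ x, ‖G x‖ ≤ L) {ψ : Space N → ℝ} (hψ : IsBump ψ) :
    ∫ x, fderiv ℝ ψ x (w x) • g x = - ∫ x, ψ x • G x (w x) := by
  have i1 := integrable_apply_smul hw.1.aestronglyMeasurable hgr h.1 hψ.continuous_fderiv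
    (hψ.2.fderiv (𝕜 := ℝ))
  have i2 := integrable_smul_of_locallyIntegrable
    (locallyIntegrable_clm_apply h.2.1.aestronglyMeasurable hG hw.1) hψ.continuous hψ.2
  ext i
  rw [PiLp.neg_apply, ← proj_apply, ← proj_apply,
    ← (EuclideanSpace.proj i : Space N →L[ℝ] ℝ).integral_comp_comm i1,
    ← (EuclideanSpace.proj i : Space N →L[ℝ] ℝ).integral_comp_comm i2]
  have h1 := hw.integral_mul_fderiv (h.clm_comp (EuclideanSpace.proj i)) hL (hG.mono fun x hx => by
    refine (ContinuousLinearMap.opNorm_comp_le _ _).trans ?_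
    have : ‖(EuclideanSpace.proj i : Space N →L[ℝ] ℝ)‖ ≤ 1 :=
      ContinuousLinearMap.opNorm_le_bound _ zero_le_one fun v => by
        rw [one_mul]; exact PiLp.norm_apply_le v i
    calc _ ≤ 1 * L := mul_le_mul this hx (norm_nonneg _) zero_le_one
      _ = L := one_mul L) hψ
  simp only [map_smul, smul_eq_mul]
  simpa only [mul_comm, ContinuousLinearMap.comp_apply] using h1

lemma fderiv_apply_eq_sum_pd (θ : Space N → ℝ) (x v : Space N) :
    fderiv ℝ θ x v = ∑ i, v i * pd i θ x := by
  conv_lhs => rw [← sum_smul_basisVec v]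
  simp [pd]

/-- The divergence of `(v · ∇) w` is symmetric in the divergence free fields `v` and `w`. -/
lemma integral_fderiv_apply_comm {v w : Space N → Space N} (hv : WeakDivFree v) (hw : WeakDivFree w)
    {DV DW : Space N → Space N →L[ℝ] Space N} (hDV : HasWeakFDeriv v DV) (hDW : HasWeakFDeriv w DW)
    {L : ℝ} (hL : 0 ≤ L) (hVL : ∀ᵐ x, ‖DV x‖ ≤ L) (hWL : ∀ᵐ x, ‖DW x‖ ≤ L) {m l : ℝ}
    (hvg : ∀ᵐ x, ‖v x‖ ≤ m + l * ‖x‖) (hwg : ∀ᵐ x, ‖w x‖ ≤ m + l * ‖x‖) {θ : Space N → ℝ}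
    (hθ : IsBump θ) : ∫ x, fderiv ℝ θ x (DV x (w x)) = ∫ x, fderiv ℝ θ x (DW x (v x)) := by
  -- Each side equals minus the integral of ∑ wᵢvⱼ∂ᵢ∂ⱼθ, which is symmetric in the two fields.
  have key {v w : Space N → Space N} (hv : WeakDivFree v) (hw : WeakDivFree w)
      {DV : Space N → Space N →L[ℝ] Space N} (hDV : HasWeakFDeriv v DV)
      (hVL : ∀ᵐ x, ‖DV x‖ ≤ L) (hwg : ∀ᵐ x, ‖w x‖ ≤ m + l * ‖x‖) :
      ∫ x, fderiv ℝ θ x (DV x (w x)) = - ∫ x, ∑ j, ∑ i, w x i * v x j * pd i (pd j θ) x := by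
    have i1 (j : Fin N) : Integrable fun x => fderiv ℝ (pd j θ) x (w x) • v x :=
      integrable_apply_smul hw.1.aestronglyMeasurable hwg hv.1 (hθ.pd j).continuous_fderiv
        ((hθ.pd j).2.fderiv (𝕜 := ℝ))
    have i2 (j : Fin N) : Integrable fun x => pd j θ x • DV x (w x) :=
      integrable_smul_of_locallyIntegrable
        (locallyIntegrable_clm_apply hDV.2.1.aestronglyMeasurable hVL hw.1) (hθ.pd j).continuous (hθ.pd j).2
    have e1 (j : Fin N) : ∫ x, fderiv ℝ (pd j θ) x (w x) * v x j = - ∫ x, pd j θ x * DV x (w x) j := by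
      have h1 := congrArg (EuclideanSpace.proj j : Space N →L[ℝ] ℝ)
        (hw.integral_fderiv_smul hwg hDV hL hVL (hθ.pd j))
      rw [map_neg, ← (EuclideanSpace.proj j : Space N →L[ℝ] ℝ).integral_comp_comm (i1 j),
        ← (EuclideanSpace.proj j : Space N →L[ℝ] ℝ).integral_comp_comm (i2 j)] at h1
      simpa only [map_smul, smul_eq_mul, proj_apply] using h1
    have j1 (j : Fin N) : Integrable fun x => fderiv ℝ (pd j θ) x (w x) * v x j :=
      (EuclideanSpace.proj j : Space N →L[ℝ] ℝ).integrable_comp (i1 j)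
    have j2 (j : Fin N) : Integrable fun x => pd j θ x * DV x (w x) j :=
      (EuclideanSpace.proj j : Space N →L[ℝ] ℝ).integrable_comp (i2 j)
    have e2 (x : Space N) : fderiv ℝ θ x (DV x (w x)) = ∑ j, pd j θ x * DV x (w x) j := by
      rw [fderiv_apply_eq_sum_pd]; simp only [mul_comm]
    have e3 (x : Space N) : ∑ j, ∑ i, w x i * v x j * pd i (pd j θ) x =
        ∑ j, fderiv ℝ (pd j θ) x (w x) * v x j := by
      refine Finset.sum_congr rfl fun j _ => ?_
      rw [fderiv_apply_eq_sum_pd, Finset.sum_mul]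
      exact Finset.sum_congr rfl fun i _ => by ring
    simp only [e2, e3]
    rw [integral_finsetSum _ fun j _ => j2 j, integral_finsetSum _ fun j _ => j1 j]
    simp only [e1, Finset.sum_neg_distrib, neg_neg]
  rw [key hv hw hDV hVL hwg, key hw hv hDW hWL hvg]
  congr 2; ext x
  rw [Finset.sum_comm]
  refine Finset.sum_congr rfl fun i _ => Finset.sum_congr rfl fun j _ => ?_
  rw [pd_comm hθ, mul_comm (w x i)]

lemma memLp_of_norm_le_mul {p : ℝ≥0∞} {E : Type*} [NormedAddCommGroup E] {f : Space N → F}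
    {g : Space N → E} (hf : AEStronglyMeasurable f) (hg : MemLp g p) {c : ℝ} (hc : 0 ≤ c)
    (h : ∀ᵐ x, ‖f x‖ ≤ c * ‖g x‖) : MemLp f p ∧ lpNorm f p volume ≤ c * lpNorm g p volume := by
  have h1 := eLpNorm_le_mul_eLpNorm_of_ae_le_mul h p
  have h2 : MemLp f p := ⟨hf, h1.trans_lt (ENNReal.mul_lt_top ENNReal.ofReal_lt_top hg.2)⟩
  refine ⟨h2, ?_⟩
  rw [← ENNReal.ofReal_le_ofReal_iff (mul_nonneg hc lpNorm_nonneg), ofReal_lpNorm h2,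
    ENNReal.ofReal_mul hc, ofReal_lpNorm hg]
  exact h1

end Steady

/-! ### Integrability of norms in time, differences of weak derivatives -/

section Slices

variable {F : Type*} [NormedAddCommGroup F] [NormedSpace ℝ F] {T : ℝ}

lemma timeInt_lpNorm {p : ℝ≥0∞} (hp : p ≠ 0) {h : ℝ → Space N → F}
    (hm : AEStronglyMeasurable (Function.uncurry h)
      ((volume.restrict (Ioo 0 T)).prod (volume : Measure (Space N)))) {κ : ℝ → ℝ} (hκ : TimeInt T κ)
    (hb : ∀ᵐ t ∂volume.restrict (Ioo 0 T), lpNorm (h t) p volume ≤ κ t) :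
    TimeInt T fun t => lpNorm (h t) p volume := by
  have h1 : ∀ᵐ t ∂volume.restrict (Ioo 0 T),
      (eLpNorm (h t) p volume).toReal = lpNorm (h t) p volume := by
    filter_upwards [ae_slice_eq_mk hm] with t ht
    exact toReal_eLpNorm (AEStronglyMeasurable.congr
      (hm.stronglyMeasurable_mk.comp_measurable measurable_prodMk_left).aestronglyMeasurable ht.symm)
  intro s t hs ht
  refine (hκ s t hs ht).mono' ?_ ?_
  · have h2 := ((aemeasurable_eLpNorm_slice hm hp).ennreal_toReal.congr h1).mono_measure
      (Measure.restrict_mono (Icc_subset_Ioo hs ht) le_rfl)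
    exact h2.aestronglyMeasurable
  · filter_upwards [ae_restrict_Icc_of_Ioo hb hs ht] with r hr
    rwa [Real.norm_of_nonneg lpNorm_nonneg]

lemma HasWeakDeriv.sub (hT : 0 < T) {γ γ' g g' : ℝ → F} (h : HasWeakDeriv T γ g)
    (h' : HasWeakDeriv T γ' g') : HasWeakDeriv T (fun t => γ t - γ' t) (fun t => g t - g' t) := by
  refine ⟨fun s t hs ht => (h.1 s t hs ht).sub (h'.1 s t hs ht),
    fun s t hs ht => (h.2.1 s t hs ht).sub (h'.2.1 s t hs ht), fun φ hφ => ?_⟩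
  simp only [smul_sub]
  rw [integral_sub (h.1.integrable_smul hT hφ.deriv_test) (h'.1.integrable_smul hT hφ.deriv_test),
    integral_sub (h.2.1.integrable_smul hT hφ) (h'.2.1.integrable_smul hT hφ), h.2.2 φ hφ, h'.2.2 φ hφ]
  abel

end Slices

end DensityEuler
end

noncomputable section
namespace DensityEuler
set_option linter.unusedSectionVars false

variable {N : ℕ}

/-! ### The difference of two momentum equations at a fixed time -/

section SteadyEstimate

variable {p : ℝ≥0∞}

/-- The data of a solution with velocity `u`, pressure gradient `P` and inverse density `a` at a
fixed time. -/
structure MomentumSlice (u ut P f : Space N → Space N) (Du : Space N → Space N →L[ℝ] Space N)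
    (a : Space N → ℝ) (m l L : ℝ) : Prop where
  divFree : WeakDivFree u
  divFree_deriv : WeakDivFree ut
  jacobian : HasWeakFDeriv u Du
  nonneg : 0 ≤ L
  bound : ∀ᵐ x, ‖Du x‖ ≤ L
  growth : ∀ᵐ x, ‖u x‖ ≤ m + l * ‖x‖
  momentum : ∀ᵐ x, f x = ut x + Du x (u x) + a x • P x
  locInt : LocallyIntegrable P
  curl : ∀ i j θ, IsBump θ → ∫ x, P x i * pd j θ x = ∫ x, P x j * pd i θ x

/-- The source term in the transport equation of the difference of two velocities. -/
def momentumSource (u₁ u₂ P₁ P₂ f₁ f₂ : Space N → Space N) (Du₁ : Space N → Space N →L[ℝ] Space N)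
    (a₁ a₂ : Space N → ℝ) (x : Space N) : Space N :=
  f₂ x - f₁ x - Du₁ x (u₂ x - u₁ x) - (a₂ x - a₁ x) • P₁ x - a₂ x • (P₂ x - P₁ x)

variable {u₁ u₂ ut₁ ut₂ P₁ P₂ f₁ f₂ : Space N → Space N} {Du₁ Du₂ : Space N → Space N →L[ℝ] Space N}
  {a₁ a₂ : Space N → ℝ} {m₁ l₁ L₁ m₂ l₂ L₂ : ℝ}

/-- The bilinear differences are split as a₂P₂ − a₁P₁ = δa P₁ + a₂ δP and Du₂u₂ − Du₁u₁ = (Dδu)u₂ +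
Du₁δu, so that P₁, Du₁ and the transporting field u₂ carry the known bounds. -/
lemma ae_momentumSource_eq (H₁ : MomentumSlice u₁ ut₁ P₁ f₁ Du₁ a₁ m₁ l₁ L₁)
    (H₂ : MomentumSlice u₂ ut₂ P₂ f₂ Du₂ a₂ m₂ l₂ L₂) :
    ∀ᵐ x, momentumSource u₁ u₂ P₁ P₂ f₁ f₂ Du₁ a₁ a₂ x =
      (ut₂ - ut₁) x + (Du₂ - Du₁) x (u₂ x) := by
  filter_upwards [H₁.momentum, H₂.momentum] with x h1 h2
  rw [momentumSource, h1, h2]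
  simp only [map_sub, Pi.sub_apply, sub_apply, sub_smul, smul_sub]
  abel

lemma ae_norm_sub_le (H₁ : MomentumSlice u₁ ut₁ P₁ f₁ Du₁ a₁ m₁ l₁ L₁)
    (H₂ : MomentumSlice u₂ ut₂ P₂ f₂ Du₂ a₂ m₂ l₂ L₂) : ∀ᵐ x, ‖(Du₂ - Du₁) x‖ ≤ L₁ + L₂ := by
  filter_upwards [H₁.bound, H₂.bound] with x h1 h2
  exact (norm_sub_le _ _).trans (by linarith)

/-- The transport equation satisfied by the difference of two velocities, at a fixed time. -/
lemma integral_smul_deriv_sub (H₁ : MomentumSlice u₁ ut₁ P₁ f₁ Du₁ a₁ m₁ l₁ L₁)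
    (H₂ : MomentumSlice u₂ ut₂ P₂ f₂ Du₂ a₂ m₂ l₂ L₂) {ψ : Space N → ℝ} (hψ : IsBump ψ) :
    ∫ x, ψ x • (ut₂ - ut₁) x = ∫ x, (fderiv ℝ ψ x (u₂ x) • (u₂ x - u₁ x) +
      ψ x • momentumSource u₁ u₂ P₁ P₂ f₁ f₂ Du₁ a₁ a₂ x) := by
  have hD := H₂.jacobian.sub H₁.jacobian
  have hDL := ae_norm_sub_le H₁ H₂
  have i1 := integrable_apply_smul H₂.divFree.1.aestronglyMeasurable H₂.growth hD.1
    hψ.continuous_fderiv (hψ.2.fderiv (𝕜 := ℝ))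
  have i2 := integrable_smul_of_locallyIntegrable (locallyIntegrable_clm_apply
    hD.2.1.aestronglyMeasurable hDL H₂.divFree.1) hψ.continuous hψ.2
  have i3 := integrable_smul_of_locallyIntegrable (H₂.divFree_deriv.sub H₁.divFree_deriv).1
    hψ.continuous hψ.2
  have e := H₂.divFree.integral_fderiv_smul H₂.growth hD (add_nonneg H₁.nonneg H₂.nonneg) hDL hψ
  calc ∫ x, ψ x • (ut₂ - ut₁) x
      = (∫ x, fderiv ℝ ψ x (u₂ x) • (u₂ - u₁) x) +
        ((∫ x, ψ x • (ut₂ - ut₁) x) + ∫ x, ψ x • (Du₂ - Du₁) x (u₂ x)) := by rw [e]; abel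
    _ = _ := by
      have i4 : Integrable fun x => ψ x • (ut₂ - ut₁) x + ψ x • (Du₂ - Du₁) x (u₂ x) := i3.add i2
      rw [← integral_add i3 i2, ← integral_add i1 i4]
      refine integral_congr_ae ?_
      filter_upwards [ae_momentumSource_eq H₁ H₂] with x hx
      rw [hx, smul_add]
      rfl

/-- The source minus Du₂δu is divergence free: it equals ∂ₜδu plus (Dδu)u₂ − Du₂δu, and the last two
terms have the same divergence by `integral_fderiv_apply_comm`. As the source contains −a₂δP, adding
α δP leaves only (α − a₂)δP on the right. -/
lemma integral_fderiv_source (H₁ : MomentumSlice u₁ ut₁ P₁ f₁ Du₁ a₁ m₁ l₁ L₁)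
    (H₂ : MomentumSlice u₂ ut₂ P₂ f₂ Du₂ a₂ m₂ l₂ L₂) {θ : Space N → ℝ} (hθ : IsBump θ) (α : ℝ) :
    ∫ x, fderiv ℝ θ x (α • (P₂ x - P₁ x)) =
      ∫ x, fderiv ℝ θ x (momentumSource u₁ u₂ P₁ P₂ f₁ f₂ Du₁ a₁ a₂ x - Du₂ x (u₂ x - u₁ x) +
        α • (P₂ x - P₁ x)) := by
  have hD := H₂.jacobian.sub H₁.jacobian
  have hDL := ae_norm_sub_le H₁ H₂
  have hdiv := H₂.divFree.sub H₁.divFree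
  have hg1 : ∀ᵐ x, ‖(u₂ - u₁) x‖ ≤ (|m₁| + |m₂|) + (|l₁| + |l₂|) * ‖x‖ := by
    filter_upwards [H₁.growth, H₂.growth] with x h1 h2
    have h3 := norm_sub_le (u₂ x) (u₁ x)
    have h4 := mul_le_mul_of_nonneg_right (le_abs_self l₁) (norm_nonneg x)
    have h5 := mul_le_mul_of_nonneg_right (le_abs_self l₂) (norm_nonneg x)
    have := le_abs_self m₁; have := le_abs_self m₂
    rw [Pi.sub_apply, add_mul]; linarith
  have hg2 : ∀ᵐ x, ‖u₂ x‖ ≤ (|m₁| + |m₂|) + (|l₁| + |l₂|) * ‖x‖ := by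
    filter_upwards [H₂.growth] with x h2
    have h4 := mul_nonneg (abs_nonneg l₁) (norm_nonneg x)
    have h5 := mul_le_mul_of_nonneg_right (le_abs_self l₂) (norm_nonneg x)
    have := abs_nonneg m₁; have := le_abs_self m₂
    rw [add_mul]; linarith
  have e := integral_fderiv_apply_comm hdiv H₂.divFree hD H₂.jacobian
    (add_nonneg H₁.nonneg H₂.nonneg) hDL (H₂.bound.mono fun x hx => by linarith [H₁.nonneg]) hg1 hg2 hθ
  have l1 := locallyIntegrable_clm_apply hD.2.1.aestronglyMeasurable hDL H₂.divFree.1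
  have l2 := locallyIntegrable_clm_apply H₂.jacobian.2.1.aestronglyMeasurable H₂.bound hdiv.1
  have l3 := (H₂.divFree_deriv.sub H₁.divFree_deriv)
  have l4 : LocallyIntegrable fun x => α • (P₂ x - P₁ x) := (H₂.locInt.sub H₁.locInt).smul α
  have i1 := integrable_fderiv_apply hθ.contDiff_one hθ.2 l1
  have i2 := integrable_fderiv_apply hθ.contDiff_one hθ.2 l2
  have i3 := integrable_fderiv_apply hθ.contDiff_one hθ.2 l3.1
  have i4 := integrable_fderiv_apply hθ.contDiff_one hθ.2 l4
  calc ∫ x, fderiv ℝ θ x (α • (P₂ x - P₁ x))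
      = (∫ x, fderiv ℝ θ x ((ut₂ - ut₁) x)) + ((∫ x, fderiv ℝ θ x ((Du₂ - Du₁) x (u₂ x))) -
          ∫ x, fderiv ℝ θ x (Du₂ x ((u₂ - u₁) x))) + ∫ x, fderiv ℝ θ x (α • (P₂ x - P₁ x)) := by
        rw [l3.2 θ hθ, e]; ring
    _ = _ := by
        have i5 : Integrable fun x => fderiv ℝ θ x ((Du₂ - Du₁) x (u₂ x)) -
          fderiv ℝ θ x (Du₂ x ((u₂ - u₁) x)) := i1.sub i2
        have i6 : Integrable fun x => fderiv ℝ θ x ((ut₂ - ut₁) x) +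
          (fderiv ℝ θ x ((Du₂ - Du₁) x (u₂ x)) - fderiv ℝ θ x (Du₂ x ((u₂ - u₁) x))) := i3.add i5
        rw [← integral_sub i1 i2, ← integral_add i3 i5, ← integral_add i6 i4]
        refine integral_congr_ae ?_
        filter_upwards [ae_momentumSource_eq H₁ H₂] with x hx
        rw [hx]
        simp only [map_add, map_sub, Pi.sub_apply, sub_apply]
        ring

/-- The pressure and the source term are controlled in `L^p`. -/
theorem exists_momentumSource_le (hN : 0 < N) (hp1 : 1 < p) (hp : p ≠ ⊤) : ∃ c C, 0 < c ∧ 0 ≤ C ∧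
    ∀ (u₁ u₂ ut₁ ut₂ P₁ P₂ f₁ f₂ : Space N → Space N) (Du₁ Du₂ : Space N → Space N →L[ℝ] Space N)
      (a₁ a₂ : Space N → ℝ) (m₁ l₁ L₁ m₂ l₂ L₂ Λ aLow aUp : ℝ),
      MomentumSlice u₁ ut₁ P₁ f₁ Du₁ a₁ m₁ l₁ L₁ → MomentumSlice u₂ ut₂ P₂ f₂ Du₂ a₂ m₂ l₂ L₂ →
      AEStronglyMeasurable a₁ → MemLp (a₂ - a₁) p → MemLp (u₂ - u₁) p → MemLp (P₂ - P₁) p →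
      MemLp (f₂ - f₁) p → 0 ≤ Λ → (∀ᵐ x, ‖P₁ x‖ ≤ Λ) → 0 < aLow → aLow ≤ aUp →
      (∀ᵐ x, aLow ≤ a₂ x ∧ a₂ x ≤ aUp) → aUp - aLow ≤ c * aLow →
      MemLp (momentumSource u₁ u₂ P₁ P₂ f₁ f₂ Du₁ a₁ a₂) p ∧
        lpNorm (momentumSource u₁ u₂ P₁ P₂ f₁ f₂ Du₁ a₁ a₂) p volume ≤
          C * (lpNorm (f₂ - f₁) p volume + (L₁ + L₂) * lpNorm (u₂ - u₁) p volume +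
            Λ * lpNorm (a₂ - a₁) p volume) := by
  obtain ⟨K, hK0, hK⟩ := exists_lpNorm_gradient_le hN hp1 hp
  -- With this oscillation the elliptic estimate loses at most half of its left side. The second
  -- constant is 2K + 1 from a₂δP plus 1 from the remaining terms.
  refine ⟨1 / (2 * K), 2 * K + 2, by positivity, by positivity, ?_⟩
  intro u₁ u₂ ut₁ ut₂ P₁ P₂ f₁ f₂ Du₁ Du₂ a₁ a₂ m₁ l₁ L₁ m₂ l₂ L₂ Λ aLow aUp H₁ H₂ ha₁ hδa hδu hδP hδf
    hΛ hPΛ haLow haUp hab hc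
  have ha₂ : AEStronglyMeasurable a₂ := by simpa using hδa.1.add ha₁
  obtain ⟨t1, n1⟩ := memLp_of_norm_le_mul (f := fun x => Du₁ x (u₂ x - u₁ x))
    (aestronglyMeasurable_clm_apply H₁.jacobian.2.1.aestronglyMeasurable hδu.1) hδu H₁.nonneg
    (H₁.bound.mono fun x hx => ((Du₁ x).le_opNorm _).trans
      (mul_le_mul_of_nonneg_right hx (norm_nonneg _)))
  obtain ⟨t2, n2⟩ := memLp_of_norm_le_mul (f := fun x => (a₂ x - a₁ x) • P₁ x)
    (hδa.1.smul H₁.locInt.aestronglyMeasurable) hδa hΛ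
    (hPΛ.mono fun x hx => by
      rw [norm_smul, mul_comm]; exact mul_le_mul_of_nonneg_right hx (norm_nonneg _))
  -- Freezing the coefficient at its lower bound leaves a perturbation of size at most aUp − aLow.
  obtain ⟨t3, n3⟩ := memLp_of_norm_le_mul (f := fun x => (a₂ x - aLow) • (P₂ x - P₁ x)) (c := aUp - aLow)
    ((ha₂.sub aestronglyMeasurable_const).smul hδP.1) hδP (sub_nonneg.2 haUp)
    (hab.mono fun x hx => by
      rw [norm_smul, Real.norm_of_nonneg (sub_nonneg.2 hx.1)]
      exact mul_le_mul_of_nonneg_right (by linarith [hx.2]) (norm_nonneg _))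
  obtain ⟨t4, n4⟩ := memLp_of_norm_le_mul (f := fun x => Du₂ x (u₂ x - u₁ x))
    (aestronglyMeasurable_clm_apply H₂.jacobian.2.1.aestronglyMeasurable hδu.1) hδu H₂.nonneg
    (H₂.bound.mono fun x hx => ((Du₂ x).le_opNorm _).trans
      (mul_le_mul_of_nonneg_right hx (norm_nonneg _)))
  obtain ⟨t5, n5⟩ := memLp_of_norm_le_mul (f := fun x => a₂ x • (P₂ x - P₁ x)) (c := aUp)
    (ha₂.smul hδP.1) hδP (haLow.le.trans haUp)
    (hab.mono fun x hx => by
      rw [norm_smul, Real.norm_of_nonneg (haLow.le.trans hx.1)]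
      exact mul_le_mul_of_nonneg_right hx.2 (norm_nonneg _))
  have hQ : MemLp (fun x => aLow • (P₂ x - P₁ x)) p := hδP.const_smul aLow
  obtain ⟨-, n6⟩ := memLp_of_norm_le_mul (f := P₂ - P₁) (c := aLow⁻¹) hδP.1 hQ (by positivity)
    (ae_of_all _ fun x => by
      rw [norm_smul, Real.norm_of_nonneg haLow.le, inv_mul_cancel_left₀ haLow.ne', Pi.sub_apply])
  have hF := (((hδf.sub t1).sub t2).sub t4).sub t3
  have nF := lpNorm_sub_le (g := fun x => (a₂ x - aLow) • (P₂ x - P₁ x)) (((hδf.sub t1).sub t2).sub t4) hp1.le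
  have nF1 := lpNorm_sub_le (g := fun x => Du₂ x (u₂ x - u₁ x)) ((hδf.sub t1).sub t2) hp1.le
  have nF2 := lpNorm_sub_le (g := fun x => (a₂ x - a₁ x) • P₁ x) (hδf.sub t1) hp1.le
  have nF3 := lpNorm_sub_le (g := fun x => Du₁ x (u₂ x - u₁ x)) hδf hp1.le
  have nS := lpNorm_sub_le (g := fun x => a₂ x • (P₂ x - P₁ x)) ((hδf.sub t1).sub t2) hp1.le
  have hell := hK _ _ hQ hF (fun i j θ hθ => ?_) (fun θ hθ => ?_)
  · refine ⟨((hδf.sub t1).sub t2).sub t5, ?_⟩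
    set D := lpNorm (P₂ - P₁) p volume
    set B := lpNorm (f₂ - f₁) p volume + (L₁ + L₂) * lpNorm (u₂ - u₁) p volume +
      Λ * lpNorm (a₂ - a₁) p volume with hB
    have hD0 : 0 ≤ D := lpNorm_nonneg
    -- B collects the terms not involving δP. The perturbation is absorbed next, and aUp·D is then
    -- recovered from aLow·D, again by the oscillation bound.
    have h1 : aLow * D ≤ K * (B + (aUp - aLow) * D) := by
      rw [inv_mul_eq_div, le_div_iff₀ haLow, mul_comm] at n6
      refine n6.trans (hell.trans (mul_le_mul_of_nonneg_left ?_ hK0.le))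
      linarith
    have h2 : K * ((aUp - aLow) * D) ≤ aLow * D / 2 := by
      calc K * ((aUp - aLow) * D) ≤ K * (1 / (2 * K) * aLow * D) := by gcongr
        _ = aLow * D / 2 := by field_simp
    have h3 : aLow * D ≤ 2 * K * B := by linarith
    have h4 : aUp * D ≤ (2 * K + 1) * B := by
      have e1 : (aUp - aLow) * D ≤ 1 / (2 * K) * aLow * D := by gcongr
      have e2 : 1 / (2 * K) * aLow * D ≤ B := by
        rw [mul_assoc, one_div, inv_mul_le_iff₀ (by positivity)]; exact h3
      linarith
    have h5 : L₂ * lpNorm (u₂ - u₁) p volume ≥ 0 := mul_nonneg H₂.nonneg lpNorm_nonneg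
    refine nS.trans ?_
    linarith
  · simp only [PiLp.smul_apply, PiLp.sub_apply, smul_eq_mul, mul_assoc, integral_const_mul, sub_mul]
    have hi (k l : Fin N) {P : Space N → Space N} (hP : LocallyIntegrable P) :
        Integrable fun x => P x k * pd l θ x := by
      have := (EuclideanSpace.proj k : Space N →L[ℝ] ℝ).integrable_comp
        (integrable_smul_of_locallyIntegrable hP (hθ.pd l).continuous (hθ.pd l).2)
      simpa only [map_smul, smul_eq_mul, proj_apply, mul_comm] using this
    rw [integral_sub (hi i j H₂.locInt) (hi i j H₁.locInt), integral_sub (hi j i H₂.locInt) (hi j i H₁.locInt),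
      H₁.curl i j θ hθ, H₂.curl i j θ hθ]
  · rw [integral_fderiv_source H₁ H₂ hθ aLow]
    congr 1; ext x; congr 1
    simp only [momentumSource, Pi.sub_apply, sub_smul]
    abel

end SteadyEstimate

end DensityEuler
end

noncomputable section
namespace DensityEuler
set_option linter.unusedSectionVars false

variable {N : ℕ}

/-! ### The difference of two solutions -/

section Difference

variable {T : ℝ} {p : ℝ≥0∞}

/-- Two solutions to be compared, with the integrability of their difference. -/
structure SolutionPair (T : ℝ) (p : ℝ≥0∞) (ρ₁ ρ₂ : ℝ → Space N → ℝ)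
    (u₁ u₂ P₁ P₂ f₁ f₂ : ℝ → Space N → Space N)
    (Du₁ Du₂ : ℝ → Space N → Space N →L[ℝ] Space N) (a₁ a₂ : ℝ → Space N → ℝ)
    (Da₁ : ℝ → Space N → Space N) (aLow aUp : ℝ) : Prop where
  pos : 0 < T
  sol₁ : IsEulerSolution T ρ₁ u₁ P₁ f₁ Du₁
  sol₂ : IsEulerSolution T ρ₂ u₂ P₂ f₂ Du₂
  inv₁ : ∀ t x, a₁ t x = 1 / ρ₁ t x
  inv₂ : ∀ t x, a₂ t x = 1 / ρ₂ t x
  grad : HasWeakGradient T a₁ Da₁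
  cont_a : ContinuousInLp T p (a₂ - a₁)
  cont_u : ContinuousInLp T p (u₂ - u₁)
  pressure : ∫⁻ τ in Ioo 0 T, eLpNorm (P₂ τ - P₁ τ) p volume < ⊤
  low_pos : 0 < aLow
  low_le_up : aLow ≤ aUp
  bounds : ∀ᵐ z : ℝ × Space N ∂(volume.restrict (slab N T)),
    aLow ≤ a₁ z.1 z.2 ∧ a₁ z.1 z.2 ≤ aUp ∧ aLow ≤ a₂ z.1 z.2 ∧ a₂ z.1 z.2 ≤ aUp
  finite : V Du₁ Du₂ Da₁ P₁ T < ⊤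

/-- The integrand of `V`, as a real number. -/
def rate (Du₁ Du₂ : ℝ → Space N → Space N →L[ℝ] Space N) (Da₁ P₁ : ℝ → Space N → Space N)
    (t : ℝ) : ℝ :=
  (eLpNorm (Du₁ t) ⊤ volume).toReal + (eLpNorm (Du₂ t) ⊤ volume).toReal +
    (eLpNorm (Da₁ t) ⊤ volume).toReal + (eLpNorm (P₁ t) ⊤ volume).toReal

lemma rate_nonneg (Du₁ Du₂ : ℝ → Space N → Space N →L[ℝ] Space N) (Da₁ P₁ : ℝ → Space N → Space N)
    (t : ℝ) : 0 ≤ rate Du₁ Du₂ Da₁ P₁ t := by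
  unfold rate; positivity

lemma V_mono {Du₁ Du₂ : ℝ → Space N → Space N →L[ℝ] Space N} {Da₁ P₁ : ℝ → Space N → Space N}
    {s t : ℝ} (h : s ≤ t) : V Du₁ Du₂ Da₁ P₁ s ≤ V Du₁ Du₂ Da₁ P₁ t :=
  lintegral_mono_set (Ioo_subset_Ioo_right h)

variable {ρ₁ ρ₂ : ℝ → Space N → ℝ} {u₁ u₂ P₁ P₂ f₁ f₂ : ℝ → Space N → Space N}
  {Du₁ Du₂ : ℝ → Space N → Space N →L[ℝ] Space N} {a₁ a₂ : ℝ → Space N → ℝ}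
  {Da₁ : ℝ → Space N → Space N} {aLow aUp : ℝ}

lemma ae_bound_of_lintegral {F : Type*} [NormedAddCommGroup F] {G : ℝ → Space N → F}
    (hG : ∫⁻ t in Ioo 0 T, eLpNorm (G t) ⊤ volume ≠ ⊤)
    (hm : AEStronglyMeasurable (Function.uncurry G)
      ((volume.restrict (Ioo 0 T)).prod (volume : Measure (Space N)))) :
    ∀ᵐ t ∂volume.restrict (Ioo 0 T), ∀ᵐ x, ‖G t x‖ ≤ (eLpNorm (G t) ⊤ volume).toReal := by
  filter_upwards [ae_lt_top' (aemeasurable_eLpNorm_slice hm (p := ⊤) (by simp)) hG] with t ht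
  exact ae_norm_le_toReal_eLpNorm ht.ne

lemma ae_memLp_of_lintegral {F : Type*} [NormedAddCommGroup F] (hp : p ≠ 0) {G : ℝ → Space N → F}
    (hm : AEStronglyMeasurable (Function.uncurry G)
      ((volume.restrict (Ioo 0 T)).prod (volume : Measure (Space N))))
    (hG : ∫⁻ t in Ioo 0 T, eLpNorm (G t) p volume ≠ ⊤) :
    ∀ᵐ t ∂volume.restrict (Ioo 0 T), MemLp (G t) p := by
  filter_upwards [ae_lt_top' (aemeasurable_eLpNorm_slice hm hp) hG, ae_slice_eq_mk hm] with t h1 h2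
  exact ⟨AEStronglyMeasurable.congr
    (hm.stronglyMeasurable_mk.comp_measurable measurable_prodMk_left).aestronglyMeasurable h2.symm, h1⟩

lemma one_div_mem {r a b : ℝ} (ha : 0 < a) (h1 : a ≤ 1 / r) (h2 : 1 / r ≤ b) :
    1 / b ≤ r ∧ r ≤ 1 / a := by
  have hr : 0 < 1 / r := ha.trans_le h1
  constructor
  · simpa using one_div_le_one_div_of_le hr h2
  · simpa using one_div_le_one_div_of_le ha h1


lemma integrableOn_lpNorm {F : Type*} [NormedAddCommGroup F] (hp : p ≠ 0) {G : ℝ → Space N → F}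
    (hm : AEStronglyMeasurable (Function.uncurry G)
      ((volume.restrict (Ioo 0 T)).prod (volume : Measure (Space N))))
    (hG : ∫⁻ t in Ioo 0 T, eLpNorm (G t) p volume ≠ ⊤) :
    IntegrableOn (fun t => lpNorm (G t) p volume) (Ioo 0 T) := by
  refine (timeInt_toReal (aemeasurable_eLpNorm_slice hm hp) hG).congr ?_
  filter_upwards [ae_memLp_of_lintegral hp hm hG] with t ht
  exact toReal_eLpNorm ht.1

lemma IsEulerSolution.aestronglyMeasurable_inv {ρ : ℝ → Space N → ℝ} {u P f : ℝ → Space N → Space N}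
    {Du : ℝ → Space N → Space N →L[ℝ] Space N} (H : IsEulerSolution T ρ u P f Du)
    {a : ℝ → Space N → ℝ} (ha : ∀ t x, a t x = 1 / ρ t x) :
    AEStronglyMeasurable (Function.uncurry a)
      ((volume.restrict (Ioo 0 T)).prod (volume : Measure (Space N))) := by
  have h1 := (LocInt.aestronglyMeasurable H.density).aemeasurable.const_div 1
  refine h1.aestronglyMeasurable.congr (ae_of_all _ fun z => ?_)
  simp only [Function.uncurry, ha]

lemma IsEulerSolution.aestronglyMeasurable_pressure {ρ : ℝ → Space N → ℝ}
    {u P f : ℝ → Space N → Space N} {Du : ℝ → Space N → Space N →L[ℝ] Space N}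
    (H : IsEulerSolution T ρ u P f Du) : AEStronglyMeasurable (Function.uncurry P)
      ((volume.restrict (Ioo 0 T)).prod (volume : Measure (Space N))) := by
  obtain ⟨Pr, h⟩ := H.pressure
  exact h.locInt.aestronglyMeasurable

lemma IsEulerSolution.ae_force_eq {ρ : ℝ → Space N → ℝ} {u P f : ℝ → Space N → Space N}
    {Du : ℝ → Space N → Space N →L[ℝ] Space N} (H : IsEulerSolution T ρ u P f Du)
    {a : ℝ → Space N → ℝ} (ha : ∀ t x, a t x = 1 / ρ t x)
    (hpos : ∀ᵐ z : ℝ × Space N ∂(volume.restrict (slab N T)), 0 < a z.1 z.2) :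
    ∃ ut : ℝ → Space N → Space N, HasWeakTimeDeriv T u ut ∧
      ∀ᵐ z : ℝ × Space N ∂(volume.restrict (slab N T)),
        f z.1 z.2 = ut z.1 z.2 + Du z.1 z.2 (u z.1 z.2) + a z.1 z.2 • P z.1 z.2 := by
  obtain ⟨ut, h1, h2⟩ := H.momentum
  refine ⟨ut, h1, ?_⟩
  filter_upwards [h2, hpos] with z hz hz'
  have hρ : a z.1 z.2 * ρ z.1 z.2 = 1 := by
    rw [ha] at hz' ⊢
    exact one_div_mul_cancel (one_div_pos.1 hz').ne'
  have := congrArg (fun v => a z.1 z.2 • v) hz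
  simpa only [smul_add, smul_smul, hρ, one_smul] using this.symm

/-- The force is not assumed measurable; its measurability is read off the momentum equation. -/
lemma IsEulerSolution.aestronglyMeasurable_force {ρ : ℝ → Space N → ℝ} {u P f : ℝ → Space N → Space N}
    {Du : ℝ → Space N → Space N →L[ℝ] Space N} (H : IsEulerSolution T ρ u P f Du)
    {a : ℝ → Space N → ℝ} (ha : ∀ t x, a t x = 1 / ρ t x)
    (hpos : ∀ᵐ z : ℝ × Space N ∂(volume.restrict (slab N T)), 0 < a z.1 z.2) :
    AEStronglyMeasurable (Function.uncurry f)
      ((volume.restrict (Ioo 0 T)).prod (volume : Measure (Space N))) := by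
  obtain ⟨ut, h1, h2⟩ := H.ae_force_eq ha hpos
  rw [slab, volume_restrict_prod_univ] at h2
  have m1 : AEStronglyMeasurable (Function.uncurry ut)
    ((volume.restrict (Ioo 0 T)).prod (volume : Measure (Space N))) :=
    LocInt.aestronglyMeasurable h1.2.1
  have m2 := aestronglyMeasurable_clm_apply (LocInt.aestronglyMeasurable H.jacobian.1)
    H.jacobian.locInt.aestronglyMeasurable
  have m3 := (H.aestronglyMeasurable_inv ha).smul H.aestronglyMeasurable_pressure
  exact ((m1.add m2).add m3).congr (h2.mono fun z hz => hz.symm)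

lemma IsEulerSolution.exists_momentumSlice (hT : 0 < T) {ρ : ℝ → Space N → ℝ}
    {u P f : ℝ → Space N → Space N}
    {Du : ℝ → Space N → Space N →L[ℝ] Space N} (H : IsEulerSolution T ρ u P f Du)
    {a : ℝ → Space N → ℝ} (ha : ∀ t x, a t x = 1 / ρ t x)
    (hpos : ∀ᵐ z : ℝ × Space N ∂(volume.restrict (slab N T)), 0 < a z.1 z.2) {m L : ℝ → ℝ}
    (hU : LipFlow T u m L) (hL : ∀ᵐ t ∂volume.restrict (Ioo 0 T), ∀ᵐ x, ‖Du t x‖ ≤ L t) :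
    ∃ ut : ℝ → Space N → Space N, HasWeakTimeDeriv T u ut ∧ ∀ᵐ t ∂volume.restrict (Ioo 0 T),
      MomentumSlice (u t) (ut t) (P t) (f t) (Du t) (a t) (m t) (L t) (L t) := by
  obtain ⟨ut, h1, h2⟩ := H.ae_force_eq ha hpos
  obtain ⟨Pr, h3⟩ := H.pressure
  refine ⟨ut, h1, ?_⟩
  filter_upwards [hU.divFree, h1.ae_weakDivFree hT hU.divFree, H.jacobian.ae_hasWeakFDeriv hT, hL,
    hU.growth, ae_ae_of_ae_slab h2, h3.locInt.ae_locallyIntegrable, h3.ae_curl hT h3.locInt]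
    with t k1 k2 k3 k4 k5 k6 k7 k8
  exact ⟨k1, k2, k3, hU.nonneg_L t, k4, k5, k6, k7, k8⟩

namespace SolutionPair

lemma lintegral_ne_top (H : SolutionPair T p ρ₁ ρ₂ u₁ u₂ P₁ P₂ f₁ f₂ Du₁ Du₂ a₁ a₂ Da₁ aLow aUp) :
    (∫⁻ t in Ioo 0 T, eLpNorm (Du₁ t) ⊤ volume ≠ ⊤) ∧ (∫⁻ t in Ioo 0 T, eLpNorm (Du₂ t) ⊤ volume ≠ ⊤) ∧
    (∫⁻ t in Ioo 0 T, eLpNorm (Da₁ t) ⊤ volume ≠ ⊤) ∧ (∫⁻ t in Ioo 0 T, eLpNorm (P₁ t) ⊤ volume ≠ ⊤) := by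
  refine ⟨?_, ?_, ?_, ?_⟩ <;> refine ((lintegral_mono fun t => ?_).trans_lt H.finite).ne
  · exact le_add_right (le_add_right le_self_add)
  · exact le_add_right (le_add_right le_add_self)
  · exact le_add_right le_add_self
  · exact le_add_self

lemma ae_bounds (H : SolutionPair T p ρ₁ ρ₂ u₁ u₂ P₁ P₂ f₁ f₂ Du₁ Du₂ a₁ a₂ Da₁ aLow aUp) :
    ∀ᵐ t ∂volume.restrict (Ioo 0 T), ∀ᵐ x,
      aLow ≤ a₁ t x ∧ a₁ t x ≤ aUp ∧ aLow ≤ a₂ t x ∧ a₂ t x ≤ aUp :=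
  ae_ae_of_ae_slab H.bounds

lemma transportEq_inv₁ (H : SolutionPair T p ρ₁ ρ₂ u₁ u₂ P₁ P₂ f₁ f₂ Du₁ Du₂ a₁ a₂ Da₁ aLow aUp)
    {m L : ℝ → ℝ} (hU : LipFlow T u₁ m L) : TransportEq T u₁ a₁ 0 := by
  have h : a₁ = fun t x => 1 / ρ₁ t x := funext fun t => funext fun x => H.inv₁ t x
  rw [h]
  refine TransportEq.one_div H.pos hU H.sol₁.density (c := 1 / aUp) (M := 1 / aLow)
    (one_div_pos.2 (H.low_pos.trans_le H.low_le_up)) ?_ (H.sol₁.transportEq H.pos)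
  filter_upwards [H.ae_bounds] with t ht
  filter_upwards [ht] with x hx
  rw [H.inv₁] at hx
  exact one_div_mem H.low_pos hx.1 hx.2.1

lemma transportEq_inv₂ (H : SolutionPair T p ρ₁ ρ₂ u₁ u₂ P₁ P₂ f₁ f₂ Du₁ Du₂ a₁ a₂ Da₁ aLow aUp)
    {m L : ℝ → ℝ} (hU : LipFlow T u₂ m L) : TransportEq T u₂ a₂ 0 := by
  have h : a₂ = fun t x => 1 / ρ₂ t x := funext fun t => funext fun x => H.inv₂ t x
  rw [h]
  refine TransportEq.one_div H.pos hU H.sol₂.density (c := 1 / aUp) (M := 1 / aLow)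
    (one_div_pos.2 (H.low_pos.trans_le H.low_le_up)) ?_ (H.sol₂.transportEq H.pos)
  filter_upwards [H.ae_bounds] with t ht
  filter_upwards [ht] with x hx
  rw [H.inv₂] at hx
  exact one_div_mem H.low_pos hx.2.2.1 hx.2.2.2

lemma ae_memLp (H : SolutionPair T p ρ₁ ρ₂ u₁ u₂ P₁ P₂ f₁ f₂ Du₁ Du₂ a₁ a₂ Da₁ aLow aUp) :
    ∀ᵐ t ∂volume.restrict (Ioo 0 T), MemLp (a₂ t - a₁ t) p ∧ MemLp (u₂ t - u₁ t) p := by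
  filter_upwards [ae_restrict_mem measurableSet_Ioo] with t ht
  exact ⟨H.cont_a.1 t ⟨ht.1.le, ht.2.le⟩, H.cont_u.1 t ⟨ht.1.le, ht.2.le⟩⟩

/-- The transport equation for the difference of the inverse densities. -/
lemma transportEq_sub_inv (H : SolutionPair T p ρ₁ ρ₂ u₁ u₂ P₁ P₂ f₁ f₂ Du₁ Du₂ a₁ a₂ Da₁ aLow aUp)
    (hp1 : 1 ≤ p) {m₁ L₁ m₂ L₂ : ℝ → ℝ} (hU₁ : LipFlow T u₁ m₁ L₁) (hU₂ : LipFlow T u₂ m₂ L₂) :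
    TransportEq T u₂ (a₂ - a₁) fun t x => -innerSL ℝ (Da₁ t x) (u₂ t x - u₁ t x) := by
  intro ψ hψ
  have hDa := ae_bound_of_lintegral H.lintegral_ne_top.2.2.1 H.grad.locInt.aestronglyMeasurable
  refine ((H.transportEq_inv₂ hU₂ ψ hψ).sub H.pos (H.transportEq_inv₁ hU₁ ψ hψ)).congr ?_ ?_
  · filter_upwards [H.ae_memLp, HasWeakSpaceDeriv.locInt H.grad |>.ae_locallyIntegrable] with t h1 h2
    have h3 : LocallyIntegrable (a₂ t) := by simpa using (h1.1.locallyIntegrable hp1).add h2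
    rw [← integral_sub (integrable_smul_of_locallyIntegrable h3 hψ.continuous hψ.2)
      (integrable_smul_of_locallyIntegrable h2 hψ.continuous hψ.2)]
    congr 1; ext x
    rw [← smul_sub]; rfl
  · filter_upwards [H.ae_memLp, HasWeakSpaceDeriv.locInt H.grad |>.ae_locallyIntegrable, hU₁.growth,
      hU₂.growth, hU₁.divFree, hU₂.divFree, H.grad.ae_hasWeakFDeriv H.pos, hDa]
      with t h1 h2 g1 g2 d1 d2 hG hb
    have h3 : LocallyIntegrable (a₂ t) := by simpa using (h1.1.locallyIntegrable hp1).add h2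
    have hb' : ∀ᵐ x, ‖innerSL ℝ (Da₁ t x)‖ ≤ (eLpNorm (Da₁ t) ⊤ volume).toReal := by
      simpa only [innerSL_apply_norm] using hb
    have hδ := d2.sub d1
    have i {a : Space N → ℝ} (ha : LocallyIntegrable a) {U : Space N → Space N} {m l : ℝ}
        (hU : LocallyIntegrable U) (hg : ∀ᵐ x, ‖U x‖ ≤ m + l * ‖x‖) :
        Integrable fun x => fderiv ℝ ψ x (U x) * a x :=
      integrable_apply_smul hU.aestronglyMeasurable hg ha hψ.continuous_fderiv
        (hψ.2.fderiv (𝕜 := ℝ))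
    have i1 := i h2 d1.1 g1
    have i2 := i h2 d2.1 g2
    have i3 := i h3 d2.1 g2
    have i4 : Integrable fun x => ψ x * innerSL ℝ (Da₁ t x) ((u₂ t - u₁ t) x) :=
      integrable_smul_of_locallyIntegrable
        (locallyIntegrable_clm_apply hG.2.1.aestronglyMeasurable hb' hδ.1) hψ.continuous hψ.2
    -- Only here is the gradient of a₁ used: replacing u₁ by u₂ as the field that transports a₁
    -- produces the source −δu·∇a₁.
    have e := hδ.integral_mul_fderiv hG ENNReal.toReal_nonneg hb' hψ
    have e' : ∫ x, a₁ t x * fderiv ℝ ψ x ((u₂ t - u₁ t) x) =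
        (∫ x, fderiv ℝ ψ x (u₂ t x) * a₁ t x) - ∫ x, fderiv ℝ ψ x (u₁ t x) * a₁ t x := by
      rw [← integral_sub i2 i1]
      congr 1; ext x
      rw [Pi.sub_apply, map_sub]; ring
    simp only [Pi.zero_apply, show (0 : ℝ → Space N → ℝ) t = 0 from rfl, mul_zero, add_zero,
      smul_eq_mul]
    calc (∫ x, fderiv ℝ ψ x (u₂ t x) * a₂ t x) - ∫ x, fderiv ℝ ψ x (u₁ t x) * a₁ t x
        = (∫ x, fderiv ℝ ψ x (u₂ t x) * a₂ t x) - (∫ x, fderiv ℝ ψ x (u₂ t x) * a₁ t x) -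
            ∫ x, ψ x * innerSL ℝ (Da₁ t x) ((u₂ t - u₁ t) x) := by linarith
      _ = _ := by
        have i5 : Integrable fun x => fderiv ℝ ψ x (u₂ t x) * a₂ t x -
          fderiv ℝ ψ x (u₂ t x) * a₁ t x := i3.sub i2
        rw [← integral_sub i3 i2, ← integral_sub i5 i4]
        congr 1; ext x
        simp only [Pi.sub_apply]; ring

lemma ae_pos (H : SolutionPair T p ρ₁ ρ₂ u₁ u₂ P₁ P₂ f₁ f₂ Du₁ Du₂ a₁ a₂ Da₁ aLow aUp) :
    (∀ᵐ z : ℝ × Space N ∂(volume.restrict (slab N T)), 0 < a₁ z.1 z.2) ∧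
      ∀ᵐ z : ℝ × Space N ∂(volume.restrict (slab N T)), 0 < a₂ z.1 z.2 :=
  ⟨H.bounds.mono fun _ hz => H.low_pos.trans_le hz.1,
    H.bounds.mono fun _ hz => H.low_pos.trans_le hz.2.2.1⟩

lemma aestronglyMeasurable_force (H : SolutionPair T p ρ₁ ρ₂ u₁ u₂ P₁ P₂ f₁ f₂ Du₁ Du₂ a₁ a₂ Da₁ aLow aUp) :
    AEStronglyMeasurable (Function.uncurry (f₂ - f₁))
      ((volume.restrict (Ioo 0 T)).prod (volume : Measure (Space N))) :=
  (H.sol₂.aestronglyMeasurable_force H.inv₂ H.ae_pos.2).sub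
    (H.sol₁.aestronglyMeasurable_force H.inv₁ H.ae_pos.1)

lemma aestronglyMeasurable_source (H : SolutionPair T p ρ₁ ρ₂ u₁ u₂ P₁ P₂ f₁ f₂ Du₁ Du₂ a₁ a₂ Da₁ aLow aUp) :
    AEStronglyMeasurable (Function.uncurry fun t =>
        momentumSource (u₁ t) (u₂ t) (P₁ t) (P₂ t) (f₁ t) (f₂ t) (Du₁ t) (a₁ t) (a₂ t))
      ((volume.restrict (Ioo 0 T)).prod (volume : Measure (Space N))) := by
  have mu := H.sol₂.jacobian.locInt.aestronglyMeasurable.sub H.sol₁.jacobian.locInt.aestronglyMeasurable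
  have ma₁ := H.sol₁.aestronglyMeasurable_inv H.inv₁
  have ma₂ := H.sol₂.aestronglyMeasurable_inv H.inv₂
  have mP₁ := H.sol₁.aestronglyMeasurable_pressure
  have mP₂ := H.sol₂.aestronglyMeasurable_pressure
  exact ((H.aestronglyMeasurable_force.sub (aestronglyMeasurable_clm_apply
    (LocInt.aestronglyMeasurable H.sol₁.jacobian.1) mu)).sub ((ma₂.sub ma₁).smul mP₁)).sub
      (ma₂.smul (mP₂.sub mP₁))

lemma integrableOn_rate (H : SolutionPair T p ρ₁ ρ₂ u₁ u₂ P₁ P₂ f₁ f₂ Du₁ Du₂ a₁ a₂ Da₁ aLow aUp) :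
    IntegrableOn (rate Du₁ Du₂ Da₁ P₁) (Ioo 0 T) := by
  obtain ⟨h1, h2, h3, h4⟩ := H.lintegral_ne_top
  exact (((timeInt_toReal (aemeasurable_eLpNorm_slice
    (LocInt.aestronglyMeasurable H.sol₁.jacobian.1) (by simp)) h1).add
    (timeInt_toReal (aemeasurable_eLpNorm_slice
      (LocInt.aestronglyMeasurable H.sol₂.jacobian.1) (by simp)) h2)).add
    (timeInt_toReal (aemeasurable_eLpNorm_slice H.grad.locInt.aestronglyMeasurable (by simp)) h3)).add
    (timeInt_toReal (aemeasurable_eLpNorm_slice H.sol₁.aestronglyMeasurable_pressure (by simp)) h4)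

end SolutionPair

end Difference

end DensityEuler
end

noncomputable section
namespace DensityEuler
set_option linter.unusedSectionVars false

variable {N : ℕ}

/-! ### The stability estimate -/

section Stability

variable {p : ℝ≥0∞}

lemma integrableOn_continuousOn_mul {T : ℝ} {X G : ℝ → ℝ} (hX : ContinuousOn X (Icc 0 T))
    (hG : IntegrableOn G (Ioo 0 T)) : IntegrableOn (fun t => X t * G t) (Icc 0 T) :=
  IntegrableOn.continuousOn_mul hX ((integrableOn_Icc_iff_integrableOn_Ioo).2 hG) isCompact_Icc

/-- The integral inequality for the norm of the difference of two solutions. -/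
theorem exists_norm_sub_le_add_integral (hN : 0 < N) (hp1 : 1 < p) (hp : p ≠ ⊤) : ∃ c C, 0 < c ∧ 0 < C ∧
    ∀ (T : ℝ) (ρ₁ ρ₂ : ℝ → Space N → ℝ) (u₁ u₂ P₁ P₂ f₁ f₂ : ℝ → Space N → Space N)
      (Du₁ Du₂ : ℝ → Space N → Space N →L[ℝ] Space N) (a₁ a₂ : ℝ → Space N → ℝ)
      (Da₁ : ℝ → Space N → Space N) (aLow aUp : ℝ),
      SolutionPair T p ρ₁ ρ₂ u₁ u₂ P₁ P₂ f₁ f₂ Du₁ Du₂ a₁ a₂ Da₁ aLow aUp → aUp - aLow ≤ c * aLow →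
      ∫⁻ τ in Ioo 0 T, eLpNorm (f₂ τ - f₁ τ) p volume ≠ ⊤ → ∀ s t, 0 < s → s ≤ t → t < T →
      lpNorm (a₂ t - a₁ t) p volume + lpNorm (u₂ t - u₁ t) p volume ≤
        lpNorm (a₂ s - a₁ s) p volume + lpNorm (u₂ s - u₁ s) p volume +
          ∫ τ in s..t, (C * rate Du₁ Du₂ Da₁ P₁ τ *
            (lpNorm (a₂ τ - a₁ τ) p volume + lpNorm (u₂ τ - u₁ τ) p volume) +
              C * lpNorm (f₂ τ - f₁ τ) p volume) := by
  have hp0 : p ≠ 0 := (zero_lt_one.trans hp1).ne'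
  obtain ⟨Ca, hCa0, hCa⟩ := exists_lpNorm_transport_le N ℝ hp1 hp
  obtain ⟨Cu, hCu0, hCu⟩ := exists_lpNorm_transport_le N (Space N) hp1 hp
  obtain ⟨c, C, hc0, hC0, hC⟩ := exists_momentumSource_le hN hp1 hp
  -- The summand 1 covers the source −δu·∇a₁, whose coefficient is one.
  refine ⟨c, 1 + Ca + Cu + C, hc0, by positivity, ?_⟩
  intro T ρ₁ ρ₂ u₁ u₂ P₁ P₂ f₁ f₂ Du₁ Du₂ a₁ a₂ Da₁ aLow aUp H hc hf s t hs hst ht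
  have hT := H.pos
  obtain ⟨v1, v2, v3, v4⟩ := H.lintegral_ne_top
  have mD₁ := LocInt.aestronglyMeasurable H.sol₁.jacobian.1
  have mD₂ := LocInt.aestronglyMeasurable H.sol₂.jacobian.1
  have mDa := H.grad.locInt.aestronglyMeasurable
  have mP₁ := H.sol₁.aestronglyMeasurable_pressure
  have mP₂ := H.sol₂.aestronglyMeasurable_pressure
  have ma := (H.sol₂.aestronglyMeasurable_inv H.inv₂).sub (H.sol₁.aestronglyMeasurable_inv H.inv₁)
  have mu := H.sol₂.jacobian.locInt.aestronglyMeasurable.sub H.sol₁.jacobian.locInt.aestronglyMeasurable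
  have b1 := ae_bound_of_lintegral v1 mD₁
  have b2 := ae_bound_of_lintegral v2 mD₂
  have b3 := ae_bound_of_lintegral v3 mDa
  have b4 := ae_bound_of_lintegral v4 mP₁
  have eP := ae_memLp_of_lintegral (G := P₂ - P₁) hp0 (mP₂.sub mP₁) H.pressure.ne
  have ef := ae_memLp_of_lintegral (G := f₂ - f₁) hp0 H.aestronglyMeasurable_force hf
  obtain ⟨m₁, hU₁⟩ := exists_lipFlow hT H.sol₁.jacobian H.sol₁.incompressible v1
  obtain ⟨m₂, hU₂⟩ := exists_lipFlow hT H.sol₂.jacobian H.sol₂.incompressible v2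
  obtain ⟨ut₁, d1, s1⟩ := H.sol₁.exists_momentumSlice hT H.inv₁ H.ae_pos.1 hU₁ b1
  obtain ⟨ut₂, d2, s2⟩ := H.sol₂.exists_momentumSlice hT H.inv₂ H.ae_pos.2 hU₂ b2
  set l₁ : ℝ → ℝ := fun t => (eLpNorm (Du₁ t) ⊤ volume).toReal with hl₁
  set l₂ : ℝ → ℝ := fun t => (eLpNorm (Du₂ t) ⊤ volume).toReal with hl₂
  set l₃ : ℝ → ℝ := fun t => (eLpNorm (Da₁ t) ⊤ volume).toReal with hl₃
  set l₄ : ℝ → ℝ := fun t => (eLpNorm (P₁ t) ⊤ volume).toReal with hl₄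
  have t3 : TimeInt T l₃ := timeInt_of_integrableOn (timeInt_toReal (aemeasurable_eLpNorm_slice mDa (by simp)) v3)
  have t4 : TimeInt T l₄ := timeInt_of_integrableOn (timeInt_toReal (aemeasurable_eLpNorm_slice mP₁ (by simp)) v4)
  have tf : TimeInt T fun τ => lpNorm (f₂ τ - f₁ τ) p volume :=
    timeInt_of_integrableOn (integrableOn_lpNorm (G := f₂ - f₁) hp0 H.aestronglyMeasurable_force hf)
  set X : ℝ → ℝ := fun t => lpNorm (a₂ t - a₁ t) p volume with hX
  set Y : ℝ → ℝ := fun t => lpNorm (u₂ t - u₁ t) p volume with hY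
  have cX : ContinuousOn X (Ioo 0 T) := (H.cont_a.continuousOn_lpNorm hp1.le).mono Ioo_subset_Icc_self
  have cY : ContinuousOn Y (Ioo 0 T) := (H.cont_u.continuousOn_lpNorm hp1.le).mono Ioo_subset_Icc_self
  have X0 (t : ℝ) : 0 ≤ X t := lpNorm_nonneg
  have Y0 (t : ℝ) : 0 ≤ Y t := lpNorm_nonneg
  set h : ℝ → Space N → Space N := fun t =>
    momentumSource (u₁ t) (u₂ t) (P₁ t) (P₂ t) (f₁ t) (f₂ t) (Du₁ t) (a₁ t) (a₂ t) with hh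
  set k : ℝ → Space N → ℝ := fun t x => -innerSL ℝ (Da₁ t x) (u₂ t x - u₁ t x) with hk
  have mk : AEStronglyMeasurable (Function.uncurry k)
      ((volume.restrict (Ioo 0 T)).prod (volume : Measure (Space N))) := (mDa.inner mu).neg
  have mh : AEStronglyMeasurable (Function.uncurry h)
      ((volume.restrict (Ioo 0 T)).prod (volume : Measure (Space N))) := H.aestronglyMeasurable_source
  have ek : ∀ᵐ t ∂volume.restrict (Ioo 0 T), MemLp (k t) p ∧ lpNorm (k t) p volume ≤ Y t * l₃ t := by
    filter_upwards [H.ae_memLp, b3, H.grad.locInt.ae_locallyIntegrable] with t h1 h2 h3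
    rw [mul_comm]
    refine memLp_of_norm_le_mul (h3.aestronglyMeasurable.inner h1.2.1).neg h1.2
      ENNReal.toReal_nonneg (h2.mono fun x hx => ?_)
    rw [norm_neg]
    exact (norm_inner_le_norm _ _).trans (mul_le_mul_of_nonneg_right hx (norm_nonneg _))
  have eh : ∀ᵐ t ∂volume.restrict (Ioo 0 T), MemLp (h t) p ∧ lpNorm (h t) p volume ≤
      C * (lpNorm (f₂ t - f₁ t) p volume + Y t * (l₁ t + l₂ t) + X t * l₄ t) := by
    filter_upwards [s1, s2, H.ae_memLp, eP, ef, b4, H.ae_bounds,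
      (HasWeakSpaceDeriv.locInt H.grad).ae_locallyIntegrable] with t h1 h2 h3 h4 h5 h6 h7 h8
    have := hC _ _ _ _ _ _ _ _ _ _ _ _ _ _ _ _ _ _ (l₄ t) aLow aUp h1 h2 h8.aestronglyMeasurable
      h3.1 h3.2 h4 h5 ENNReal.toReal_nonneg h6 H.low_pos H.low_le_up (h7.mono fun x hx => hx.2.2) hc
    refine ⟨this.1, this.2.trans_eq ?_⟩
    simp only [hX, hY]
    rw [mul_comm (l₄ t), mul_comm (l₁ t + l₂ t)]
  have tk := timeInt_lpNorm hp0 mk (TimeInt.continuousOn_mul cY t3) (ek.mono fun _ h => h.2)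
  have th := timeInt_lpNorm hp0 mh (((tf.add (TimeInt.continuousOn_mul cY (hU₁.timeInt_L.add hU₂.timeInt_L))).add
    (TimeInt.continuousOn_mul cX t4)).const_mul C) (eh.mono fun _ h => h.2)
  -- The time derivatives are functions, so the equation for δu follows by pairing them with ψ and
  -- applying the fixed-time identity `integral_smul_deriv_sub` at almost every time.
  have eq_u : TransportEq T u₂ (u₂ - u₁) h := by
    intro ψ hψ
    refine ((d2.hasWeakDeriv hT hψ).sub hT (d1.hasWeakDeriv hT hψ)).congr ?_ ?_
    · filter_upwards [hU₁.divFree, hU₂.divFree] with t h1 h2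
      rw [← integral_sub (integrable_smul_of_locallyIntegrable h2.1 hψ.continuous hψ.2)
        (integrable_smul_of_locallyIntegrable h1.1 hψ.continuous hψ.2)]
      congr 1; ext1 x
      rw [← smul_sub]; rfl
    · filter_upwards [s1, s2] with t h1 h2
      have := integral_smul_deriv_sub h1 h2 hψ
      rw [← integral_sub (integrable_smul_of_locallyIntegrable h2.divFree_deriv.1 hψ.continuous hψ.2)
        (integrable_smul_of_locallyIntegrable h1.divFree_deriv.1 hψ.continuous hψ.2)]
      refine Eq.trans ?_ this
      congr 1; ext1 x
      rw [← smul_sub]; rfl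
  have iX : X t ≤ X s + ∫ τ in s..t, (lpNorm (k τ) p volume + Ca * l₂ τ * X τ) :=
    hCa T u₂ m₂ l₂ (a₂ - a₁) k hT hU₂ ma H.cont_a (H.transportEq_sub_inv hp1.le hU₁ hU₂) mk
    (ek.mono fun _ h => h.1) tk s t hs hst ht
  have iY : Y t ≤ Y s + ∫ τ in s..t, (lpNorm (h τ) p volume + Cu * l₂ τ * Y τ) :=
    hCu T u₂ m₂ l₂ (u₂ - u₁) h hT hU₂ mu H.cont_u eq_u mh (eh.mono fun _ h => h.1) th s t hs hst ht
  have j1 : TimeInt T fun τ => lpNorm (k τ) p volume + Ca * l₂ τ * X τ := by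
    have := tk.add ((TimeInt.continuousOn_mul cX hU₂.timeInt_L).const_mul Ca)
    exact fun s t hs ht => (this s t hs ht).congr (ae_of_all _ fun τ => by simp only; ring)
  have j2 : TimeInt T fun τ => lpNorm (h τ) p volume + Cu * l₂ τ * Y τ := by
    have := th.add ((TimeInt.continuousOn_mul cY hU₂.timeInt_L).const_mul Cu)
    exact fun s t hs ht => (this s t hs ht).congr (ae_of_all _ fun τ => by simp only; ring)
  have j3 : TimeInt T fun τ => (1 + Ca + Cu + C) * rate Du₁ Du₂ Da₁ P₁ τ * (X τ + Y τ) +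
      (1 + Ca + Cu + C) * lpNorm (f₂ τ - f₁ τ) p volume := by
    have := ((TimeInt.continuousOn_mul (cX.add cY) (timeInt_of_integrableOn H.integrableOn_rate)).add
      tf).const_mul (1 + Ca + Cu + C)
    exact fun s t hs ht => (this s t hs ht).congr (ae_of_all _ fun τ => by
      simp only [Pi.add_apply]; ring)
  have k1 := j1.intervalIntegrable hs hst ht
  have k2 := j2.intervalIntegrable hs hst ht
  have hle := intervalIntegral.integral_mono_ae_restrict hst (k1.add k2)
    (j3.intervalIntegrable hs hst ht) (ae_restrict_Icc_of_Ioo (p := fun τ =>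
      (lpNorm (k τ) p volume + Ca * l₂ τ * X τ) + (lpNorm (h τ) p volume + Cu * l₂ τ * Y τ) ≤
        (1 + Ca + Cu + C) * rate Du₁ Du₂ Da₁ P₁ τ * (X τ + Y τ) +
          (1 + Ca + Cu + C) * lpNorm (f₂ τ - f₁ τ) p volume) (by
      filter_upwards [ek, eh] with τ h1 h2
      refine (add_le_add (add_le_add_left h1.2 _) (add_le_add_left h2.2 _)).trans ?_
      have p1 : 0 ≤ l₁ τ := ENNReal.toReal_nonneg
      have p2 : 0 ≤ l₂ τ := ENNReal.toReal_nonneg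
      have p3 : 0 ≤ l₃ τ := ENNReal.toReal_nonneg
      have p4 : 0 ≤ l₄ τ := ENNReal.toReal_nonneg
      have pf : 0 ≤ lpNorm (f₂ τ - f₁ τ) p volume := lpNorm_nonneg
      have er : rate Du₁ Du₂ Da₁ P₁ τ = l₁ τ + l₂ τ + l₃ τ + l₄ τ := rfl
      rw [er, ← sub_nonneg]
      have px := X0 τ
      have py := Y0 τ
      -- The difference of the two sides after all cancellations, written with nonnegative terms
      -- only.
      have : 0 ≤ (1 + Ca + Cu) * lpNorm (f₂ τ - f₁ τ) p volume +
          X τ * ((1 + Cu) * (l₁ τ + l₂ τ + l₃ τ + l₄ τ) + Ca * (l₁ τ + l₃ τ + l₄ τ) +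
            C * (l₁ τ + l₂ τ + l₃ τ)) +
          Y τ * ((l₁ τ + l₂ τ + l₄ τ) + Ca * (l₁ τ + l₂ τ + l₃ τ + l₄ τ) +
            Cu * (l₁ τ + l₃ τ + l₄ τ) + C * (l₃ τ + l₄ τ)) := by positivity
      refine this.trans_eq ?_
      ring) hs ht)
  rw [intervalIntegral.integral_add k1 k2] at hle
  linarith

lemma V_eq_ofReal {T : ℝ} {ρ₁ ρ₂ : ℝ → Space N → ℝ} {u₁ u₂ P₁ P₂ f₁ f₂ : ℝ → Space N → Space N}
    {Du₁ Du₂ : ℝ → Space N → Space N →L[ℝ] Space N} {a₁ a₂ : ℝ → Space N → ℝ}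
    {Da₁ : ℝ → Space N → Space N} {aLow aUp : ℝ}
    (H : SolutionPair T p ρ₁ ρ₂ u₁ u₂ P₁ P₂ f₁ f₂ Du₁ Du₂ a₁ a₂ Da₁ aLow aUp) {t : ℝ} (ht0 : 0 ≤ t)
    (ht : t ≤ T) :
    (V Du₁ Du₂ Da₁ P₁ t).toReal = ∫ τ in 0..t, rate Du₁ Du₂ Da₁ P₁ τ := by
  obtain ⟨v1, v2, v3, v4⟩ := H.lintegral_ne_top
  have e1 := ae_lt_top' (aemeasurable_eLpNorm_slice (p := ⊤)
    (LocInt.aestronglyMeasurable H.sol₁.jacobian.1) (by simp)) v1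
  have e2 := ae_lt_top' (aemeasurable_eLpNorm_slice (p := ⊤)
    (LocInt.aestronglyMeasurable H.sol₂.jacobian.1) (by simp)) v2
  have e3 := ae_lt_top' (aemeasurable_eLpNorm_slice (p := ⊤) H.grad.locInt.aestronglyMeasurable (by simp)) v3
  have e4 := ae_lt_top' (aemeasurable_eLpNorm_slice (p := ⊤) H.sol₁.aestronglyMeasurable_pressure (by simp)) v4
  have hsub : Ioo 0 t ⊆ Ioo 0 T := Ioo_subset_Ioo_right ht
  have h1 : V Du₁ Du₂ Da₁ P₁ t = ∫⁻ τ in Ioo 0 t, ENNReal.ofReal (rate Du₁ Du₂ Da₁ P₁ τ) := by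
    refine lintegral_congr_ae (ae_restrict_of_ae_restrict_of_subset hsub ?_)
    filter_upwards [e1, e2, e3, e4] with τ h1 h2 h3 h4
    rw [rate, ENNReal.ofReal_add (by positivity) (by positivity),
      ENNReal.ofReal_add (by positivity) (by positivity),
      ENNReal.ofReal_add (by positivity) (by positivity), ENNReal.ofReal_toReal h1.ne,
      ENNReal.ofReal_toReal h2.ne, ENNReal.ofReal_toReal h3.ne, ENNReal.ofReal_toReal h4.ne]
  rw [h1, ← ofReal_integral_eq_lintegral_ofReal (H.integrableOn_rate.mono_set hsub)
    (ae_of_all _ fun τ => rate_nonneg _ _ _ _ τ), ENNReal.toReal_ofReal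
    (integral_nonneg fun τ => rate_nonneg _ _ _ _ τ), intervalIntegral.integral_of_le ht0,
    integral_Ioc_eq_integral_Ioo]

/-- The stability estimate at the final time, for forces with integrable difference. -/
theorem exists_pairNorm_le (hN : 0 < N) (hp1 : 1 < p) (hp : p ≠ ⊤) : ∃ c C, 0 < c ∧ 0 < C ∧
    ∀ (T : ℝ) (ρ₁ ρ₂ : ℝ → Space N → ℝ) (u₁ u₂ P₁ P₂ f₁ f₂ : ℝ → Space N → Space N)
      (Du₁ Du₂ : ℝ → Space N → Space N →L[ℝ] Space N) (a₁ a₂ : ℝ → Space N → ℝ)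
      (Da₁ : ℝ → Space N → Space N) (aLow aUp : ℝ),
      SolutionPair T p ρ₁ ρ₂ u₁ u₂ P₁ P₂ f₁ f₂ Du₁ Du₂ a₁ a₂ Da₁ aLow aUp → aUp - aLow ≤ c * aLow →
      ∫⁻ τ in Ioo 0 T, eLpNorm (f₂ τ - f₁ τ) p volume ≠ ⊤ →
      pairNorm p (a₂ T - a₁ T) (u₂ T - u₁ T) ≤
        ENNReal.ofReal (Real.exp (C * (V Du₁ Du₂ Da₁ P₁ T).toReal)) *
          (pairNorm p (a₂ 0 - a₁ 0) (u₂ 0 - u₁ 0) +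
            ENNReal.ofReal C * ∫⁻ τ in Ioo 0 T,
              ENNReal.ofReal (Real.exp (-(C * (V Du₁ Du₂ Da₁ P₁ τ).toReal))) *
                eLpNorm (f₂ τ - f₁ τ) p volume) := by
  have hp0 : p ≠ 0 := (zero_lt_one.trans hp1).ne'
  obtain ⟨c, C, hc0, hC0, hC⟩ := exists_norm_sub_le_add_integral hN hp1 hp
  refine ⟨c, C, hc0, hC0, ?_⟩
  intro T ρ₁ ρ₂ u₁ u₂ P₁ P₂ f₁ f₂ Du₁ Du₂ a₁ a₂ Da₁ aLow aUp H hc hf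
  have hT := H.pos
  set Z : ℝ → ℝ := fun t => lpNorm (a₂ t - a₁ t) p volume + lpNorm (u₂ t - u₁ t) p volume with hZ
  set v := rate Du₁ Du₂ Da₁ P₁ with hv
  set φ : ℝ → ℝ := fun τ => lpNorm (f₂ τ - f₁ τ) p volume with hφ
  have hZ0 (t : ℝ) : 0 ≤ Z t := add_nonneg lpNorm_nonneg lpNorm_nonneg
  have cZ : ContinuousOn Z (Icc 0 T) :=
    (H.cont_a.continuousOn_lpNorm hp1.le).add (H.cont_u.continuousOn_lpNorm hp1.le)
  have iv := H.integrableOn_rate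
  have iφ : IntegrableOn φ (Ioo 0 T) :=
    integrableOn_lpNorm (G := f₂ - f₁) hp0 H.aestronglyMeasurable_force hf
  have toI {g : ℝ → ℝ} (hg : IntegrableOn g (Icc 0 T)) {s t : ℝ} (hs : 0 ≤ s) (hst : s ≤ t) (ht : t ≤ T) :
      IntervalIntegrable g volume s t :=
    (intervalIntegrable_iff_integrableOn_Icc_of_le hst).2 (hg.mono_set (Icc_subset_Icc hs ht))
  have iv' : IntegrableOn v (Icc 0 T) := by
    rw [integrableOn_Icc_iff_integrableOn_Ioo]; exact iv
  have iφ' : IntegrableOn φ (Icc 0 T) := by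
    rw [integrableOn_Icc_iff_integrableOn_Ioo]; exact iφ
  have ig : IntegrableOn (fun τ => C * v τ * Z τ + C * φ τ) (Icc 0 T) := by
    refine (((integrableOn_continuousOn_mul cZ iv).add iφ').const_mul C).congr (ae_of_all _ fun τ => ?_)
    simp only [Pi.add_apply]; ring
  have prim {g : ℝ → ℝ} (hg : IntegrableOn g (Icc 0 T)) {t : ℝ} (ht0 : 0 ≤ t) (ht : t ≤ T) :
      ContinuousOn (fun τ => ∫ σ in 0..τ, g σ) (Icc 0 t) := by
    have := intervalIntegral.continuousOn_primitive_interval (μ := volume) (f := g) (a := 0) (b := t)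
      (by rw [uIcc_of_le ht0]; exact hg.mono_set (Icc_subset_Icc_right ht))
    rwa [uIcc_of_le ht0] at this
  -- The inequality is known between interior times; continuity of the norms on the closed interval
  -- extends it to the initial and the final time.
  have hint : ∀ r ∈ Icc 0 T, Z r ≤ Z 0 + ∫ τ in 0..r, (C * v τ * Z τ + C * φ τ) := by
    intro r hr
    have := le_of_ae_antitone (T := T) (A := univ) (ae_of_all _ fun _ => mem_univ _) le_rfl hr.1 hr.2
      (Z := fun t => Z t - ∫ τ in 0..t, (C * v τ * Z τ + C * φ τ))
      ((cZ.mono (Icc_subset_Icc_right hr.2)).sub (prim ig hr.1 hr.2)) fun a _ b _ ha hab hb => by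
        have h1 := hC T ρ₁ ρ₂ u₁ u₂ P₁ P₂ f₁ f₂ Du₁ Du₂ a₁ a₂ Da₁ aLow aUp H hc hf a b ha hab
          (hb.trans_le hr.2)
        have h2 := intervalIntegral.integral_add_adjacent_intervals
          (toI ig le_rfl ha.le ((hab.trans hb.le).trans hr.2)) (toI ig ha.le hab (hb.le.trans hr.2))
        simp only [hZ] at h1 h2 ⊢
        linarith
    simp only [intervalIntegral.integral_same, sub_zero] at this
    linarith
  have main := gronwall_integral hT.le hC0.le cZ (toI iv' le_rfl hT.le le_rfl)
    (rate_nonneg Du₁ Du₂ Da₁ P₁) (toI iφ' le_rfl hT.le le_rfl) hint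
  have hpair (t : ℝ) (ht : t ∈ Icc 0 T) : pairNorm p (a₂ t - a₁ t) (u₂ t - u₁ t) = ENNReal.ofReal (Z t) := by
    have ha : MemLp (a₂ t - a₁ t) p := H.cont_a.1 t ht
    have hu : MemLp (u₂ t - u₁ t) p := H.cont_u.1 t ht
    rw [pairNorm, hZ, ENNReal.ofReal_add lpNorm_nonneg lpNorm_nonneg, ofReal_lpNorm ha, ofReal_lpNorm hu]
  have iE : IntegrableOn (fun τ => Real.exp (-(C * ∫ r in 0..τ, v r)) * φ τ) (Ioo 0 T) := by
    refine (integrableOn_continuousOn_mul ?_ iφ).mono_set Ioo_subset_Icc_self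
    exact Real.continuous_exp.comp_continuousOn ((continuousOn_const.mul (prim iv' hT.le le_rfl)).neg)
  have hE0 (τ : ℝ) : 0 ≤ Real.exp (-(C * ∫ r in 0..τ, v r)) * φ τ :=
    mul_nonneg (Real.exp_pos _).le lpNorm_nonneg
  have hlint : ∫⁻ τ in Ioo 0 T, ENNReal.ofReal (Real.exp (-(C * (V Du₁ Du₂ Da₁ P₁ τ).toReal))) *
      eLpNorm (f₂ τ - f₁ τ) p volume =
      ENNReal.ofReal (∫ τ in 0..T, Real.exp (-(C * ∫ r in 0..τ, v r)) * φ τ) := by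
    rw [intervalIntegral.integral_of_le hT.le, integral_Ioc_eq_integral_Ioo,
      ofReal_integral_eq_lintegral_ofReal iE (ae_of_all _ hE0)]
    refine lintegral_congr_ae ?_
    filter_upwards [ae_restrict_mem measurableSet_Ioo,
      ae_memLp_of_lintegral (G := f₂ - f₁) hp0 H.aestronglyMeasurable_force hf] with τ hτ hfτ
    have hfτ' : MemLp (f₂ τ - f₁ τ) p := hfτ
    rw [ENNReal.ofReal_mul (Real.exp_pos _).le, V_eq_ofReal H hτ.1.le hτ.2.le, hφ, ofReal_lpNorm hfτ']
  rw [hpair T ⟨hT.le, le_rfl⟩, hpair 0 ⟨le_rfl, hT.le⟩, hlint, V_eq_ofReal H hT.le le_rfl,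
    ← ENNReal.ofReal_mul hC0.le, ← ENNReal.ofReal_add (hZ0 0) (mul_nonneg hC0.le
      (intervalIntegral.integral_nonneg hT.le fun τ _ => hE0 τ)), ← ENNReal.ofReal_mul (Real.exp_pos _).le]
  exact ENNReal.ofReal_le_ofReal main

end Stability

end DensityEuler

end

/-! ### The stability theorem -/

theorem mainTheorem7 (N : ℕ) (hN : 2 ≤ N) (p : ℝ≥0∞) (hp1 : 1 < p) (hp : p < ⊤) :
    ∃ c C : ℝ, 0 < c ∧ 0 < C ∧
      ∀ (T : ℝ) (_ : 0 < T)
        (ρ₁ ρ₂ : ℝ → DensityEuler.Space N → ℝ)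
        (u₁ u₂ P₁ P₂ f₁ f₂ : ℝ → DensityEuler.Space N → DensityEuler.Space N)
        (Du₁ Du₂ : ℝ → DensityEuler.Space N → DensityEuler.Space N →L[ℝ] DensityEuler.Space N)
        (_ : DensityEuler.IsEulerSolution T ρ₁ u₁ P₁ f₁ Du₁)
        (_ : DensityEuler.IsEulerSolution T ρ₂ u₂ P₂ f₂ Du₂)
        (a₁ a₂ : ℝ → DensityEuler.Space N → ℝ)
        (_ : ∀ t x, a₁ t x = 1 / ρ₁ t x) (_ : ∀ t x, a₂ t x = 1 / ρ₂ t x)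
        (Da₁ : ℝ → DensityEuler.Space N → DensityEuler.Space N)
        (_ : DensityEuler.HasWeakGradient T a₁ Da₁)
        -- `δa`, `δu` lie in `C([0,T]; L^p)` and `∇δΠ` lies in `L¹([0,T]; L^p)`
        (_ : DensityEuler.ContinuousInLp T p (a₂ - a₁))
        (_ : DensityEuler.ContinuousInLp T p (u₂ - u₁))
        (_ : ∫⁻ τ in Ioo 0 T, eLpNorm (P₂ τ - P₁ τ) p volume < ⊤)
        -- `a_* ≤ a₁, a₂ ≤ a^*` almost everywhere
        (aLow aUp : ℝ) (_ : 0 < aLow) (_ : aLow ≤ aUp)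
        (_ : ∀ᵐ z : ℝ × DensityEuler.Space N ∂(volume.restrict (DensityEuler.slab N T)),
          aLow ≤ a₁ z.1 z.2 ∧ a₁ z.1 z.2 ≤ aUp ∧ aLow ≤ a₂ z.1 z.2 ∧ a₂ z.1 z.2 ≤ aUp)
        (_ : aUp - aLow ≤ c * aLow)
        (_ : ∀ t ∈ Icc 0 T, DensityEuler.V Du₁ Du₂ Da₁ P₁ t < ⊤),
        ∀ t ∈ Icc 0 T,
          DensityEuler.pairNorm p (a₂ t - a₁ t) (u₂ t - u₁ t) ≤
            ENNReal.ofReal (Real.exp (C * (DensityEuler.V Du₁ Du₂ Da₁ P₁ t).toReal)) *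
              (DensityEuler.pairNorm p (a₂ 0 - a₁ 0) (u₂ 0 - u₁ 0) +
                ENNReal.ofReal C * ∫⁻ τ in Ioo 0 t,
                  ENNReal.ofReal (Real.exp (-(C * (DensityEuler.V Du₁ Du₂ Da₁ P₁ τ).toReal))) *
                    eLpNorm (f₂ τ - f₁ τ) p volume) := by
  obtain ⟨c, C, hc0, hC0, hC⟩ := DensityEuler.exists_pairNorm_le (N := N) (by omega) hp1 hp.ne
  refine ⟨c, C, hc0, hC0, ?_⟩
  intro T hT ρ₁ ρ₂ u₁ u₂ P₁ P₂ f₁ f₂ Du₁ Du₂ h₁ h₂ a₁ a₂ ha₁ ha₂ Da₁ hDa hca hcu hP aLow aUp hlow hle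
    hab hc hV t ht
  -- At the initial time the estimate holds because both the exponential factor is at least 1 and
  -- the force term is nonnegative.
  rcases ht.1.eq_or_lt with rfl | ht0
  · refine le_self_add.trans (le_mul_of_one_le_left zero_le ?_)
    rw [← ENNReal.ofReal_one]
    exact ENNReal.ofReal_le_ofReal (Real.one_le_exp (mul_nonneg hC0.le ENNReal.toReal_nonneg))
  -- If δf is not integrable in time with values in L^p, the right side is infinite: on (0, t) the
  -- weight is at least exp(−C V(t)) > 0.
  by_cases hf : ∫⁻ τ in Ioo 0 t, eLpNorm (f₂ τ - f₁ τ) p volume = ⊤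
  · have h1 : ∫⁻ τ in Ioo 0 t, ENNReal.ofReal
        (Real.exp (-(C * (DensityEuler.V Du₁ Du₂ Da₁ P₁ τ).toReal))) *
          eLpNorm (f₂ τ - f₁ τ) p volume = ⊤ := by
      rw [eq_top_iff]
      calc (⊤ : ℝ≥0∞) = ENNReal.ofReal (Real.exp (-(C * (DensityEuler.V Du₁ Du₂ Da₁ P₁ t).toReal))) *
            ∫⁻ τ in Ioo 0 t, eLpNorm (f₂ τ - f₁ τ) p volume := by
            rw [hf, ENNReal.mul_top (ENNReal.ofReal_pos.2 (Real.exp_pos _)).ne']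
        _ ≤ ∫⁻ τ in Ioo 0 t, ENNReal.ofReal
              (Real.exp (-(C * (DensityEuler.V Du₁ Du₂ Da₁ P₁ t).toReal))) *
                eLpNorm (f₂ τ - f₁ τ) p volume := lintegral_const_mul_le _ _
        _ ≤ _ := by
            refine setLIntegral_mono' measurableSet_Ioo fun τ hτ => ?_
            have h2 := ENNReal.toReal_mono (hV t ht).ne (DensityEuler.V_mono (Du₁ := Du₁) (Du₂ := Du₂)
              (Da₁ := Da₁) (P₁ := P₁) hτ.2.le)
            gcongr
    rw [h1, ENNReal.mul_top (ENNReal.ofReal_pos.2 hC0).ne', add_top,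
      ENNReal.mul_top (ENNReal.ofReal_pos.2 (Real.exp_pos _)).ne']
    exact le_top
  -- The estimate at time t is the final-time estimate for the solutions restricted to [0, t]; thus
  -- the force only needs to be integrable up to t.
  · refine hC t ρ₁ ρ₂ u₁ u₂ P₁ P₂ f₁ f₂ Du₁ Du₂ a₁ a₂ Da₁ aLow aUp
      ⟨ht0, h₁.mono ht.2, h₂.mono ht.2, ha₁, ha₂, DensityEuler.HasWeakSpaceDeriv.mono ht.2 hDa,
        hca.mono ht.2, hcu.mono ht.2, (lintegral_mono_set (Ioo_subset_Ioo_right ht.2)).trans_lt hP,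
        hlow, hle, ae_restrict_of_ae_restrict_of_subset (DensityEuler.slab_mono ht.2) hab,
        hV t ht⟩ hc hf
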